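/- Let $\mathbb D$ be the open unit disc, $\mathbb T$ the unit circle and $\Delta=\widehat{\mathbb C}\setminus\overline{\mathbb D}$, and let $d\ge 2$. **Definitions.** For a map $f$ analytic near $\mathbb T$, the *cusps* of the curve $f(\mathbb T)$ are the points $f(\zeta)$ with $|\zeta|=1$, $f'(\zeta)=0$, and its *double points* are the points $f(\zeta_1)=f(\zeta_2)$ with $|\zeta_1|=|\zeta_2|=1$, $\zeta_1\ne\zeta_2$. Cusps and double points are called *singular points*. $(S_d)$ is the set of polynomials $f(z)=z+a_2z^2+\dots+a_dz^d$ that are univalent in $\mathbb D$; $f\in(S_d)$ is a *Suffridge polynomial* if $f(\mathbb T)$ has $d-1$ cusps and $d-2$ double points. $(\Sigma_d)$ is the set of functions $f(z)=z+a_1/z+\dots+a_d/z^d$ that are univalent in $\Delta$; $f\in(\Sigma_d)$ is a *Suffridge polynomial* if $f(\mathbb T)$ has $d+1$ cusps and $d-2$ double points. A bounded domain $\Omega\subset\mathbb C$ (respectively a domain $\Omega\subset\widehat{\mathbb C}$ with $\infty\in\Omega$) with $\operatorname{int}\operatorname{clos}\Omega=\Omega$ is a *bounded* (respectively *unbounded*)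 *quadrature domain* if there is a rational function $r$ with all its poles in $\Omega$ (and, in the bounded case, $r(\infty)=0$) such that $$\int_\Omega g\,dA=\frac1{2i}\oint_{\partial\Omega} g(z)\,r(z)\,dz$$ for all $g$ analytic in $\Omega$ and continuous up to the boundary (with $g(\infty)=0$ and the area integral in the principal value sense in the unbounded case). Its *order* is $\deg r$, and its *nodes* are the poles of $r$. A simply connected bounded quadrature domain of order $d$ is *extreme* if $0$ is its only node and its boundary has $d-1$ cusps and $d-2$ double points; a simply connected unbounded quadrature domain of order $d$ is *extreme* if $\infty$ is its only node and its boundary has $d+1$ cusps and $d-2$ double points. Here cusps and double points of $\partial\Omega$ are those of $\varphi(\mathbb T)$, where $\varphi$ is a conformal map of $\mathbb D$ (respectively of $\Delta$, with $\varphi(\infty)=\infty$) onto $\Omega$ that is analytic up to $\mathbb T$. For the next two definitions, a *cusp* of a Jordan curve is a point at which the unit tangent has one-sided limits that are opposite to each other. It is *inward* (*outward*) if its tip points into the interior (exterior) of the curve. A Jordan curve is *cardioid-like* if it is smooth and has positive curvature with respect to the counterclockwise orientation, except for a single inward cusp. It is *deltoid-like* if it is smooth except for three outward cusps, and at least one of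 the arcs between the cusps has negative curvature (counterclockwise orientation) and total variation of the tangent direction less than $\pi$. **Theorem.** 1. Let $f\in(\Sigma_d)$ be a Suffridge polynomial. Then $\mathbb C\setminus f(\overline\Delta)$ has $d-1$ components, and the boundary of each of them contains exactly three singular points and is a deltoid-like curve. 2. Let $f\in(S_d)$ be a Suffridge polynomial. Then $\mathbb C\setminus f(\overline{\mathbb D})$ has $d-2$ bounded components and one unbounded component $U_\infty$. The boundary of each bounded component contains exactly three singular points and is a deltoid-like curve. The boundary of $U_\infty$ contains a single singular point (a cusp if $d=2$, a double point if $d>2$) and is a cardioid-like curve. 3. Let $\Omega$ be an extreme unbounded quadrature domain of order $d$. Then the interior of $\Omega^c$ has $d-1$ components, and each of them is bounded by a deltoid-like curve. 4. Let $\Omega$ be an extreme bounded quadrature domain of order $d$. Then the interior of $\Omega^c$ has $d-1$ components, exactly one of them unbounded. The boundary of the unbounded component is cardioid-like, and the boundaries of the bounded components are deltoid-like. -/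

import Mathlib

open Set Filter Topology MeasureTheory

noncomputable section

/-! ### Components, cusps and double points -/

/-- The connected components of a planar set `V`. -/
def planarComponents (V : Set ℂ) : Set (Set ℂ) :=
  {U | ∃ z ∈ V, U = connectedComponentIn V z}

/-- The cusps of the curve `f(𝕋)`: the points `f ζ` with `|ζ| = 1` and `f' ζ = 0`.
(Used only for maps `f` that are analytic in a neighbourhood of the unit circle.) -/
def cuspPoints (f : ℂ → ℂ) : Set ℂ :=
  {p | ∃ ζ : ℂ, ‖ζ‖ = 1 ∧ deriv f ζ = 0 ∧ f ζ = p}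

/-- The double points of the curve `f(𝕋)`. -/
def doublePoints (f : ℂ → ℂ) : Set ℂ :=
  {p | ∃ ζ₁ ζ₂ : ℂ, ‖ζ₁‖ = 1 ∧ ‖ζ₂‖ = 1 ∧ ζ₁ ≠ ζ₂ ∧ f ζ₁ = p ∧ f ζ₂ = p}

/-- The singular points of the curve `f(𝕋)`: cusps and double points. -/
def singularPoints (f : ℂ → ℂ) : Set ℂ := cuspPoints f ∪ doublePoints f

/-! ### Suffridge polynomials -/

/-- The class `S_d`: polynomials `z + a₂ z² + ⋯ + a_d z^d` that are univalent in the unit disc. -/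
def classS (d : ℕ) : Set (ℂ → ℂ) :=
  {f | (∃ a : ℕ → ℂ, ∀ z, f z = z + ∑ k ∈ Finset.Icc 2 d, a k * z ^ k) ∧
    InjOn f (Metric.ball 0 1)}

/-- The class `Σ_d`: functions `z + a₁/z + ⋯ + a_d/z^d` that are univalent in the exterior of
the closed unit disc (with `∞ ↦ ∞`). The value at `0` plays no role. -/
def classSigma (d : ℕ) : Set (ℂ → ℂ) :=
  {f | (∃ a : ℕ → ℂ, ∀ z, z ≠ 0 → f z = z + ∑ k ∈ Finset.Icc 1 d, a k / z ^ k) ∧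
    InjOn f {z | 1 < ‖z‖}}

/-- `f ∈ S_d` is a Suffridge polynomial if `f(𝕋)` has `d - 1` cusps and `d - 2` double points. -/
def IsSuffridgeS (d : ℕ) (f : ℂ → ℂ) : Prop :=
  f ∈ classS d ∧ (cuspPoints f).encard + 1 = d ∧ (doublePoints f).encard + 2 = d

/-- `f ∈ Σ_d` is a Suffridge polynomial if `f(𝕋)` has `d + 1` cusps and `d - 2` double points. -/
def IsSuffridgeSigma (d : ℕ) (f : ℂ → ℂ) : Prop :=
  f ∈ classSigma d ∧ (cuspPoints f).encard = d + 1 ∧ (doublePoints f).encard + 2 = d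

/-! ### Extreme quadrature domains -/

/-- `Ω` is a bounded quadrature domain of order `d` whose only node is the origin. The quadrature
function is `r(z) = q(1/z)` with a polynomial `q` of degree `d` without constant term, i.e. the
general rational function of degree `d` with `r(∞) = 0` and the origin as its only pole.
As `g r` is analytic in `Ω` off the origin, the integral of `g r` along `∂Ω` (with `Ω` on the left)
is the integral along any circle `|z| = ρ` that bounds a closed disc contained in `Ω`. -/
structure IsBoundedQDNodeZero (d : ℕ) (Ω : Set ℂ) : Prop where
  isBounded : Bornology.IsBounded Ω
  isOpen : IsOpen Ω
  isConnected : IsConnected Ω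
  interior_closure : interior (closure Ω) = Ω
  zero_mem : (0 : ℂ) ∈ Ω
  quadrature : ∃ q : Polynomial ℂ, q.natDegree = d ∧ q.coeff 0 = 0 ∧
    ∀ g : ℂ → ℂ, DifferentiableOn ℂ g Ω → ContinuousOn g (closure Ω) →
      ∀ ρ : ℝ, 0 < ρ → Metric.closedBall 0 ρ ⊆ Ω →
        ∫ z in Ω, g z = (2 * Complex.I)⁻¹ * ∮ z in C(0, ρ), g z * q.eval z⁻¹

/-- The finite part of a subset of the Riemann sphere. -/
def finitePart (Ω : Set (OnePoint ℂ)) : Set ℂ := (fun z : ℂ => (z : OnePoint ℂ)) ⁻¹' Ω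

/-- `Ω` is an unbounded quadrature domain (a domain in the Riemann sphere that contains `∞`) of
order `d` whose only node is `∞`: the quadrature function is a polynomial `q` of degree `d`.
The area integral is a principal value, and as `g q` is analytic in `Ω` off `∞`, the integral of
`g q` along `∂Ω` (with `Ω` on the left) is minus the counterclockwise integral along any circle
`|z| = ρ` whose closed exterior is contained in `Ω`. -/
structure IsUnboundedQDNodeInfty (d : ℕ) (Ω : Set (OnePoint ℂ)) : Prop where
  isOpen : IsOpen Ω
  isConnected : IsConnected Ω
  interior_closure : interior (closure Ω) = Ω
  infty_mem : OnePoint.infty ∈ Ω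
  quadrature : ∃ q : Polynomial ℂ, q.natDegree = d ∧
    ∀ g : ℂ → ℂ, DifferentiableOn ℂ g (finitePart Ω) → ContinuousOn g (closure (finitePart Ω)) →
      Tendsto g (Bornology.cobounded ℂ) (𝓝 0) →
      ∀ ρ : ℝ, 0 < ρ → {z : ℂ | ρ ≤ ‖z‖} ⊆ finitePart Ω →
        Tendsto (fun R : ℝ => ∫ z in finitePart Ω ∩ Metric.ball 0 R, g z) atTop
          (𝓝 (-((2 * Complex.I)⁻¹ * ∮ z in C(0, ρ), g z * q.eval z)))

/-- `φ` is a conformal map of the unit disc onto `Ω`, analytic up to the unit circle. -/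
structure IsDiscUniformization (φ : ℂ → ℂ) (Ω : Set ℂ) : Prop where
  analytic : AnalyticOnNhd ℂ φ (Metric.closedBall 0 1)
  injOn : InjOn φ (Metric.ball 0 1)
  image_eq : φ '' Metric.ball 0 1 = Ω

/-- `φ` is a conformal map of the exterior disc (with `∞ ↦ ∞`) onto a domain in the sphere with
finite part `W`, analytic up to the unit circle. -/
structure IsExteriorUniformization (φ : ℂ → ℂ) (W : Set ℂ) : Prop where
  analytic : AnalyticOnNhd ℂ φ {z | 1 ≤ ‖z‖}
  injOn : InjOn φ {z | 1 < ‖z‖}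
  tendsto : Tendsto φ (Bornology.cobounded ℂ) (Bornology.cobounded ℂ)
  image_eq : φ '' {z | 1 < ‖z‖} = W

/-- An extreme bounded quadrature domain of order `d`: simply connected, the origin is the only
node, and the boundary has `d - 1` cusps and `d - 2` double points. The cusps and the double points
of the boundary do not depend on the choice of the uniformization `φ`. -/
structure IsExtremeBoundedQD (d : ℕ) (Ω : Set ℂ) : Prop where
  quadratureDomain : IsBoundedQDNodeZero d Ω
  simplyConnected : IsSimplyConnected Ω
  singularities : ∃ φ : ℂ → ℂ, IsDiscUniformization φ Ω ∧
    (cuspPoints φ).encard + 1 = d ∧ (doublePoints φ).encard + 2 = d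

/-- An extreme unbounded quadrature domain of order `d`: simply connected, `∞` is the only
node, and the boundary has `d + 1` cusps and `d - 2` double points. -/
structure IsExtremeUnboundedQD (d : ℕ) (Ω : Set (OnePoint ℂ)) : Prop where
  quadratureDomain : IsUnboundedQDNodeInfty d Ω
  simplyConnected : IsSimplyConnected Ω
  singularities : ∃ φ : ℂ → ℂ, IsExteriorUniformization φ (finitePart Ω) ∧
    (cuspPoints φ).encard = d + 1 ∧ (doublePoints φ).encard + 2 = d

/-! ### Cardioid-like and deltoid-like curves -/

/-- The interior of a Jordan curve `J`: the union of the bounded components of its complement. -/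
def jordanInside (J : Set ℂ) : Set ℂ :=
  {z | z ∉ J ∧ Bornology.IsBounded (connectedComponentIn Jᶜ z)}

/-- The unit tangent vector. -/
def unitTangent (γ : ℝ → ℂ) (t : ℝ) : ℂ := deriv γ t / (‖deriv γ t‖ : ℂ)

/-- The signed curvature (positive when the curve turns left). -/
def signedCurvature (γ : ℝ → ℂ) (t : ℝ) : ℝ :=
  ((starRingEnd ℂ) (deriv γ t) * deriv (deriv γ) t).im / ‖deriv γ t‖ ^ 3

/-- `γ` is a counterclockwise parametrization with period `n` of the Jordan curve `J`, regular and
smooth except at the `n` parameters `0, …, n - 1` modulo `n` (that is, at the integers), at which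
`J` has cusps. Counterclockwise means that the interior of `J` lies on the left. -/
structure IsCuspedParametrization (n : ℕ) (γ : ℝ → ℂ) (J : Set ℂ) : Prop where
  continuous : Continuous γ
  periodic : Function.Periodic γ n
  injOn : InjOn γ (Ico 0 (n : ℝ))
  range_eq : range γ = J
  smooth : ∀ j : ℤ, ContDiffOn ℝ (⊤ : ℕ∞) γ (Ioo (j : ℝ) (j + 1))
  regular : ∀ t : ℝ, t ∉ range ((↑) : ℤ → ℝ) → deriv γ t ≠ 0
  counterclockwise : ∀ t : ℝ, t ∉ range ((↑) : ℤ → ℝ) →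
    ∀ᶠ ε : ℝ in 𝓝[>] 0, γ t + ε * (Complex.I * deriv γ t) ∈ jordanInside J
  cusp : ∀ j : ℤ, ∃ u : ℂ, Tendsto (unitTangent γ) (𝓝[<] (j : ℝ)) (𝓝 u) ∧
    Tendsto (unitTangent γ) (𝓝[>] (j : ℝ)) (𝓝 (-u))

/-- The cusp of `γ` at parameter `t` is inward: the incoming tangent direction `u`, in which the
tip of the cusp points, leads into the interior of the curve. -/
def IsInwardCusp (γ : ℝ → ℂ) (t : ℝ) : Prop :=
  ∃ u : ℂ, Tendsto (unitTangent γ) (𝓝[<] t) (𝓝 u) ∧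
    ∀ᶠ ε : ℝ in 𝓝[>] 0, γ t + ε * u ∈ jordanInside (range γ)

/-- The cusp of `γ` at parameter `t` is outward: the tip of the cusp points into the exterior. -/
def IsOutwardCusp (γ : ℝ → ℂ) (t : ℝ) : Prop :=
  ∃ u : ℂ, Tendsto (unitTangent γ) (𝓝[<] t) (𝓝 u) ∧
    ∀ᶠ ε : ℝ in 𝓝[>] 0, γ t + ε * u ∉ range γ ∪ jordanInside (range γ)

/-- A Jordan curve is cardioid-like if it is smooth with positive curvature with respect to the
counterclockwise orientation, except for a single inward cusp. -/
def IsCardioidLike (J : Set ℂ) : Prop :=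
  ∃ γ : ℝ → ℂ, IsCuspedParametrization 1 γ J ∧ IsInwardCusp γ 0 ∧
    ∀ t ∈ Ioo (0 : ℝ) 1, 0 < signedCurvature γ t

/-- A Jordan curve is deltoid-like if it is smooth except for three outward cusps and at least one
of the arcs between the cusps has negative curvature (with respect to the counterclockwise
orientation) and total variation of the tangent direction less than `π`. The total variation of
the direction angle of the tangent is that of the unit tangent vector, measured along the circle. -/
def IsDeltoidLike (J : Set ℂ) : Prop :=
  ∃ γ : ℝ → ℂ, IsCuspedParametrization 3 γ J ∧
    (∀ j : ℤ, IsOutwardCusp γ j) ∧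
    ∃ j : ℤ, (∀ t ∈ Ioo (j : ℝ) (j + 1), signedCurvature γ t < 0) ∧
      eVariationOn (unitTangent γ) (Ioo (j : ℝ) (j + 1)) < ENNReal.ofReal Real.pi

end

/-! The whole argument is a count in which every inequality turns out to be an equality.

Write the boundary curve as the image of the circle under a map `F` of the (possibly punctured)
disc; exterior maps are composed with `w ↦ 1/w`. The Suffridge condition puts all zeros of the
polynomial factor of `F'` on the circle. On the circle each factor `1 - ζ/η` is a constant times
`exp (it/2)` times a real sine (`polar_form`), so the velocity of the curve is a real signed speed
times `c * exp (iκt)`. With `D = d - 2` double points, `κ = (D+1)/2` for the exterior and `κ =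
(D+3)/2` for the disc. Away from its cusps the curve therefore bends strictly to its left, the side
on which the image `G` lies. Univalence gives the rest of `TurningLoop`: branches meet only in
pairs, with opposite velocities and away from the cusps.

Cusps and double parameters cut the circle into `3(D+1)` arcs for the exterior and `3D+1` for the
disc. Cauchy integrals along chains of arcs replace winding numbers and the Jordan curve theorem:
along a closed chain the integral is locally constant off the curve and jumps by `2πi` exactly
across the arcs of the chain. Hence `G` lies on one side only of every arc, each arc borders one
complementary component on its right, and a closed chain separates the components of its arcs from
those of the other arcs (`IsClosedChain.comp_ne`). The `D` loops cut off at the double points then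
force at least `D+1` components (`IsMate.card_components_ge`).

Seen from a complementary component, the arcs bulge inwards. The point of its closure farthest from
any given centre must therefore be a vertex, and a bounded component has at least three vertices
(`IsMate.three_le_vertices`). This leaves exactly `D+1` components, with three arcs each, except
that the unbounded one has a single arc in the disc case. Walking round a component, the tangent
reverses at every corner; with an odd number of arcs the total turning is an odd multiple of `π`
(`IsMate.exists_turning`). For the single arc it is at least `3π`, because an arc turning by at most
`π` cannot close up. The total turning available is `2πκ`, which leaves exactly `π` for each bounded
component: every one of its arcs turns by less than `π`, and the boundary is deltoid-like. These
counts are `TurningLoop.deltoids_of_bounded` and `TurningLoop.deltoids_cardioid_of_unbounded`.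

For quadrature domains it remains to show that the conformal map has finitely many coefficients. The
test functions are powers of the inverse map times a product vanishing at the double points, which
makes them continuous on the closure of the domain. High powers annihilate the contour integral, so
`wⁿ A` is orthogonal to a derivative-type function `E` for all large `n`, where `A` has no zeros in
the open disc. As `E` is analytic beyond the circle, its coefficients decay geometrically; this
allows a convolution with the coefficients of `1/A`, although `A` may vanish on the circle, and
shows that the high coefficients of `E` vanish (`taylorCoeff_eq_zero_of_orthogonal`). -/

/-! ### Cauchy integrals along arcs -/

/-- The integral of `dz / (z - p)` along the arc `γ` between the parameters `a` and `b`. -/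
noncomputable def arcIntegral (γ γ' : ℝ → ℂ) (a b : ℝ) (p : ℂ) : ℂ := ∫ t in a..b, γ' t / (γ t - p)

/-- Differentiation under the integral gives `γ' / (γ - p)²`, which has the primitive `-1/(γ - p)`
along the arc. Only endpoint terms remain, and these cancel when arcs are joined into a closed
chain. -/
lemma hasDerivAt_arcIntegral {γ γ' : ℝ → ℂ} (hγ : ∀ t, HasDerivAt γ (γ' t) t)
    (hγ' : Continuous γ') {a b : ℝ} (hab : a ≤ b) {p : ℂ} (hp : ∀ t ∈ Icc a b, γ t ≠ p) :
    HasDerivAt (arcIntegral γ γ' a b) ((γ a - p)⁻¹ - (γ b - p)⁻¹) p := by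
  have hc : Continuous γ := continuous_iff_continuousAt.2 fun t => (hγ t).continuousAt
  have hK : IsCompact (γ '' Icc a b) := isCompact_Icc.image hc
  have hpK : p ∈ (γ '' Icc a b)ᶜ := by
    rintro ⟨t, ht, rfl⟩; exact hp t ht rfl
  obtain ⟨r, hr, hball⟩ := Metric.isOpen_iff.1 hK.isClosed.isOpen_compl p hpK
  -- Halving the radius keeps the denominators uniformly away from zero, which yields the dominating
  -- constant `M / (r/2)²`.
  have hfar : ∀ t ∈ Icc a b, ∀ q ∈ Metric.ball p (r / 2), r / 2 ≤ ‖γ t - q‖ := by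
    intro t ht q hq
    by_contra! h
    have hm : γ t ∈ Metric.ball p r → False := fun h => hball h ⟨t, ht, rfl⟩
    refine hm ?_
    rw [Metric.mem_ball, dist_eq_norm]
    rw [Metric.mem_ball, dist_eq_norm] at hq
    calc ‖γ t - p‖ = ‖(γ t - q) + (q - p)‖ := by ring_nf
      _ ≤ ‖γ t - q‖ + ‖q - p‖ := norm_add_le _ _
      _ < r := by linarith
  have hne : ∀ t ∈ Icc a b, ∀ q ∈ Metric.ball p (r / 2), γ t - q ≠ 0 := fun t ht q hq h0 => by
    have := hfar t ht q hq
    rw [h0, norm_zero] at this; linarith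
  obtain ⟨M, hM⟩ := (isCompact_Icc (a := a) (b := b)).exists_bound_of_continuousOn hγ'.continuousOn
  have huI : uIoc a b ⊆ Icc a b := by
    rw [uIoc_of_le hab]; exact Ioc_subset_Icc_self
  have hcont : ∀ q ∈ Metric.ball p (r / 2), ContinuousOn (fun t => γ' t / (γ t - q)) (Icc a b) :=
    fun q hq => hγ'.continuousOn.div (hc.continuousOn.sub continuousOn_const)
      fun t ht => hne t ht q hq
  have hpm : p ∈ Metric.ball p (r / 2) := Metric.mem_ball_self (by linarith)
  have hcont' : ContinuousOn (fun t => γ' t / (γ t - p) ^ 2) (Icc a b) :=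
    hγ'.continuousOn.div ((hc.continuousOn.sub continuousOn_const).pow 2)
      fun t ht => pow_ne_zero 2 (hne t ht p hpm)
  have key := intervalIntegral.hasDerivAt_integral_of_dominated_loc_of_deriv_le
    (μ := volume) (a := a) (b := b) (F := fun q t => γ' t / (γ t - q))
    (F' := fun q t => γ' t / (γ t - q) ^ 2) (x₀ := p) (bound := fun _ => M / (r / 2) ^ 2)
    (Metric.ball_mem_nhds p (by linarith : 0 < r / 2))
    (by
      filter_upwards [Metric.ball_mem_nhds p (by linarith : 0 < r / 2)] with q hq
      exact ((hcont q hq).mono huI).aestronglyMeasurable measurableSet_uIoc)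
    (ContinuousOn.intervalIntegrable (by rw [uIcc_of_le hab]; exact hcont p hpm))
    ((hcont'.mono huI).aestronglyMeasurable measurableSet_uIoc)
    (by
      refine Eventually.of_forall fun t ht q hq => ?_
      have ht' := huI ht
      rw [norm_div, norm_pow]
      have := hfar t ht' q hq
      have h1 := hM t ht'
      have h0 : 0 ≤ M := (norm_nonneg _).trans h1
      gcongr)
    (by simp)
    (by
      refine Eventually.of_forall fun t ht q hq => ?_
      have h0 := hne t (huI ht) q hq
      have h2 : HasDerivAt (fun q => γ t - q) (-1) q := by
        simpa using (hasDerivAt_id q).const_sub (γ t)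
      refine ((hasDerivAt_const q (γ' t)).div h2 h0).congr_deriv ?_
      ring)
  have hint : (∫ t in a..b, γ' t / (γ t - p) ^ 2) = (γ a - p)⁻¹ - (γ b - p)⁻¹ := by
    have := intervalIntegral.integral_eq_sub_of_hasDerivAt (a := a) (b := b)
      (f := fun t => -(γ t - p)⁻¹) (f' := fun t => γ' t / (γ t - p) ^ 2) (by
        intro t ht
        rw [uIcc_of_le hab] at ht
        have h0 := hne t ht p hpm
        refine (((hγ t).sub_const p).inv h0).neg.congr_deriv ?_
        ring) (ContinuousOn.intervalIntegrable (by rw [uIcc_of_le hab]; exact hcont'))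
    rw [this]; ring
  rw [← hint]
  exact key.2

lemma log_sub_log_neg_of_im_pos {z : ℂ} (h : 0 < z.im) :
    Complex.log z - Complex.log (-z) = Real.pi * Complex.I := by
  simp only [Complex.log, norm_neg, Complex.arg_neg_eq_arg_sub_pi_of_im_pos h]
  push_cast; ring

/-- The jump of the Cauchy integral along a short arc that crosses the imaginary axis from left
to right at the origin. -/
lemma tendsto_jump_of_crossing {z z' : ℝ → ℂ} (hz : ∀ t, HasDerivAt z (z' t) t)
    (hz' : Continuous z') {t₀ t₁ t₂ : ℝ} (h₁ : t₁ < t₀) (h₂ : t₀ < t₂) (h0 : z t₀ = 0)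
    (hneg : ∀ t ∈ Ico t₁ t₀, (z t).re < 0) (hpos : ∀ t ∈ Ioc t₀ t₂, 0 < (z t).re) :
    Tendsto (fun ε : ℝ => arcIntegral z z' t₁ t₂ (ε * Complex.I) -
      arcIntegral z z' t₁ t₂ (-(ε * Complex.I))) (𝓝[>] 0) (𝓝 (2 * Real.pi * Complex.I)) := by
  have hc : Continuous z := continuous_iff_continuousAt.2 fun t => (hz t).continuousAt
  have h12 : t₁ ≤ t₂ := (h₁.trans h₂).le
  have hre : ∀ t ∈ Icc t₁ t₂, (z t).re ≠ 0 ∨ t = t₀ := by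
    intro t ht
    rcases lt_trichotomy t t₀ with h | h | h
    · exact .inl (hneg t ⟨ht.1, h⟩).ne
    · exact .inr h
    · exact .inl (hpos t ⟨h, ht.2⟩).ne'
  -- The arc meets the imaginary axis only at `0`, so it avoids the ray going up from `εi` and the
  -- ray going down from `-εi`. Multiplication by `±I` moves these rays onto the cut of `log`, so
  -- the rotated logarithms are primitives along the whole arc.
  have hs1 : ∀ ε : ℝ, 0 < ε → ∀ t ∈ Icc t₁ t₂,
      Complex.I * (z t - ε * Complex.I) ∈ Complex.slitPlane := by
    intro ε hε t ht
    rw [Complex.mem_slitPlane_iff]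
    rcases hre t ht with h | rfl
    · right; simpa using h
    · left; simpa [h0] using hε
  have hs2 : ∀ ε : ℝ, 0 < ε → ∀ t ∈ Icc t₁ t₂,
      -Complex.I * (z t + ε * Complex.I) ∈ Complex.slitPlane := by
    intro ε hε t ht
    rw [Complex.mem_slitPlane_iff]
    rcases hre t ht with h | rfl
    · right; simpa using h
    · left; simpa [h0] using hε
  have hformula : ∀ ε : ℝ, 0 < ε → arcIntegral z z' t₁ t₂ (ε * Complex.I) -
      arcIntegral z z' t₁ t₂ (-(ε * Complex.I)) =
      (Complex.log (Complex.I * (z t₂ - ε * Complex.I)) -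
        Complex.log (-Complex.I * (z t₂ + ε * Complex.I))) -
      (Complex.log (Complex.I * (z t₁ - ε * Complex.I)) -
        Complex.log (-Complex.I * (z t₁ + ε * Complex.I))) := by
    intro ε hε
    have e1 : arcIntegral z z' t₁ t₂ (ε * Complex.I) =
        Complex.log (Complex.I * (z t₂ - ε * Complex.I)) -
        Complex.log (Complex.I * (z t₁ - ε * Complex.I)) := by
      have hne : ∀ t ∈ Icc t₁ t₂, z t - ε * Complex.I ≠ 0 := fun t ht h => by
        have := Complex.slitPlane_ne_zero (hs1 ε hε t ht)
        simp [h] at this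
      refine intervalIntegral.integral_eq_sub_of_hasDerivAt
        (f := fun t => Complex.log (Complex.I * (z t - ε * Complex.I))) ?_ ?_
      · intro t ht
        rw [uIcc_of_le h12] at ht
        refine ((((hz t).sub_const (ε * Complex.I)).const_mul Complex.I).clog_real
          (hs1 ε hε t ht)).congr_deriv ?_
        rw [mul_div_mul_left _ _ Complex.I_ne_zero]
      · refine ContinuousOn.intervalIntegrable ?_
        rw [uIcc_of_le h12]
        exact hz'.continuousOn.div (by fun_prop) hne
    have e2 : arcIntegral z z' t₁ t₂ (-(ε * Complex.I)) =
        Complex.log (-Complex.I * (z t₂ + ε * Complex.I)) -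
        Complex.log (-Complex.I * (z t₁ + ε * Complex.I)) := by
      have hne : ∀ t ∈ Icc t₁ t₂, z t + ε * Complex.I ≠ 0 := fun t ht h => by
        have := Complex.slitPlane_ne_zero (hs2 ε hε t ht)
        simp [h] at this
      refine intervalIntegral.integral_eq_sub_of_hasDerivAt
        (f := fun t => Complex.log (-Complex.I * (z t + ε * Complex.I))) ?_ ?_
      · intro t ht
        rw [uIcc_of_le h12] at ht
        refine ((((hz t).add_const (ε * Complex.I)).const_mul (-Complex.I)).clog_real
          (hs2 ε hε t ht)).congr_deriv ?_
        rw [mul_div_mul_left _ _ (neg_ne_zero.2 Complex.I_ne_zero), sub_neg_eq_add]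
      · refine ContinuousOn.intervalIntegrable ?_
        rw [uIcc_of_le h12]
        simp only [sub_neg_eq_add]
        exact hz'.continuousOn.div (by fun_prop) hne
    rw [e1, e2]; ring
  have hlim : ∀ w : ℂ, w.re ≠ 0 → Tendsto (fun ε : ℝ =>
      Complex.log (Complex.I * (w - ε * Complex.I)) -
        Complex.log (-Complex.I * (w + ε * Complex.I))) (𝓝[>] 0)
      (𝓝 (Complex.log (Complex.I * w) - Complex.log (-(Complex.I * w)))) := by
    intro w hw
    refine tendsto_nhdsWithin_of_tendsto_nhds ?_
    have hca : ContinuousAt (fun ε : ℝ =>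
      Complex.log (Complex.I * (w - ε * Complex.I)) -
        Complex.log (-Complex.I * (w + ε * Complex.I))) 0 := by
      refine ContinuousAt.sub (ContinuousAt.clog (by fun_prop) ?_)
        (ContinuousAt.clog (by fun_prop) ?_) <;>
      · rw [Complex.mem_slitPlane_iff]; right; simpa using hw
    simpa [ContinuousAt] using hca
  have hp := hpos t₂ ⟨h₂, le_rfl⟩
  have hn := hneg t₁ ⟨le_rfl, h₁⟩
  -- In the limit the two branches differ by `πi` at the right endpoint and by `-πi` at the left
  -- one; the difference is the jump `2πi`.
  have L := (hlim (z t₂) hp.ne').sub (hlim (z t₁) hn.ne)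
  rw [log_sub_log_neg_of_im_pos (by simpa using hp)] at L
  have hn2 := log_sub_log_neg_of_im_pos (z := -(Complex.I * z t₁)) (by simpa using hn)
  rw [neg_neg] at hn2
  have : Complex.log (Complex.I * z t₁) - Complex.log (-(Complex.I * z t₁)) =
      -(Real.pi * Complex.I) := by rw [← hn2]; ring
  rw [this] at L
  have e : (Real.pi * Complex.I - -(Real.pi * Complex.I) : ℂ) = 2 * Real.pi * Complex.I := by ring
  rw [e] at L
  refine L.congr' ?_
  filter_upwards [self_mem_nhdsWithin] with ε hε
  exact (hformula ε hε).symm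

lemma arcIntegral_affine (γ γ' : ℝ → ℂ) (a b : ℝ) (p q : ℂ) {e : ℂ} (he : e ≠ 0) :
    arcIntegral (fun t => (γ t - p) / e) (fun t => γ' t / e) a b q =
      arcIntegral γ γ' a b (p + q * e) := by
  unfold arcIntegral
  congr 1; ext t
  rw [show (γ t - p) / e - q = (γ t - (p + q * e)) / e by field_simp; ring,
    div_div_div_cancel_right₀ he]

/-- The jump of the Cauchy integral at a regular point of an arc that is passed only once. -/
lemma tendsto_jump_arcIntegral {γ γ' : ℝ → ℂ} (hγ : ∀ t, HasDerivAt γ (γ' t) t)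
    (hγ' : Continuous γ') {a b t₀ : ℝ} (ht₀ : t₀ ∈ Ioo a b) (h0 : γ' t₀ ≠ 0)
    (hsimple : ∀ t ∈ Icc a b, γ t = γ t₀ → t = t₀) :
    Tendsto (fun ε : ℝ => arcIntegral γ γ' a b (γ t₀ + ε * (Complex.I * γ' t₀)) -
      arcIntegral γ γ' a b (γ t₀ - ε * (Complex.I * γ' t₀))) (𝓝[>] 0)
      (𝓝 (2 * Real.pi * Complex.I)) := by
  set e := γ' t₀ with he
  -- In the frame with origin `γ t₀` and first axis `γ' t₀`, the real part increases near `t₀`: the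
  -- arc crosses the imaginary axis once, from left to right.
  set z : ℝ → ℂ := fun t => (γ t - γ t₀) / e with hzdef
  have hz : ∀ t, HasDerivAt z (γ' t / e) t := fun t => ((hγ t).sub_const _).div_const e
  have hz' : Continuous fun t => γ' t / e := hγ'.div_const e
  have hre : ∀ t, HasDerivAt (fun t => (z t).re) (γ' t / e).re t := fun t =>
    (Complex.reCLM.hasFDerivAt.comp_hasDerivAt t (hz t))
  have hev : ∀ᶠ t in 𝓝 t₀, 0 < (γ' t / e).re := by
    have : ContinuousAt (fun t => (γ' t / e).re) t₀ := by fun_prop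
    refine this.eventually_const_lt ?_
    simp [← he, div_self h0]
  obtain ⟨δ, hδ, hball⟩ := Metric.eventually_nhds_iff_ball.1
    (hev.and (Ioo_mem_nhds ht₀.1 ht₀.2))
  set t₁ := t₀ - δ / 2
  set t₂ := t₀ + δ / 2
  have hsub : ∀ t ∈ Icc t₁ t₂, t ∈ Metric.ball t₀ δ := by
    intro t ht
    rw [Metric.mem_ball, Real.dist_eq, abs_lt]
    constructor <;> [have := ht.1; have := ht.2] <;> simp only [t₁, t₂] at this <;> linarith
  have hmono : StrictMonoOn (fun t => (z t).re) (Icc t₁ t₂) := by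
    refine strictMonoOn_of_deriv_pos (convex_Icc _ _)
      (fun t _ => (hre t).continuousAt.continuousWithinAt) fun t ht => ?_
    rw [(hre t).deriv]
    exact (hball t (hsub t (interior_subset ht))).1
  have hzt₀ : z t₀ = 0 := by simp [hzdef]
  have h1 : t₁ < t₀ := by simp only [t₁]; linarith
  have h2 : t₀ < t₂ := by simp only [t₂]; linarith
  have J := tendsto_jump_of_crossing hz hz' h1 h2 hzt₀
    (fun t ht => by
      have := hmono ⟨ht.1, ht.2.le.trans h2.le⟩ ⟨h1.le, h2.le⟩ ht.2
      simpa [hzt₀] using this)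
    (fun t ht => by
      have := hmono ⟨h1.le, h2.le⟩ ⟨h1.le.trans ht.1.le, ht.2⟩ ht.1
      simpa [hzt₀] using this)
  have ha1 : a < t₁ := (hball t₁ (hsub t₁ ⟨le_rfl, (h1.trans h2).le⟩)).2.1
  have hb2 : t₂ < b := (hball t₂ (hsub t₂ ⟨(h1.trans h2).le, le_rfl⟩)).2.2
  -- The pieces of the arc away from `γ t₀` have a continuous Cauchy integral there and contribute
  -- no jump.
  have far : ∀ u v, u ≤ v → (∀ t ∈ Icc u v, γ t ≠ γ t₀) →
      Tendsto (fun ε : ℝ => arcIntegral γ γ' u v (γ t₀ + ε * (Complex.I * e)) -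
      arcIntegral γ γ' u v (γ t₀ - ε * (Complex.I * e))) (𝓝[>] 0) (𝓝 0) := by
    intro u v huv hne
    have hcont := (hasDerivAt_arcIntegral hγ hγ' huv hne).continuousAt
    refine tendsto_nhdsWithin_of_tendsto_nhds ?_
    have c1 : ContinuousAt (fun ε : ℝ => arcIntegral γ γ' u v (γ t₀ + ε * (Complex.I * e))) 0 :=
      ContinuousAt.comp (g := arcIntegral γ γ' u v)
        (f := fun ε : ℝ => γ t₀ + ε * (Complex.I * e)) (x := 0) (by simpa using hcont)
        (by fun_prop)
    have c2 : ContinuousAt (fun ε : ℝ => arcIntegral γ γ' u v (γ t₀ - ε * (Complex.I * e))) 0 :=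
      ContinuousAt.comp (g := arcIntegral γ γ' u v)
        (f := fun ε : ℝ => γ t₀ - ε * (Complex.I * e)) (x := 0) (by simpa using hcont)
        (by fun_prop)
    have c3 : Tendsto _ _ _ := c1.sub c2
    simpa [Pi.sub_def] using c3
  have hc : Continuous γ := continuous_iff_continuousAt.2 fun t => (hγ t).continuousAt
  have hII : ∀ u v, u ≤ v → ∀ p, (∀ t ∈ Icc u v, γ t ≠ p) →
      IntervalIntegrable (fun t => γ' t / (γ t - p)) volume u v := by
    intro u v huv p hne
    refine ContinuousOn.intervalIntegrable ?_
    rw [uIcc_of_le huv]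
    exact hγ'.continuousOn.div (by fun_prop) fun t ht => sub_ne_zero.2 (hne t ht)
  have hev : ∀ u v, (∀ t ∈ Icc u v, γ t ≠ γ t₀) → ∀ c : ℂ,
      ∀ᶠ ε : ℝ in 𝓝[>] 0, ∀ t ∈ Icc u v, γ t ≠ γ t₀ + ε * c := by
    intro u v hne c
    have ho : (γ '' Icc u v)ᶜ ∈ 𝓝 (γ t₀) :=
      (isCompact_Icc.image hc).isClosed.isOpen_compl.mem_nhds (by
        rintro ⟨t, ht, h⟩; exact hne t ht h)
    have hcont : ContinuousAt (fun ε : ℝ => γ t₀ + ε * c) 0 := by fun_prop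
    have := hcont.preimage_mem_nhds (by simpa using ho)
    filter_upwards [mem_nhdsWithin_of_mem_nhds this] with ε hε t ht h
    exact hε ⟨t, ht, h⟩
  have n1 : ∀ t ∈ Icc a t₁, γ t ≠ γ t₀ := fun t ht h => by
    have := hsimple t ⟨ht.1, ht.2.trans ((h1.trans h2).le.trans hb2.le)⟩ h
    linarith [ht.2]
  have n2 : ∀ t ∈ Icc t₂ b, γ t ≠ γ t₀ := fun t ht h => by
    have := hsimple t ⟨ha1.le.trans ((h1.trans h2).le.trans ht.1), ht.2⟩ h
    linarith [ht.1]
  have n3 : ∀ r : ℝ, r ≠ 0 → ∀ t ∈ Icc t₁ t₂, γ t ≠ γ t₀ + r * (Complex.I * e) := by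
    intro r hr t ht h
    have hzt : z t = r * Complex.I := by
      simp only [hzdef, h]; field_simp; ring
    have ht0 : t = t₀ := hmono.injOn ht ⟨h1.le, h2.le⟩ (by simp [hzt, hzt₀])
    rw [ht0, hzt₀] at hzt
    simp [hr] at hzt
  have f1 := far a t₁ ha1.le n1
  have f2 := far t₂ b hb2.le n2
  have S := (f1.add J).add f2
  simp only [zero_add, add_zero] at S
  refine S.congr' ?_
  filter_upwards [self_mem_nhdsWithin, hev a t₁ n1 (Complex.I * e), hev a t₁ n1 (-(Complex.I * e)),
    hev t₂ b n2 (Complex.I * e), hev t₂ b n2 (-(Complex.I * e))] with ε (hε : 0 < ε) g1 g2 g3 g4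
  have E1 : arcIntegral z (fun t => γ' t / e) t₁ t₂ (ε * Complex.I) =
      arcIntegral γ γ' t₁ t₂ (γ t₀ + ε * (Complex.I * e)) := by
    rw [hzdef, arcIntegral_affine _ _ _ _ _ _ h0, mul_assoc]
  have E2 : arcIntegral z (fun t => γ' t / e) t₁ t₂ (-(ε * Complex.I)) =
      arcIntegral γ γ' t₁ t₂ (γ t₀ - ε * (Complex.I * e)) := by
    rw [hzdef, arcIntegral_affine _ _ _ _ _ _ h0]; congr 1; ring
  have add : ∀ p, (∀ t ∈ Icc a t₁, γ t ≠ p) → (∀ t ∈ Icc t₁ t₂, γ t ≠ p) →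
      (∀ t ∈ Icc t₂ b, γ t ≠ p) → arcIntegral γ γ' a t₁ p + arcIntegral γ γ' t₁ t₂ p +
        arcIntegral γ γ' t₂ b p = arcIntegral γ γ' a b p := by
    intro p q1 q2 q3
    have i1 := hII a t₁ ha1.le p q1
    have i2 := hII t₁ t₂ (h1.trans h2).le p q2
    have i3 := hII t₂ b hb2.le p q3
    unfold arcIntegral
    rw [intervalIntegral.integral_add_adjacent_intervals i1 i2,
      intervalIntegral.integral_add_adjacent_intervals (i1.trans i2) i3]
  rw [E1, E2, ← add _ g1 (n3 ε hε.ne') g3, ← add (γ t₀ - ε * (Complex.I * e))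
    (by simpa [sub_eq_add_neg] using g2)
    (by simpa [sub_eq_add_neg] using n3 (-ε) (neg_ne_zero.2 hε.ne'))
    (by simpa [sub_eq_add_neg] using g4)]
  ring

/-! ### Loops whose tangent direction turns at a constant rate -/

/-- The point of the unit circle with argument `t`. -/
noncomputable def circlePoint (t : ℝ) : ℂ := Complex.exp (t * Complex.I)

lemma circlePoint_eq_iff {t t' : ℝ} :
    circlePoint t = circlePoint t' ↔ ∃ n : ℤ, t = t' + n * (2 * Real.pi) := by
  unfold circlePoint
  rw [Complex.exp_eq_exp_iff_exists_int]
  refine exists_congr fun n => ?_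
  rw [show (t' * Complex.I + n * (2 * Real.pi * Complex.I) : ℂ) =
    ((t' + n * (2 * Real.pi) : ℝ) : ℂ) * Complex.I by push_cast; ring]
  rw [mul_left_inj' Complex.I_ne_zero, Complex.ofReal_inj]

lemma norm_circlePoint (t : ℝ) : ‖circlePoint t‖ = 1 := Complex.norm_exp_ofReal_mul_I t

lemma continuous_circlePoint : Continuous circlePoint := by
  unfold circlePoint; fun_prop

/-- The direction `c * exp (i κ t)`. -/
noncomputable def turningDir (κ : ℝ) (c : ℂ) (t : ℝ) : ℂ := c * circlePoint (κ * t)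

/-- A closed curve `γ` with tangent direction `± c * exp (i κ t)` that bounds the open connected
set `G` lying on its left, with signed speed `s`. It may touch itself in opposite directions. -/
structure TurningLoop (κ : ℝ) (c : ℂ) (s : ℝ → ℝ) (γ : ℝ → ℂ) (G : Set ℂ) : Prop where
  kappa_pos : 0 < κ
  norm_c : ‖c‖ = 1
  smooth : ContDiff ℝ (⊤ : ℕ∞) s
  hasDerivAt : ∀ t, HasDerivAt γ (turningDir κ c t * s t) t
  periodic : ∀ t t', circlePoint t = circlePoint t' → γ t = γ t'
  simple_zero : ∀ t, s t = 0 → deriv s t ≠ 0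
  isOpen : IsOpen G
  isConnected : IsConnected G
  notMem : ∀ t, γ t ∉ G
  isClosed : IsClosed (G ∪ range γ)
  left : ∀ t, s t ≠ 0 → ∀ᶠ ε : ℝ in 𝓝[>] 0, γ t + ε * (Complex.I * (turningDir κ c t * s t)) ∈ G
  opposite : ∀ t t', γ t = γ t' → circlePoint t ≠ circlePoint t' →
    s t ≠ 0 ∧ s t' ≠ 0 ∧ ∃ r : ℝ, 0 < r ∧ turningDir κ c t * s t = -r * (turningDir κ c t' * s t')

/-- A half of a local branch of `γ`, as a graph over the tangent line: with `ω, τ = ±1`, the points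
`γ (t₀ + τ u)` are `p + e * (ω * x + ω * τ * h x * I)`. -/
structure HalfArc (γ : ℝ → ℂ) (p e : ℂ) (ω τ t₀ δ : ℝ) (h : ℝ → ℝ) (x₁ : ℝ) : Prop where
  pos : 0 < x₁
  continuous : Continuous h
  zero_left : ∀ x ≤ 0, h x = 0
  mono : StrictMonoOn h (Icc 0 x₁)
  param : ∀ u ∈ Icc 0 δ, ∃ x ∈ Icc 0 x₁, γ (t₀ + τ * u) = p + e * (ω * x + ω * τ * h x * Complex.I)
  surj : ∀ x ∈ Icc 0 x₁, ∃ u ∈ Icc 0 δ, γ (t₀ + τ * u) = p + e * (ω * x + ω * τ * h x * Complex.I)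

/-- A strictly increasing continuous `X` is a homeomorphism of compact intervals, so the curve `(X,
Y)` is the graph of `Y ∘ X⁻¹`. The constant extension through `projIcc` makes `h` vanish on the
left, so that two half graphs can later be combined by adding them. -/
lemma exists_graph_of_strictMonoOn {X Y : ℝ → ℝ} {δ : ℝ} (hδ : 0 < δ) (hXc : Continuous X)
    (hYc : Continuous Y) (hX : StrictMonoOn X (Icc 0 δ)) (hY : StrictMonoOn Y (Icc 0 δ))
    (hX0 : X 0 = 0) (hY0 : Y 0 = 0) :
    ∃ h : ℝ → ℝ, Continuous h ∧ (∀ x ≤ 0, h x = 0) ∧ StrictMonoOn h (Icc 0 (X δ)) ∧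
      (∀ u ∈ Icc 0 δ, h (X u) = Y u) ∧ ∀ x ∈ Icc 0 (X δ), ∃ u ∈ Icc 0 δ, X u = x := by
  have h0 : (0 : ℝ) ∈ Icc 0 δ := ⟨le_rfl, hδ.le⟩
  have h1 : δ ∈ Icc 0 δ := ⟨hδ.le, le_rfl⟩
  have hXδ : 0 < X δ := hX0 ▸ hX h0 h1 hδ
  have hsurj : ∀ x ∈ Icc 0 (X δ), ∃ u ∈ Icc 0 δ, X u = x := by
    intro x hx
    have := intermediate_value_Icc hδ.le hXc.continuousOn
    rw [hX0] at this
    exact this hx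
  have hmaps : ∀ u ∈ Icc 0 δ, X u ∈ Icc 0 (X δ) := fun u hu =>
    ⟨hX0 ▸ hX.monotoneOn h0 hu hu.1, hX.monotoneOn hu h1 hu.2⟩
  let e : Icc 0 δ ≃ Icc 0 (X δ) := Equiv.ofBijective (fun u => ⟨X u, hmaps u u.2⟩)
    ⟨fun u v huv => Subtype.ext (hX.injOn u.2 v.2 (Subtype.ext_iff.1 huv)),
      fun x => by
        obtain ⟨u, hu, hux⟩ := hsurj x x.2
        exact ⟨⟨u, hu⟩, Subtype.ext hux⟩⟩
  have hec : Continuous e := Continuous.subtype_mk (hXc.comp continuous_subtype_val) _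
  have hes : Continuous e.symm := hec.continuous_symm_of_equiv_compact_to_t2
  let h : ℝ → ℝ := fun x => Y (e.symm (projIcc 0 (X δ) hXδ.le x))
  have hval : ∀ u ∈ Icc 0 δ, h (X u) = Y u := by
    intro u hu
    simp only [h]
    rw [projIcc_of_mem hXδ.le (hmaps u hu)]
    have : (⟨X u, hmaps u hu⟩ : Icc 0 (X δ)) = e ⟨u, hu⟩ := rfl
    rw [this, e.symm_apply_apply]
  refine ⟨h, hYc.comp (continuous_subtype_val.comp (hes.comp continuous_projIcc)), ?_, ?_, hval,
    hsurj⟩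
  · intro x hx
    have : h x = h (X 0) := by
      simp only [h]
      rw [projIcc_of_le_left hXδ.le hx, hX0, projIcc_left]
    rw [this, hval 0 h0, hY0]
  · intro x hx y hy hxy
    obtain ⟨u, hu, rfl⟩ := hsurj x hx
    obtain ⟨v, hv, rfl⟩ := hsurj y hy
    rw [hval u hu, hval v hv]
    exact hY hu hv ((hX.lt_iff_lt hu hv).1 hxy)

lemma circlePoint_add (t t' : ℝ) : circlePoint (t + t') = circlePoint t * circlePoint t' := by
  simp [circlePoint, add_mul, Complex.exp_add]

lemma circlePoint_eq_cos_sin (t : ℝ) : circlePoint t = Real.cos t + Real.sin t * Complex.I := by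
  rw [circlePoint, Complex.exp_mul_I, Complex.ofReal_cos, Complex.ofReal_sin]

namespace TurningLoop

variable {κ : ℝ} {c : ℂ} {s : ℝ → ℝ} {γ : ℝ → ℂ} {G : Set ℂ}

lemma norm_dir (hL : TurningLoop κ c s γ G) (t : ℝ) : ‖turningDir κ c t‖ = 1 := by
  rw [turningDir, norm_mul, hL.norm_c, norm_circlePoint, mul_one]

lemma dir_ne_zero (hL : TurningLoop κ c s γ G) (t : ℝ) : turningDir κ c t ≠ 0 :=
  norm_pos_iff.1 (by rw [hL.norm_dir]; exact one_pos)

lemma continuous (hL : TurningLoop κ c s γ G) : Continuous γ :=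
  continuous_iff_continuousAt.2 fun t => (hL.hasDerivAt t).continuousAt

/-- In the frame `e` the direction at `t₀ + τu` is rotated by `τκu`, so up to the signs `ω` and `ωτ`
the coordinates have derivatives `r cos κu` and `r sin κu` with `r > 0`. Both increase while `κu <
π/2`. The signs record the orientation of the frame (`μ`), the side of `p` (`ω`) and the direction
of time (`τ`); the half arc lies above the tangent when `ωτ = 1` and below it when `ωτ = -1`. -/
lemma exists_halfArc (hL : TurningLoop κ c s γ G) {p e : ℂ} {μ ω τ t₀ δ₀ : ℝ}
    (hμ : μ = 1 ∨ μ = -1) (hω : ω = 1 ∨ ω = -1) (hτ : τ = 1 ∨ τ = -1) (hδ₀ : 0 < δ₀)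
    (hp : γ t₀ = p) (he : turningDir κ c t₀ = μ * e)
    (hs : ∀ u ∈ Ioo 0 δ₀, 0 < μ * ω * τ * s (t₀ + τ * u)) :
    ∃ δ₁ ∈ Ioc 0 δ₀, ∀ δ ∈ Ioo 0 δ₁, ∃ h x₁, HalfArc γ p e ω τ t₀ δ h x₁ := by
  have hκ := hL.kappa_pos
  have hμ2 : μ * μ = 1 := by rcases hμ with rfl | rfl <;> norm_num
  have hω2 : ω * ω = 1 := by rcases hω with rfl | rfl <;> norm_num
  have hτ2 : τ * τ = 1 := by rcases hτ with rfl | rfl <;> norm_num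
  have hμ0 : μ ≠ 0 := by rintro rfl; norm_num at hμ2
  have he0 : e ≠ 0 := by
    rintro rfl
    exact hL.dir_ne_zero t₀ (by rw [he, mul_zero])
  set r : ℝ → ℝ := fun u => μ * ω * τ * s (t₀ + τ * u) with hr
  set w : ℝ → ℂ := fun u => (γ (t₀ + τ * u) - p) / e with hw
  have hwd : ∀ u, HasDerivAt w (ω * (r u * Real.cos (κ * u)) +
      ω * τ * (r u * Real.sin (κ * u)) * Complex.I) u := by
    intro u
    have h1 : HasDerivAt (fun u => t₀ + τ * u) τ u := by
      simpa using ((hasDerivAt_id u).const_mul τ).const_add t₀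
    have h2 := (((hL.hasDerivAt (t₀ + τ * u)).scomp u h1).sub_const p).div_const e
    refine h2.congr_deriv ?_
    have h3 : turningDir κ c (t₀ + τ * u) = μ * e * (Real.cos (κ * u) +
        τ * Real.sin (κ * u) * Complex.I) := by
      rw [← he, turningDir, turningDir, mul_add, circlePoint_add, mul_assoc]
      congr 2
      rw [circlePoint_eq_cos_sin]
      rcases hτ with rfl | rfl <;> simp
    rw [h3, Complex.real_smul]
    simp only [hr]
    push_cast
    have hω2' : (ω : ℂ) * ω = 1 := by exact_mod_cast hω2
    have hτ2' : (τ : ℂ) * τ = 1 := by exact_mod_cast hτ2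
    field_simp
    linear_combination (τ * s (t₀ + τ * u) * (1 : ℂ) * μ * (-1) * Complex.cos (κ * u) - s (t₀ + τ * u) * μ * τ ^ 2 * Complex.I * Complex.sin (κ * u)) * hω2'
  have hre : ∀ u, HasDerivAt (fun u => ω * (w u).re) (r u * Real.cos (κ * u)) u := by
    intro u
    have := (Complex.reCLM.hasFDerivAt.comp_hasDerivAt u (hwd u)).const_mul ω
    refine this.congr_deriv ?_
    simp only [Complex.reCLM_apply, Complex.add_re, Complex.mul_re, Complex.mul_im,
      Complex.ofReal_re, Complex.ofReal_im, Complex.I_re, Complex.I_im]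
    linear_combination (r u * Real.cos (κ * u)) * hω2
  have him : ∀ u, HasDerivAt (fun u => ω * τ * (w u).im) (r u * Real.sin (κ * u)) u := by
    intro u
    have := (Complex.imCLM.hasFDerivAt.comp_hasDerivAt u (hwd u)).const_mul (ω * τ)
    refine this.congr_deriv ?_
    simp only [Complex.imCLM_apply, Complex.add_im, Complex.mul_re, Complex.mul_im,
      Complex.ofReal_re, Complex.ofReal_im, Complex.I_re, Complex.I_im]
    linear_combination (r u * Real.sin (κ * u)) * hω2 + (r u * Real.sin (κ * u)) * ω * ω * hτ2
  refine ⟨min δ₀ (Real.pi / 2 / κ), ⟨lt_min hδ₀ (by positivity), min_le_left _ _⟩, ?_⟩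
  intro δ hδ
  have hrange : ∀ u ∈ interior (Icc 0 δ), 0 < r u ∧ 0 < Real.cos (κ * u) ∧
      0 < Real.sin (κ * u) := by
    intro u hu
    rw [interior_Icc] at hu
    have hu1 : u < δ₀ := hu.2.trans (hδ.2.trans_le (min_le_left _ _))
    have hu2 : u < Real.pi / 2 / κ := hu.2.trans (hδ.2.trans_le (min_le_right _ _))
    rw [lt_div_iff₀ hκ] at hu2
    have h0 : 0 < κ * u := mul_pos hκ hu.1
    refine ⟨hs u ⟨hu.1, hu1⟩, Real.cos_pos_of_mem_Ioo ⟨?_, ?_⟩, Real.sin_pos_of_pos_of_lt_pi h0 ?_⟩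
      <;> nlinarith [Real.pi_pos]
  have hXc : Continuous fun u => ω * (w u).re :=
    continuous_iff_continuousAt.2 fun u => (hre u).continuousAt
  have hYc : Continuous fun u => ω * τ * (w u).im :=
    continuous_iff_continuousAt.2 fun u => (him u).continuousAt
  have hX : StrictMonoOn (fun u => ω * (w u).re) (Icc 0 δ) :=
    strictMonoOn_of_deriv_pos (convex_Icc _ _) hXc.continuousOn fun u hu => by
      rw [(hre u).deriv]; exact mul_pos (hrange u hu).1 (hrange u hu).2.1
  have hY : StrictMonoOn (fun u => ω * τ * (w u).im) (Icc 0 δ) :=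
    strictMonoOn_of_deriv_pos (convex_Icc _ _) hYc.continuousOn fun u hu => by
      rw [(him u).deriv]; exact mul_pos (hrange u hu).1 (hrange u hu).2.2
  have hw0 : w 0 = 0 := by simp [hw, hp]
  obtain ⟨h, hhc, hh0, hhm, hhval, hhs⟩ := exists_graph_of_strictMonoOn hδ.1 hXc hYc hX hY
    (by simp [hw0]) (by simp [hw0])
  have h0 : (0 : ℝ) ∈ Icc 0 δ := ⟨le_rfl, hδ.1.le⟩
  have h1 : δ ∈ Icc 0 δ := ⟨hδ.1.le, le_rfl⟩
  have hpt : ∀ u ∈ Icc 0 δ, γ (t₀ + τ * u) = p + e * (ω * ((ω * (w u).re : ℝ) : ℂ) +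
      ω * τ * h (ω * (w u).re) * Complex.I) := by
    intro u hu
    rw [hhval u hu]
    have : γ (t₀ + τ * u) = p + e * w u := by simp only [hw]; field_simp; ring
    rw [this]
    congr 2
    have hω2' : (ω : ℂ) * ω = 1 := by exact_mod_cast hω2
    have hτ2' : (τ : ℂ) * τ = 1 := by exact_mod_cast hτ2
    conv_lhs => rw [← Complex.re_add_im (w u)]
    push_cast
    linear_combination (-((w u).re : ℂ) - (w u).im * Complex.I) * hω2' -
      ω * ω * (w u).im * Complex.I * hτ2'
  refine ⟨h, ω * (w δ).re, ?_, hhc, hh0, hhm, ?_, ?_⟩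
  · simpa [hw0] using hX h0 h1 hδ.1
  · intro u hu
    refine ⟨_, ⟨?_, hX.monotoneOn hu h1 hu.2⟩, hpt u hu⟩
    simpa [hw0] using hX.monotoneOn h0 hu hu.1
  · intro x hx
    obtain ⟨u, hu, rfl⟩ := hhs x hx
    exact ⟨u, hu, hpt u hu⟩

/-- Points of the curve close to `p` have parameters close to the preimages of `p`. -/
lemma exists_ball_localization (hL : TurningLoop κ c s γ G) {p : ℂ} {T : Set ℝ}
    (hT : ∀ t, γ t = p → ∃ t₀ ∈ T, circlePoint t = circlePoint t₀) {δ : ℝ} (hδ : 0 < δ) :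
    ∃ r > 0, ∀ t, ‖γ t - p‖ < r → ∃ t₀ ∈ T, ∃ t', |t' - t₀| < δ ∧
      circlePoint t' = circlePoint t := by
  set O : Set ℝ := {t | ∃ t₀ ∈ T, ∃ t', |t' - t₀| < δ ∧ circlePoint t' = circlePoint t} with hO
  have hOo : IsOpen O := by
    have : O = ⋃ t₀ ∈ T, ⋃ n : ℤ, {t | |t + n * (2 * Real.pi) - t₀| < δ} := by
      ext t
      simp only [hO, mem_ofPred_eq, mem_iUnion, exists_prop, circlePoint_eq_iff]
      constructor
      · rintro ⟨t₀, h0, t', ht', n, rfl⟩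
        exact ⟨t₀, h0, n, ht'⟩
      · rintro ⟨t₀, h0, n, hn⟩
        exact ⟨t₀, h0, _, hn, n, rfl⟩
    rw [this]
    refine isOpen_biUnion fun t₀ _ => isOpen_iUnion fun n => ?_
    exact isOpen_lt (by fun_prop) continuous_const
  have hK : IsCompact (γ '' (Icc 0 (2 * Real.pi) \ O)) :=
    (isCompact_Icc.diff hOo).image hL.continuous
  have hpK : p ∈ (γ '' (Icc 0 (2 * Real.pi) \ O))ᶜ := by
    rintro ⟨t, ⟨_, ht⟩, htp⟩
    obtain ⟨t₀, h0, h1⟩ := hT t htp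
    exact ht ⟨t₀, h0, t₀, by simpa using hδ, h1.symm⟩
  obtain ⟨r, hr, hball⟩ := Metric.isOpen_iff.1 hK.isClosed.isOpen_compl p hpK
  refine ⟨r, hr, fun t ht => ?_⟩
  obtain ⟨t₁, ht₁, n, hn⟩ : ∃ t₁ ∈ Icc 0 (2 * Real.pi), ∃ n : ℤ, t₁ = t + n * (2 * Real.pi) := by
    have h2 : 0 < 2 * Real.pi := Real.two_pi_pos
    have := toIcoMod_mem_Ico h2 0 t
    refine ⟨toIcoMod h2 0 t, ⟨this.1, by simpa using this.2.le⟩, -toIcoDiv h2 0 t, ?_⟩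
    rw [toIcoMod, zsmul_eq_mul]; push_cast; ring
  have hE : circlePoint t₁ = circlePoint t := circlePoint_eq_iff.2 ⟨n, hn⟩
  have hmem : t₁ ∈ O := by
    by_contra hno
    have : γ t ∈ Metric.ball p r := by rwa [Metric.mem_ball, dist_eq_norm]
    exact hball this ⟨t₁, ⟨ht₁, hno⟩, hL.periodic _ _ hE⟩
  obtain ⟨t₀, h0, t', h1, h2⟩ := hmem
  exact ⟨t₀, h0, t', h1, h2.trans hE⟩

end TurningLoop

/-- The decomposition of the unit circle by the singular parameters of a closed curve `γ` (cusps and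
double points) into arcs `(a i, b i)`. The arc that ends where `v` begins is `pred v`. -/
structure ArcSystem (s : ℝ → ℝ) (γ : ℝ → ℂ) {ι : Type} [Fintype ι] [DecidableEq ι] (a b : ι → ℝ)
    (pred : Equiv.Perm ι) : Prop where
  lt : ∀ i, a i < b i
  end_pred : ∀ v, circlePoint (b (pred v)) = circlePoint (a v)
  regular : ∀ i, ∀ t ∈ Ioo (a i) (b i), s t ≠ 0 ∧ ∀ t', γ t' = γ t → circlePoint t' = circlePoint t
  cover : ∀ t, ∃ i, ∃ t' ∈ Ico (a i) (b i), circlePoint t' = circlePoint t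
  disj : ∀ i j, ∀ t ∈ Ico (a i) (b i), ∀ t' ∈ Ico (a j) (b j),
    circlePoint t = circlePoint t' → i = j ∧ t = t'
  sum_length : ∑ i, (b i - a i) = 2 * Real.pi
  singular : ∀ v, s (a v) = 0 ∨ ∃ t, γ t = γ (a v) ∧ circlePoint t ≠ circlePoint (a v)
  -- `J` is the run of consecutive arcs from the vertex `i` up to the vertex `j`: in cyclic order
  -- its indicator jumps up at `i` and down at `j`.
  interval : ∀ i j, i ≠ j → ∃ J : Finset ι, ∀ v,
    ((if v ∈ J then 1 else 0) - (if pred v ∈ J then 1 else 0) : ℤ) =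
      (if v = i then 1 else 0) - (if v = j then 1 else 0)

/-- The arcs with index in `I` form a closed chain. -/
def IsClosedChain (γ : ℝ → ℂ) {ι : Type} (a b : ι → ℝ) (I : Finset ι) : Prop :=
  ∀ ψ : ℂ → ℂ, ∑ i ∈ I, ψ (γ (a i)) = ∑ i ∈ I, ψ (γ (b i))

/-- The Cauchy integral along the arcs with index in `I`. -/
noncomputable def chainIntegral (γ γ' : ℝ → ℂ) {ι : Type} (a b : ι → ℝ) (I : Finset ι) (p : ℂ) : ℂ :=
  ∑ i ∈ I, arcIntegral γ γ' (a i) (b i) p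

lemma IsOpen.isPreconnected_const_of_hasDerivAt_zero {f : ℂ → ℂ} {O S : Set ℂ} (hO : IsOpen O)
    (hf : ∀ p ∈ O, HasDerivAt f 0 p) (hS : IsPreconnected S) (hSO : S ⊆ O) {x y : ℂ} (hx : x ∈ S)
    (hy : y ∈ S) : f x = f y := by
  have h1 := hS.subset_connectedComponentIn hx hSO
  have h2 := connectedComponentIn_subset O x
  exact hO.connectedComponentIn.is_const_of_deriv_eq_zero isPreconnected_connectedComponentIn
    (fun p hp => (hf p (h2 hp)).differentiableAt.differentiableWithinAt)
    (fun p hp => (hf p (h2 hp)).deriv) (h1 hx) (h1 hy)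

section

variable {κ : ℝ} {c : ℂ} {s : ℝ → ℝ} {γ : ℝ → ℂ} {G : Set ℂ} {ι : Type} [Fintype ι] [DecidableEq ι]
  {a b : ι → ℝ} {pred : Equiv.Perm ι}

lemma TurningLoop.isClosed_range (hL : TurningLoop κ c s γ G) : IsClosed (range γ) := by
  have : range γ = (G ∪ range γ) \ G := by
    rw [union_sdiff_left]
    refine (sdiff_eq_left.2 ?_).symm
    rw [disjoint_left]
    rintro _ ⟨t, rfl⟩; exact hL.notMem t
  rw [this]
  exact hL.isClosed.sdiff hL.isOpen

lemma TurningLoop.continuous_velocity (hL : TurningLoop κ c s γ G) :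
    Continuous fun t => turningDir κ c t * s t := by
  have := hL.smooth.continuous
  unfold turningDir circlePoint
  fun_prop

/-- The endpoint terms cancel on applying the chain condition to `ψ z = (z - p)⁻¹`. The chain
integral is thus locally constant off the curve and serves as `2πi` times a winding number. -/
lemma TurningLoop.hasDerivAt_chainIntegral (hL : TurningLoop κ c s γ G)
    (hA : ArcSystem s γ a b pred) {I : Finset ι} (hI : IsClosedChain γ a b I) {p : ℂ}
    (hp : p ∈ (range γ)ᶜ) :
    HasDerivAt (chainIntegral γ (fun t => turningDir κ c t * s t) a b I) 0 p := by
  have h : ∀ i ∈ I, HasDerivAt (arcIntegral γ (fun t => turningDir κ c t * s t) (a i) (b i)) _ p :=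
    fun i _ => hasDerivAt_arcIntegral hL.hasDerivAt hL.continuous_velocity (hA.lt i).le
      fun t _ ht => hp ⟨t, ht⟩
  have hs := HasDerivAt.fun_sum h
  rw [Finset.sum_sub_distrib, hI fun z => (z - p)⁻¹, sub_self] at hs
  exact hs

lemma ArcSystem.notMem_arc (hA : ArcSystem s γ a b pred) {i j : ι} {t t' : ℝ}
    (ht : t ∈ Ioo (a i) (b i)) (ht' : t' ∈ Icc (a j) (b j)) (h : γ t' = γ t) : j = i ∧ t' = t := by
  have hE := (hA.regular i t ht).2 t' h
  rcases ht'.2.lt_or_eq with hlt | heq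
  · exact hA.disj j i t' ⟨ht'.1, hlt⟩ t ⟨ht.1.le, ht.2⟩ hE
  -- A right endpoint is, modulo the period, the left endpoint of the following arc, so it is never
  -- interior to an arc.
  · exfalso
    have h1 := hA.end_pred (pred.symm j)
    rw [pred.apply_symm_apply, ← heq, hE] at h1
    have := hA.disj i (pred.symm j) t ⟨ht.1.le, ht.2⟩ (a (pred.symm j))
      ⟨le_rfl, hA.lt _⟩ h1
    rw [← this.1] at this
    exact ht.1.ne' this.2

/-- An interior point of an arc is passed only once by the whole curve: arc `i` contributes the jump
`2πi`, and every other arc has a continuous Cauchy integral there. -/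
lemma TurningLoop.tendsto_jump_chainIntegral (hL : TurningLoop κ c s γ G)
    (hA : ArcSystem s γ a b pred) (I : Finset ι) {i : ι} {t : ℝ} (ht : t ∈ Ioo (a i) (b i)) :
    Tendsto (fun ε : ℝ => chainIntegral γ (fun t => turningDir κ c t * s t) a b I
        (γ t + ε * (Complex.I * (turningDir κ c t * s t))) -
      chainIntegral γ (fun t => turningDir κ c t * s t) a b I
        (γ t - ε * (Complex.I * (turningDir κ c t * s t)))) (𝓝[>] 0)
      (𝓝 (if i ∈ I then 2 * Real.pi * Complex.I else 0)) := by
  have hterm : ∀ j ∈ I, Tendsto (fun ε : ℝ =>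
      arcIntegral γ (fun t => turningDir κ c t * s t) (a j) (b j)
        (γ t + ε * (Complex.I * (turningDir κ c t * s t))) -
      arcIntegral γ (fun t => turningDir κ c t * s t) (a j) (b j)
        (γ t - ε * (Complex.I * (turningDir κ c t * s t)))) (𝓝[>] 0)
      (𝓝 (if j = i then 2 * Real.pi * Complex.I else 0)) := by
    intro j _
    split_ifs with hji
    · subst hji
      exact tendsto_jump_arcIntegral hL.hasDerivAt hL.continuous_velocity ht
        (mul_ne_zero (hL.dir_ne_zero t) (by exact_mod_cast (hA.regular j t ht).1))
        fun t' ht' h => (hA.notMem_arc ht ht' h).2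
    · have hcont := (hasDerivAt_arcIntegral hL.hasDerivAt hL.continuous_velocity (hA.lt j).le
        (p := γ t) fun t' ht' h => hji (hA.notMem_arc ht ht' h).1).continuousAt
      set e := Complex.I * (turningDir κ c t * s t)
      refine tendsto_nhdsWithin_of_tendsto_nhds ?_
      have c1 : ContinuousAt (fun ε : ℝ => arcIntegral γ (fun t => turningDir κ c t * s t) (a j)
          (b j) (γ t + ε * e)) 0 :=
        ContinuousAt.comp (g := arcIntegral γ (fun t => turningDir κ c t * s t) (a j) (b j))
          (f := fun ε : ℝ => γ t + ε * e) (x := 0) (by simpa using hcont) (by fun_prop)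
      have c2 : ContinuousAt (fun ε : ℝ => arcIntegral γ (fun t => turningDir κ c t * s t) (a j)
          (b j) (γ t - ε * e)) 0 :=
        ContinuousAt.comp (g := arcIntegral γ (fun t => turningDir κ c t * s t) (a j) (b j))
          (f := fun ε : ℝ => γ t - ε * e) (x := 0) (by simpa using hcont) (by fun_prop)
      have c3 : Tendsto _ _ _ := c1.sub c2
      simpa [Pi.sub_def] using c3
  have := tendsto_finsetSum I hterm
  simp only [Finset.sum_ite_eq', Finset.sum_sub_distrib] at this
  exact this

lemma ArcSystem.isClosedChain_univ (hL : TurningLoop κ c s γ G) (hA : ArcSystem s γ a b pred) :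
    IsClosedChain γ a b Finset.univ := by
  intro ψ
  rw [← Equiv.sum_comp pred (fun i => ψ (γ (b i)))]
  refine Finset.sum_congr rfl fun v _ => ?_
  rw [hL.periodic _ _ (hA.end_pred v)]

end

/-! ### Local pictures of a turning loop -/

/-- The point with coordinates `x, y` in the frame with origin `p` and first axis `e`. -/
noncomputable def framePoint (p e : ℂ) (x y : ℝ) : ℂ := p + e * (x + y * Complex.I)

lemma framePoint_inj {p e : ℂ} (he : e ≠ 0) {x y x' y' : ℝ} :
    framePoint p e x y = framePoint p e x' y' ↔ x = x' ∧ y = y' := by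
  unfold framePoint
  rw [add_right_inj, mul_right_inj' he]
  constructor
  · intro h
    have h1 := congrArg Complex.re h
    have h2 := congrArg Complex.im h
    simp at h1 h2
    exact ⟨h1, h2⟩
  · rintro ⟨rfl, rfl⟩; rfl

lemma exists_framePoint {p e : ℂ} (he : e ≠ 0) (z : ℂ) :
    z = framePoint p e ((z - p) / e).re ((z - p) / e).im := by
  unfold framePoint
  rw [Complex.re_add_im]
  field_simp; ring

lemma norm_framePoint_sub {p e : ℂ} (he : ‖e‖ = 1) {x y r : ℝ} (hx : |x| < r / 2)
    (hy : |y| < r / 2) : ‖framePoint p e x y - p‖ < r := by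
  unfold framePoint
  rw [add_sub_cancel_left, norm_mul, he, one_mul]
  calc ‖(x + y * Complex.I : ℂ)‖ ≤ ‖(x : ℂ)‖ + ‖(y * Complex.I : ℂ)‖ := norm_add_le _ _
    _ = |x| + |y| := by simp
    _ < r := by linarith

lemma eventually_framePoint {p e : ℂ} (he : e ≠ 0) {x y x₁ η : ℝ} (hx : |x| < x₁) (hy : |y| < η) :
    ∀ᶠ z in 𝓝 (framePoint p e x y), ∃ x y, |x| < x₁ ∧ |y| < η ∧ z = framePoint p e x y := by
  have hc : Continuous fun z : ℂ => (z - p) / e := by fun_prop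
  have h := framePoint_inj (p := p) he |>.1 (exists_framePoint (p := p) he (framePoint p e x y))
  have h1 : ∀ᶠ z in 𝓝 (framePoint p e x y), |((z - p) / e).re| < x₁ :=
    ((Complex.continuous_re.comp hc).abs.continuousAt).eventually_lt_const (by
      simpa [← h.1] using hx)
  have h2 : ∀ᶠ z in 𝓝 (framePoint p e x y), |((z - p) / e).im| < η :=
    ((Complex.continuous_im.comp hc).abs.continuousAt).eventually_lt_const (by
      simpa [← h.2] using hy)
  filter_upwards [h1, h2] with z hz1 hz2
  exact ⟨_, _, hz1, hz2, exists_framePoint he z⟩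

/-- The points strictly between two graphs. -/
def betweenGraphs (p e : ℂ) (S : Set ℝ) (f g : ℝ → ℝ) : Set ℂ :=
  {z | ∃ x y, x ∈ S ∧ f x < y ∧ y < g x ∧ z = framePoint p e x y}

lemma isPreconnected_betweenGraphs (p e : ℂ) {S : Set ℝ} (hS : IsPreconnected S) {f g : ℝ → ℝ}
    (hf : Continuous f) (hg : Continuous g) (hfg : ∀ x ∈ S, f x < g x) :
    IsPreconnected (betweenGraphs p e S f g) := by
  have : betweenGraphs p e S f g =
      (fun q : ℝ × ℝ => framePoint p e q.1 (f q.1 + q.2 * (g q.1 - f q.1))) ''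
        (S ×ˢ Ioo (0 : ℝ) 1) := by
    ext z
    constructor
    · rintro ⟨x, y, hx, h1, h2, rfl⟩
      have h3 : 0 < g x - f x := sub_pos.2 (hfg x hx)
      refine ⟨(x, (y - f x) / (g x - f x)), ⟨hx, div_pos (by linarith) h3,
        (div_lt_one h3).2 (by linarith)⟩, ?_⟩
      dsimp only
      rw [div_mul_cancel₀ _ h3.ne']
      congr 1; ring
    · rintro ⟨⟨x, u⟩, ⟨hx, hu0, hu1⟩, rfl⟩
      have h3 : 0 < g x - f x := sub_pos.2 (hfg x hx)
      dsimp only at hu0 hu1 hx ⊢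
      exact ⟨x, _, hx, by nlinarith, by nlinarith, rfl⟩
  rw [this]
  refine (hS.prod isPreconnected_Ioo).image _ (Continuous.continuousOn ?_)
  unfold framePoint
  fun_prop

namespace HalfArc

variable {γ : ℝ → ℂ} {p e : ℂ} {ω τ t₀ δ x₁ : ℝ} {h : ℝ → ℝ}

lemma h_pos (H : HalfArc γ p e ω τ t₀ δ h x₁) {x : ℝ} (hx : x ∈ Ioc 0 x₁) : 0 < h x := by
  have := H.mono ⟨le_rfl, H.pos.le⟩ ⟨hx.1.le, hx.2⟩ hx.1
  rwa [H.zero_left 0 le_rfl] at this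

lemma param' (H : HalfArc γ p e ω τ t₀ δ h x₁) {u : ℝ} (hu : u ∈ Icc 0 δ) :
    ∃ x ∈ Icc 0 x₁, γ (t₀ + τ * u) = framePoint p e (ω * x) (ω * τ * h x) := by
  obtain ⟨x, hx, hxe⟩ := H.param u hu
  refine ⟨x, hx, ?_⟩
  rw [hxe, framePoint]; push_cast; rfl

lemma surj' (H : HalfArc γ p e ω τ t₀ δ h x₁) (he : e ≠ 0) (hω : ω ≠ 0) (hp : γ t₀ = p) {x : ℝ}
    (hx : x ∈ Ioc 0 x₁) :
    ∃ u ∈ Ioc 0 δ, γ (t₀ + τ * u) = framePoint p e (ω * x) (ω * τ * h x) := by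
  obtain ⟨u, hu, hxe⟩ := H.surj x ⟨hx.1.le, hx.2⟩
  have hxe' : γ (t₀ + τ * u) = framePoint p e (ω * x) (ω * τ * h x) := by
    rw [hxe, framePoint]; push_cast; rfl
  refine ⟨u, ⟨hu.1.lt_of_ne' ?_, hu.2⟩, hxe'⟩
  rintro rfl
  have hp0 : framePoint p e 0 0 = p := by simp [framePoint]
  rw [mul_zero, add_zero, hp] at hxe'
  have := (((framePoint_inj he).1 (hp0.trans hxe')).1).symm
  simp [hω, hx.1.ne'] at this

end HalfArc

section

variable {κ : ℝ} {c : ℂ} {s : ℝ → ℝ} {γ : ℝ → ℂ} {G : Set ℂ}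

lemma exists_small_box {A B : ℝ → ℝ} (hA : Continuous A) (hB : Continuous B) (hA0 : A 0 = 0)
    (hB0 : B 0 = 0) {η X : ℝ} (hη : 0 < η) (hX : 0 < X) :
    ∃ x₁ ∈ Ioo 0 X, ∀ x, |x| < x₁ → |A x| < η ∧ |B x| < η := by
  have h1 : ∀ᶠ x in 𝓝 (0 : ℝ), |A x| < η :=
    hA.abs.continuousAt.eventually_lt_const (by simpa [hA0] using hη)
  have h2 : ∀ᶠ x in 𝓝 (0 : ℝ), |B x| < η :=
    hB.abs.continuousAt.eventually_lt_const (by simpa [hB0] using hη)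
  obtain ⟨r, hr, hball⟩ := Metric.eventually_nhds_iff_ball.1 (h1.and h2)
  refine ⟨min r (X / 2), ⟨lt_min hr (by linarith), (min_le_right _ _).trans_lt (by linarith)⟩,
    fun x hx => hball x ?_⟩
  rw [Metric.mem_ball, Real.dist_eq, sub_zero]
  exact hx.trans_le (min_le_left _ _)

lemma exists_sign {x : ℝ} (hx : x ≠ 0) : ∃ μ : ℝ, (μ = 1 ∨ μ = -1) ∧ 0 < μ * x ∧ μ * |x| = x := by
  rcases lt_or_gt_of_ne hx with h | h
  · exact ⟨-1, .inr rfl, by linarith, by rw [abs_of_neg h]; ring⟩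
  · exact ⟨1, .inl rfl, by linarith, by rw [abs_of_pos h]; ring⟩

lemma TurningLoop.eventually_sign (hL : TurningLoop κ c s γ G) {t μ : ℝ} (h : 0 < μ * s t) :
    ∃ δ₀ > 0, ∀ t', |t' - t| < δ₀ → 0 < μ * s t' := by
  have hc : Continuous fun t => μ * s t := continuous_const.mul hL.smooth.continuous
  obtain ⟨r, hr, hball⟩ := Metric.eventually_nhds_iff_ball.1
    (hc.continuousAt.eventually_const_lt h)
  exact ⟨r, hr, fun t' ht' => hball t' (by rwa [Metric.mem_ball, Real.dist_eq])⟩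

/-- Near a regular simple point the curve is the graph of a function with a strict minimum. -/
lemma TurningLoop.exists_box_regular (hL : TurningLoop κ c s γ G) {t : ℝ} (hs : s t ≠ 0)
    (hsimple : ∀ t', γ t' = γ t → circlePoint t' = circlePoint t) :
    ∃ e : ℂ, ‖e‖ = 1 ∧ turningDir κ c t * s t = |s t| * e ∧
    ∃ x₁ > 0, ∃ η > 0, ∃ A : ℝ → ℝ, Continuous A ∧ A 0 = 0 ∧
      (∀ x, |x| < x₁ → x ≠ 0 → 0 < A x) ∧ (∀ x, |x| < x₁ → |A x| < η) ∧
      ∀ x y, |x| < x₁ → |y| < η → (framePoint (γ t) e x y ∈ range γ ↔ y = A x) := by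
  obtain ⟨μ, hμ, hμs, hμa⟩ := exists_sign hs
  have hμ2 : (μ : ℂ) * μ = 1 := by rcases hμ with rfl | rfl <;> norm_num
  set e := μ * turningDir κ c t with he
  have hdir : turningDir κ c t = μ * e := by rw [he, ← mul_assoc, hμ2, one_mul]
  have hen : ‖e‖ = 1 := by
    rw [he, norm_mul, hL.norm_dir]; rcases hμ with rfl | rfl <;> simp
  have he0 : e ≠ 0 := norm_pos_iff.1 (by rw [hen]; exact one_pos)
  refine ⟨e, hen, ?_, ?_⟩
  · conv_lhs => rw [hdir, ← hμa]
    push_cast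
    linear_combination (((|s t| : ℝ) : ℂ) * e) * hμ2
  obtain ⟨δ₀, hδ₀, hsign⟩ := hL.eventually_sign hμs
  -- The forward half (`ω = τ = 1`) goes to the right and the backward half (`ω = τ = -1`) to the
  -- left. In both cases `ωτ = 1`, so both lie above the tangent.
  obtain ⟨d1, hd1, H1⟩ := hL.exists_halfArc (p := γ t) (e := e) (ω := 1) (τ := 1) hμ (.inl rfl)
    (.inl rfl) hδ₀ rfl hdir (fun u hu => by
      have := hsign (t + 1 * u) (by rw [abs_lt]; constructor <;> linarith [hu.1, hu.2])
      linarith)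
  obtain ⟨d2, hd2, H2⟩ := hL.exists_halfArc (p := γ t) (e := e) (ω := -1) (τ := -1) hμ (.inr rfl)
    (.inr rfl) hδ₀ rfl hdir (fun u hu => by
      have := hsign (t + -1 * u) (by rw [abs_lt]; constructor <;> linarith [hu.1, hu.2])
      linarith)
  obtain ⟨δ, hδ0, hδ⟩ := exists_between (lt_min hd1.1 hd2.1)
  obtain ⟨h1, X1, H1⟩ := H1 δ ⟨hδ0, hδ.trans_le (min_le_left _ _)⟩
  obtain ⟨h2, X2, H2⟩ := H2 δ ⟨hδ0, hδ.trans_le (min_le_right _ _)⟩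
  obtain ⟨r, hr, hloc⟩ := hL.exists_ball_localization (p := γ t) (T := {t})
    (fun t' ht' => ⟨t, rfl, hsimple t' ht'⟩) hδ0
  set A : ℝ → ℝ := fun x => h1 x + h2 (-x) with hAdef
  have hAc : Continuous A := H1.continuous.add (H2.continuous.comp continuous_neg)
  have hA0 : A 0 = 0 := by simp [hAdef, H1.zero_left, H2.zero_left]
  obtain ⟨x₁, ⟨hx₁, hx₁'⟩, hAB⟩ := exists_small_box hAc hAc hA0 hA0 (η := r / 2)
    (X := min (min X1 X2) (r / 2)) (by linarith) (lt_min (lt_min H1.pos H2.pos) (by linarith))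
  have hxX1 : x₁ < X1 := hx₁'.trans_le ((min_le_left _ _).trans (min_le_left _ _))
  have hxX2 : x₁ < X2 := hx₁'.trans_le ((min_le_left _ _).trans (min_le_right _ _))
  have hxr : x₁ < r / 2 := hx₁'.trans_le (min_le_right _ _)
  have hAp : ∀ x, 0 ≤ x → A x = h1 x := fun x hx => by simp [hAdef, H2.zero_left, hx]
  have hAn : ∀ x, x ≤ 0 → A x = h2 (-x) := fun x hx => by simp [hAdef, H1.zero_left, hx]
  refine ⟨x₁, hx₁, r / 2, by linarith, A, hAc, hA0, ?_, fun x hx => (hAB x hx).1, ?_⟩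
  · intro x hx hx0
    rw [abs_lt] at hx
    rcases lt_or_gt_of_ne hx0 with h | h
    · rw [hAn x h.le]; exact H2.h_pos ⟨by linarith, by linarith⟩
    · rw [hAp x h.le]; exact H1.h_pos ⟨h, by linarith⟩
  · intro x y hx hy
    constructor
    · rintro ⟨t', ht'⟩
      obtain ⟨t₁, ht₁ : t₁ = t, t'', h3, h4⟩ := hloc t' (by
        rw [ht']; exact norm_framePoint_sub hen (hx.trans hxr) hy)
      rw [← hL.periodic _ _ h4] at ht'
      rw [ht₁, abs_lt] at h3
      rcases le_total t'' t with h5 | h5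
      · obtain ⟨x', hx', hxe⟩ := H2.param' (u := t - t'') ⟨by linarith, by linarith⟩
        rw [show t + -1 * (t - t'') = t'' by ring, ht', framePoint_inj he0] at hxe
        rw [hxe.1, hxe.2, hAn _ (by linarith [hx'.1])]; simp
      · obtain ⟨x', hx', hxe⟩ := H1.param' (u := t'' - t) ⟨by linarith, by linarith⟩
        rw [show t + 1 * (t'' - t) = t'' by ring, ht', framePoint_inj he0] at hxe
        rw [hxe.1, hxe.2, hAp _ (by linarith [hx'.1])]; simp
    · rintro rfl
      rw [abs_lt] at hx
      rcases lt_trichotomy x 0 with h | rfl | h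
      · obtain ⟨u, _, hu⟩ := H2.surj' he0 (by norm_num) rfl (x := -x) ⟨by linarith, by linarith⟩
        refine ⟨_, hu.trans ?_⟩
        rw [hAn x h.le]; simp
      · exact ⟨t, by simp [hA0, framePoint]⟩
      · obtain ⟨u, _, hu⟩ := H1.surj' he0 (by norm_num) rfl (x := x) ⟨by linarith, by linarith⟩
        refine ⟨_, hu.trans ?_⟩
        rw [hAp x h.le]; simp

/-- Three velocities cannot be pairwise opposite: two of them opposite to the third would have the
same direction. -/
lemma TurningLoop.circlePoint_of_double (hL : TurningLoop κ c s γ G) {α β t : ℝ}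
    (hαβ : γ α = γ β) (hne : circlePoint α ≠ circlePoint β) (ht : γ t = γ α) :
    circlePoint t = circlePoint α ∨ circlePoint t = circlePoint β := by
  by_contra! h
  obtain ⟨-, -, r1, hr1, h1⟩ := hL.opposite t α ht h.1
  obtain ⟨-, hs, r2, hr2, h2⟩ := hL.opposite t β (ht.trans hαβ) h.2
  obtain ⟨-, -, r3, hr3, h3⟩ := hL.opposite α β hαβ hne
  rw [h1, h3] at h2
  have hv : turningDir κ c β * s β ≠ 0 := mul_ne_zero (hL.dir_ne_zero β) (by exact_mod_cast hs)
  have : (r1 * r3 + r2 : ℂ) * (turningDir κ c β * s β) = 0 := by linear_combination h2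
  rw [mul_eq_zero, or_iff_left hv] at this
  have h4 : r1 * r3 + r2 = 0 := by exact_mod_cast this
  nlinarith [mul_pos hr1 hr3]

lemma TurningLoop.circlePoint_of_cusp (hL : TurningLoop κ c s γ G) {α t : ℝ}
    (hα : s α = 0) (ht : γ t = γ α) : circlePoint t = circlePoint α := by
  by_contra h
  exact (hL.opposite t α ht h).2.1 hα

/-- Near a double point the curve consists of two graphs that touch each other. -/
lemma TurningLoop.exists_box_double (hL : TurningLoop κ c s γ G) {α β : ℝ} (hαβ : γ α = γ β)
    (hne : circlePoint α ≠ circlePoint β) {δ₀ : ℝ} (hδ₀ : 0 < δ₀) :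
    ∃ e : ℂ, ‖e‖ = 1 ∧ turningDir κ c α * s α = |s α| * e ∧ turningDir κ c β * s β = |s β| * -e ∧
    ∃ x₁ > 0, ∃ η > 0, ∃ A B : ℝ → ℝ, Continuous A ∧ Continuous B ∧ A 0 = 0 ∧ B 0 = 0 ∧
      (∀ x, |x| < x₁ → x ≠ 0 → 0 < A x ∧ B x < 0) ∧ (∀ x, |x| < x₁ → |A x| < η ∧ |B x| < η) ∧
      (∀ x y, |x| < x₁ → |y| < η → (framePoint (γ α) e x y ∈ range γ ↔ y = A x ∨ y = B x)) ∧
      (∀ x ∈ Ioo 0 x₁, (∃ u ∈ Ioo 0 δ₀, γ (α + u) = framePoint (γ α) e x (A x)) ∧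
        ∃ u ∈ Ioo 0 δ₀, γ (β - u) = framePoint (γ α) e x (B x)) ∧
      (∀ x ∈ Ioo 0 x₁, (∃ u ∈ Ioo 0 δ₀, γ (α - u) = framePoint (γ α) e (-x) (A (-x))) ∧
        ∃ u ∈ Ioo 0 δ₀, γ (β + u) = framePoint (γ α) e (-x) (B (-x))) := by
  obtain ⟨hsα, hsβ, ρ, hρ, hopp⟩ := hL.opposite α β hαβ hne
  obtain ⟨μ, hμ, hμs, hμa⟩ := exists_sign hsα
  obtain ⟨ν, hν, hνs, hνa⟩ := exists_sign hsβ
  have hμ2 : (μ : ℂ) * μ = 1 := by rcases hμ with rfl | rfl <;> norm_num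
  have hν2 : (ν : ℂ) * ν = 1 := by rcases hν with rfl | rfl <;> norm_num
  set e := μ * turningDir κ c α with he
  have hdir : turningDir κ c α = μ * e := by rw [he, ← mul_assoc, hμ2, one_mul]
  have hen : ‖e‖ = 1 := by
    rw [he, norm_mul, hL.norm_dir]; rcases hμ with rfl | rfl <;> simp
  have he0 : e ≠ 0 := norm_pos_iff.1 (by rw [hen]; exact one_pos)
  have hvα : turningDir κ c α * s α = |s α| * e := by
    conv_lhs => rw [hdir, ← hμa]
    push_cast
    linear_combination (((|s α| : ℝ) : ℂ) * e) * hμ2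
  -- Both directions are unit vectors, so comparing norms in the opposite-velocity relation removes
  -- the positive factor.
  have hdir' : turningDir κ c β = (-ν : ℝ) * e := by
    have h1 : (ρ * |s β| : ℝ) * (turningDir κ c β * ν) = (|s α| : ℝ) * -e := by
      have : turningDir κ c β * s β = |s β| * (turningDir κ c β * ν) := by
        conv_lhs => rw [← hνa]
        push_cast; ring
      push_cast
      linear_combination hopp - hvα - ρ * this
    have h2 : ρ * |s β| = |s α| := by
      have := congrArg norm h1
      rw [norm_mul, norm_mul, norm_mul, norm_neg, hen, hL.norm_dir] at this
      have hν1 : ‖(ν : ℂ)‖ = 1 := by rcases hν with rfl | rfl <;> simp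
      rw [hν1, Complex.norm_real, Complex.norm_real, Real.norm_of_nonneg (by positivity),
        Real.norm_of_nonneg (by positivity)] at this
      linarith
    rw [h2] at h1
    have h3 := mul_left_cancel₀ (by exact_mod_cast (abs_pos.2 hsα).ne') h1
    push_cast
    linear_combination ν * h3 - turningDir κ c β * hν2
  have hν' : -ν = 1 ∨ -ν = -1 := by rcases hν with rfl | rfl <;> simp
  refine ⟨e, hen, hvα, ?_, ?_⟩
  · conv_lhs => rw [hdir', ← hνa]
    push_cast
    linear_combination (((|s β| : ℝ) : ℂ) * -e) * hν2
  obtain ⟨δ₁, hδ₁, hsign⟩ := hL.eventually_sign hμs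
  obtain ⟨δ₂, hδ₂, hsign'⟩ := hL.eventually_sign hνs
  set D := min δ₀ (min δ₁ δ₂) with hD
  have hD0 : 0 < D := lt_min hδ₀ (lt_min hδ₁ hδ₂)
  have hD1 : D ≤ δ₁ := (min_le_right _ _).trans (min_le_left _ _)
  have hD2 : D ≤ δ₂ := (min_le_right _ _).trans (min_le_right _ _)
  obtain ⟨d1, hd1, H1⟩ := hL.exists_halfArc (p := γ α) (e := e) (ω := 1) (τ := 1) hμ (.inl rfl)
    (.inl rfl) hD0 rfl hdir (fun u hu => by
      have := hsign (α + 1 * u) (by rw [abs_lt]; constructor <;> linarith [hu.1, hu.2])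
      linarith)
  obtain ⟨d2, hd2, H2⟩ := hL.exists_halfArc (p := γ α) (e := e) (ω := -1) (τ := -1) hμ (.inr rfl)
    (.inr rfl) hD0 rfl hdir (fun u hu => by
      have := hsign (α + -1 * u) (by rw [abs_lt]; constructor <;> linarith [hu.1, hu.2])
      linarith)
  -- The second branch moves in direction `-e`: its right half is run backwards and its left half
  -- forwards. Thus `ωτ = -1` for both, and this branch lies below the tangent.
  obtain ⟨d3, hd3, H3⟩ := hL.exists_halfArc (p := γ α) (e := e) (ω := 1) (τ := -1) hν' (.inl rfl)
    (.inr rfl) hD0 hαβ.symm hdir' (fun u hu => by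
      have := hsign' (β + -1 * u) (by rw [abs_lt]; constructor <;> linarith [hu.1, hu.2])
      linarith)
  obtain ⟨d4, hd4, H4⟩ := hL.exists_halfArc (p := γ α) (e := e) (ω := -1) (τ := 1) hν' (.inr rfl)
    (.inl rfl) hD0 hαβ.symm hdir' (fun u hu => by
      have := hsign' (β + 1 * u) (by rw [abs_lt]; constructor <;> linarith [hu.1, hu.2])
      linarith)
  obtain ⟨δ, hδ0, hδ⟩ := exists_between (lt_min (lt_min hd1.1 hd2.1) (lt_min hd3.1 hd4.1))
  obtain ⟨h1, X1, H1⟩ := H1 δ ⟨hδ0, hδ.trans_le ((min_le_left _ _).trans (min_le_left _ _))⟩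
  obtain ⟨h2, X2, H2⟩ := H2 δ ⟨hδ0, hδ.trans_le ((min_le_left _ _).trans (min_le_right _ _))⟩
  obtain ⟨h3, X3, H3⟩ := H3 δ ⟨hδ0, hδ.trans_le ((min_le_right _ _).trans (min_le_left _ _))⟩
  obtain ⟨h4, X4, H4⟩ := H4 δ ⟨hδ0, hδ.trans_le ((min_le_right _ _).trans (min_le_right _ _))⟩
  have hδδ₀ : δ < δ₀ := (hδ.trans_le ((min_le_left _ _).trans (min_le_left _ _))).trans_le
    (hd1.2.trans (min_le_left _ _))
  obtain ⟨r, hr, hloc⟩ := hL.exists_ball_localization (p := γ α) (T := {α, β})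
    (fun t' ht' => by
      rcases hL.circlePoint_of_double hαβ hne ht' with h | h
      · exact ⟨α, .inl rfl, h⟩
      · exact ⟨β, .inr rfl, h⟩) hδ0
  set A : ℝ → ℝ := fun x => h1 x + h2 (-x) with hAdef
  set B : ℝ → ℝ := fun x => -(h3 x + h4 (-x)) with hBdef
  have hAc : Continuous A := H1.continuous.add (H2.continuous.comp continuous_neg)
  have hBc : Continuous B := (H3.continuous.add (H4.continuous.comp continuous_neg)).neg
  have hA0 : A 0 = 0 := by simp [hAdef, H1.zero_left, H2.zero_left]
  have hB0 : B 0 = 0 := by simp [hBdef, H3.zero_left, H4.zero_left]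
  obtain ⟨x₁, ⟨hx₁, hx₁'⟩, hAB⟩ := exists_small_box hAc hBc hA0 hB0 (η := r / 2)
    (X := min (min (min X1 X2) (min X3 X4)) (r / 2)) (by linarith)
    (lt_min (lt_min (lt_min H1.pos H2.pos) (lt_min H3.pos H4.pos)) (by linarith))
  simp only [lt_min_iff] at hx₁'
  obtain ⟨⟨⟨hxX1, hxX2⟩, hxX3, hxX4⟩, hxr⟩ := hx₁'
  have hAp : ∀ x, 0 ≤ x → A x = h1 x := fun x hx => by simp [hAdef, H2.zero_left, hx]
  have hAn : ∀ x, x ≤ 0 → A x = h2 (-x) := fun x hx => by simp [hAdef, H1.zero_left, hx]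
  have hBp : ∀ x, 0 ≤ x → B x = -h3 x := fun x hx => by simp [hBdef, H4.zero_left, hx]
  have hBn : ∀ x, x ≤ 0 → B x = -h4 (-x) := fun x hx => by simp [hBdef, H3.zero_left, hx]
  have arcR : ∀ x ∈ Ioo 0 x₁, (∃ u ∈ Ioo 0 δ₀, γ (α + u) = framePoint (γ α) e x (A x)) ∧
        ∃ u ∈ Ioo 0 δ₀, γ (β - u) = framePoint (γ α) e x (B x) := by
    intro x hx
    obtain ⟨u, hu, h⟩ := H1.surj' he0 (by norm_num) rfl (x := x) ⟨hx.1, by linarith [hx.2]⟩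
    obtain ⟨v, hv, h'⟩ := H3.surj' he0 (by norm_num) hαβ.symm (x := x) ⟨hx.1, by linarith [hx.2]⟩
    refine ⟨⟨u, ⟨hu.1, by linarith [hu.2]⟩, ?_⟩, v, ⟨hv.1, by linarith [hv.2]⟩, ?_⟩
    · rw [hAp x hx.1.le]; simpa using h
    · rw [hBp x hx.1.le]; simpa [sub_eq_add_neg] using h'
  have arcL : ∀ x ∈ Ioo 0 x₁, (∃ u ∈ Ioo 0 δ₀, γ (α - u) = framePoint (γ α) e (-x) (A (-x))) ∧
        ∃ u ∈ Ioo 0 δ₀, γ (β + u) = framePoint (γ α) e (-x) (B (-x)) := by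
    intro x hx
    obtain ⟨u, hu, h⟩ := H2.surj' he0 (by norm_num) rfl (x := x) ⟨hx.1, by linarith [hx.2]⟩
    obtain ⟨v, hv, h'⟩ := H4.surj' he0 (by norm_num) hαβ.symm (x := x) ⟨hx.1, by linarith [hx.2]⟩
    refine ⟨⟨u, ⟨hu.1, by linarith [hu.2]⟩, ?_⟩, v, ⟨hv.1, by linarith [hv.2]⟩, ?_⟩
    · rw [hAn (-x) (by linarith [hx.1])]; simpa [sub_eq_add_neg] using h
    · rw [hBn (-x) (by linarith [hx.1])]; simpa using h'
  refine ⟨x₁, hx₁, r / 2, by linarith, A, B, hAc, hBc, hA0, hB0, ?_, hAB, ?_, arcR, arcL⟩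
  · intro x hx hx0
    rw [abs_lt] at hx
    rcases lt_or_gt_of_ne hx0 with h | h
    · rw [hAn x h.le, hBn x h.le]
      exact ⟨H2.h_pos ⟨by linarith, by linarith⟩, neg_lt_zero.2 (H4.h_pos ⟨by linarith, by linarith⟩)⟩
    · rw [hAp x h.le, hBp x h.le]
      exact ⟨H1.h_pos ⟨h, by linarith⟩, neg_lt_zero.2 (H3.h_pos ⟨h, by linarith⟩)⟩
  · intro x y hx hy
    constructor
    · rintro ⟨t', ht'⟩
      obtain ⟨t₁, ht₁, t'', h5, h6⟩ := hloc t' (by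
        rw [ht']; exact norm_framePoint_sub hen (hx.trans hxr) hy)
      rw [← hL.periodic _ _ h6] at ht'
      rw [abs_lt] at h5
      rcases ht₁ with rfl | rfl
      · left
        rcases le_total t'' t₁ with h7 | h7
        · obtain ⟨x', hx', hxe⟩ := H2.param' (u := t₁ - t'') ⟨by linarith, by linarith⟩
          rw [show t₁ + -1 * (t₁ - t'') = t'' by ring, ht', framePoint_inj he0] at hxe
          rw [hxe.1, hxe.2, hAn _ (by linarith [hx'.1])]; simp
        · obtain ⟨x', hx', hxe⟩ := H1.param' (u := t'' - t₁) ⟨by linarith, by linarith⟩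
          rw [show t₁ + 1 * (t'' - t₁) = t'' by ring, ht', framePoint_inj he0] at hxe
          rw [hxe.1, hxe.2, hAp _ (by linarith [hx'.1])]; simp
      · right
        rcases le_total t'' t₁ with h7 | h7
        · obtain ⟨x', hx', hxe⟩ := H3.param' (u := t₁ - t'') ⟨by linarith, by linarith⟩
          rw [show t₁ + -1 * (t₁ - t'') = t'' by ring, ht', framePoint_inj he0] at hxe
          rw [hxe.1, hxe.2, hBp _ (by linarith [hx'.1])]; simp
        · obtain ⟨x', hx', hxe⟩ := H4.param' (u := t'' - t₁) ⟨by linarith, by linarith⟩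
          rw [show t₁ + 1 * (t'' - t₁) = t'' by ring, ht', framePoint_inj he0] at hxe
          rw [hxe.1, hxe.2, hBn _ (by linarith [hx'.1])]; simp
    · intro hy'
      rw [abs_lt] at hx
      rcases lt_trichotomy x 0 with h | rfl | h
      · obtain ⟨⟨u, -, hu⟩, v, -, hv⟩ := arcL (-x) ⟨by linarith, by linarith⟩
        rw [neg_neg] at hu hv
        rcases hy' with rfl | rfl
        · exact ⟨_, hu⟩
        · exact ⟨_, hv⟩
      · exact ⟨α, by rcases hy' with rfl | rfl <;> simp [hA0, hB0, framePoint]⟩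
      · obtain ⟨⟨u, -, hu⟩, v, -, hv⟩ := arcR x ⟨by linarith, by linarith⟩
        rcases hy' with rfl | rfl
        · exact ⟨_, hu⟩
        · exact ⟨_, hv⟩

/-- The zero of the speed is simple, so the speed changes sign while the direction field `exp (iκt)`
turns on continuously. The motion along the curve therefore reverses. -/
lemma TurningLoop.exists_sign_cusp (hL : TurningLoop κ c s γ G) {α : ℝ} (hα : s α = 0) :
    ∃ μ : ℝ, (μ = 1 ∨ μ = -1) ∧ ∃ δ > 0, ∀ u ∈ Ioo 0 δ, 0 < μ * s (α + u) ∧ μ * s (α - u) < 0 := by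
  obtain ⟨μ, hμ, hμs, -⟩ := exists_sign (hL.simple_zero α hα)
  refine ⟨μ, hμ, ?_⟩
  have hd : ∀ t, HasDerivAt (fun t => μ * s t) (μ * deriv s t) t := fun t =>
    ((hL.smooth.differentiable (by simp)) t).hasDerivAt.const_mul μ
  have hdc : Continuous fun t => μ * deriv s t :=
    continuous_const.mul (hL.smooth.continuous_deriv (by simp))
  obtain ⟨δ, hδ, hball⟩ := Metric.eventually_nhds_iff_ball.1
    (hdc.continuousAt.eventually_const_lt hμs)
  have hm : StrictMonoOn (fun t => μ * s t) (Metric.ball α δ) := by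
    refine strictMonoOn_of_deriv_pos (convex_ball _ _)
      (fun t _ => (hd t).continuousAt.continuousWithinAt) fun t ht => ?_
    rw [(hd t).deriv]; exact hball t (interior_subset ht)
  refine ⟨δ, hδ, fun u hu => ?_⟩
  have hc : α ∈ Metric.ball α δ := Metric.mem_ball_self hδ
  have hp : α + u ∈ Metric.ball α δ := by
    rw [Metric.mem_ball, Real.dist_eq, abs_lt]; constructor <;> linarith [hu.1, hu.2]
  have hn : α - u ∈ Metric.ball α δ := by
    rw [Metric.mem_ball, Real.dist_eq, abs_lt]; constructor <;> linarith [hu.1, hu.2]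
  have h1 := hm hc hp (by linarith [hu.1])
  have h2 := hm hn hc (by linarith [hu.1])
  simp only [hα, mul_zero] at h1 h2
  exact ⟨h1, h2⟩

/-- Near a cusp the curve consists of two half graphs on opposite sides of the tangent. -/
lemma TurningLoop.exists_box_cusp (hL : TurningLoop κ c s γ G) {α : ℝ} (hα : s α = 0) {δ₀ : ℝ}
    (hδ₀ : 0 < δ₀) :
    ∃ e : ℂ, ‖e‖ = 1 ∧ (∃ μ : ℝ, (μ = 1 ∨ μ = -1) ∧ e = μ * turningDir κ c α ∧
        ∃ δ > 0, ∀ u ∈ Ioo 0 δ, 0 < μ * s (α + u) ∧ μ * s (α - u) < 0) ∧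
    ∃ x₁ > 0, ∃ η > 0, ∃ A B : ℝ → ℝ, Continuous A ∧ Continuous B ∧ (∀ x ≤ 0, A x = 0 ∧ B x = 0) ∧
      (∀ x ∈ Ioo 0 x₁, 0 < A x ∧ B x < 0) ∧ (∀ x, |x| < x₁ → |A x| < η ∧ |B x| < η) ∧
      StrictMonoOn A (Ico 0 x₁) ∧
      (∀ x y, |x| < x₁ → |y| < η →
        (framePoint (γ α) e x y ∈ range γ ↔ 0 ≤ x ∧ (y = A x ∨ y = B x))) ∧
      ∀ x ∈ Ioo 0 x₁, (∃ u ∈ Ioo 0 δ₀, γ (α + u) = framePoint (γ α) e x (A x)) ∧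
        ∃ u ∈ Ioo 0 δ₀, γ (α - u) = framePoint (γ α) e x (B x) := by
  obtain ⟨μ, hμ, δ₁, hδ₁, hsign⟩ := hL.exists_sign_cusp hα
  have hμ2 : (μ : ℂ) * μ = 1 := by rcases hμ with rfl | rfl <;> norm_num
  set e := μ * turningDir κ c α with he
  have hdir : turningDir κ c α = μ * e := by rw [he, ← mul_assoc, hμ2, one_mul]
  have hen : ‖e‖ = 1 := by
    rw [he, norm_mul, hL.norm_dir]; rcases hμ with rfl | rfl <;> simp
  have he0 : e ≠ 0 := norm_pos_iff.1 (by rw [hen]; exact one_pos)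
  refine ⟨e, hen, ⟨μ, hμ, he, δ₁, hδ₁, hsign⟩, ?_⟩
  have hD0 : 0 < min δ₀ δ₁ := lt_min hδ₀ hδ₁
  -- Because the speed changes sign, both halves leave the cusp on the side of `e` (`ω = 1`); time
  -- direction `τ = 1` gives the upper one, `τ = -1` the lower one.
  obtain ⟨d1, hd1, H1⟩ := hL.exists_halfArc (p := γ α) (e := e) (ω := 1) (τ := 1) hμ (.inl rfl)
    (.inl rfl) hD0 rfl hdir (fun u hu => by
      have := (hsign u ⟨hu.1, hu.2.trans_le (min_le_right _ _)⟩).1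
      rw [one_mul]; linarith)
  obtain ⟨d3, hd3, H3⟩ := hL.exists_halfArc (p := γ α) (e := e) (ω := 1) (τ := -1) hμ (.inl rfl)
    (.inr rfl) hD0 rfl hdir (fun u hu => by
      have := (hsign u ⟨hu.1, hu.2.trans_le (min_le_right _ _)⟩).2
      rw [sub_eq_add_neg, ← neg_one_mul u] at this; linarith)
  obtain ⟨δ, hδ0, hδ⟩ := exists_between (lt_min hd1.1 hd3.1)
  obtain ⟨h1, X1, H1⟩ := H1 δ ⟨hδ0, hδ.trans_le (min_le_left _ _)⟩
  obtain ⟨h3, X3, H3⟩ := H3 δ ⟨hδ0, hδ.trans_le (min_le_right _ _)⟩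
  have hδδ₀ : δ < δ₀ := (hδ.trans_le (min_le_left _ _)).trans_le
    (hd1.2.trans (min_le_left _ _))
  obtain ⟨r, hr, hloc⟩ := hL.exists_ball_localization (p := γ α) (T := {α})
    (fun t' ht' => ⟨α, rfl, hL.circlePoint_of_cusp hα ht'⟩) hδ0
  have hA0 : h1 0 = 0 := H1.zero_left 0 le_rfl
  have hB0 : -h3 0 = 0 := by simp [H3.zero_left 0 le_rfl]
  obtain ⟨x₁, ⟨hx₁, hx₁'⟩, hAB⟩ := exists_small_box H1.continuous H3.continuous.neg hA0 hB0
    (η := r / 2) (X := min (min X1 X3) (r / 2)) (by linarith)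
    (lt_min (lt_min H1.pos H3.pos) (by linarith))
  simp only [lt_min_iff] at hx₁'
  obtain ⟨⟨hxX1, hxX3⟩, hxr⟩ := hx₁'
  have arcR : ∀ x ∈ Ioo 0 x₁, (∃ u ∈ Ioo 0 δ₀, γ (α + u) = framePoint (γ α) e x (h1 x)) ∧
        ∃ u ∈ Ioo 0 δ₀, γ (α - u) = framePoint (γ α) e x (-h3 x) := by
    intro x hx
    obtain ⟨u, hu, h⟩ := H1.surj' he0 (by norm_num) rfl (x := x) ⟨hx.1, by linarith [hx.2]⟩
    obtain ⟨v, hv, h'⟩ := H3.surj' he0 (by norm_num) rfl (x := x) ⟨hx.1, by linarith [hx.2]⟩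
    refine ⟨⟨u, ⟨hu.1, by linarith [hu.2]⟩, ?_⟩, v, ⟨hv.1, by linarith [hv.2]⟩, ?_⟩
    · simpa using h
    · simpa [sub_eq_add_neg] using h'
  refine ⟨x₁, hx₁, r / 2, by linarith, h1, fun x => -h3 x, H1.continuous, H3.continuous.neg,
    fun x hx => by simp [H1.zero_left x hx, H3.zero_left x hx], ?_, hAB,
    H1.mono.mono fun x hx => ⟨hx.1, by linarith [hx.2]⟩, ?_, arcR⟩
  · intro x hx
    exact ⟨H1.h_pos ⟨hx.1, by linarith [hx.2]⟩,
      neg_lt_zero.2 (H3.h_pos ⟨hx.1, by linarith [hx.2]⟩)⟩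
  · intro x y hx hy
    constructor
    · rintro ⟨t', ht'⟩
      obtain ⟨t₁, ht₁ : t₁ = α, t'', h5, h6⟩ := hloc t' (by
        rw [ht']; exact norm_framePoint_sub hen (hx.trans hxr) hy)
      rw [← hL.periodic _ _ h6] at ht'
      rw [ht₁, abs_lt] at h5
      rcases le_total t'' α with h7 | h7
      · obtain ⟨x', hx', hxe⟩ := H3.param' (u := α - t'') ⟨by linarith, by linarith⟩
        rw [show α + -1 * (α - t'') = t'' by ring, ht', framePoint_inj he0] at hxe
        rw [hxe.1, hxe.2]
        simpa using hx'.1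
      · obtain ⟨x', hx', hxe⟩ := H1.param' (u := t'' - α) ⟨by linarith, by linarith⟩
        rw [show α + 1 * (t'' - α) = t'' by ring, ht', framePoint_inj he0] at hxe
        rw [hxe.1, hxe.2]
        simpa using hx'.1
    · rintro ⟨h0, hy'⟩
      rw [abs_lt] at hx
      rcases h0.eq_or_lt with rfl | h
      · exact ⟨α, by rcases hy' with rfl | rfl <;> simp [H1.zero_left, H3.zero_left, framePoint]⟩
      · obtain ⟨⟨u, -, hu⟩, v, -, hv⟩ := arcR x ⟨by linarith, by linarith⟩
        rcases hy' with rfl | rfl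
        · exact ⟨_, hu⟩
        · exact ⟨_, hv⟩

end

/-! ### Components of the complement and their boundary arcs -/

lemma exists_planarComponents_of_isPreconnected {V S : Set ℂ} (hS : IsPreconnected S) (hSV : S ⊆ V)
    (hne : S.Nonempty) : ∃ U ∈ planarComponents V, S ⊆ U := by
  obtain ⟨z, hz⟩ := hne
  exact ⟨_, ⟨z, hSV hz, rfl⟩, hS.subset_connectedComponentIn hz hSV⟩

lemma planarComponents_subset {V U : Set ℂ} (hU : U ∈ planarComponents V) : U ⊆ V := by
  obtain ⟨z, _, rfl⟩ := hU
  exact connectedComponentIn_subset V z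

lemma planarComponents_nonempty {V U : Set ℂ} (hU : U ∈ planarComponents V) : U.Nonempty := by
  obtain ⟨z, hz, rfl⟩ := hU
  exact ⟨z, mem_connectedComponentIn hz⟩

lemma planarComponents_isPreconnected {V U : Set ℂ} (hU : U ∈ planarComponents V) :
    IsPreconnected U := by
  obtain ⟨z, _, rfl⟩ := hU
  exact isPreconnected_connectedComponentIn

lemma planarComponents_isOpen {V U : Set ℂ} (hV : IsOpen V) (hU : U ∈ planarComponents V) :
    IsOpen U := by
  obtain ⟨z, _, rfl⟩ := hU
  exact hV.connectedComponentIn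

lemma subset_of_mem_planarComponents {V U S : Set ℂ} (hU : U ∈ planarComponents V)
    (hS : IsPreconnected S) (hSV : S ⊆ V) (hSU : (S ∩ U).Nonempty) : S ⊆ U := by
  obtain ⟨z, _, rfl⟩ := hU
  obtain ⟨x, hx, hxU⟩ := hSU
  rw [connectedComponentIn_eq hxU]
  exact hS.subset_connectedComponentIn hx hSV

lemma planarComponents_eq {V U U' : Set ℂ} (hU : U ∈ planarComponents V)
    (hU' : U' ∈ planarComponents V) {x : ℂ} (hx : x ∈ U) (hx' : x ∈ U') : U = U' :=
  (subset_of_mem_planarComponents hU' (planarComponents_isPreconnected hU)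
    (planarComponents_subset hU) ⟨x, hx, hx'⟩).antisymm
  (subset_of_mem_planarComponents hU (planarComponents_isPreconnected hU')
    (planarComponents_subset hU') ⟨x, hx', hx⟩)

lemma eventually_framePoint_mem {p e : ℂ} (he : e ≠ 0) {x y : ℝ} {O : Set (ℝ × ℝ)} (hO : IsOpen O)
    (h : (x, y) ∈ O) :
    ∀ᶠ z in 𝓝 (framePoint p e x y), ∃ x y, (x, y) ∈ O ∧ z = framePoint p e x y := by
  have hc : Continuous fun z : ℂ => (((z - p) / e).re, ((z - p) / e).im) := by fun_prop
  have h' := framePoint_inj (p := p) he |>.1 (exists_framePoint (p := p) he (framePoint p e x y))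
  have := hc.continuousAt.preimage_mem_nhds (x := framePoint p e x y) (hO.mem_nhds (by
    rw [← h'.1, ← h'.2]; exact h))
  filter_upwards [this] with z hz
  exact ⟨_, _, hz, exists_framePoint he z⟩

/-- `U` is the component that lies to the right of the curve at the parameter `t`. -/
structure IsRightSide (V : Set ℂ) (γ : ℝ → ℂ) (v : ℂ) (t : ℝ) (U : Set ℂ) : Prop where
  near : ∀ᶠ z in 𝓝 (γ t), z ∈ V → z ∈ U
  right : ∀ᶠ ε : ℝ in 𝓝[>] 0, γ t - ε * (Complex.I * v) ∈ U
  tangent : ∀ᶠ ε : ℝ in 𝓝[>] 0, γ t + ε * v ∈ U ∧ γ t - ε * v ∈ U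

lemma IsRightSide.mem_closure {V : Set ℂ} {γ : ℝ → ℂ} {v : ℂ} {t : ℝ} {U : Set ℂ}
    (h : IsRightSide V γ v t U) : γ t ∈ closure U := by
  have hc : Tendsto (fun ε : ℝ => γ t - ε * (Complex.I * v)) (𝓝[>] 0) (𝓝 (γ t)) := by
    refine tendsto_nhdsWithin_of_tendsto_nhds ?_
    have : ContinuousAt (fun ε : ℝ => γ t - ε * (Complex.I * v)) 0 := by fun_prop
    simpa [ContinuousAt] using this
  exact mem_closure_of_tendsto hc h.right

lemma eventually_pos_lt {r : ℝ} (hr : 0 < r) (m : ℝ) (hm : 0 < m) :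
    ∀ᶠ ε : ℝ in 𝓝[>] 0, 0 < ε * m ∧ ε * m < r := by
  have h : ∀ᶠ ε : ℝ in 𝓝[>] 0, ε < r / m :=
    mem_nhdsWithin_of_mem_nhds (Iio_mem_nhds (div_pos hr hm))
  filter_upwards [h, self_mem_nhdsWithin] with ε h1 (h2 : 0 < ε)
  exact ⟨mul_pos h2 hm, (lt_div_iff₀ hm).1 h1⟩

section

variable {κ : ℝ} {c : ℂ} {s : ℝ → ℝ} {γ : ℝ → ℂ} {G : Set ℂ} {ι : Type} [Fintype ι] [DecidableEq ι]
  {a b : ι → ℝ} {pred : Equiv.Perm ι}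

lemma TurningLoop.isOpen_compl (hL : TurningLoop κ c s γ G) : IsOpen (G ∪ range γ)ᶜ :=
  hL.isClosed.isOpen_compl

lemma TurningLoop.subset_or_subset (hL : TurningLoop κ c s γ G) {S : Set ℂ} (hS : IsPreconnected S)
    (h : ∀ z ∈ S, z ∉ range γ) : S ⊆ G ∨ S ⊆ (G ∪ range γ)ᶜ := by
  refine isPreconnected_iff_subset_of_disjoint.1 hS G _ hL.isOpen hL.isOpen_compl ?_ ?_
  · intro z hz
    by_cases hG : z ∈ G
    · exact .inl hG
    · exact .inr fun hz' => hz'.elim hG (h z hz)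
  · ext z; simp; tauto

lemma TurningLoop.subset_G (hL : TurningLoop κ c s γ G) {S : Set ℂ} (hS : IsPreconnected S)
    (h : ∀ z ∈ S, z ∉ range γ) {z : ℂ} (hz : z ∈ S) (hzG : z ∈ G) : S ⊆ G :=
  (hL.subset_or_subset hS h).resolve_right fun h' => h' hz (.inl hzG)

/-- The graph divides a small box into two connected parts, and the part on the left of the curve
lies in `G`. If the right part did too, the Cauchy integral of the whole curve, constant on the
connected set `G`, would have no jump across the arc. The tangent line lies on the right because the
graph has a strict minimum. -/
lemma TurningLoop.exists_isRightSide (hL : TurningLoop κ c s γ G) (hA : ArcSystem s γ a b pred)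
    {i : ι} {t : ℝ} (ht : t ∈ Ioo (a i) (b i)) :
    ∃ U ∈ planarComponents (G ∪ range γ)ᶜ,
      IsRightSide (G ∪ range γ)ᶜ γ (turningDir κ c t * s t) t U := by
  obtain ⟨hs, hsimple⟩ := hA.regular i t ht
  obtain ⟨e, hen, hv, x₁, hx₁, η, hη, A, hAc, hA0, hApos, hAη, hmem⟩ :=
    hL.exists_box_regular hs hsimple
  have he0 : e ≠ 0 := norm_pos_iff.1 (by rw [hen]; exact one_pos)
  have hs' : 0 < |s t| := abs_pos.2 hs
  set p := γ t with hp
  have hI : IsPreconnected (Ioo (-x₁) x₁) := isPreconnected_Ioo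
  have hxI : ∀ x, x ∈ Ioo (-x₁) x₁ ↔ |x| < x₁ := fun x => abs_lt.symm
  set up := betweenGraphs p e (Ioo (-x₁) x₁) A (fun _ => η)
  set dn := betweenGraphs p e (Ioo (-x₁) x₁) (fun _ => -η) A
  have hupc : IsPreconnected up := isPreconnected_betweenGraphs p e hI hAc continuous_const
    fun x hx => (abs_lt.1 (hAη x ((hxI x).1 hx))).2
  have hdnc : IsPreconnected dn := isPreconnected_betweenGraphs p e hI continuous_const hAc
    fun x hx => (abs_lt.1 (hAη x ((hxI x).1 hx))).1
  have hupr : ∀ z ∈ up, z ∉ range γ := by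
    rintro _ ⟨x, y, hx, h1, h2, rfl⟩ h
    have hx' := (hxI x).1 hx
    rw [hmem x y hx' (abs_lt.2 ⟨by linarith [(abs_lt.1 (hAη x hx')).1], h2⟩)] at h
    exact h1.ne' h
  have hdnr : ∀ z ∈ dn, z ∉ range γ := by
    rintro _ ⟨x, y, hx, h1, h2, rfl⟩ h
    have hx' := (hxI x).1 hx
    rw [hmem x y hx' (abs_lt.2 ⟨h1, by linarith [(abs_lt.1 (hAη x hx')).2]⟩)] at h
    exact h2.ne h
  have h0 : (0 : ℝ) ∈ Ioo (-x₁) x₁ := ⟨by linarith, hx₁⟩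
  have hup : ∀ ε : ℝ, 0 < ε * |s t| → ε * |s t| < η →
      p + ε * (Complex.I * (turningDir κ c t * s t)) ∈ up := by
    intro ε h1 h2
    refine ⟨0, ε * |s t|, h0, by rwa [hA0], h2, ?_⟩
    rw [hv, framePoint]; push_cast; ring
  have hdn : ∀ ε : ℝ, 0 < ε * |s t| → ε * |s t| < η →
      p - ε * (Complex.I * (turningDir κ c t * s t)) ∈ dn := by
    intro ε h1 h2
    refine ⟨0, -(ε * |s t|), h0, by linarith, by rw [hA0]; linarith, ?_⟩
    rw [hv, framePoint]; push_cast; ring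
  have hupG : up ⊆ G := by
    obtain ⟨ε, h1, h2⟩ := ((hL.left t hs).and (eventually_pos_lt hη _ hs')).exists
    exact hL.subset_G hupc hupr (hup ε h2.1 h2.2) h1
  have hdnV : dn ⊆ (G ∪ range γ)ᶜ := by
    refine (hL.subset_or_subset hdnc hdnr).resolve_left fun hdnG => ?_
    have hj := hL.tendsto_jump_chainIntegral hA Finset.univ ht
    rw [if_pos (Finset.mem_univ i)] at hj
    have hz : Tendsto (fun _ : ℝ => (0 : ℂ)) (𝓝[>] 0) (𝓝 (2 * Real.pi * Complex.I)) := by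
      refine hj.congr' ?_
      filter_upwards [eventually_pos_lt hη _ hs'] with ε hε
      rw [sub_eq_zero]
      have hGr : G ⊆ (range γ)ᶜ := by
        rintro z hz ⟨t', rfl⟩; exact hL.notMem t' hz
      exact hL.isClosed_range.isOpen_compl.isPreconnected_const_of_hasDerivAt_zero
        (fun q hq => hL.hasDerivAt_chainIntegral hA (hA.isClosedChain_univ hL) hq)
        hL.isConnected.isPreconnected hGr (hupG (hup ε hε.1 hε.2)) (hdnG (hdn ε hε.1 hε.2))
    have := tendsto_nhds_unique hz tendsto_const_nhds
    simp [Real.pi_ne_zero] at this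
  obtain ⟨ε₀, hε₀⟩ := (eventually_pos_lt hη _ hs').exists
  obtain ⟨U, hU, hdnU⟩ := exists_planarComponents_of_isPreconnected hdnc hdnV
    ⟨_, hdn ε₀ hε₀.1 hε₀.2⟩
  refine ⟨U, hU, ?_, ?_, ?_⟩
  · rw [show γ t = framePoint p e 0 0 by simp [framePoint, hp]]
    filter_upwards [eventually_framePoint he0 (x := 0) (y := 0) (x₁ := x₁) (η := η) (by simpa)
      (by simpa)] with z ⟨x, y, hx, hy, hz⟩ hzV
    apply hdnU
    rcases lt_trichotomy y (A x) with h | h | h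
    · exact ⟨x, y, (hxI x).2 hx, (abs_lt.1 hy).1, h, hz⟩
    · exact absurd (.inr (hz ▸ (hmem x y hx hy).2 h)) hzV
    · exact absurd (.inl (hupG ⟨x, y, (hxI x).2 hx, h, (abs_lt.1 hy).2, hz⟩)) hzV
  · filter_upwards [eventually_pos_lt hη _ hs'] with ε hε
    exact hdnU (hdn ε hε.1 hε.2)
  · filter_upwards [eventually_pos_lt hx₁ _ hs'] with ε hε
    have h1 : abs (ε * |s t|) < x₁ := by rw [abs_of_pos hε.1]; exact hε.2
    have h2 : abs (-(ε * |s t|)) < x₁ := by rw [abs_neg]; exact h1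
    refine ⟨hdnU ⟨ε * |s t|, 0, (hxI _).2 h1, by linarith, hApos _ h1 hε.1.ne', ?_⟩,
      hdnU ⟨-(ε * |s t|), 0, (hxI _).2 h2, by linarith, hApos _ h2 (neg_ne_zero.2 hε.1.ne'), ?_⟩⟩
    · rw [hv, framePoint]; push_cast; ring
    · rw [hv, framePoint]; push_cast; ring

/-- The component to the right of each arc. -/
lemma TurningLoop.exists_rightComponent (hL : TurningLoop κ c s γ G)
    (hA : ArcSystem s γ a b pred) :
    ∃ comp : ι → Set ℂ, ∀ i, comp i ∈ planarComponents (G ∪ range γ)ᶜ ∧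
      ∀ t ∈ Ioo (a i) (b i),
        IsRightSide (G ∪ range γ)ᶜ γ (turningDir κ c t * s t) t (comp i) := by
  have key : ∀ i, ∃ U, U ∈ planarComponents (G ∪ range γ)ᶜ ∧ ∀ t ∈ Ioo (a i) (b i),
      IsRightSide (G ∪ range γ)ᶜ γ (turningDir κ c t * s t) t U := by
    intro i
    choose! U hU hUs using fun t (ht : t ∈ Ioo (a i) (b i)) => hL.exists_isRightSide hA ht
    obtain ⟨m, hm⟩ := exists_between (hA.lt i)
    -- The component on the right is locally constant in the parameter: near `γ t` all complementary
    -- points belong to one component. The parameter interval is connected.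
    have hconst : ∀ t ∈ Ioo (a i) (b i), U m = U t := fun t ht =>
      isPreconnected_Ioo.induction₂ (fun x y => U x = U y) (by
        intro x hx
        have h1 := (hUs x hx).near.eventually_nhds
        have h2 := hL.continuous.continuousAt.eventually h1
        filter_upwards [mem_nhdsWithin_of_mem_nhds h2, self_mem_nhdsWithin] with y hy hyI
        obtain ⟨z, hz1, hz2⟩ := ((mem_closure_iff_frequently.1 (hUs y hyI).mem_closure).and_eventually
          hy).exists
        exact planarComponents_eq (hU x hx) (hU y hyI)
          (hz2 (planarComponents_subset (hU y hyI) hz1)) hz1)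
        (fun _ _ _ _ _ _ h1 h2 => h1.trans h2) (fun _ _ _ _ h => h.symm) hm ht
    exact ⟨U m, hU m hm, fun t ht => hconst t ht ▸ hUs t ht⟩
  choose comp h1 h2 using key
  exact ⟨comp, fun i => ⟨h1 i, h2 i⟩⟩

/-- If `up` lies in `G`, a component that touches the upper graph meets the region between the
graphs. -/
lemma exists_mem_between_of_closure {p e : ℂ} (he : e ≠ 0) {V U : Set ℂ} (hUV : U ⊆ V) {x₁ η : ℝ}
    {S : Set ℝ} (hS : IsOpen S) {A B : ℝ → ℝ} (hB : Continuous B) {x : ℝ} (hxS : x ∈ S)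
    (hx : |x| < x₁) (hA : |A x| < η) (hBA : B x < A x)
    (hV : ∀ x y, |x| < x₁ → |y| < η → A x ≤ y → framePoint p e x y ∉ V)
    (hcl : framePoint p e x (A x) ∈ closure U) :
    (U ∩ betweenGraphs p e S B A).Nonempty := by
  have hO : IsOpen {q : ℝ × ℝ | |q.1| < x₁ ∧ |q.2| < η ∧ q.1 ∈ S ∧ B q.1 < q.2} :=
    (isOpen_lt continuous_fst.abs continuous_const).and <|
      (isOpen_lt continuous_snd.abs continuous_const).and <|
      (hS.preimage continuous_fst).and (isOpen_lt (hB.comp continuous_fst) continuous_snd)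
  obtain ⟨z, hz, x', y', ⟨h1, h2, h3, h4⟩, rfl⟩ :=
    ((mem_closure_iff_frequently.1 hcl).and_eventually
      (eventually_framePoint_mem he hO ⟨hx, hA, hxS, hBA⟩)).exists
  refine ⟨_, hz, x', y', h3, h4, ?_, rfl⟩
  by_contra! h
  exact hV x' y' h1 h2 h (hUV hz)

lemma exists_mem_between_of_closure' {p e : ℂ} (he : e ≠ 0) {V U : Set ℂ} (hUV : U ⊆ V) {x₁ η : ℝ}
    {S : Set ℝ} (hS : IsOpen S) {A B : ℝ → ℝ} (hA : Continuous A) {x : ℝ} (hxS : x ∈ S)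
    (hx : |x| < x₁) (hB : |B x| < η) (hBA : B x < A x)
    (hV : ∀ x y, |x| < x₁ → |y| < η → y ≤ B x → framePoint p e x y ∉ V)
    (hcl : framePoint p e x (B x) ∈ closure U) :
    (U ∩ betweenGraphs p e S B A).Nonempty := by
  have hO : IsOpen {q : ℝ × ℝ | |q.1| < x₁ ∧ |q.2| < η ∧ q.1 ∈ S ∧ q.2 < A q.1} :=
    (isOpen_lt continuous_fst.abs continuous_const).and <|
      (isOpen_lt continuous_snd.abs continuous_const).and <|
      (hS.preimage continuous_fst).and (isOpen_lt continuous_snd (hA.comp continuous_fst))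
  obtain ⟨z, hz, x', y', ⟨h1, h2, h3, h4⟩, rfl⟩ :=
    ((mem_closure_iff_frequently.1 hcl).and_eventually
      (eventually_framePoint_mem he hO ⟨hx, hB, hxS, hBA⟩)).exists
  refine ⟨_, hz, x', y', h3, ?_, h4, rfl⟩
  by_contra! h
  exact hV x' y' h1 h2 h (hUV hz)

end

section

variable {κ : ℝ} {c : ℂ} {s : ℝ → ℝ} {γ : ℝ → ℂ} {G : Set ℂ} {ι : Type} [Fintype ι] [DecidableEq ι]
  {a b : ι → ℝ} {pred : Equiv.Perm ι}

lemma ArcSystem.gamma_end (hL : TurningLoop κ c s γ G) (hA : ArcSystem s γ a b pred) (v : ι)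
    (u : ℝ) : γ (b (pred v) - u) = γ (a v - u) := by
  apply hL.periodic
  rw [sub_eq_add_neg, sub_eq_add_neg, circlePoint_add, circlePoint_add, hA.end_pred]

/-- `comp i` is the component of the complement to the right of the `i`-th arc. -/
def IsRightComponents (κ : ℝ) (c : ℂ) (s : ℝ → ℝ) (γ : ℝ → ℂ) (G : Set ℂ) {ι : Type}
    (a b : ι → ℝ) (comp : ι → Set ℂ) : Prop :=
  ∀ i, comp i ∈ planarComponents (G ∪ range γ)ᶜ ∧ ∀ t ∈ Ioo (a i) (b i),
    IsRightSide (G ∪ range γ)ᶜ γ (turningDir κ c t * s t) t (comp i)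

lemma exists_sign_unique {x μ ν : ℝ} (hμ : μ = 1 ∨ μ = -1) (hν : ν = 1 ∨ ν = -1) (h1 : 0 < μ * x)
    (h2 : 0 < ν * x) : μ = ν := by
  rcases hμ with rfl | rfl <;> rcases hν with rfl | rfl <;> first | rfl | linarith

/-- The two half graphs cut the box into the horn between them and an outer region that is connected
around the tip. The outer region contains points to the left of the forward half and so lies in `G`.
The components bordering the two halves must reach into the horn, hence they coincide. The backward
continuation of the tangent leaves the tip into the outer region. -/
lemma TurningLoop.cusp_corner (hL : TurningLoop κ c s γ G) (hA : ArcSystem s γ a b pred)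
    {comp : ι → Set ℂ} (hC : IsRightComponents κ c s γ G a b comp) {v : ι} (hv : s (a v) = 0) :
    comp (pred v) = comp v ∧ (∀ᶠ z in 𝓝 (γ (a v)), z ∈ (G ∪ range γ)ᶜ → z ∈ comp v) ∧
    ∃ μ : ℝ, (μ = 1 ∨ μ = -1) ∧
      (∃ δ > 0, ∀ u ∈ Ioo 0 δ, 0 < μ * s (a v + u) ∧ μ * s (a v - u) < 0) ∧
      ∀ᶠ ε : ℝ in 𝓝[>] 0, γ (a v) - ε * (μ * turningDir κ c (a v)) ∈ G := by
  have hκ := hL.kappa_pos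
  set V := (G ∪ range γ)ᶜ with hV
  obtain ⟨μ', hμ', δ', hδ', hsign'⟩ := hL.exists_sign_cusp hv
  obtain ⟨δ₀, hδ₀0, hδ₀⟩ := exists_between (lt_min (lt_min hδ' (show 0 < Real.pi / 2 / κ by positivity))
    (lt_min (sub_pos.2 (hA.lt v)) (sub_pos.2 (hA.lt (pred v)))))
  simp only [lt_min_iff] at hδ₀
  obtain ⟨⟨hδ1, hδ2⟩, hδ3, hδ4⟩ := hδ₀
  obtain ⟨e, hen, ⟨μ, hμ, heμ, δ, hδ, hsign⟩, x₁, hx₁, η, hη, A, B, hAc, hBc, hAB0, hAB, hABη, hAm,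
    hmem, harc⟩ := hL.exists_box_cusp hv hδ₀0
  have hμμ : μ = μ' := by
    obtain ⟨u, hu0, hu⟩ := exists_between (lt_min hδ hδ')
    exact exists_sign_unique hμ hμ' (hsign u ⟨hu0, hu.trans_le (min_le_left _ _)⟩).1
      (hsign' u ⟨hu0, hu.trans_le (min_le_right _ _)⟩).1
  have he0 : e ≠ 0 := norm_pos_iff.1 (by rw [hen]; exact one_pos)
  set p := γ (a v) with hp
  have hA0 : A 0 = 0 := (hAB0 0 le_rfl).1
  have hB0 : B 0 = 0 := (hAB0 0 le_rfl).2
  have hA' : ∀ x, |x| < x₁ → 0 ≤ A x ∧ B x ≤ 0 := fun x hx => by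
    rcases le_or_gt x 0 with h | h
    · exact ⟨(hAB0 x h).1.ge, (hAB0 x h).2.le⟩
    · exact ⟨(hAB x ⟨h, (abs_lt.1 hx).2⟩).1.le, (hAB x ⟨h, (abs_lt.1 hx).2⟩).2.le⟩
  have hxI : ∀ x, x ∈ Ioo (-x₁) x₁ ↔ |x| < x₁ := fun x => abs_lt.symm
  set up := betweenGraphs p e (Ioo (-x₁) x₁) A (fun _ => η) with hup
  set dn := betweenGraphs p e (Ioo (-x₁) x₁) (fun _ => -η) B with hdn
  set lf := betweenGraphs p e (Ioo (-x₁) 0) (fun _ => -η) (fun _ => η) with hlf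
  set horn := betweenGraphs p e (Ioo 0 x₁) B A with hhorn
  have hout : IsPreconnected (up ∪ lf ∪ dn) := by
    have m0 : -x₁ / 2 ∈ Ioo (-x₁) 0 := ⟨by linarith, by linarith⟩
    have m1 : -x₁ / 2 ∈ Ioo (-x₁) x₁ := ⟨by linarith, by linarith⟩
    have mA := hAB0 (-x₁ / 2) m0.2.le
    refine IsPreconnected.union' (s := up ∪ lf) ?_ (IsPreconnected.union' ?_ ?_ ?_) ?_
    · exact ⟨framePoint p e (-x₁ / 2) (-η / 2),
        .inr ⟨_, _, m0, by linarith, by linarith, rfl⟩,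
        ⟨_, _, m1, by linarith, by rw [mA.2]; linarith, rfl⟩⟩
    · exact ⟨framePoint p e (-x₁ / 2) (η / 2), ⟨_, _, m1, by rw [mA.1]; linarith, by linarith, rfl⟩,
        ⟨_, _, m0, by linarith, by linarith, rfl⟩⟩
    · exact isPreconnected_betweenGraphs p e isPreconnected_Ioo hAc continuous_const
        fun x hx => (abs_lt.1 (hABη x ((hxI x).1 hx)).1).2
    · exact isPreconnected_betweenGraphs p e isPreconnected_Ioo continuous_const continuous_const
        fun x hx => by linarith
    · exact isPreconnected_betweenGraphs p e isPreconnected_Ioo continuous_const hBc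
        fun x hx => (abs_lt.1 (hABη x ((hxI x).1 hx)).2).1
  have houtr : ∀ z ∈ up ∪ lf ∪ dn, z ∉ range γ := by
    rintro z ((⟨x, y, hx, h1, h2, rfl⟩ | ⟨x, y, hx, h1, h2, rfl⟩) | ⟨x, y, hx, h1, h2, rfl⟩) h
    · have hx' := (hxI x).1 hx
      have := hA' x hx'
      rw [hmem x y hx' (abs_lt.2 ⟨by linarith, h2⟩)] at h
      rcases h.2 with h | h <;> linarith
    · rw [hmem x y (abs_lt.2 ⟨hx.1, by linarith [hx.2]⟩) (abs_lt.2 ⟨h1, h2⟩)] at h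
      linarith [hx.2, h.1]
    · have hx' := (hxI x).1 hx
      have := hA' x hx'
      rw [hmem x y hx' (abs_lt.2 ⟨h1, by linarith⟩)] at h
      rcases h.2 with h | h <;> linarith
  have hhornr : ∀ z ∈ horn, z ∉ range γ := by
    rintro z ⟨x, y, hx, h1, h2, rfl⟩ h
    have hx' : |x| < x₁ := abs_lt.2 ⟨by linarith [hx.1], hx.2⟩
    have h3 := abs_lt.1 (hABη x hx').1
    have h4 := abs_lt.1 (hABη x hx').2
    rw [hmem x y hx' (abs_lt.2 ⟨by linarith, by linarith⟩)] at h
    rcases h.2 with h | h <;> linarith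
  have hhornc : IsPreconnected horn := isPreconnected_betweenGraphs p e isPreconnected_Ioo hBc hAc
    fun x hx => (hAB x hx).2.trans (hAB x hx).1
  have hmid : x₁ / 2 ∈ Ioo 0 x₁ := ⟨by linarith, by linarith⟩
  obtain ⟨⟨u, hu, huA⟩, u', hu', huB⟩ := harc _ hmid
  have hmid' : |x₁ / 2| < x₁ := abs_lt.2 ⟨by linarith, by linarith⟩
  have houtG : up ∪ lf ∪ dn ⊆ G := by
    have hs := hsign' u ⟨hu.1, hu.2.trans hδ1⟩
    rw [← hμμ] at hs
    have hsne : s (a v + u) ≠ 0 := fun h0 => by rw [h0] at hs; simp at hs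
    have hκu : κ * u < Real.pi / 2 := by
      have := hu.2.trans hδ2
      rw [lt_div_iff₀ hκ] at this
      linarith
    have hκu0 : 0 < κ * u := mul_pos hκ hu.1
    have hcos : 0 < Real.cos (κ * u) := Real.cos_pos_of_mem_Ioo ⟨by linarith, hκu⟩
    have hsin : 0 < Real.sin (κ * u) := Real.sin_pos_of_pos_of_lt_pi hκu0 (by linarith)
    have hηA : 0 < η - A (x₁ / 2) := by linarith [(abs_lt.1 (hABη _ hmid').1).2]
    obtain ⟨ε, ⟨h1, h2⟩, h3, h4⟩ := ((hL.left _ hsne).and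
      (eventually_pos_lt hηA _ (mul_pos hs.1 hcos)) |>.and
      (eventually_pos_lt hmid.1 _ (mul_pos hs.1 hsin))).exists
    -- At parameter `a v + u` the left normal is rotated by `κu`: moving along it decreases the
    -- first coordinate and increases the second, and `A` is strictly increasing, so the point lies
    -- above the graph.
    refine hL.subset_G hout houtr (.inl (.inl ?_)) h1
    refine ⟨x₁ / 2 - ε * (μ * s (a v + u) * Real.sin (κ * u)),
      A (x₁ / 2) + ε * (μ * s (a v + u) * Real.cos (κ * u)), ⟨by linarith, by linarith⟩, ?_,
      by linarith [h2.2], ?_⟩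
    · have := hAm ⟨by linarith, by linarith⟩ ⟨hmid.1.le, hmid.2⟩
        (show x₁ / 2 - ε * (μ * s (a v + u) * Real.sin (κ * u)) < x₁ / 2 by linarith)
      linarith [h2.1]
    · rw [huA, framePoint, framePoint]
      have hd : turningDir κ c (a v + u) = μ * e * circlePoint (κ * u) := by
        have hμ2 : (μ : ℂ) * μ = 1 := by rcases hμ with rfl | rfl <;> norm_num
        rw [heμ, ← mul_assoc, hμ2, one_mul, turningDir, turningDir, mul_add, circlePoint_add,
          mul_assoc]
      rw [hd, circlePoint_eq_cos_sin]
      push_cast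
      linear_combination ε * e * μ * s (a v + u) * Complex.sin (κ * u) * Complex.I_mul_I
  have hleft : ∀ x y, |x| < x₁ → |y| < η → x < 0 → framePoint p e x y ∈ G := by
    intro x y hx hy hx0
    exact houtG (.inl (.inr ⟨x, y, ⟨(abs_lt.1 hx).1, hx0⟩, (abs_lt.1 hy).1, (abs_lt.1 hy).2, rfl⟩))
  have hupV' : ∀ x y, |x| < x₁ → |y| < η → A x ≤ y → framePoint p e x y ∉ V := by
    intro x y hx hy hAy
    rcases lt_or_ge x 0 with hx0 | hx0
    · exact fun h' => h' (.inl (hleft x y hx hy hx0))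
    · rcases hAy.eq_or_lt with h | h
      · exact fun h' => h' (.inr ((hmem x y hx hy).2 ⟨hx0, .inl h.symm⟩))
      · exact fun h' => h' (.inl (houtG (.inl (.inl ⟨x, y, (hxI x).2 hx, h, (abs_lt.1 hy).2, rfl⟩))))
  have hdnV' : ∀ x y, |x| < x₁ → |y| < η → y ≤ B x → framePoint p e x y ∉ V := by
    intro x y hx hy hBy
    rcases lt_or_ge x 0 with hx0 | hx0
    · exact fun h' => h' (.inl (hleft x y hx hy hx0))
    · rcases hBy.eq_or_lt with h | h
      · exact fun h' => h' (.inr ((hmem x y hx hy).2 ⟨hx0, .inr h⟩))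
      · exact fun h' => h' (.inl (houtG (.inr ⟨x, y, (hxI x).2 hx, (abs_lt.1 hy).1, h, rfl⟩)))
  have hBA := (hAB _ hmid).2.trans (hAB _ hmid).1
  have hmeet1 : (comp v ∩ horn).Nonempty := by
    refine exists_mem_between_of_closure he0 (planarComponents_subset (hC v).1) isOpen_Ioo hBc hmid
      hmid' (hABη _ hmid').1 hBA hupV' ?_
    rw [← huA]
    exact ((hC v).2 _ ⟨by linarith [hu.1], by linarith [hu.2]⟩).mem_closure
  have hmeet2 : (comp (pred v) ∩ horn).Nonempty := by
    refine exists_mem_between_of_closure' he0 (planarComponents_subset (hC (pred v)).1) isOpen_Ioo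
      hAc hmid hmid' (hABη _ hmid').2 hBA hdnV' ?_
    rw [← huB, ← hA.gamma_end hL]
    exact ((hC (pred v)).2 _ ⟨by linarith [hu'.2], by linarith [hu'.1]⟩).mem_closure
  have hhornV : horn ⊆ V := by
    obtain ⟨z, hz, hzh⟩ := hmeet1
    exact (hL.subset_or_subset hhornc hhornr).resolve_left fun h =>
      planarComponents_subset (hC v).1 hz (.inl (h hzh))
  have hhornU : horn ⊆ comp v := subset_of_mem_planarComponents (hC v).1 hhornc hhornV
    (by rw [inter_comm]; exact hmeet1)
  refine ⟨?_, ?_, μ, hμ, ⟨δ, hδ, hsign⟩, ?_⟩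
  · obtain ⟨z, hz, hzh⟩ := hmeet2
    exact planarComponents_eq (hC _).1 (hC v).1 hz (hhornU hzh)
  · have hp0 : p = framePoint p e 0 0 := by simp [framePoint]
    rw [hp0]
    filter_upwards [eventually_framePoint he0 (x := 0) (y := 0) (x₁ := x₁) (η := η) (by simpa)
      (by simpa)] with z ⟨x, y, hx, hy, hz⟩ hzV
    rw [hz] at hzV
    have h1 : y < A x := not_le.1 fun h => hupV' x y hx hy h hzV
    have h2 : B x < y := not_le.1 fun h => hdnV' x y hx hy h hzV
    have h3 : 0 < x := by
      by_contra! h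
      have := hAB0 x h
      linarith
    exact hhornU ⟨x, y, ⟨h3, (abs_lt.1 hx).2⟩, h2, h1, hz⟩
  · filter_upwards [eventually_pos_lt hx₁ 1 one_pos] with ε hε
    rw [mul_one] at hε
    have := hleft (-ε) 0 (abs_lt.2 ⟨by linarith, by linarith⟩) (by simpa) (by linarith)
    rw [framePoint] at this
    rw [← heμ]
    convert this using 1
    push_cast; ring

/-- The touching graphs leave four regions in the box. The upper and the lower one are to the left
of the two oppositely directed branches and lie in `G`. The right horn is bordered by the arc
leaving along the first branch and the arc arriving along the second, so these share a component;
the left horn is bordered by the other two arcs and contains the ray in direction `-e`. -/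
lemma TurningLoop.double_corner (hL : TurningLoop κ c s γ G) (hA : ArcSystem s γ a b pred)
    {comp : ι → Set ℂ} (hC : IsRightComponents κ c s γ G a b comp) {v w : ι} (hvw : v ≠ w)
    (hγ : γ (a v) = γ (a w)) :
    comp (pred w) = comp v ∧
    (∀ᶠ z in 𝓝 (γ (a v)), z ∈ (G ∪ range γ)ᶜ → z ∈ comp v ∨ z ∈ comp w) ∧
    ∃ e : ℂ, turningDir κ c (a v) * s (a v) = |s (a v)| * e ∧
      turningDir κ c (a w) * s (a w) = |s (a w)| * -e ∧
      ∀ᶠ ε : ℝ in 𝓝[>] 0, γ (a v) - ε * e ∈ comp w := by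
  set V := (G ∪ range γ)ᶜ with hV
  have hne : circlePoint (a v) ≠ circlePoint (a w) := fun h =>
    hvw (hA.disj v w _ ⟨le_rfl, hA.lt v⟩ _ ⟨le_rfl, hA.lt w⟩ h).1
  obtain ⟨hsv, hsw, -⟩ := hL.opposite _ _ hγ hne
  obtain ⟨δ₀, hδ₀0, hδ₀⟩ := exists_between (lt_min
    (lt_min (sub_pos.2 (hA.lt v)) (sub_pos.2 (hA.lt w)))
    (lt_min (sub_pos.2 (hA.lt (pred v))) (sub_pos.2 (hA.lt (pred w)))))
  simp only [lt_min_iff] at hδ₀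
  obtain ⟨⟨hδ1, hδ2⟩, hδ3, hδ4⟩ := hδ₀
  obtain ⟨e, hen, hev, hew, x₁, hx₁, η, hη, A, B, hAc, hBc, hA0, hB0, hAB, hABη, hmem, harcR,
    harcL⟩ := hL.exists_box_double hγ hne hδ₀0
  have he0 : e ≠ 0 := norm_pos_iff.1 (by rw [hen]; exact one_pos)
  set p := γ (a v) with hp
  have hA' : ∀ x, |x| < x₁ → 0 ≤ A x ∧ B x ≤ 0 := fun x hx => by
    rcases eq_or_ne x 0 with rfl | h
    · exact ⟨hA0.ge, hB0.le⟩
    · exact ⟨(hAB x hx h).1.le, (hAB x hx h).2.le⟩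
  have hxI : ∀ x, x ∈ Ioo (-x₁) x₁ ↔ |x| < x₁ := fun x => abs_lt.symm
  set up := betweenGraphs p e (Ioo (-x₁) x₁) A (fun _ => η) with hup
  set dn := betweenGraphs p e (Ioo (-x₁) x₁) (fun _ => -η) B with hdn
  set hornR := betweenGraphs p e (Ioo 0 x₁) B A with hhornR
  set hornL := betweenGraphs p e (Ioo (-x₁) 0) B A with hhornL
  have hsv' := abs_pos.2 hsv
  have hsw' := abs_pos.2 hsw
  have hupG : up ⊆ G := by
    obtain ⟨ε, h1, h2⟩ := ((hL.left _ hsv).and (eventually_pos_lt hη _ hsv')).exists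
    refine hL.subset_G (isPreconnected_betweenGraphs p e isPreconnected_Ioo hAc continuous_const
        fun x hx => (abs_lt.1 (hABη x ((hxI x).1 hx)).1).2) ?_
      (z := γ (a v) + ε * (Complex.I * (turningDir κ c (a v) * s (a v)))) ?_ h1
    · rintro z ⟨x, y, hx, h1, h2, rfl⟩ h
      have hx' := (hxI x).1 hx
      have := hA' x hx'
      rw [hmem x y hx' (abs_lt.2 ⟨by linarith, h2⟩)] at h
      rcases h with h | h <;> linarith
    · refine ⟨0, ε * |s (a v)|, ⟨by linarith, hx₁⟩, by rw [hA0]; exact h2.1, h2.2, ?_⟩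
      rw [hev, framePoint]; push_cast; ring
  have hdnG : dn ⊆ G := by
    obtain ⟨ε, h1, h2⟩ := ((hL.left _ hsw).and (eventually_pos_lt hη _ hsw')).exists
    refine hL.subset_G (isPreconnected_betweenGraphs p e isPreconnected_Ioo continuous_const hBc
        fun x hx => (abs_lt.1 (hABη x ((hxI x).1 hx)).2).1) ?_
      (z := γ (a w) + ε * (Complex.I * (turningDir κ c (a w) * s (a w)))) ?_ h1
    · rintro z ⟨x, y, hx, h1, h2, rfl⟩ h
      have hx' := (hxI x).1 hx
      have := hA' x hx'
      rw [hmem x y hx' (abs_lt.2 ⟨h1, by linarith⟩)] at h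
      rcases h with h | h <;> linarith
    · refine ⟨0, -(ε * |s (a w)|), ⟨by linarith, hx₁⟩, by linarith, by rw [hB0]; linarith, ?_⟩
      rw [hew, ← hγ, framePoint]; push_cast; ring
  have hupV : ∀ x y, |x| < x₁ → |y| < η → A x ≤ y → framePoint p e x y ∉ V := by
    intro x y hx hy hAy h'
    rcases hAy.eq_or_lt with h | h
    · exact h' (.inr ((hmem x y hx hy).2 (.inl h.symm)))
    · exact h' (.inl (hupG ⟨x, y, (hxI x).2 hx, h, (abs_lt.1 hy).2, rfl⟩))
  have hdnV : ∀ x y, |x| < x₁ → |y| < η → y ≤ B x → framePoint p e x y ∉ V := by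
    intro x y hx hy hBy h'
    rcases hBy.eq_or_lt with h | h
    · exact h' (.inr ((hmem x y hx hy).2 (.inr h)))
    · exact h' (.inl (hdnG ⟨x, y, (hxI x).2 hx, (abs_lt.1 hy).1, h, rfl⟩))
  have hhorn : ∀ S : Set ℝ, IsOpen S → IsPreconnected S → (∀ x ∈ S, |x| < x₁ ∧ x ≠ 0) → ∀ i j,
      (∃ x ∈ S, framePoint p e x (A x) ∈ closure (comp i)) →
      (∃ x ∈ S, framePoint p e x (B x) ∈ closure (comp j)) →
      comp j = comp i ∧ betweenGraphs p e S B A ⊆ comp i := by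
    rintro S hSo hSc hS i j ⟨x, hx, hxc⟩ ⟨y, hy, hyc⟩
    have hr : ∀ z ∈ betweenGraphs p e S B A, z ∉ range γ := by
      rintro z ⟨x, y, hx, h1, h2, rfl⟩ h
      have hx' := (hS x hx).1
      have h3 := abs_lt.1 (hABη x hx').1
      have h4 := abs_lt.1 (hABη x hx').2
      rw [hmem x y hx' (abs_lt.2 ⟨by linarith, by linarith⟩)] at h
      rcases h with h | h <;> linarith
    have hBA : ∀ x ∈ S, B x < A x := fun x hx =>
      (hAB x (hS x hx).1 (hS x hx).2).2.trans (hAB x (hS x hx).1 (hS x hx).2).1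
    have hc : IsPreconnected (betweenGraphs p e S B A) :=
      isPreconnected_betweenGraphs p e hSc hBc hAc hBA
    obtain ⟨z, hz, hzh⟩ := exists_mem_between_of_closure he0 (planarComponents_subset (hC i).1) hSo
      hBc hx (hS x hx).1 (hABη x (hS x hx).1).1 (hBA x hx) hupV hxc
    obtain ⟨z', hz', hzh'⟩ := exists_mem_between_of_closure' he0 (planarComponents_subset (hC j).1)
      hSo hAc hy (hS y hy).1 (hABη y (hS y hy).1).2 (hBA y hy) hdnV hyc
    have hV' : betweenGraphs p e S B A ⊆ V :=
      (hL.subset_or_subset hc hr).resolve_left fun h =>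
        planarComponents_subset (hC i).1 hz (.inl (h hzh))
    have hU := subset_of_mem_planarComponents (hC i).1 hc hV' ⟨z, hzh, hz⟩
    exact ⟨planarComponents_eq (hC j).1 (hC i).1 hz' (hU hzh'), hU⟩
  have hmid : x₁ / 2 ∈ Ioo 0 x₁ := ⟨by linarith, by linarith⟩
  obtain ⟨⟨u₁, hu₁, hu₁e⟩, u₂, hu₂, hu₂e⟩ := harcR _ hmid
  obtain ⟨⟨u₃, hu₃, hu₃e⟩, u₄, hu₄, hu₄e⟩ := harcL _ hmid
  have hR := hhorn (Ioo 0 x₁) isOpen_Ioo isPreconnected_Ioo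
    (fun x hx => ⟨abs_lt.2 ⟨by linarith [hx.1], hx.2⟩, hx.1.ne'⟩) v (pred w)
    ⟨_, hmid, by
      rw [← hu₁e]
      exact ((hC v).2 _ ⟨by linarith [hu₁.1], by linarith [hu₁.2]⟩).mem_closure⟩
    ⟨_, hmid, by
      rw [← hu₂e, ← hA.gamma_end hL]
      exact ((hC (pred w)).2 _ ⟨by linarith [hu₂.2], by linarith [hu₂.1]⟩).mem_closure⟩
  have hmid' : -(x₁ / 2) ∈ Ioo (-x₁) 0 := ⟨by linarith, by linarith⟩
  have hLl := hhorn (Ioo (-x₁) 0) isOpen_Ioo isPreconnected_Ioo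
    (fun x hx => ⟨abs_lt.2 ⟨hx.1, by linarith [hx.2]⟩, hx.2.ne⟩) (pred v) w
    ⟨_, hmid', by
      rw [← hu₃e, ← hA.gamma_end hL]
      exact ((hC (pred v)).2 _ ⟨by linarith [hu₃.2], by linarith [hu₃.1]⟩).mem_closure⟩
    ⟨_, hmid', by
      rw [← hu₄e]
      exact ((hC w).2 _ ⟨by linarith [hu₄.1], by linarith [hu₄.2]⟩).mem_closure⟩
  rw [← hLl.1] at hLl
  refine ⟨hR.1, ?_, e, hev, hew, ?_⟩
  · have hp0 : p = framePoint p e 0 0 := by simp [framePoint]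
    rw [hp0]
    filter_upwards [eventually_framePoint he0 (x := 0) (y := 0) (x₁ := x₁) (η := η) (by simpa)
      (by simpa)] with z ⟨x, y, hx, hy, hz⟩ hzV
    rw [hz] at hzV
    have h1 : y < A x := not_le.1 fun h => hupV x y hx hy h hzV
    have h2 : B x < y := not_le.1 fun h => hdnV x y hx hy h hzV
    rcases lt_trichotomy x 0 with h | rfl | h
    · exact .inr (hLl.2 ⟨x, y, ⟨(abs_lt.1 hx).1, h⟩, h2, h1, hz⟩)
    · linarith
    · exact .inl (hR.2 ⟨x, y, ⟨h, (abs_lt.1 hx).2⟩, h2, h1, hz⟩)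
  · filter_upwards [eventually_pos_lt hx₁ 1 one_pos] with ε hε
    rw [mul_one] at hε
    have hx : |-ε| < x₁ := abs_lt.2 ⟨by linarith, by linarith⟩
    have h1 := hAB (-ε) hx (by linarith [hε.1])
    refine hLl.2 ⟨-ε, 0, ⟨by linarith, by linarith⟩, h1.2, h1.1, ?_⟩
    rw [framePoint]; push_cast; ring

end

/-! ### Pairing of the corners, closed chains, and the number of components and vertices. -/

section

variable {κ : ℝ} {c : ℂ} {s : ℝ → ℝ} {γ : ℝ → ℂ} {G : Set ℂ} {ι : Type} [Fintype ι] [DecidableEq ι]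
  {a b : ι → ℝ} {pred : Equiv.Perm ι}

lemma ArcSystem.circlePoint_injective (hA : ArcSystem s γ a b pred) {v w : ι}
    (h : circlePoint (a v) = circlePoint (a w)) : v = w :=
  (hA.disj v w _ ⟨le_rfl, hA.lt v⟩ _ ⟨le_rfl, hA.lt w⟩ h).1

/-- Every point of the curve is a vertex or lies on an open arc. -/
lemma ArcSystem.vertex_or_arc (hL : TurningLoop κ c s γ G) (hA : ArcSystem s γ a b pred) {z : ℂ}
    (hz : z ∈ range γ) : (∃ i, γ (a i) = z) ∨ ∃ i, ∃ t ∈ Ioo (a i) (b i), γ t = z := by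
  obtain ⟨t, rfl⟩ := hz
  obtain ⟨i, t', ht', hE⟩ := hA.cover t
  rcases ht'.1.eq_or_lt with h | h
  · exact .inl ⟨i, by rw [h]; exact hL.periodic _ _ hE⟩
  · exact .inr ⟨i, t', ⟨h, ht'.2⟩, hL.periodic _ _ hE⟩

/-- `mate v` is the second parameter of a double point, and `v` itself at a cusp. -/
structure IsMate (s : ℝ → ℝ) (γ : ℝ → ℂ) {ι : Type} (a : ι → ℝ) (mate : Equiv.Perm ι) : Prop where
  involutive : ∀ v, mate (mate v) = v
  eq_iff : ∀ v, mate v = v ↔ s (a v) = 0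
  gamma : ∀ v, γ (a (mate v)) = γ (a v)
  unique : ∀ v w, γ (a w) = γ (a v) → w = v ∨ w = mate v

/-- A vertex that is not a cusp has a second parameter with the same image. That parameter is again
a vertex, since interior points of arcs are simple, and it is the only other one because at most two
branches meet at a point. -/
lemma TurningLoop.exists_mate (hL : TurningLoop κ c s γ G) (hA : ArcSystem s γ a b pred) :
    ∃ mate : Equiv.Perm ι, IsMate s γ a mate := by
  have hinj : ∀ {v w}, v ≠ w → circlePoint (a v) ≠ circlePoint (a w) := fun h h' =>
    h (hA.circlePoint_injective h')
  have h1 : ∀ v, ∃ w, (w = v ↔ s (a v) = 0) ∧ γ (a w) = γ (a v) ∧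
      ∀ x, γ (a x) = γ (a v) → x = v ∨ x = w := by
    intro v
    by_cases hv : s (a v) = 0
    · exact ⟨v, by simp [hv], rfl, fun x hx => .inl
        (hA.circlePoint_injective (hL.circlePoint_of_cusp hv hx))⟩
    · obtain ⟨t, ht, hne⟩ := (hA.singular v).resolve_left hv
      obtain ⟨w, t', ht', hE⟩ := hA.cover t
      have hw : a w = t' := by
        rcases ht'.1.eq_or_lt with h | h
        · exact h
        · refine absurd ((hA.regular w t' ⟨h, ht'.2⟩).2 (a v) ?_) ?_
          · rw [← ht]; exact (hL.periodic _ _ hE).symm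
          · rw [hE]; exact hne.symm
      have hγw : γ (a w) = γ (a v) := by rw [hw, hL.periodic _ _ hE, ht]
      have hEw : circlePoint (a w) = circlePoint t := by rw [hw, hE]
      have hwv : w ≠ v := by
        rintro rfl; exact hne hEw.symm
      refine ⟨w, by simp [hv, hwv], hγw, fun x hx => ?_⟩
      rcases hL.circlePoint_of_double hγw.symm (hinj hwv.symm) hx with h | h
      · exact .inl (hA.circlePoint_injective h)
      · exact .inr (hA.circlePoint_injective h)
  choose m hm1 hm2 hm3 using h1
  have hinv : Function.Involutive m := by
    intro v
    by_cases hv : m v = v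
    · rw [hv, hv]
    rcases hm3 v (m (m v)) ((hm2 _).trans (hm2 _)) with h | h
    · exact h
    · exfalso
      have h0 := (hm1 (m v)).1 h
      have : circlePoint (a v) = circlePoint (a (m v)) := hL.circlePoint_of_cusp h0 (hm2 v).symm
      exact hv (hA.circlePoint_injective this).symm
  exact ⟨hinv.toPerm m, hinv, hm1, hm2, hm3⟩

/-- The arc leaving along one branch and the arc arriving along the mate bound the same sector of
the complement. So `pred ∘ mate` walks from arc to arc along the boundary of a single component. -/
lemma IsMate.comp_pred (hL : TurningLoop κ c s γ G) (hA : ArcSystem s γ a b pred)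
    {comp : ι → Set ℂ} (hC : IsRightComponents κ c s γ G a b comp) {mate : Equiv.Perm ι}
    (hM : IsMate s γ a mate) (v : ι) : comp (pred (mate v)) = comp v := by
  by_cases h : mate v = v
  · rw [h]; exact (hL.cusp_corner hA hC ((hM.eq_iff v).1 h)).1
  · exact (hL.double_corner hA hC (Ne.symm h) (hM.gamma v).symm).1

lemma IsMate.near (hL : TurningLoop κ c s γ G) (hA : ArcSystem s γ a b pred)
    {comp : ι → Set ℂ} (hC : IsRightComponents κ c s γ G a b comp) {mate : Equiv.Perm ι}
    (hM : IsMate s γ a mate) (v : ι) :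
    ∀ᶠ z in 𝓝 (γ (a v)), z ∈ (G ∪ range γ)ᶜ → z ∈ comp v ∨ z ∈ comp (mate v) := by
  by_cases h : mate v = v
  · filter_upwards [(hL.cusp_corner hA hC ((hM.eq_iff v).1 h)).2.1] with z hz hzV
    exact .inl (hz hzV)
  · exact (hL.double_corner hA hC (Ne.symm h) (hM.gamma v).symm).2.1

/-- The arcs of a closed chain and the other arcs bound different components. -/
lemma IsClosedChain.comp_ne (hL : TurningLoop κ c s γ G) (hA : ArcSystem s γ a b pred)
    {comp : ι → Set ℂ} (hC : IsRightComponents κ c s γ G a b comp) {I : Finset ι}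
    (hI : IsClosedChain γ a b I) {i j : ι} (hi : i ∈ I) (hj : j ∉ I) : comp i ≠ comp j := by
  set g := chainIntegral γ (fun t => turningDir κ c t * s t) a b I
  have hd := fun p hp => hL.hasDerivAt_chainIntegral hA hI (p := p) hp
  have hO := hL.isClosed_range.isOpen_compl
  have hGr : G ⊆ (range γ)ᶜ := by rintro z hz ⟨t', rfl⟩; exact hL.notMem t' hz
  obtain ⟨z₀, hz₀⟩ := hL.isConnected.nonempty
  -- The chain integral has one value on the connected set `G`. Passing from `G` across arc `k` into
  -- `comp k` changes it by `2πi` or `0` according to whether `k ∈ I`, so a component determines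
  -- membership of its arcs in `I`.
  have key : ∀ k, ∀ z ∈ comp k, g z₀ - g z = if k ∈ I then 2 * Real.pi * Complex.I else 0 := by
    intro k z hz
    obtain ⟨t, ht⟩ := exists_between (hA.lt k)
    have h1 := hL.tendsto_jump_chainIntegral hA I ht
    have hUr : comp k ⊆ (range γ)ᶜ := fun z hz h' => planarComponents_subset (hC k).1 hz (.inr h')
    refine tendsto_nhds_unique (tendsto_const_nhds.congr' ?_) h1
    filter_upwards [((hC k).2 t ht).right, hL.left t (hA.regular k t ht).1] with ε h2 h3
    change _ = g _ - g _
    rw [hO.isPreconnected_const_of_hasDerivAt_zero (f := g) hd hL.isConnected.isPreconnected hGr hz₀ h3,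
      hO.isPreconnected_const_of_hasDerivAt_zero (f := g) hd (planarComponents_isPreconnected (hC k).1) hUr
        hz h2]
  intro h
  obtain ⟨z, hz⟩ := planarComponents_nonempty (hC i).1
  have h1 := key i z hz
  have h2 := key j z (h ▸ hz)
  rw [if_pos hi] at h1
  rw [if_neg hj, h1] at h2
  simp [Real.pi_ne_zero] at h2

lemma ArcSystem.gamma_b (hL : TurningLoop κ c s γ G) (hA : ArcSystem s γ a b pred) (v : ι) :
    γ (b (pred v)) = γ (a v) := hL.periodic _ _ (hA.end_pred v)

/-- Summation by parts: the end of `pred v` is the start of `v`, so only the two ends of the run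
survive, and they are the same point of the plane. This is the loop cut off at a double point. -/
lemma ArcSystem.isClosedChain_interval (hL : TurningLoop κ c s γ G) (hA : ArcSystem s γ a b pred)
    {i j : ι} (hij : γ (a i) = γ (a j)) {J : Finset ι} (hJ : ∀ v,
      ((if v ∈ J then 1 else 0) - (if pred v ∈ J then 1 else 0) : ℤ) =
      (if v = i then 1 else 0) - (if v = j then 1 else 0)) : IsClosedChain γ a b J := by
  intro ψ
  rw [← sub_eq_zero]
  have h1 : ∑ v ∈ J, ψ (γ (a v)) = ∑ v, (if v ∈ J then (1 : ℂ) else 0) * ψ (γ (a v)) := by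
    simp [Finset.sum_ite_mem]
  have h2 : ∑ v ∈ J, ψ (γ (b v)) = ∑ v, (if pred v ∈ J then (1 : ℂ) else 0) * ψ (γ (a v)) := by
    rw [show ∑ v ∈ J, ψ (γ (b v)) = ∑ v, (if v ∈ J then (1 : ℂ) else 0) * ψ (γ (b v)) by
      simp [Finset.sum_ite_mem], ← Equiv.sum_comp pred]
    exact Finset.sum_congr rfl fun v _ => by rw [hA.gamma_b hL]
  rw [h1, h2, ← Finset.sum_sub_distrib]
  have h3 : ∀ v, (if v ∈ J then (1 : ℂ) else 0) * ψ (γ (a v)) -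
      (if pred v ∈ J then (1 : ℂ) else 0) * ψ (γ (a v)) =
      (if v = i then ψ (γ (a v)) else 0) - (if v = j then ψ (γ (a v)) else 0) := by
    intro v
    have := congrArg (fun n : ℤ => (n : ℂ)) (hJ v)
    push_cast at this
    rw [← sub_mul, this, sub_mul]
    simp
  rw [Finset.sum_congr rfl fun v _ => h3 v, Finset.sum_sub_distrib]
  simp [hij]

/-- The arc `pred (mate v)` ends at the point where `v` starts, so the permutation matches endpoints
with starting points inside an invariant set. -/
lemma IsMate.isClosedChain_of_invariant (hL : TurningLoop κ c s γ G)
    (hA : ArcSystem s γ a b pred) {mate : Equiv.Perm ι} (hM : IsMate s γ a mate) {I : Finset ι}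
    (hI : ∀ v, pred (mate v) ∈ I ↔ v ∈ I) : IsClosedChain γ a b I := by
  intro ψ
  rw [show ∑ v ∈ I, ψ (γ (b v)) = ∑ v, (if v ∈ I then ψ (γ (b v)) else 0) by
      simp [Finset.sum_ite_mem], ← Equiv.sum_comp (mate.trans pred)]
  rw [show ∑ v ∈ I, ψ (γ (a v)) = ∑ v, (if v ∈ I then ψ (γ (a v)) else 0) by
      simp [Finset.sum_ite_mem]]
  refine Finset.sum_congr rfl fun v _ => ?_
  rw [Equiv.trans_apply, hA.gamma_b hL, hM.gamma]
  simp only [hI]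

/-- The number of components exceeds the number of double points. -/
lemma IsMate.card_components_ge (hL : TurningLoop κ c s γ G) (hA : ArcSystem s γ a b pred)
    {comp : ι → Set ℂ} (hC : IsRightComponents κ c s γ G a b comp) {mate : Equiv.Perm ι}
    (hM : IsMate s γ a mate) (P : Finset ℂ) (hP : ∀ p ∈ P, ∃ v, γ (a v) = p ∧ mate v ≠ v)
    [Nonempty ι] : P.card + 1 ≤ (range comp).ncard := by
  classical
  have h1 : ∀ p : P, ∃ v, γ (a v) = p ∧ mate v ≠ v := fun p => hP p p.2
  choose v hv hvm using h1
  have h2 : ∀ p : P, ∃ J : Finset ι, ∀ x,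
      ((if x ∈ J then 1 else 0) - (if pred x ∈ J then 1 else 0) : ℤ) =
      (if x = v p then 1 else 0) - (if x = mate (v p) then 1 else 0) :=
    fun p => hA.interval _ _ (hvm p).symm
  choose J hJ using h2
  have hJc : ∀ p, ∀ x y, comp x = comp y → (x ∈ J p ↔ y ∈ J p) := by
    intro p x y hxy
    have hc := hA.isClosedChain_interval hL (hM.gamma (v p)).symm (hJ p)
    by_contra h
    by_cases hx : x ∈ J p
    · exact hc.comp_ne hL hA hC hx (fun hy => h ⟨fun _ => hy, fun _ => hx⟩) hxy
    · by_cases hy : y ∈ J p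
      · exact hc.comp_ne hL hA hC hy hx hxy.symm
      · exact h ⟨fun h => absurd h hx, fun h => absurd h hy⟩
  choose r hr using fun u : range comp => u.2
  -- Linear combinations of the indicators of the loops `J p` and the constant `1`. They are
  -- constant on the arcs of each component, so `Λ` evaluates them on one arc `r u` per component.
  -- Injectivity of `Λ` is the desired inequality of dimensions.
  let F : (P → ℝ) × ℝ → ι → ℝ := fun q x => q.2 + ∑ p, q.1 p * (if x ∈ J p then 1 else 0)
  let Λ : (P → ℝ) × ℝ →ₗ[ℝ] (range comp → ℝ) :=
    { toFun := fun q u => F q (r u)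
      map_add' := fun q q' => by
        ext u
        simp only [F, Prod.fst_add, Prod.snd_add, Pi.add_apply, add_mul, Finset.sum_add_distrib]
        ring
      map_smul' := fun m q => by
        ext u
        simp only [F, Prod.smul_fst, Prod.smul_snd, Pi.smul_apply, smul_eq_mul, RingHom.id_apply,
          mul_add, Finset.mul_sum, mul_assoc] }
  have hΛ : Function.Injective Λ := by
    rw [← LinearMap.ker_eq_bot, LinearMap.ker_eq_bot']
    intro q hq
    have hF : ∀ x, F q x = 0 := by
      intro x
      have h3 : F q (r ⟨comp x, x, rfl⟩) = 0 := congrFun hq ⟨comp x, x, rfl⟩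
      rw [← h3]
      have h4 : comp (r ⟨comp x, x, rfl⟩) = comp x := hr ⟨comp x, x, rfl⟩
      simp only [F]
      congr 1
      exact Finset.sum_congr rfl fun p _ => by simp only [hJc p _ _ h4]
    have hq1 : ∀ p, q.1 p = 0 := by
      intro p
      have h5 : ∑ p', q.1 p' * ((if v p = v p' then 1 else 0) -
          (if v p = mate (v p') then 1 else 0) : ℝ) = 0 := by
        -- Across the vertex `v p` only the indicator of `J p` jumps, since the other loops begin
        -- and end at vertices over other double points. The difference isolates the coefficient of
        -- `p`.
        have h6 : F q (v p) - F q (pred (v p)) = 0 := by rw [hF, hF, sub_zero]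
        simp only [F, add_sub_add_left_eq_sub, ← Finset.sum_sub_distrib, ← mul_sub] at h6
        refine (Finset.sum_congr rfl fun p' _ => ?_).trans h6
        congr 1
        have := congrArg (fun n : ℤ => (n : ℝ)) (hJ p' (v p))
        push_cast at this
        exact this.symm
      have h7 : ∀ p', v p = v p' ∨ v p = mate (v p') → p' = p := by
        rintro p' (h | h)
        · exact Subtype.ext (by rw [← hv p', ← hv p, h])
        · exact Subtype.ext (by rw [← hv p', ← hv p, h, hM.gamma])
      rw [Finset.sum_eq_single p] at h5
      · simpa [(hvm p).symm] using h5
      · intro p' _ hne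
        rw [if_neg fun h => hne (h7 p' (.inl h)), if_neg fun h => hne (h7 p' (.inr h))]
        simp
      · simp
    have hq2 : q.2 = 0 := by
      have := hF (Classical.arbitrary ι)
      simpa [F, hq1] using this
    exact Prod.ext (funext hq1) hq2
  have hfin : Finite (range comp) := inferInstance
  have := Fintype.ofFinite (range comp)
  have := LinearMap.finrank_le_finrank_of_injective hΛ
  rw [Module.finrank_prod, Module.finrank_fintype_fun_eq_card, Module.finrank_fintype_fun_eq_card,
    Module.finrank_self, Fintype.card_coe] at this
  rwa [← Nat.card_coe_set_eq, Nat.card_eq_fintype_card]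

lemma TurningLoop.frontier_subset (hL : TurningLoop κ c s γ G) {U : Set ℂ}
    (hU : U ∈ planarComponents (G ∪ range γ)ᶜ) : frontier U ⊆ range γ := by
  have hUo := planarComponents_isOpen hL.isOpen_compl hU
  have hUV := planarComponents_subset hU
  intro z hz
  rw [hUo.frontier_eq] at hz
  by_contra hzr
  by_cases hzG : z ∈ G
  · obtain ⟨x, hx, hxU⟩ := mem_closure_iff.1 hz.1 G hL.isOpen hzG
    exact hUV hxU (.inl hx)
  · have hzV : z ∈ (G ∪ range γ)ᶜ := fun h => h.elim hzG hzr
    obtain ⟨x, hx, hxU⟩ := mem_closure_iff.1 hz.1 _ hL.isOpen_compl.connectedComponentIn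
      (mem_connectedComponentIn hzV)
    have := planarComponents_eq hU ⟨z, hzV, rfl⟩ hxU hx
    exact hz.2 (this ▸ mem_connectedComponentIn hzV)

/-- Near a curve point the complement consists only of the sectors on the right of the adjacent
arcs, so a component accumulating there is one of the corresponding `comp i`. -/
lemma IsMate.frontier_cases (hL : TurningLoop κ c s γ G) (hA : ArcSystem s γ a b pred)
    {comp : ι → Set ℂ} (hC : IsRightComponents κ c s γ G a b comp) {mate : Equiv.Perm ι}
    (hM : IsMate s γ a mate) {U : Set ℂ} (hU : U ∈ planarComponents (G ∪ range γ)ᶜ) {z : ℂ}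
    (hz : z ∈ frontier U) :
    (∃ i, comp i = U ∧ γ (a i) = z) ∨ ∃ i, comp i = U ∧ ∃ t ∈ Ioo (a i) (b i), γ t = z := by
  have hUV := planarComponents_subset hU
  have hfr := mem_closure_iff_frequently.1 (frontier_subset_closure hz)
  rcases hA.vertex_or_arc hL (hL.frontier_subset hU hz) with ⟨i, rfl⟩ | ⟨i, t, ht, rfl⟩
  · left
    obtain ⟨x, hx, hx'⟩ := (hfr.and_eventually (hM.near hL hA hC i)).exists
    rcases hx' (hUV hx) with h | h
    · exact ⟨i, planarComponents_eq (hC i).1 hU h hx, rfl⟩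
    · exact ⟨mate i, planarComponents_eq (hC _).1 hU h hx, hM.gamma i⟩
  · right
    obtain ⟨x, hx, hx'⟩ := (hfr.and_eventually ((hC i).2 t ht).near).exists
    exact ⟨i, planarComponents_eq (hC i).1 hU (hx' (hUV hx)) hx, t, ht, rfl⟩

/-- A component that no arc borders would have no frontier points. It would contain the complement
of the finite vertex set, which is connected, and hence meet `G`. -/
lemma IsMate.range_comp (hL : TurningLoop κ c s γ G) (hA : ArcSystem s γ a b pred)
    {comp : ι → Set ℂ} (hC : IsRightComponents κ c s γ G a b comp) {mate : Equiv.Perm ι}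
    (hM : IsMate s γ a mate) : range comp = planarComponents (G ∪ range γ)ᶜ := by
  refine Subset.antisymm (by rintro _ ⟨i, rfl⟩; exact (hC i).1) fun U hU => ?_
  by_contra hno
  have hUV := planarComponents_subset hU
  have hUo := planarComponents_isOpen hL.isOpen_compl hU
  set F : Set ℂ := range fun i => γ (a i)
  have hF : IsConnected Fᶜ := (Set.finite_range _).countable.isConnected_compl_of_one_lt_rank
    (by rw [Complex.rank_real_complex]; exact Cardinal.one_lt_two)
  have hsub : Fᶜ ⊆ U := by
    refine hF.isPreconnected.subset_of_closure_inter_subset hUo ?_ ?_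
    · obtain ⟨z, hz⟩ := planarComponents_nonempty hU
      refine ⟨z, ?_, hz⟩
      rintro ⟨i, rfl⟩
      exact hUV hz (.inr ⟨_, rfl⟩)
    · rintro z ⟨hz, hzF⟩
      by_contra hzU
      have hfr : z ∈ frontier U := by rw [hUo.frontier_eq]; exact ⟨hz, hzU⟩
      rcases hM.frontier_cases hL hA hC hU hfr with ⟨i, hi, -⟩ | ⟨i, hi, -⟩ <;>
      exact hno ⟨i, hi⟩
  obtain ⟨z, hz⟩ := hL.isConnected.nonempty
  refine hUV (hsub ?_) (.inl hz)
  rintro ⟨i, rfl⟩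
  exact hL.notMem _ hz

lemma IsRightComponents.arc_subset_frontier (hL : TurningLoop κ c s γ G)
    (hA : ArcSystem s γ a b pred) {comp : ι → Set ℂ}
    (hC : IsRightComponents κ c s γ G a b comp) (i : ι) {t : ℝ} (ht : t ∈ Icc (a i) (b i)) :
    γ t ∈ frontier (comp i) := by
  rw [(planarComponents_isOpen hL.isOpen_compl (hC i).1).frontier_eq]
  refine ⟨?_, fun h => planarComponents_subset (hC i).1 h (.inr ⟨t, rfl⟩)⟩
  have h1 : MapsTo γ (Ioo (a i) (b i)) (closure (comp i)) := fun t ht =>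
    ((hC i).2 t ht).mem_closure
  have h2 := h1.closure hL.continuous
  rw [closure_Ioo (hA.lt i).ne, closure_closure] at h2
  exact h2 ht

/-- A bounded component has at least three vertices on its boundary. -/
lemma IsMate.three_le_vertices (hL : TurningLoop κ c s γ G) (hA : ArcSystem s γ a b pred)
    {comp : ι → Set ℂ} (hC : IsRightComponents κ c s γ G a b comp) {mate : Equiv.Perm ι}
    (hM : IsMate s γ a mate) {U : Set ℂ} (hU : U ∈ planarComponents (G ∪ range γ)ᶜ)
    (hb : Bornology.IsBounded U) : 3 ≤ ((fun i => γ (a i)) '' {i | comp i = U}).ncard := by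
  have hUo := planarComponents_isOpen hL.isOpen_compl hU
  set F : Set ℂ := (fun i => γ (a i)) '' {i | comp i = U} with hF
  have hFfin : F.Finite := (Set.toFinite _).image _
  have hKc : IsCompact (closure U) := Metric.isCompact_of_isClosed_isBounded isClosed_closure
    hb.closure
  obtain ⟨z₀, hz₀⟩ := planarComponents_nonempty hU
  have hfar : ∀ o : ℂ, ∃ f ∈ F, ∀ x ∈ U, ‖x - o‖ ≤ ‖f - o‖ := by
    intro o
    obtain ⟨z, hzc, hmax⟩ := hKc.exists_isMaxOn ⟨z₀, subset_closure hz₀⟩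
      (f := fun x => ‖x - o‖) (by fun_prop)
    refine ⟨z, ?_, fun x hx => hmax (subset_closure hx)⟩
    -- By the parallelogram law a farthest point is not the midpoint of two points of the closure.
    -- This excludes interior points and, because nearby points of the tangent line belong to the
    -- component, also interior points of arcs.
    have hmid : ∀ w : ℂ, w ≠ 0 → z + w ∈ closure U → z - w ∈ closure U → False := by
      intro w hw h1 h2
      have h3 : ‖z + w - o‖ ≤ ‖z - o‖ := hmax h1
      have h4 : ‖z - w - o‖ ≤ ‖z - o‖ := hmax h2
      have h5 := parallelogram_law_with_norm ℝ (z - o) w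
      rw [show z - o + w = z + w - o by ring, show z - o - w = z - w - o by ring] at h5
      have h6 := norm_pos_iff.2 hw
      have h7 := mul_self_le_mul_self (norm_nonneg _) h3
      have h8 := mul_self_le_mul_self (norm_nonneg _) h4
      nlinarith
    have hzU : z ∉ U := by
      intro hzU
      have hcont : ∀ᶠ ε : ℝ in 𝓝[>] 0, z + (ε : ℂ) ∈ U ∧ z - (ε : ℂ) ∈ U := by
        have c1 : ContinuousAt (fun ε : ℝ => z + (ε : ℂ)) 0 := by fun_prop
        have c2 : ContinuousAt (fun ε : ℝ => z - (ε : ℂ)) 0 := by fun_prop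
        exact mem_nhdsWithin_of_mem_nhds <|
          (c1.eventually (hUo.mem_nhds (by simpa))).and (c2.eventually (hUo.mem_nhds (by simpa)))
      obtain ⟨ε, ⟨h1, h2⟩, h3 : 0 < ε⟩ := (hcont.and self_mem_nhdsWithin).exists
      exact hmid ε (by exact_mod_cast h3.ne') (subset_closure h1) (subset_closure h2)
    have hfr : z ∈ frontier U := by rw [hUo.frontier_eq]; exact ⟨hzc, hzU⟩
    rcases hM.frontier_cases hL hA hC hU hfr with ⟨i, hi, hiz⟩ | ⟨i, hi, t, ht, rfl⟩
    · exact ⟨i, hi, hiz⟩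
    · exfalso
      obtain ⟨ε, ⟨h1, h2⟩, h3 : 0 < ε⟩ := (((hC i).2 t ht).tangent.and self_mem_nhdsWithin).exists
      rw [hi] at h1 h2
      exact hmid _ (mul_ne_zero (by exact_mod_cast h3.ne') (mul_ne_zero (hL.dir_ne_zero t)
        (by exact_mod_cast (hA.regular i t ht).1))) (subset_closure h1) (subset_closure h2)
  by_contra! hlt
  -- With at most two vertices, every circle through them encloses the component if its centre is
  -- equidistant from both. Centres far out on the perpendicular bisector squeeze the component into
  -- a line, which an open set cannot satisfy.
  obtain ⟨p, q, hFpq⟩ : ∃ p q : ℂ, F ⊆ {p, q} := by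
    interval_cases h : F.ncard
    · rw [Set.ncard_eq_zero hFfin] at h
      exact ⟨0, 0, by rw [h]; exact empty_subset _⟩
    · obtain ⟨p, hp⟩ := Set.ncard_eq_one.1 h
      exact ⟨p, p, by rw [hp]; simp⟩
    · obtain ⟨p, q, -, hpq⟩ := Set.ncard_eq_two.1 h
      exact ⟨p, q, hpq.le⟩
  have hfar' : ∀ o : ℂ, ∀ x ∈ U, ‖x - o‖ ≤ ‖p - o‖ ∨ ‖x - o‖ ≤ ‖q - o‖ := by
    intro o x hx
    obtain ⟨f, hf, hle⟩ := hfar o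
    rcases hFpq hf with rfl | rfl
    · exact .inl (hle x hx)
    · exact .inr (hle x hx)
  have hshift : ∀ d : ℂ, ∀ᶠ ε : ℝ in 𝓝[>] 0, z₀ + ε * d ∈ U := by
    intro d
    have c1 : ContinuousAt (fun ε : ℝ => z₀ + (ε : ℂ) * d) 0 := by fun_prop
    exact mem_nhdsWithin_of_mem_nhds (c1.eventually (hUo.mem_nhds (by simpa)))
  by_cases hpq : q = p
  · have hp : ∀ x ∈ U, x = p := fun x hx => by
      have := hfar' p x hx
      rw [hpq, or_self, sub_self, norm_zero, norm_le_zero_iff, sub_eq_zero] at this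
      exact this
    obtain ⟨ε, h1, h3 : 0 < ε⟩ := ((hshift 1).and self_mem_nhdsWithin).exists
    have e1 := hp _ h1
    rw [← hp _ hz₀] at e1
    have : (ε : ℂ) = 0 := by simpa using e1
    exact h3.ne' (by exact_mod_cast this)
  · have hn : q - p ≠ 0 := sub_ne_zero.2 hpq
    have hN : 0 < Complex.normSq (q - p) := Complex.normSq_pos.2 hn
    have hline : ∀ x ∈ U, ((x - p) / (q - p)).im = 0 := by
      intro x hx
      by_contra him
      set w := (x - p) / (q - p) with hw
      have hx' : x = p + w * (q - p) := by rw [hw, div_mul_cancel₀ _ hn]; ring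
      obtain ⟨μ, hμ, hμi, hμa⟩ := exists_sign him
      -- In the coordinate with `p = 0` and `q = 1` the centre is `1/2 - μTi`, on the side of the
      -- line away from `x`. This `T` makes the cross term in `(Im w + μT)²` equal to `2`, which
      -- exceeds the `1/4` contributed by `p` or `q`.
      set T : ℝ := 1 / |w.im| with hT
      have hwi := abs_pos.2 him
      have hTw : T * |w.im| = 1 := by rw [hT]; field_simp
      have key : ∀ f : ℝ, (f - 1 / 2) ^ 2 = 1 / 4 →
          ¬ ‖x - (p + (1 / 2 - μ * T * Complex.I) * (q - p))‖ ≤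
            ‖p + f * (q - p) - (p + (1 / 2 - μ * T * Complex.I) * (q - p))‖ := by
        intro f hf hle
        rw [hx', show p + w * (q - p) - (p + (1 / 2 - μ * T * Complex.I) * (q - p)) =
          (w - 1 / 2 + μ * T * Complex.I) * (q - p) by ring,
          show p + f * (q - p) - (p + (1 / 2 - μ * T * Complex.I) * (q - p)) =
          (f - 1 / 2 + μ * T * Complex.I) * (q - p) by ring, norm_mul, norm_mul,
          mul_le_mul_iff_left₀ (norm_pos_iff.2 hn)] at hle
        have h2 := mul_self_le_mul_self (norm_nonneg _) hle
        rw [← sq, ← sq, Complex.sq_norm, Complex.sq_norm, Complex.normSq_apply,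
          Complex.normSq_apply] at h2
        have hμ2 : μ * μ = 1 := by rcases hμ with rfl | rfl <;> norm_num
        simp at h2
        have h3 : w.im * (μ * T) = 1 := by
          rw [← hTw]; nth_rewrite 1 [← hμa]
          linear_combination (|w.im| * T) * hμ2
        nlinarith [sq_nonneg (w.re - 2⁻¹), sq_nonneg w.im]
      rcases hfar' (p + (1 / 2 - μ * T * Complex.I) * (q - p)) x hx with h | h
      · exact key 0 (by norm_num) (by simpa using h)
      · exact key 1 (by norm_num) (by simpa using h)
    obtain ⟨ε, h1, h3 : 0 < ε⟩ := ((hshift (Complex.I * (q - p))).and self_mem_nhdsWithin).exists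
    have e1 := hline _ h1
    have e2 := hline _ hz₀
    rw [show (z₀ + ε * (Complex.I * (q - p)) - p) / (q - p) = (z₀ - p) / (q - p) + ε * Complex.I by
      field_simp; ring, Complex.add_im, e2] at e1
    simp at e1
    exact h3.ne' e1

end

/-! ### Components as sides of their frontier, and the tangents at the corners. -/

lemma connectedComponentIn_eq_of_union {J A B : Set ℂ} (hA : IsOpen A) (hB : IsOpen B)
    (hAB : Disjoint A B) (hJ : Jᶜ = A ∪ B) (hAc : IsPreconnected A) {x : ℂ} (hx : x ∈ A) :
    connectedComponentIn Jᶜ x = A := by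
  have hxJ : x ∈ Jᶜ := hJ ▸ .inl hx
  refine Subset.antisymm ?_ (hAc.subset_connectedComponentIn hx (hJ ▸ subset_union_left))
  exact isPreconnected_connectedComponentIn.subset_left_of_subset_union hA hB hAB
    (hJ ▸ connectedComponentIn_subset _ _) ⟨x, mem_connectedComponentIn hxJ, hx⟩

lemma compl_frontier_eq {U : Set ℂ} (hU : IsOpen U) : (frontier U)ᶜ = U ∪ (closure U)ᶜ := by
  ext z
  have : z ∈ U → z ∈ closure U := fun h => subset_closure h
  simp only [hU.frontier_eq, mem_compl_iff, Set.mem_sdiff, mem_union]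
  tauto

/-- The complement of the frontier is the disjoint union of two open connected sets, `U` and the
complement of its closure. They are its components, and the second is unbounded because the plane
is. -/
lemma jordanInside_frontier_of_isBounded {U : Set ℂ} (hU : IsOpen U) (hUc : IsPreconnected U)
    (hc : IsPreconnected (closure U)ᶜ) (hb : Bornology.IsBounded U) :
    jordanInside (frontier U) = U := by
  have hd : Disjoint U (closure U)ᶜ := disjoint_compl_right.mono_left subset_closure
  have hJ := compl_frontier_eq hU
  ext z
  constructor
  · rintro ⟨hz, hzb⟩
    have hz' : z ∈ U ∪ (closure U)ᶜ := hJ ▸ hz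
    refine hz'.resolve_right fun hzc => ?_
    rw [connectedComponentIn_eq_of_union isClosed_closure.isOpen_compl hU hd.symm
      (hJ.trans (union_comm _ _)) hc hzc] at hzb
    have := hb.closure.union hzb
    rw [union_compl_self] at this
    exact NormedSpace.unbounded_univ ℝ ℂ this
  · intro hz
    refine ⟨fun h => (hU.frontier_eq ▸ h : z ∈ closure U \ U).2 hz, ?_⟩
    rw [connectedComponentIn_eq_of_union hU isClosed_closure.isOpen_compl hd hJ hUc hz]
    exact hb

lemma jordanInside_frontier_of_not_isBounded {U : Set ℂ} (hU : IsOpen U) (hUc : IsPreconnected U)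
    (hc : IsPreconnected (closure U)ᶜ) (hb : ¬ Bornology.IsBounded U)
    (hb' : Bornology.IsBounded (closure U)ᶜ) : jordanInside (frontier U) = (closure U)ᶜ := by
  have hd : Disjoint U (closure U)ᶜ := disjoint_compl_right.mono_left subset_closure
  have hJ := compl_frontier_eq hU
  ext z
  constructor
  · rintro ⟨hz, hzb⟩
    have hz' : z ∈ U ∪ (closure U)ᶜ := hJ ▸ hz
    refine hz'.resolve_left fun hzc => ?_
    rw [connectedComponentIn_eq_of_union hU isClosed_closure.isOpen_compl hd hJ hUc hzc] at hzb
    exact hb hzb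
  · intro hz
    refine ⟨fun h => hz (frontier_subset_closure h), ?_⟩
    rwa [connectedComponentIn_eq_of_union isClosed_closure.isOpen_compl hU hd.symm
      (hJ.trans (union_comm _ _)) hc hz]

section

variable {κ : ℝ} {c : ℂ} {s : ℝ → ℝ} {γ : ℝ → ℂ} {G : Set ℂ} {ι : Type} [Fintype ι] [DecidableEq ι]
  {a b : ι → ℝ} {pred : Equiv.Perm ι}

lemma ArcSystem.arc_mem_closure (hL : TurningLoop κ c s γ G) (hA : ArcSystem s γ a b pred) (i : ι)
    {t : ℝ} (ht : t ∈ Icc (a i) (b i)) : γ t ∈ closure G := by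
  have h1 : MapsTo γ (Ioo (a i) (b i)) (closure G) := fun t ht => by
    have hc : Tendsto (fun ε : ℝ => γ t + ε * (Complex.I * (turningDir κ c t * s t))) (𝓝[>] 0)
        (𝓝 (γ t)) := by
      refine tendsto_nhdsWithin_of_tendsto_nhds ?_
      have : ContinuousAt (fun ε : ℝ => γ t + ε * (Complex.I * (turningDir κ c t * s t))) 0 := by
        fun_prop
      simpa [ContinuousAt] using this
    exact mem_closure_of_tendsto hc (hL.left t (hA.regular i t ht).1)
  have h2 := h1.closure hL.continuous
  rw [closure_Ioo (hA.lt i).ne, closure_closure] at h2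
  exact h2 ht

lemma ArcSystem.range_subset_closure (hL : TurningLoop κ c s γ G) (hA : ArcSystem s γ a b pred) :
    range γ ⊆ closure G := by
  rintro _ ⟨t, rfl⟩
  obtain ⟨i, t', ht', hE⟩ := hA.cover t
  rw [← hL.periodic _ _ hE]
  exact hA.arc_mem_closure hL i ⟨ht'.1, ht'.2.le⟩

/-- Everything off the closure of `U` is joined to the connected set `G`: curve points are in the
closure of `G`, and any other component is linked to `G` through an interior point of one of its
arcs, which is not in the closure of `U`. -/
lemma IsMate.isPreconnected_compl_closure (hL : TurningLoop κ c s γ G)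
    (hA : ArcSystem s γ a b pred) {comp : ι → Set ℂ}
    (hC : IsRightComponents κ c s γ G a b comp) {mate : Equiv.Perm ι} (hM : IsMate s γ a mate)
    {U : Set ℂ} (hU : U ∈ planarComponents (G ∪ range γ)ᶜ) : IsPreconnected (closure U)ᶜ := by
  have hUV := planarComponents_subset hU
  have hGU : G ⊆ (closure U)ᶜ := by
    intro z hz hzU
    obtain ⟨x, hx, hxU⟩ := mem_closure_iff.1 hzU G hL.isOpen hz
    exact hUV hxU (.inl hx)
  obtain ⟨g, hg⟩ := hL.isConnected.nonempty
  have hGc := hL.isConnected.isPreconnected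
  refine isPreconnected_of_forall g fun x hx => ?_
  by_cases hxV : x ∈ (G ∪ range γ)ᶜ
  · set U' := connectedComponentIn (G ∪ range γ)ᶜ x
    have hU' : U' ∈ planarComponents (G ∪ range γ)ᶜ := ⟨x, hxV, rfl⟩
    have hxU' : x ∈ U' := mem_connectedComponentIn hxV
    have hne : U' ≠ U := by
      rintro h; exact hx (subset_closure (h ▸ hxU'))
    obtain ⟨i, hi⟩ : U' ∈ range comp := by rw [hM.range_comp hL hA hC]; exact hU'
    obtain ⟨t, ht⟩ := exists_between (hA.lt i)
    have ht' : t ∈ Ioo (a i) (b i) := ht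
    have hy := (hC i).2 t ht'
    rw [hi] at hy
    have hyU : γ t ∈ (closure U)ᶜ := by
      intro h
      obtain ⟨z, hz, hz'⟩ := ((mem_closure_iff_frequently.1 h).and_eventually hy.near).exists
      exact hne (planarComponents_eq hU' hU (hz' (hUV hz)) hz)
    have h1 : IsPreconnected (insert (γ t) U') :=
      (planarComponents_isPreconnected hU').subset_closure (subset_insert _ _)
        (insert_subset hy.mem_closure subset_closure)
    have h2 : IsPreconnected (insert (γ t) G) := hGc.subset_closure (subset_insert _ _)
      (insert_subset (hA.range_subset_closure hL ⟨t, rfl⟩) subset_closure)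
    refine ⟨insert (γ t) U' ∪ insert (γ t) G, ?_, .inr (.inr hg), .inl (.inr hxU'),
      h1.union (γ t) (mem_insert _ _) (mem_insert _ _) h2⟩
    refine union_subset (insert_subset hyU fun z hz hzU => ?_) (insert_subset hyU hGU)
    obtain ⟨w, hw, hwU⟩ := mem_closure_iff.1 hzU U' (planarComponents_isOpen hL.isOpen_compl hU') hz
    exact hne (planarComponents_eq hU' hU hw hwU)
  · rw [mem_compl_iff, not_not] at hxV
    have hxc : x ∈ closure G := hxV.elim (fun h => subset_closure h)
      fun h => hA.range_subset_closure hL h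
    exact ⟨insert x G, insert_subset hx hGU, .inr hg, mem_insert _ _,
      hGc.subset_closure (subset_insert _ _) (insert_subset hxc subset_closure)⟩

/-- The sign of the speed on the `i`-th arc. -/
def IsArcSign (s : ℝ → ℝ) {ι : Type} (a b : ι → ℝ) (sg : ι → ℝ) : Prop :=
  ∀ i, (sg i = 1 ∨ sg i = -1) ∧ ∀ t ∈ Ioo (a i) (b i), 0 < sg i * s t

lemma TurningLoop.exists_arcSign (hL : TurningLoop κ c s γ G) (hA : ArcSystem s γ a b pred) :
    ∃ sg : ι → ℝ, IsArcSign s a b sg := by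
  have : ∀ i, ∃ μ : ℝ, (μ = 1 ∨ μ = -1) ∧ ∀ t ∈ Ioo (a i) (b i), 0 < μ * s t := by
    intro i
    have hsc := hL.smooth.continuous
    obtain ⟨m, hm⟩ := exists_between (hA.lt i)
    obtain ⟨μ, hμ, hμs, -⟩ := exists_sign (hA.regular i m hm).1
    refine ⟨μ, hμ, fun t ht => ?_⟩
    by_contra! hle
    have hcont : ContinuousOn (fun t => μ * s t) (Ioo (a i) (b i)) := by fun_prop
    obtain ⟨x, hx, hx0⟩ := isPreconnected_Ioo.intermediate_value ht hm hcont ⟨hle, hμs.le⟩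
    have := (hA.regular i x hx).1
    rcases hμ with rfl | rfl <;> simp at hx0 <;> exact this hx0
  choose sg h using this
  exact ⟨sg, h⟩

/-- The direction and the signed speed need not be `2π`-periodic separately, for instance when `κ`
is a half-integer; both may change sign. Their product is the derivative of a periodic curve. -/
lemma TurningLoop.velocity_periodic (hL : TurningLoop κ c s γ G) {t t' : ℝ}
    (h : circlePoint t = circlePoint t') :
    turningDir κ c t * s t = turningDir κ c t' * s t' := by
  obtain ⟨n, rfl⟩ := circlePoint_eq_iff.1 h
  have h1 := (hL.hasDerivAt (t' + n * (2 * Real.pi))).comp_add_const t' (n * (2 * Real.pi))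
  have h2 : (fun x => γ (x + n * (2 * Real.pi))) = γ := by
    ext x
    exact hL.periodic _ _ (circlePoint_eq_iff.2 ⟨n, rfl⟩)
  rw [h2] at h1
  exact h1.unique (hL.hasDerivAt t')

lemma turningDir_add (κ : ℝ) (c : ℂ) (t u : ℝ) :
    turningDir κ c (t + u) = turningDir κ c t * circlePoint (κ * u) := by
  rw [turningDir, turningDir, mul_add, circlePoint_add, mul_assoc]

lemma TurningLoop.sign_dir_eq (hL : TurningLoop κ c s γ G) {μ ν x y t t' : ℝ}
    (hμ : μ = 1 ∨ μ = -1) (hν : ν = 1 ∨ ν = -1) (hx : 0 < μ * x) (hy : 0 < ν * y)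
    (h : turningDir κ c t * x = turningDir κ c t' * y) :
    (μ : ℂ) * turningDir κ c t = ν * turningDir κ c t' := by
  have hμ2 : (μ : ℂ) * μ = 1 := by rcases hμ with rfl | rfl <;> norm_num
  have hν2 : (ν : ℂ) * ν = 1 := by rcases hν with rfl | rfl <;> norm_num
  have hn := congrArg norm h
  rw [norm_mul, norm_mul, hL.norm_dir, hL.norm_dir, one_mul, one_mul, Complex.norm_real,
    Complex.norm_real, Real.norm_eq_abs, Real.norm_eq_abs] at hn
  have hx' : |x| = μ * x := by
    rcases hμ with rfl | rfl
    · rw [abs_of_pos] <;> linarith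
    · rw [abs_of_neg] <;> linarith
  have hy' : |y| = ν * y := by
    rcases hν with rfl | rfl
    · rw [abs_of_pos] <;> linarith
    · rw [abs_of_neg] <;> linarith
  rw [hx', hy'] at hn
  have hn' : (μ : ℂ) * x = ν * y := by exact_mod_cast hn
  have hne : (ν : ℂ) * y ≠ 0 := by exact_mod_cast hy.ne'
  refine mul_right_cancel₀ hne ?_
  linear_combination h - turningDir κ c t * μ * hn' + turningDir κ c t * x * hμ2 -
    turningDir κ c t' * y * hν2

/-- At each corner the incoming and outgoing tangents are opposite, and the backward continuation
of the outgoing tangent leads into `G` or into the component on the other side of the corner. -/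
lemma IsMate.corner_dir (hL : TurningLoop κ c s γ G) (hA : ArcSystem s γ a b pred)
    {comp : ι → Set ℂ} (hC : IsRightComponents κ c s γ G a b comp) {mate : Equiv.Perm ι}
    (hM : IsMate s γ a mate) {sg : ι → ℝ} (hsg : IsArcSign s a b sg) (v : ι) :
    (sg (pred (mate v)) : ℂ) * turningDir κ c (b (pred (mate v))) =
      -(sg v * turningDir κ c (a v)) ∧
    ∀ᶠ ε : ℝ in 𝓝[>] 0, γ (a v) - ε * (sg v * turningDir κ c (a v)) ∈ G ∨
      (mate v ≠ v ∧ γ (a v) - ε * (sg v * turningDir κ c (a v)) ∈ comp (mate v)) := by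
  have hneg : ∀ {x : ℝ}, x = 1 ∨ x = -1 → -x = 1 ∨ -x = -1 := by
    rintro x (rfl | rfl) <;> simp
  by_cases h : mate v = v
  · rw [h]
    obtain ⟨-, -, μ, hμ, ⟨δ, hδ, hsign⟩, hray⟩ := hL.cusp_corner hA hC ((hM.eq_iff v).1 h)
    obtain ⟨u, hu0, hu⟩ := exists_between (lt_min hδ (lt_min (sub_pos.2 (hA.lt v))
      (sub_pos.2 (hA.lt (pred v)))))
    simp only [lt_min_iff] at hu
    have hs := hsign u ⟨hu0, hu.1⟩
    have hμv : μ = sg v := exists_sign_unique hμ (hsg v).1 hs.1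
      ((hsg v).2 _ ⟨by linarith, by linarith⟩)
    rw [← hμv]
    refine ⟨?_, hray.mono fun _ h => .inl h⟩
    -- At the cusp itself the velocity vanishes, so the directions are compared at a time `u`
    -- earlier; the common rotation by `-κu` then cancels.
    have hvel : turningDir κ c (b (pred v) - u) * s (b (pred v) - u) =
        turningDir κ c (a v - u) * s (a v - u) := by
      apply hL.velocity_periodic
      rw [sub_eq_add_neg, sub_eq_add_neg, circlePoint_add, circlePoint_add, hA.end_pred]
    have := hL.sign_dir_eq (hsg (pred v)).1 (hneg hμ) ((hsg (pred v)).2 _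
      ⟨by linarith, by linarith⟩) (by linarith) hvel
    rw [sub_eq_add_neg, sub_eq_add_neg, turningDir_add, turningDir_add] at this
    refine mul_right_cancel₀ (norm_pos_iff.1 ?_ : circlePoint (κ * -u) ≠ 0) ?_
    · rw [norm_circlePoint]; exact one_pos
    · push_cast at this
      linear_combination this
  · obtain ⟨-, -, e, hev, hew, hray⟩ := hL.double_corner hA hC (Ne.symm h) (hM.gamma v).symm
    set w := mate v
    have hne : circlePoint (a v) ≠ circlePoint (a w) := fun h' =>
      h (hA.circlePoint_injective h').symm
    obtain ⟨hsv, hsw, -⟩ := hL.opposite _ _ (hM.gamma v).symm hne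
    have hvb : turningDir κ c (b (pred w)) * s (b (pred w)) = turningDir κ c (a w) * s (a w) :=
      hL.velocity_periodic (hA.end_pred w)
    have hsb : s (b (pred w)) ≠ 0 := by
      intro h0
      rw [h0, Complex.ofReal_zero, mul_zero] at hvb
      exact mul_ne_zero (hL.dir_ne_zero _) (by exact_mod_cast hsw) hvb.symm
    -- At a double point the speed does not vanish, so its sign on the open arc persists at the
    -- endpoint.
    have hcl : ∀ i, ∀ t ∈ Icc (a i) (b i), s t ≠ 0 → 0 < sg i * s t := by
      intro i t ht h0
      have hsc := hL.smooth.continuous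
      have h1 : MapsTo (fun t => sg i * s t) (Ioo (a i) (b i)) (Ici 0) := fun t ht =>
        ((hsg i).2 t ht).le
      have h2 := h1.closure (by fun_prop)
      rw [closure_Ioo (hA.lt i).ne, closure_Ici] at h2
      refine (h2 ht : 0 ≤ sg i * s t).lt_of_ne' (mul_ne_zero ?_ h0)
      rcases (hsg i).1 with h | h <;> rw [h] <;> norm_num
    have hpos : ∀ {i t} {e' : ℂ}, t ∈ Icc (a i) (b i) → s t ≠ 0 →
        turningDir κ c t * s t = |s t| * e' → (sg i : ℂ) * turningDir κ c t = e' := by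
      intro i t e' ht h0 he'
      have h3 := hcl i t ht h0
      have habs : |s t| = sg i * s t := by
        rcases (hsg i).1 with h | h <;> rw [h] at h3 ⊢
        · rw [abs_of_pos] <;> linarith
        · rw [abs_of_neg] <;> linarith
      have hsg2 : (sg i : ℂ) * sg i = 1 := by rcases (hsg i).1 with h | h <;> rw [h] <;> norm_num
      rw [habs] at he'
      push_cast at he'
      refine mul_right_cancel₀ (by exact_mod_cast h0 : (s t : ℂ) ≠ 0) ?_
      linear_combination sg i * he' + s t * e' * hsg2
    have e1 := hpos (i := v) ⟨le_rfl, (hA.lt v).le⟩ hsv hev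
    have habs : |s (b (pred w))| = |s (a w)| := by
      have := congrArg norm hvb
      rwa [norm_mul, norm_mul, hL.norm_dir, hL.norm_dir, one_mul, one_mul, Complex.norm_real,
        Complex.norm_real] at this
    have e2 := hpos (i := pred w) (e' := -e) ⟨(hA.lt _).le, le_rfl⟩ hsb
      (by rw [hvb, habs]; exact hew)
    rw [e1]
    exact ⟨e2, hray.mono fun ε hε => .inr ⟨h, hε⟩⟩

end

/-! ### Closed curves made of arcs -/

/-- The curve that runs on `[k, k + 1]` through the arc of `γ` from `α k` to `α k + ℓ k`. -/
noncomputable def gluedCurve (γ : ℝ → ℂ) (α ℓ : ℤ → ℝ) (x : ℝ) : ℂ :=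
  γ (α ⌊x⌋ + Int.fract x * ℓ ⌊x⌋)

/-- Consecutive arcs fit together at corners where the tangent reverses its direction. -/
structure IsCornerChain (κ : ℝ) (c : ℂ) (s : ℝ → ℝ) (γ : ℝ → ℂ) (α ℓ ρ : ℤ → ℝ) : Prop where
  sign : ∀ k, (ρ k = 1 ∨ ρ k = -1) ∧ ∀ x ∈ Ioo (0 : ℝ) 1, 0 < ρ k * (ℓ k * s (α k + x * ℓ k))
  joint : ∀ k, γ (α k + ℓ k) = γ (α (k + 1))
  corner : ∀ k, (ρ k : ℂ) * turningDir κ c (α k + ℓ k) = -(ρ (k + 1) * turningDir κ c (α (k + 1)))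

section

variable {κ : ℝ} {c : ℂ} {s : ℝ → ℝ} {γ : ℝ → ℂ} {G : Set ℂ} {α ℓ ρ : ℤ → ℝ}

lemma contDiff_turningDir (κ : ℝ) (c : ℂ) : ContDiff ℝ (⊤ : ℕ∞) (turningDir κ c) := by
  unfold turningDir circlePoint
  have : ContDiff ℝ (⊤ : ℕ∞) fun t : ℝ => ((κ * t : ℝ) : ℂ) :=
    Complex.ofRealCLM.contDiff.comp (contDiff_const.mul contDiff_id)
  fun_prop

lemma hasDerivAt_turningDir (κ : ℝ) (c : ℂ) (t : ℝ) :
    HasDerivAt (turningDir κ c) (Complex.I * κ * turningDir κ c t) t := by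
  have h1 : HasDerivAt (fun t : ℝ => ((κ * t : ℝ) : ℂ) * Complex.I) (κ * Complex.I) t := by
    have := (((hasDerivAt_id t).const_mul κ).ofReal_comp).mul_const Complex.I
    simpa using this
  refine (h1.cexp.const_mul c).congr_deriv ?_
  rw [turningDir, circlePoint]
  ring

lemma TurningLoop.contDiff (hL : TurningLoop κ c s γ G) : ContDiff ℝ (⊤ : ℕ∞) γ := by
  rw [contDiff_infty_iff_deriv]
  refine ⟨fun t => (hL.hasDerivAt t).differentiableAt, ?_⟩
  have : deriv γ = fun t => turningDir κ c t * s t := funext fun t => (hL.hasDerivAt t).deriv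
  rw [this]
  exact (contDiff_turningDir κ c).mul (Complex.ofRealCLM.contDiff.comp hL.smooth)

lemma norm_circlePoint_sub_le (x y : ℝ) : ‖circlePoint x - circlePoint y‖ ≤ |x - y| := by
  have h : circlePoint x - circlePoint y = circlePoint y * (Complex.exp (Complex.I * (x - y : ℝ)) - 1) := by
    rw [show x = y + (x - y) by ring, circlePoint_add, circlePoint, circlePoint]
    push_cast
    rw [mul_comm Complex.I]
    ring_nf
  rw [h, norm_mul, norm_circlePoint, one_mul]
  simpa using Real.norm_exp_I_mul_ofReal_sub_one_le (x := x - y)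

namespace IsCornerChain

lemma glued_eq (hQ : IsCornerChain κ c s γ α ℓ ρ) {k : ℤ} {x : ℝ} (hx : x ∈ Icc (k : ℝ) (k + 1)) :
    gluedCurve γ α ℓ x = γ (α k + (x - k) * ℓ k) := by
  rcases hx.2.lt_or_eq with h | h
  · have : ⌊x⌋ = k := Int.floor_eq_iff.2 ⟨hx.1, h⟩
    rw [gluedCurve, Int.fract, this]
  · have : ⌊x⌋ = k + 1 := by rw [h]; exact_mod_cast Int.floor_intCast (k + 1)
    rw [gluedCurve, Int.fract, this, h]
    push_cast
    simp [hQ.joint]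

lemma continuous (hL : TurningLoop κ c s γ G) (hQ : IsCornerChain κ c s γ α ℓ ρ) :
    Continuous (gluedCurve γ α ℓ) := by
  have hc : ∀ k : ℤ, ContinuousOn (gluedCurve γ α ℓ) (Icc (k : ℝ) (k + 1)) := by
    intro k
    have h1 : Continuous fun x : ℝ => γ (α k + (x - k) * ℓ k) := hL.continuous.comp (by fun_prop)
    exact h1.continuousOn.congr fun x hx => hQ.glued_eq hx
  rw [continuous_iff_continuousAt]
  intro x
  have h1 := Int.floor_le x
  have h2 := Int.lt_floor_add_one x
  rcases h1.eq_or_lt with h | h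
  · rw [continuousAt_iff_continuous_left_right]
    constructor
    · have := hc (⌊x⌋ - 1) x ⟨by push_cast; linarith, by push_cast; linarith⟩
      refine this.mono_of_mem_nhdsWithin (Icc_mem_nhdsLE_of_mem ⟨?_, ?_⟩) <;> push_cast <;> linarith
    · exact (hc ⌊x⌋ x ⟨h1, h2.le⟩).mono_of_mem_nhdsWithin (Icc_mem_nhdsGE_of_mem ⟨h1, h2⟩)
  · exact (hc ⌊x⌋ x ⟨h1, h2.le⟩).continuousAt (Icc_mem_nhds h h2)

lemma hasDerivAt (hL : TurningLoop κ c s γ G) (hQ : IsCornerChain κ c s γ α ℓ ρ) {k : ℤ} {x : ℝ}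
    (hx : x ∈ Ioo (k : ℝ) (k + 1)) : HasDerivAt (gluedCurve γ α ℓ)
      (ℓ k * (turningDir κ c (α k + (x - k) * ℓ k) * s (α k + (x - k) * ℓ k))) x := by
  have h1 : HasDerivAt (fun x : ℝ => α k + (x - k) * ℓ k) (ℓ k) x := by
    simpa using (((hasDerivAt_id x).sub_const (k : ℝ)).mul_const (ℓ k)).const_add (α k)
  have h2 := (hL.hasDerivAt (α k + (x - k) * ℓ k)).scomp x h1
  rw [Complex.real_smul] at h2
  refine h2.congr_of_eventuallyEq ?_
  filter_upwards [isOpen_Ioo.mem_nhds hx] with y hy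
  exact hQ.glued_eq (Ioo_subset_Icc_self hy)

lemma deriv_eventuallyEq (hL : TurningLoop κ c s γ G) (hQ : IsCornerChain κ c s γ α ℓ ρ) {k : ℤ}
    {x : ℝ} (hx : x ∈ Ioo (k : ℝ) (k + 1)) : deriv (gluedCurve γ α ℓ) =ᶠ[𝓝 x] fun x =>
      ℓ k * (turningDir κ c (α k + (x - k) * ℓ k) * s (α k + (x - k) * ℓ k)) := by
  filter_upwards [isOpen_Ioo.mem_nhds hx] with y hy
  exact (hQ.hasDerivAt hL hy).deriv

lemma sign_pos (hQ : IsCornerChain κ c s γ α ℓ ρ) {k : ℤ} {x : ℝ}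
    (hx : x ∈ Ioo (k : ℝ) (k + 1)) : 0 < ρ k * (ℓ k * s (α k + (x - k) * ℓ k)) :=
  (hQ.sign k).2 _ ⟨by linarith [hx.1], by linarith [hx.2]⟩

lemma unitTangent_eq (hL : TurningLoop κ c s γ G) (hQ : IsCornerChain κ c s γ α ℓ ρ) {k : ℤ} {x : ℝ}
    (hx : x ∈ Ioo (k : ℝ) (k + 1)) :
    unitTangent (gluedCurve γ α ℓ) x = ρ k * turningDir κ c (α k + (x - k) * ℓ k) := by
  have h := hQ.sign_pos hx
  rw [unitTangent, (hQ.hasDerivAt hL hx).deriv, norm_mul, norm_mul, hL.norm_dir, one_mul,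
    Complex.norm_real, Complex.norm_real, ← norm_mul, Real.norm_eq_abs]
  set t := α k + (x - k) * ℓ k
  have habs : |ℓ k * s t| = ρ k * (ℓ k * s t) := by
    rcases (hQ.sign k).1 with h' | h' <;> rw [h'] at h ⊢
    · rw [abs_of_pos] <;> linarith
    · rw [abs_of_neg] <;> linarith
  have hr : (ρ k : ℂ) * ρ k = 1 := by rcases (hQ.sign k).1 with h | h <;> rw [h] <;> norm_num
  rw [habs, div_eq_iff (by exact_mod_cast h.ne')]
  push_cast
  linear_combination -(ℓ k * s t * turningDir κ c t : ℂ) * hr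

lemma tendsto_left (hL : TurningLoop κ c s γ G) (hQ : IsCornerChain κ c s γ α ℓ ρ) (k : ℤ) :
    Tendsto (unitTangent (gluedCurve γ α ℓ)) (𝓝[<] (k : ℝ))
      (𝓝 (-(ρ k * turningDir κ c (α k)))) := by
  have h1 : Continuous fun x : ℝ => (ρ (k - 1) : ℂ) * turningDir κ c (α (k - 1) +
      (x - (k - 1 : ℤ)) * ℓ (k - 1)) :=
    continuous_const.mul ((contDiff_turningDir κ c).continuous.comp (by fun_prop))
  have h2 := (h1.tendsto (k : ℝ)).mono_left (nhdsWithin_le_nhds (s := Iio (k : ℝ)))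
  have h3 := hQ.corner (k - 1)
  rw [sub_add_cancel] at h3
  rw [show (k : ℝ) - ((k - 1 : ℤ) : ℝ) = 1 by push_cast; ring, one_mul, h3] at h2
  refine h2.congr' ?_
  have : Ioo ((k : ℝ) - 1) k ∈ 𝓝[<] (k : ℝ) := Ioo_mem_nhdsLT (by linarith)
  filter_upwards [this] with x hx
  exact (hQ.unitTangent_eq hL (k := k - 1) (by push_cast; simpa using hx)).symm

lemma tendsto_right (hL : TurningLoop κ c s γ G) (hQ : IsCornerChain κ c s γ α ℓ ρ) (k : ℤ) :
    Tendsto (unitTangent (gluedCurve γ α ℓ)) (𝓝[>] (k : ℝ))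
      (𝓝 (ρ k * turningDir κ c (α k))) := by
  have h1 : Continuous fun x : ℝ => (ρ k : ℂ) * turningDir κ c (α k + (x - k) * ℓ k) :=
    continuous_const.mul ((contDiff_turningDir κ c).continuous.comp (by fun_prop))
  have h2 := (h1.tendsto (k : ℝ)).mono_left (nhdsWithin_le_nhds (s := Ioi (k : ℝ)))
  rw [sub_self, zero_mul, add_zero] at h2
  refine h2.congr' ?_
  filter_upwards [Ioo_mem_nhdsGT (show (k : ℝ) < k + 1 by linarith)] with x hx
  exact (hQ.unitTangent_eq hL hx).symm

/-- Only the rotation of the direction contributes, with rate `κ ℓ k`; the change of speed is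
tangential. Since `κ > 0`, arcs run forward turn left and arcs run backward turn right. -/
lemma signedCurvature_eq (hL : TurningLoop κ c s γ G) (hQ : IsCornerChain κ c s γ α ℓ ρ) {k : ℤ}
    {x : ℝ} (hx : x ∈ Ioo (k : ℝ) (k + 1)) : ∃ m > 0,
    signedCurvature (gluedCurve γ α ℓ) x = ℓ k * m := by
  have hκ := hL.kappa_pos
  have hpos := hQ.sign_pos hx
  rw [signedCurvature, (hQ.hasDerivAt hL hx).deriv, (hQ.deriv_eventuallyEq hL hx).deriv_eq]
  have h1 : HasDerivAt (fun x : ℝ => α k + (x - k) * ℓ k) (ℓ k) x := by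
    simpa using (((hasDerivAt_id x).sub_const (k : ℝ)).mul_const (ℓ k)).const_add (α k)
  have h2 := (hasDerivAt_turningDir κ c (α k + (x - k) * ℓ k)).scomp x h1
  have hs := ((hL.smooth.differentiable (by simp)) (α k + (x - k) * ℓ k)).hasDerivAt
  have h3 := (hs.comp x h1).ofReal_comp
  have h4 := (h2.mul h3).const_mul (ℓ k : ℂ)
  simp only [Pi.mul_def, Function.comp_apply, Complex.real_smul] at h4
  rw [h4.deriv]
  set t := α k + (x - k) * ℓ k
  set D := turningDir κ c t with hD
  have hDD : (starRingEnd ℂ) D * D = 1 := by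
    rw [mul_comm, Complex.mul_conj, Complex.normSq_eq_norm_sq, hL.norm_dir]; norm_num
  have hne : ℓ k * s t ≠ 0 := fun h => by rw [h, mul_zero] at hpos; exact lt_irrefl _ hpos
  have e1 : (starRingEnd ℂ) (ℓ k * (D * s t)) * (ℓ k * (ℓ k * (Complex.I * κ * D) * s t +
      D * ((deriv s t * ℓ k : ℝ) : ℂ))) =
      ((ℓ k * (ℓ k * ℓ k * (s t * s t) * κ) : ℝ) : ℂ) * Complex.I +
        ((ℓ k * ℓ k * ℓ k * s t * deriv s t : ℝ) : ℂ) := by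
    simp only [map_mul, Complex.conj_ofReal]
    push_cast
    linear_combination (ℓ k * ℓ k * s t * ℓ k * (Complex.I * κ * s t + deriv s t) : ℂ) * hDD
  rw [e1]
  refine ⟨(ℓ k * ℓ k * (s t * s t) * κ) / ‖(ℓ k : ℂ) * (D * s t)‖ ^ 3, ?_, ?_⟩
  · have h5 : 0 < ℓ k * ℓ k * (s t * s t) := by
      have := mul_self_pos.2 hne
      nlinarith
    have h6 : (ℓ k : ℂ) * (D * s t) ≠ 0 := by
      have := hL.dir_ne_zero t
      have h7 : (ℓ k : ℂ) * s t ≠ 0 := by exact_mod_cast hne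
      have := mul_ne_zero this h7
      rwa [mul_left_comm] at this
    have := norm_pos_iff.2 h6
    positivity
  · simp only [Complex.add_im, Complex.mul_im, Complex.ofReal_re, Complex.ofReal_im, Complex.I_re,
      Complex.I_im]
    ring

lemma contDiffOn (hL : TurningLoop κ c s γ G) (hQ : IsCornerChain κ c s γ α ℓ ρ) (k : ℤ) :
    ContDiffOn ℝ (⊤ : ℕ∞) (gluedCurve γ α ℓ) (Ioo (k : ℝ) (k + 1)) := by
  have h1 : ContDiff ℝ (⊤ : ℕ∞) fun x : ℝ => γ (α k + (x - k) * ℓ k) :=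
    hL.contDiff.comp (by fun_prop)
  exact h1.contDiffOn.congr fun x hx => hQ.glued_eq (Ioo_subset_Icc_self hx)

/-- The unit tangent moves on the circle with constant rate `κ |ℓ k|` over a parameter interval of
length one. -/
lemma eVariationOn_le (hL : TurningLoop κ c s γ G) (hQ : IsCornerChain κ c s γ α ℓ ρ) (k : ℤ) :
    eVariationOn (unitTangent (gluedCurve γ α ℓ)) (Ioo (k : ℝ) (k + 1)) ≤
      ENNReal.ofReal (κ * |ℓ k|) := by
  have hκ := hL.kappa_pos
  set f : ℝ → ℂ := fun x => ρ k * turningDir κ c (α k + (x - k) * ℓ k)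
  have h1 : eVariationOn (unitTangent (gluedCurve γ α ℓ)) (Ioo (k : ℝ) (k + 1)) =
      eVariationOn f (Ioo (k : ℝ) (k + 1)) := eVariationOn.congr fun x hx => hQ.unitTangent_eq hL hx
  rw [h1]
  refine (eVariationOn.mono f Ioo_subset_Icc_self).trans ?_
  have hlip : LipschitzOnWith (κ * |ℓ k|).toNNReal f univ := by
    refine LipschitzOnWith.of_dist_le_mul fun x _ y _ => ?_
    rw [Real.coe_toNNReal _ (by positivity), Complex.dist_eq, Real.dist_eq]
    simp only [f, turningDir]
    rw [← mul_sub, ← mul_sub, norm_mul, norm_mul, hL.norm_c, Complex.norm_real, one_mul]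
    have hr : ‖ρ k‖ = 1 := by rcases (hQ.sign k).1 with h | h <;> rw [h] <;> norm_num
    rw [hr, one_mul]
    refine (norm_circlePoint_sub_le _ _).trans (le_of_eq ?_)
    rw [show κ * (α k + (x - k) * ℓ k) - κ * (α k + (y - k) * ℓ k) = κ * ℓ k * (x - y) by ring,
      abs_mul, abs_mul, abs_of_pos hκ]
  have h2 := hlip.comp_eVariationOn_le (g := fun x : ℝ => x) (s := Icc (k : ℝ) (k + 1))
    (mapsTo_univ _ _)
  refine h2.trans ?_
  have h3 : eVariationOn (fun x : ℝ => x) (Icc (k : ℝ) (k + 1) ) ≤ ENNReal.ofReal 1 := by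
    have := (monotoneOn_id (s := Icc (k : ℝ) (k + 1))).eVariationOn_eq
      (left_mem_Icc.2 (by linarith)) (right_mem_Icc.2 (by linarith))
    rw [inter_self, id, id, add_sub_cancel_left] at this
    exact this.le
  calc _ ≤ _ := mul_le_mul' le_rfl h3
    _ = _ := by rw [ENNReal.ofReal_one, mul_one]; rfl

lemma isCuspedParametrization (hL : TurningLoop κ c s γ G) (hQ : IsCornerChain κ c s γ α ℓ ρ)
    {n : ℕ} {J : Set ℂ} (hα : ∀ k, α (k + n) = α k) (hℓ : ∀ k, ℓ (k + n) = ℓ k)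
    (hinj : InjOn (gluedCurve γ α ℓ) (Ico 0 (n : ℝ))) (hJ : range (gluedCurve γ α ℓ) = J)
    (hccw : ∀ k, ∀ x ∈ Ioo (0 : ℝ) 1, ∀ᶠ ε : ℝ in 𝓝[>] 0, γ (α k + x * ℓ k) + ε * (Complex.I *
      (ℓ k * (turningDir κ c (α k + x * ℓ k) * s (α k + x * ℓ k)))) ∈ jordanInside J) :
    IsCuspedParametrization n (gluedCurve γ α ℓ) J := by
  have hfl : ∀ t : ℝ, t ∉ range ((↑) : ℤ → ℝ) → t ∈ Ioo (⌊t⌋ : ℝ) (⌊t⌋ + 1) := fun t ht =>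
    ⟨(Int.floor_le t).lt_of_ne fun h => ht ⟨_, h⟩, Int.lt_floor_add_one t⟩
  refine ⟨hQ.continuous hL, ?_, hinj, hJ, hQ.contDiffOn hL, ?_, ?_, ?_⟩
  · intro x
    have h1 : ⌊x + n⌋ = ⌊x⌋ + n := by exact_mod_cast Int.floor_add_natCast x n
    rw [gluedCurve, gluedCurve, Int.fract_add_natCast, h1, hα, hℓ]
  · intro t ht
    rw [(hQ.hasDerivAt hL (hfl t ht)).deriv]
    have hpos := hQ.sign_pos (hfl t ht)
    have h7 : (ℓ ⌊t⌋ : ℂ) * s (α ⌊t⌋ + (t - ⌊t⌋) * ℓ ⌊t⌋) ≠ 0 := by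
      intro h
      rw [show ℓ ⌊t⌋ * s (α ⌊t⌋ + (t - ⌊t⌋) * ℓ ⌊t⌋) = 0 by exact_mod_cast h, mul_zero] at hpos
      exact lt_irrefl _ hpos
    rw [mul_left_comm]
    exact mul_ne_zero (hL.dir_ne_zero _) h7
  · intro t ht
    have h := hfl t ht
    rw [(hQ.hasDerivAt hL h).deriv, hQ.glued_eq (Ioo_subset_Icc_self h)]
    have := hccw ⌊t⌋ (t - ⌊t⌋) ⟨by linarith [h.1], by linarith [h.2]⟩
    exact this
  · intro k
    exact ⟨_, hQ.tendsto_left hL k, by rw [neg_neg]; exact hQ.tendsto_right hL k⟩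

end IsCornerChain

end

section

variable {κ : ℝ} {c : ℂ} {s : ℝ → ℝ} {γ : ℝ → ℂ} {G : Set ℂ} {ι : Type} [Fintype ι] [DecidableEq ι]
  {a b : ι → ℝ} {pred : Equiv.Perm ι} {comp : ι → Set ℂ} {mate : Equiv.Perm ι} {α ℓ ρ : ℤ → ℝ}
  {idx : ℤ → ι} {U : Set ℂ} {sg : ι → ℝ}

/-- Each `(α k, ℓ k)` describes the arc with index `idx k`, run forward or backward. -/
def IsArcSequence (a b : ι → ℝ) (idx : ℤ → ι) (α ℓ : ℤ → ℝ) : Prop :=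
  ∀ k, (α k = a (idx k) ∧ ℓ k = b (idx k) - a (idx k)) ∨
    (α k = b (idx k) ∧ ℓ k = a (idx k) - b (idx k))

lemma IsArcSequence.mem_Icc (hA : ArcSystem s γ a b pred) (hS : IsArcSequence a b idx α ℓ) (k : ℤ)
    {x : ℝ} (hx : x ∈ Icc (0 : ℝ) 1) : α k + x * ℓ k ∈ Icc (a (idx k)) (b (idx k)) := by
  have := hA.lt (idx k)
  obtain ⟨h1, h2⟩ := hx
  rcases hS k with ⟨e1, e2⟩ | ⟨e1, e2⟩ <;> rw [e1, e2] <;> constructor <;> nlinarith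

lemma IsArcSequence.mem_Ioo (hA : ArcSystem s γ a b pred) (hS : IsArcSequence a b idx α ℓ) (k : ℤ)
    {x : ℝ} (hx : x ∈ Ioo (0 : ℝ) 1) : α k + x * ℓ k ∈ Ioo (a (idx k)) (b (idx k)) := by
  have := hA.lt (idx k)
  obtain ⟨h1, h2⟩ := hx
  rcases hS k with ⟨e1, e2⟩ | ⟨e1, e2⟩ <;> rw [e1, e2] <;> constructor <;> nlinarith

lemma IsArcSequence.ne_zero (hA : ArcSystem s γ a b pred) (hS : IsArcSequence a b idx α ℓ) (k : ℤ) :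
    ℓ k ≠ 0 := by
  have := hA.lt (idx k)
  rcases hS k with ⟨e1, e2⟩ | ⟨e1, e2⟩ <;> rw [e2] <;> intro h <;> linarith

lemma IsArcSequence.exists_eq (hA : ArcSystem s γ a b pred) (hS : IsArcSequence a b idx α ℓ) (k : ℤ)
    {t : ℝ} (ht : t ∈ Icc (a (idx k)) (b (idx k))) : ∃ x ∈ Icc (0 : ℝ) 1, t = α k + x * ℓ k := by
  have hlt := hA.lt (idx k)
  have h0 : 0 < b (idx k) - a (idx k) := sub_pos.2 hlt
  rcases hS k with ⟨e1, e2⟩ | ⟨e1, e2⟩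
  · refine ⟨(t - a (idx k)) / (b (idx k) - a (idx k)), ⟨div_nonneg (by linarith [ht.1]) h0.le,
      (div_le_one h0).2 (by linarith [ht.2])⟩, ?_⟩
    rw [e1, e2]; field_simp; ring
  · refine ⟨(b (idx k) - t) / (b (idx k) - a (idx k)), ⟨div_nonneg (by linarith [ht.2]) h0.le,
      (div_le_one h0).2 (by linarith [ht.1])⟩, ?_⟩
    rw [e1, e2, show a (idx k) - b (idx k) = -(b (idx k) - a (idx k)) by ring]; field_simp; ring

/-- An interior point of an arc lies on no other arc and determines its parameter. Distinctness of
the corners is an extra hypothesis, since different arcs may start at the same double point. -/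
lemma IsCornerChain.injOn_glued (hA : ArcSystem s γ a b pred) (hS : IsArcSequence a b idx α ℓ)
    {n : ℕ} (hidx : InjOn idx (Ico 0 (n : ℤ))) (hv : InjOn (fun k => γ (α k)) (Ico 0 (n : ℤ))) :
    InjOn (gluedCurve γ α ℓ) (Ico 0 (n : ℝ)) := by
  have hfl : ∀ x ∈ Ico 0 (n : ℝ), ⌊x⌋ ∈ Ico 0 (n : ℤ) := fun x hx =>
    ⟨Int.floor_nonneg.2 hx.1, Int.floor_lt.2 (by exact_mod_cast hx.2)⟩
  have hf : ∀ x : ℝ, Int.fract x ∈ Icc (0 : ℝ) 1 := fun x =>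
    ⟨Int.fract_nonneg x, (Int.fract_lt_one x).le⟩
  have key : ∀ x ∈ Ico 0 (n : ℝ), ∀ y ∈ Ico 0 (n : ℝ), Int.fract x ≠ 0 →
      gluedCurve γ α ℓ y = gluedCurve γ α ℓ x → y = x := by
    intro x hx y hy hx0 hxy
    have h1 := hS.mem_Ioo hA ⌊x⌋ ⟨(Int.fract_nonneg x).lt_of_ne' hx0, Int.fract_lt_one x⟩
    obtain ⟨h3, h4⟩ := hA.notMem_arc h1 (hS.mem_Icc hA ⌊y⌋ (hf y)) hxy
    have h5 := hidx (hfl y hy) (hfl x hx) h3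
    rw [h5] at h4
    have h6 := mul_right_cancel₀ (hS.ne_zero hA _) (add_left_cancel h4)
    rw [← Int.floor_add_fract x, ← Int.floor_add_fract y, h5, h6]
  intro x hx y hy hxy
  by_cases hx0 : Int.fract x = 0
  · by_cases hy0 : Int.fract y = 0
    · rw [gluedCurve, gluedCurve, hx0, hy0, zero_mul, add_zero, zero_mul, add_zero] at hxy
      have := hv (hfl x hx) (hfl y hy) hxy
      rw [← Int.floor_add_fract x, ← Int.floor_add_fract y, this, hx0, hy0]
    · exact key y hy x hx hy0 hxy
  · exact (key x hx y hy hx0 hxy.symm).symm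

lemma IsCornerChain.range_glued (hL : TurningLoop κ c s γ G) (hA : ArcSystem s γ a b pred)
    (hC : IsRightComponents κ c s γ G a b comp) (hM : IsMate s γ a mate)
    (hQ : IsCornerChain κ c s γ α ℓ ρ) (hS : IsArcSequence a b idx α ℓ)
    (hU : U ∈ planarComponents (G ∪ range γ)ᶜ) (hidx : range idx = {i | comp i = U}) :
    range (gluedCurve γ α ℓ) = frontier U := by
  refine Subset.antisymm ?_ fun z hz => ?_
  · rintro _ ⟨x, rfl⟩
    have h1 : comp (idx ⌊x⌋) = U := by
      have : idx ⌊x⌋ ∈ {i | comp i = U} := hidx ▸ mem_range_self _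
      exact this
    rw [← h1]
    exact hC.arc_subset_frontier hL hA _ (hS.mem_Icc hA ⌊x⌋
      ⟨Int.fract_nonneg x, (Int.fract_lt_one x).le⟩)
  · obtain ⟨i, hi, t, ht, rfl⟩ : ∃ i, comp i = U ∧ ∃ t ∈ Icc (a i) (b i), γ t = z := by
      rcases hM.frontier_cases hL hA hC hU hz with ⟨i, hi, h⟩ | ⟨i, hi, t, ht, h⟩
      · exact ⟨i, hi, a i, left_mem_Icc.2 (hA.lt i).le, h⟩
      · exact ⟨i, hi, t, Ioo_subset_Icc_self ht, h⟩
    have : i ∈ range idx := hidx ▸ (show i ∈ {i | comp i = U} from hi)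
    obtain ⟨k, rfl⟩ := this
    obtain ⟨x, hx, rfl⟩ := hS.exists_eq hA k ht
    refine ⟨k + x, ?_⟩
    rw [hQ.glued_eq (k := k) ⟨by linarith [hx.1], by linarith [hx.2]⟩, add_sub_cancel_left]

lemma TurningLoop.notMem_closure_component (hL : TurningLoop κ c s γ G)
    (hC : IsRightComponents κ c s γ G a b comp) (hU : U ∈ planarComponents (G ∪ range γ)ᶜ) {z : ℂ}
    (hz : z ∈ G ∨ ∃ w, comp w ≠ U ∧ z ∈ comp w) : z ∉ closure U := by
  intro hzU
  rcases hz with hz | ⟨w, hw, hz⟩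
  · obtain ⟨x, hx, hxU⟩ := mem_closure_iff.1 hzU G hL.isOpen hz
    exact planarComponents_subset hU hxU (.inl hx)
  · obtain ⟨x, hx, hxU⟩ := mem_closure_iff.1 hzU _
      (planarComponents_isOpen hL.isOpen_compl (hC w).1) hz
    exact hw (planarComponents_eq (hC w).1 hU hx hxU)

lemma eventually_nhdsGT_mul {P : ℝ → Prop} (h : ∀ᶠ ε : ℝ in 𝓝[>] 0, P ε) {m : ℝ} (hm : 0 < m) :
    ∀ᶠ ε : ℝ in 𝓝[>] 0, P (ε * m) := by
  have h1 : Tendsto (fun ε : ℝ => ε * m) (𝓝[>] 0) (𝓝[>] 0) := by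
    refine tendsto_nhdsWithin_iff.2 ⟨tendsto_nhdsWithin_of_tendsto_nhds ?_, ?_⟩
    · have : ContinuousAt (fun ε : ℝ => ε * m) 0 := by fun_prop
      simpa [ContinuousAt] using this
    · filter_upwards [self_mem_nhdsWithin] with ε hε
      exact mul_pos hε hm
  exact h1.eventually h

/-- A bounded component whose boundary consists of three short arcs is bounded by a deltoid-like
curve. -/
lemma IsMate.isDeltoidLike (hL : TurningLoop κ c s γ G) (hA : ArcSystem s γ a b pred)
    (hC : IsRightComponents κ c s γ G a b comp) (hM : IsMate s γ a mate)
    (hU : U ∈ planarComponents (G ∪ range γ)ᶜ) (hb : Bornology.IsBounded U)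
    (hper : ∀ k, idx (k + 3) = idx k) (hidx : InjOn idx (Ico 0 3))
    (hrange : range idx = {i | comp i = U}) (hstep : ∀ k, idx (k + 1) = pred (mate (idx k)))
    (hvert : InjOn (fun i => γ (a i)) {i | comp i = U})
    (hshort : κ * (b (idx 0) - a (idx 0)) < Real.pi) : IsDeltoidLike (frontier U) := by
  obtain ⟨sg, hsg⟩ := hL.exists_arcSign hA
  -- The component lies to the right of its arcs, so the counterclockwise boundary runs through them
  -- backwards. The negative `ℓ` makes the curvature negative.
  set α : ℤ → ℝ := fun k => b (idx k)
  set ℓ : ℤ → ℝ := fun k => a (idx k) - b (idx k) with hℓ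
  set ρ : ℤ → ℝ := fun k => -sg (idx k)
  have hS : IsArcSequence a b idx α ℓ := fun k => .inr ⟨rfl, rfl⟩
  have hend : ∀ k, α k + ℓ k = a (idx k) := fun k => add_sub_cancel _ _
  have hjoint : ∀ k, γ (a (idx k)) = γ (α (k + 1)) := fun k => by
    simp only [α]
    rw [hstep, hA.gamma_b hL, hM.gamma]
  have hcorner : ∀ k, (sg (idx k) : ℂ) * turningDir κ c (a (idx k)) =
      ρ (k + 1) * turningDir κ c (α (k + 1)) := fun k => by
    simp only [ρ, α]
    rw [hstep]
    push_cast
    linear_combination (hM.corner_dir hL hA hC hsg (idx k)).1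
  have hneg : ∀ k, ℓ k < 0 := fun k => sub_neg.2 (hA.lt _)
  have hcomp : ∀ k, comp (idx k) = U := fun k => by
    have : idx k ∈ {i | comp i = U} := hrange ▸ mem_range_self k
    exact this
  have hQ : IsCornerChain κ c s γ α ℓ ρ := by
    refine ⟨fun k => ⟨?_, fun x hx => ?_⟩, fun k => by rw [hend, hjoint], fun k => ?_⟩
    · rcases (hsg (idx k)).1 with h | h <;> simp [ρ, h]
    · have h1 := (hsg (idx k)).2 _ (hS.mem_Ioo hA k hx)
      have h2 := mul_pos (neg_pos.2 (hneg k)) h1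
      simp only [ρ]
      linarith
    · rw [hend, ← hcorner]
      simp only [ρ]
      push_cast
      ring
  have hUo := planarComponents_isOpen hL.isOpen_compl hU
  have hJ : jordanInside (frontier U) = U := jordanInside_frontier_of_isBounded hUo
    (planarComponents_isPreconnected hU) (hM.isPreconnected_compl_closure hL hA hC hU) hb
  have hr := IsCornerChain.range_glued hL hA hC hM hQ hS hU hrange
  refine ⟨gluedCurve γ α ℓ, ?_, fun k => ?_, 0, fun t ht => ?_, ?_⟩
  · refine hQ.isCuspedParametrization hL (n := 3) (fun k => ?_) (fun k => ?_) ?_ hr ?_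
    · simp only [α]; push_cast; rw [hper]
    · simp only [ℓ]; push_cast; rw [hper]
    · refine IsCornerChain.injOn_glued hA hS (by exact_mod_cast hidx) ?_
      intro k hk m hm hkm
      have h1 := hjoint (k - 1)
      have h2 := hjoint (m - 1)
      rw [sub_add_cancel] at h1 h2
      have h3 := hvert (hcomp (k - 1)) (hcomp (m - 1)) (h1.trans (Eq.trans hkm h2.symm))
      have h4 : idx k = idx m := by
        have := hstep (k - 1)
        have h5 := hstep (m - 1)
        rw [sub_add_cancel] at this h5
        rw [this, h5, h3]
      exact hidx (by exact_mod_cast hk) (by exact_mod_cast hm) h4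
    · intro k x hx
      rw [hJ]
      have h1 := ((hC (idx k)).2 _ (hS.mem_Ioo hA k hx)).right
      rw [hcomp] at h1
      filter_upwards [eventually_nhdsGT_mul h1 (neg_pos.2 (hneg k))] with ε hε
      convert hε using 1
      push_cast
      ring
  · refine ⟨_, hQ.tendsto_left hL k, ?_⟩
    rw [hr, hJ, union_comm, ← closure_eq_self_union_frontier]
    have hc := (hM.corner_dir hL hA hC hsg (idx (k - 1))).2
    filter_upwards [hc] with ε hε
    have e1 := hcorner (k - 1)
    have e2 := hjoint (k - 1)
    rw [sub_add_cancel] at e1 e2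
    rw [hQ.glued_eq (k := k) ⟨le_rfl, by linarith⟩, sub_self, zero_mul, add_zero, ← e1, ← e2,
      mul_neg, ← sub_eq_add_neg]
    -- The tip leads into `G` or into the component at the mate of the corner. The latter differs
    -- from `U`, because the two arcs start at the same point while the vertices of `U` are
    -- distinct.
    refine hL.notMem_closure_component hC hU (hε.imp_right fun h => ⟨_, fun h' => ?_, h.2⟩)
    exact h.1 (hvert h' (hcomp _) (hM.gamma _))
  · obtain ⟨m, hm, e⟩ := hQ.signedCurvature_eq hL ht
    rw [e]
    exact mul_neg_of_neg_of_pos (hneg 0) hm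
  · refine (hQ.eVariationOn_le hL 0).trans_lt ?_
    rw [ENNReal.ofReal_lt_ofReal_iff Real.pi_pos, abs_of_neg (hneg 0)]
    simp only [hℓ]
    linarith

/-- An unbounded component whose boundary is a single arc is bounded by a cardioid-like curve. -/
lemma IsMate.isCardioidLike (hL : TurningLoop κ c s γ G) (hA : ArcSystem s γ a b pred)
    (hC : IsRightComponents κ c s γ G a b comp) (hM : IsMate s γ a mate)
    (hU : U ∈ planarComponents (G ∪ range γ)ᶜ) (hb : ¬ Bornology.IsBounded U)
    (hb' : Bornology.IsBounded (closure U)ᶜ) {i : ι} (hi : {j | comp j = U} = {i})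
    (hstep : pred (mate i) = i) : IsCardioidLike (frontier U) := by
  obtain ⟨sg, hsg⟩ := hL.exists_arcSign hA
  -- Here the inside of the Jordan curve is the complement of the closure of `U`, on the left of the
  -- arc. The arc is run forward, so its curvature is positive.
  set α : ℤ → ℝ := fun _ => a i
  set ℓ : ℤ → ℝ := fun _ => b i - a i
  set ρ : ℤ → ℝ := fun _ => sg i
  have hlt := hA.lt i
  have hS : IsArcSequence a b (fun _ => i) α ℓ := fun k => .inl ⟨rfl, rfl⟩
  have hend : ∀ k, α k + ℓ k = b i := fun k => add_sub_cancel _ _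
  have hci : comp i = U := by
    have : i ∈ {j | comp j = U} := by rw [hi]; rfl
    exact this
  have hcd := hM.corner_dir hL hA hC hsg i
  rw [hstep] at hcd
  have hQ : IsCornerChain κ c s γ α ℓ ρ := by
    refine ⟨fun k => ⟨(hsg i).1, fun x hx => ?_⟩, fun k => ?_, fun k => ?_⟩
    · have h1 := (hsg i).2 _ (hS.mem_Ioo hA k hx)
      have h2 := mul_pos (sub_pos.2 hlt) h1
      simp only [ρ, ℓ] at h2 ⊢
      linarith
    · rw [hend k]
      have := hA.gamma_b hL (mate i)
      rwa [hstep, hM.gamma] at this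
    · rw [hend k]; exact hcd.1
  have hUo := planarComponents_isOpen hL.isOpen_compl hU
  have hJ : jordanInside (frontier U) = (closure U)ᶜ := jordanInside_frontier_of_not_isBounded hUo
    (planarComponents_isPreconnected hU) (hM.isPreconnected_compl_closure hL hA hC hU) hb hb'
  have hr := IsCornerChain.range_glued hL hA hC hM hQ hS hU (by rw [hi]; exact range_const)
  have hone : ∀ k ∈ Ico 0 ((1 : ℕ) : ℤ), k = 0 := fun k hk => by
    have h1 := hk.1
    have h2 := hk.2
    push_cast at h2
    omega
  refine ⟨gluedCurve γ α ℓ, ?_, ⟨-((ρ 0 : ℂ) * turningDir κ c (α 0)), ?_, ?_⟩, fun t ht => ?_⟩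
  · refine hQ.isCuspedParametrization hL (n := 1) (fun k => rfl) (fun k => rfl) ?_ hr ?_
    · refine IsCornerChain.injOn_glued hA hS ?_ ?_ <;> intro k hk m hm _ <;>
        rw [hone k hk, hone m hm]
    · intro k x hx
      rw [hJ]
      have h1 := hL.left _ (hA.regular i _ (hS.mem_Ioo hA k hx)).1
      filter_upwards [eventually_nhdsGT_mul h1 (sub_pos.2 hlt)] with ε hε
      refine hL.notMem_closure_component hC hU (.inl ?_)
      convert hε using 1
      simp only [ℓ]
      push_cast
      ring
  · have := hQ.tendsto_left hL 0
    rwa [Int.cast_zero] at this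
  · rw [hr, hJ]
    filter_upwards [hcd.2] with ε hε
    have h0 := hQ.glued_eq (k := 0) (x := 0) (by simp)
    rw [h0, Int.cast_zero, sub_self, zero_mul, add_zero, mul_neg, ← sub_eq_add_neg]
    refine hL.notMem_closure_component hC hU (hε.imp_right fun h => ⟨_, fun h' => ?_, h.2⟩)
    have : mate i ∈ ({i} : Set ι) := hi ▸ (show mate i ∈ {j | comp j = U} from h')
    exact h.1 this
  · obtain ⟨m, hm, e⟩ := hQ.signedCurvature_eq hL (k := 0) (by simpa using ht)
    rw [e]
    exact mul_pos (sub_pos.2 hlt) hm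

end

/-! ### The turning of the tangent around a component, and the two final counts. -/

section

variable {κ : ℝ} {c : ℂ} {s : ℝ → ℝ} {γ : ℝ → ℂ} {G : Set ℂ} {ι : Type} [Fintype ι] [DecidableEq ι]
  {a b : ι → ℝ} {pred : Equiv.Perm ι} {comp : ι → Set ℂ} {mate : Equiv.Perm ι} {U : Set ℂ}

open scoped Classical in
/-- The arcs on the boundary of a component. -/
noncomputable def fiber {ι : Type} [Fintype ι] (comp : ι → Set ℂ) (U : Set ℂ) : Finset ι :=
  Finset.univ.filter fun i => comp i = U

lemma mem_fiber {i : ι} : i ∈ fiber comp U ↔ comp i = U := by simp [fiber]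

lemma coe_fiber : (fiber comp U : Set ι) = {i | comp i = U} := by ext; simp [fiber]

/-- The arcs on the boundary of a component form a single cycle. -/
lemma IsMate.isCycleOn_fiber (hL : TurningLoop κ c s γ G) (hA : ArcSystem s γ a b pred)
    (hC : IsRightComponents κ c s γ G a b comp) (hM : IsMate s γ a mate) :
    (pred * mate).IsCycleOn (fiber comp U : Set ι) := by
  classical
  have hpres : ∀ v, comp ((pred * mate) v) = comp v := fun v => hM.comp_pred hL hA hC v
  refine ⟨⟨fun v hv => ?_, (Equiv.injective _).injOn, fun v hv => ?_⟩, fun x hx y hy => ?_⟩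
  · rw [coe_fiber] at hv ⊢
    exact (hpres v).trans hv
  · rw [coe_fiber] at hv ⊢
    refine ⟨(pred * mate).symm v, ?_, Equiv.apply_symm_apply _ _⟩
    have := hpres ((pred * mate).symm v)
    rw [Equiv.apply_symm_apply] at this
    exact this.symm.trans hv
  · by_contra hxy
    -- The arcs in one cycle of `pred * mate` form a closed chain, and a closed chain shares no
    -- component with the remaining arcs.
    have hI := hM.isClosedChain_of_invariant hL hA
      (I := Finset.univ.filter fun z => (pred * mate).SameCycle x z) fun v => by
        simp only [Finset.mem_filter, Finset.mem_univ, true_and]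
        exact Equiv.Perm.sameCycle_apply_right
    refine hI.comp_ne hL hA hC (i := x) (j := y) (by simpa using Equiv.Perm.SameCycle.refl _ x) (by simpa using hxy) ?_
    rw [Finset.mem_coe, mem_fiber] at hx hy
    rw [hx, hy]

/-- The tangent turns by an odd multiple of `π` along a boundary with an odd number of arcs. -/
lemma IsMate.exists_turning (hL : TurningLoop κ c s γ G) (hA : ArcSystem s γ a b pred)
    (hC : IsRightComponents κ c s γ G a b comp) (hM : IsMate s γ a mate)
    (hodd : Odd (fiber comp U).card) :
    ∃ n : ℕ, ∑ i ∈ fiber comp U, κ * (b i - a i) = (2 * n + 1) * Real.pi := by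
  obtain ⟨sg, hsg⟩ := hL.exists_arcSign hA
  set F := fiber comp U
  set σ := pred * mate
  set out : ι → ℂ := fun v => sg v * turningDir κ c (a v) with hout
  set E : ι → ℂ := fun v => circlePoint (κ * (b v - a v)) with hE
  have h1 : ∀ v, out (σ v) * E (σ v) = -out v := by
    intro v
    have := (hM.corner_dir hL hA hC hsg v).1
    rw [show b (pred (mate v)) = a (pred (mate v)) + (b (pred (mate v)) - a (pred (mate v))) by ring,
      turningDir_add] at this
    simp only [out, E, σ, Equiv.Perm.mul_apply]
    rw [mul_assoc, this]
  -- Multiplying the corner relations over the whole boundary, the outgoing directions cancel. What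
  -- remains is that the product of all rotations equals `(-1)` to the number of arcs.
  have h2 : ∏ v ∈ F, out v * E v = ∏ v ∈ F, -out v := by
    rw [← Finset.prod_congr rfl fun v _ => h1 v]
    have hbij := (hM.isCycleOn_fiber (U := U) hL hA hC).1
    symm
    refine Finset.prod_bij (fun v _ => σ v) (fun v hv => hbij.mapsTo hv)
      (fun v _ w _ h => σ.injective h) (fun w hw => ?_) fun _ _ => rfl
    obtain ⟨v, hv, hvw⟩ := hbij.surjOn hw
    exact ⟨v, hv, hvw⟩
  have h3 : ∏ v ∈ F, out v ≠ 0 := Finset.prod_ne_zero_iff.2 fun v _ => by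
    refine mul_ne_zero ?_ (hL.dir_ne_zero _)
    rcases (hsg v).1 with h | h <;> rw [h] <;> norm_num
  have h4 : ∏ v ∈ F, E v = -1 := by
    rw [Finset.prod_mul_distrib, Finset.prod_neg, hodd.neg_one_pow, mul_comm] at h2
    exact mul_right_cancel₀ h3 h2
  have h5 : ∀ F : Finset ι, ∏ v ∈ F, E v = circlePoint (∑ v ∈ F, κ * (b v - a v)) := by
    intro F
    simp only [E, circlePoint]
    rw [← Complex.exp_sum, ← Finset.sum_mul]
    push_cast
    rfl
  have h6 : circlePoint (∑ v ∈ F, κ * (b v - a v)) = circlePoint Real.pi := by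
    rw [← h5, h4, circlePoint, Complex.exp_pi_mul_I]
  obtain ⟨n, hn⟩ := circlePoint_eq_iff.1 h6
  have hnn : 0 ≤ ∑ v ∈ F, κ * (b v - a v) := Finset.sum_nonneg fun v _ =>
    (mul_pos hL.kappa_pos (sub_pos.2 (hA.lt v))).le
  have hn0 : 0 ≤ n := by
    by_contra! h
    have h7 : (n : ℝ) ≤ -1 := by exact_mod_cast (by omega : n ≤ -1)
    have := Real.pi_pos
    nlinarith
  lift n to ℕ using hn0
  exact ⟨n, by rw [hn]; push_cast; ring⟩

/-- An arc that turns by at most `π` does not close up. -/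
lemma TurningLoop.gamma_ne_of_short (hL : TurningLoop κ c s γ G) (hA : ArcSystem s γ a b pred)
    {i : ι} (hi : κ * (b i - a i) ≤ Real.pi) : γ (b i) ≠ γ (a i) := by
  have hκ := hL.kappa_pos
  obtain ⟨sg, hsg⟩ := hL.exists_arcSign hA
  set e : ℂ := sg i * turningDir κ c (a i) with he
  have hsg2 : (sg i : ℂ) * sg i = 1 := by rcases (hsg i).1 with h | h <;> rw [h] <;> norm_num
  have he0 : e ≠ 0 := mul_ne_zero (left_ne_zero_of_mul (hsg2 ▸ one_ne_zero)) (hL.dir_ne_zero _)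
  -- The coordinate normal to the initial direction of motion has derivative `sin (κ(t - a i))`
  -- times the positive speed, so it increases as long as the turning is at most `π`.
  set f : ℝ → ℝ := fun t => (γ t / e).im
  have hf : ∀ t, HasDerivAt f (Real.sin (κ * (t - a i)) * (sg i * s t)) t := by
    intro t
    have h1 := Complex.imCLM.hasFDerivAt.comp_hasDerivAt t ((hL.hasDerivAt t).div_const e)
    refine h1.congr_deriv ?_
    have h2 : turningDir κ c t * s t / e =
        ((Real.cos (κ * (t - a i)) * (sg i * s t) : ℝ) : ℂ) +
        ((Real.sin (κ * (t - a i)) * (sg i * s t) : ℝ) : ℂ) * Complex.I := by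
      rw [div_eq_iff he0, show t = a i + (t - a i) by ring, turningDir_add, circlePoint_eq_cos_sin,
        he, add_sub_cancel]
      push_cast
      linear_combination -(turningDir κ c (a i) * s t * (Complex.cos (κ * (t - a i)) +
        Complex.sin (κ * (t - a i)) * Complex.I)) * hsg2
    rw [h2]
    simp only [Complex.imCLM_apply, Complex.add_im, Complex.mul_im, Complex.ofReal_re,
      Complex.ofReal_im, Complex.I_re, Complex.I_im]
    ring
  have hmono : StrictMonoOn f (Icc (a i) (b i)) := by
    refine strictMonoOn_of_deriv_pos (convex_Icc _ _)
      (fun t _ => (hf t).continuousAt.continuousWithinAt) fun t ht => ?_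
    rw [interior_Icc] at ht
    rw [(hf t).deriv]
    refine mul_pos (Real.sin_pos_of_pos_of_lt_pi (mul_pos hκ (sub_pos.2 ht.1)) ?_) ((hsg i).2 t ht)
    refine lt_of_lt_of_le ?_ hi
    exact mul_lt_mul_of_pos_left (by linarith [ht.2]) hκ
  intro h
  have := hmono (left_mem_Icc.2 (hA.lt i).le) (right_mem_Icc.2 (hA.lt i).le) (hA.lt i)
  simp only [f, h, lt_self_iff_false] at this

lemma three_le_card_fiber (hL : TurningLoop κ c s γ G) (hA : ArcSystem s γ a b pred)
    (hC : IsRightComponents κ c s γ G a b comp) (hM : IsMate s γ a mate)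
    (hU : U ∈ planarComponents (G ∪ range γ)ᶜ) (hb : Bornology.IsBounded U) :
    3 ≤ (fiber comp U).card := by
  have h1 := hM.three_le_vertices hL hA hC hU hb
  rw [← coe_fiber] at h1
  have h2 := Set.ncard_image_le (f := fun i => γ (a i)) (fiber comp U).finite_toSet
  rw [Set.ncard_coe_finset] at h2
  exact h1.trans h2

lemma injOn_vertices (hL : TurningLoop κ c s γ G) (hA : ArcSystem s γ a b pred)
    (hC : IsRightComponents κ c s γ G a b comp) (hM : IsMate s γ a mate)
    (hU : U ∈ planarComponents (G ∪ range γ)ᶜ) (hb : Bornology.IsBounded U)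
    (hcard : (fiber comp U).card = 3) : InjOn (fun i => γ (a i)) {i | comp i = U} := by
  have h1 := hM.three_le_vertices hL hA hC hU hb
  rw [← coe_fiber] at h1 ⊢
  have h2 := Set.ncard_image_le (f := fun i => γ (a i)) (fiber comp U).finite_toSet
  rw [Set.ncard_coe_finset] at h2
  refine Set.injOn_of_ncard_image_eq ?_ (fiber comp U).finite_toSet
  rw [Set.ncard_coe_finset]
  omega

lemma vertices_inter_frontier (hL : TurningLoop κ c s γ G) (hA : ArcSystem s γ a b pred)
    (hC : IsRightComponents κ c s γ G a b comp) (hM : IsMate s γ a mate)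
    (hU : U ∈ planarComponents (G ∪ range γ)ᶜ) :
    (range fun i => γ (a i)) ∩ frontier U = (fun i => γ (a i)) '' {i | comp i = U} := by
  refine Subset.antisymm ?_ ?_
  · rintro _ ⟨⟨v, rfl⟩, hz⟩
    rcases hM.frontier_cases hL hA hC hU hz with ⟨i, hi, h⟩ | ⟨i, hi, t, ht, h⟩
    · exact ⟨i, hi, h⟩
    · obtain ⟨rfl, h2⟩ := hA.notMem_arc ht (left_mem_Icc.2 (hA.lt v).le) h.symm
      exact absurd h2 ht.1.ne
  · rintro _ ⟨i, hi, rfl⟩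
    refine ⟨⟨i, rfl⟩, ?_⟩
    rw [← (show comp i = U from hi)]
    exact hC.arc_subset_frontier hL hA i (left_mem_Icc.2 (hA.lt i).le)

/-- The powers of `pred * mate` enumerate the three arcs cyclically. Their turnings are positive
with sum `π`, so each one is strictly below `π`. -/
lemma IsMate.deltoid_of_card (hL : TurningLoop κ c s γ G) (hA : ArcSystem s γ a b pred)
    (hC : IsRightComponents κ c s γ G a b comp) (hM : IsMate s γ a mate)
    (hU : U ∈ planarComponents (G ∪ range γ)ᶜ) (hb : Bornology.IsBounded U)
    (hcard : (fiber comp U).card = 3) (hlen : ∑ i ∈ fiber comp U, κ * (b i - a i) = Real.pi) :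
    ((range fun i => γ (a i)) ∩ frontier U).encard = 3 ∧ IsDeltoidLike (frontier U) := by
  have hinj := injOn_vertices hL hA hC hM hU hb hcard
  have hcyc := hM.isCycleOn_fiber (U := U) hL hA hC
  obtain ⟨i₀, hi₀⟩ : (fiber comp U).Nonempty := Finset.card_pos.1 (by omega)
  refine ⟨?_, ?_⟩
  · rw [vertices_inter_frontier hL hA hC hM hU, hinj.encard_image, ← coe_fiber,
      Set.encard_coe_eq_coe_finsetCard, hcard]
    rfl
  · have hmod : ∀ m n : ℤ, ((pred * mate) ^ m) i₀ = ((pred * mate) ^ n) i₀ ↔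
        m ≡ n [ZMOD 3] := fun m n => by
      rw [hcyc.zpow_apply_eq_zpow_apply hi₀, hcard]; rfl
    refine hM.isDeltoidLike (idx := fun k => ((pred * mate) ^ k) i₀) hL hA hC hU hb
      (fun k => (hmod _ _).2 (by simp [Int.ModEq])) (fun m hm n hn hmn => ?_) ?_ (fun k => ?_) hinj ?_
    · have h := (hmod m n).1 hmn
      rw [Int.ModEq, Int.emod_eq_of_lt hm.1 hm.2, Int.emod_eq_of_lt hn.1 hn.2] at h
      exact h
    · rw [hcyc.range_zpow hi₀, coe_fiber]
    · rw [add_comm, zpow_add, zpow_one]; rfl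
    · rw [zpow_zero, Equiv.Perm.one_apply, ← hlen]
      obtain ⟨j, hj, hne⟩ := Finset.exists_mem_ne (by omega : 1 < (fiber comp U).card) i₀
      exact Finset.single_lt_sum hne hi₀ hj (mul_pos hL.kappa_pos (sub_pos.2 (hA.lt j)))
        fun k _ _ => (mul_pos hL.kappa_pos (sub_pos.2 (hA.lt k))).le

lemma IsMate.exists_finset (hL : TurningLoop κ c s γ G) (hA : ArcSystem s γ a b pred)
    (hC : IsRightComponents κ c s γ G a b comp) (hM : IsMate s γ a mate) :
    ∃ S : Finset (Set ℂ), (S : Set (Set ℂ)) = planarComponents (G ∪ range γ)ᶜ ∧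
      (∀ f : ι → ℝ, ∑ U ∈ S, ∑ i ∈ fiber comp U, f i = ∑ i, f i) ∧
      ∑ U ∈ S, (fiber comp U).card = Fintype.card ι ∧ (range comp).ncard = S.card := by
  classical
  have hmem : ∀ i, comp i ∈ Finset.univ.image comp := fun i =>
    Finset.mem_image_of_mem _ (Finset.mem_univ _)
  have hr : ((Finset.univ.image comp : Finset (Set ℂ)) : Set (Set ℂ)) = range comp := by simp
  refine ⟨Finset.univ.image comp, ?_, fun f => ?_, ?_, ?_⟩
  · rw [hr, hM.range_comp hL hA hC]
  · have := Finset.sum_fiberwise_of_maps_to (s := Finset.univ) (g := comp)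
      (fun i _ => hmem i) f
    rw [← this]
    exact Finset.sum_congr rfl fun U _ => Finset.sum_congr (by ext; simp [fiber]) fun _ _ => rfl
  · have := Finset.card_eq_sum_card_fiberwise (s := Finset.univ) (f := comp)
      (t := Finset.univ.image comp) (fun i _ => hmem i)
    rw [← Finset.card_univ, this]
    exact Finset.sum_congr rfl fun U _ => congrArg Finset.card (by ext; simp [fiber])
  · rw [← hr, Set.ncard_coe_finset]

/-- The complementary components if all of them are bounded and there are as few arcs as possible. -/
theorem TurningLoop.deltoids_of_bounded [Nonempty ι] (hL : TurningLoop κ c s γ G)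
    (hA : ArcSystem s γ a b pred) {D : ℕ} (hD : D ≤ {p | ∃ v, γ (a v) = p ∧ s (a v) ≠ 0}.ncard)
    (hcard : Fintype.card ι = 3 * (D + 1)) (hκ : 2 * κ = D + 1)
    (hb : ∀ U ∈ planarComponents (G ∪ range γ)ᶜ, Bornology.IsBounded U) :
    (planarComponents (G ∪ range γ)ᶜ).encard = (D + 1 : ℕ) ∧
    ∀ U ∈ planarComponents (G ∪ range γ)ᶜ,
      ((range fun i => γ (a i)) ∩ frontier U).encard = 3 ∧ IsDeltoidLike (frontier U) := by
  obtain ⟨comp, hC⟩ := hL.exists_rightComponent hA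
  obtain ⟨mate, hM⟩ := hL.exists_mate hA
  obtain ⟨S, hS, hsum, hcS, hSc⟩ := hM.exists_finset hL hA hC
  have hfin : {p | ∃ v, γ (a v) = p ∧ s (a v) ≠ 0}.Finite :=
    (Set.finite_range fun v => γ (a v)).subset (by rintro _ ⟨v, rfl, -⟩; exact ⟨v, rfl⟩)
  have h1 := hM.card_components_ge hL hA hC hfin.toFinset (by
    intro p hp
    obtain ⟨v, hv, hs⟩ := hfin.mem_toFinset.1 hp
    exact ⟨v, hv, fun h => hs ((hM.eq_iff v).1 h)⟩)
  rw [← Set.ncard_eq_toFinset_card _ hfin, hSc] at h1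
  have hmem : ∀ U ∈ S, U ∈ planarComponents (G ∪ range γ)ᶜ := fun U hU => hS ▸ hU
  have h3 : ∀ U ∈ S, 3 ≤ (fiber comp U).card := fun U hU =>
    three_le_card_fiber hL hA hC hM (hmem U hU) (hb U (hmem U hU))
  have h4 := Finset.card_nsmul_le_sum S (fun U => (fiber comp U).card) 3 h3
  rw [hcS, hcard, smul_eq_mul] at h4
  -- At least `D+1` components, each with at least three of the `3(D+1)` arcs: equality holds
  -- throughout.
  have h5 : S.card = D + 1 := by omega
  have h6 : ∀ U ∈ S, 3 = (fiber comp U).card := (Finset.sum_eq_sum_iff_of_le h3).1 (by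
    rw [hcS, hcard, Finset.sum_const, smul_eq_mul, h5]; ring)
  have h7 : ∀ U ∈ S, Real.pi ≤ ∑ i ∈ fiber comp U, κ * (b i - a i) := fun U hU => by
    obtain ⟨n, hn⟩ := hM.exists_turning (U := U) hL hA hC (by rw [← h6 U hU]; decide)
    rw [hn]
    have := mul_nonneg (Nat.cast_nonneg (α := ℝ) n) Real.pi_pos.le
    linarith
  -- The turnings are odd multiples of `π`, hence at least `π`, and together they make up `2πκ =
  -- (D+1)π`.
  have h8 : ∀ U ∈ S, Real.pi = ∑ i ∈ fiber comp U, κ * (b i - a i) :=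
    (Finset.sum_eq_sum_iff_of_le h7).1 (by
      rw [hsum, ← Finset.mul_sum, hA.sum_length, Finset.sum_const, nsmul_eq_mul, h5]
      push_cast
      linear_combination -Real.pi * hκ)
  refine ⟨by rw [← hS, Set.encard_coe_eq_coe_finsetCard, h5], fun U hU => ?_⟩
  have hUS : U ∈ S := by rw [← Finset.mem_coe, hS]; exact hU
  exact hM.deltoid_of_card hL hA hC hU (hb U hU) (h6 U hUS).symm (h8 U hUS).symm

/-- The complementary components if exactly one of them is unbounded and there are as few arcs as
possible. -/
theorem TurningLoop.deltoids_cardioid_of_unbounded [Nonempty ι] (hL : TurningLoop κ c s γ G)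
    (hA : ArcSystem s γ a b pred) {D : ℕ} (hD : D ≤ {p | ∃ v, γ (a v) = p ∧ s (a v) ≠ 0}.ncard)
    (hcard : Fintype.card ι = 3 * D + 1) (hκ : 2 * κ = D + 3) {W : Set ℂ}
    (hW : W ∈ planarComponents (G ∪ range γ)ᶜ) (hWb : ¬ Bornology.IsBounded W)
    (hWb' : Bornology.IsBounded (closure W)ᶜ)
    (hb : ∀ U ∈ planarComponents (G ∪ range γ)ᶜ, U ≠ W → Bornology.IsBounded U) :
    (planarComponents (G ∪ range γ)ᶜ).encard = (D + 1 : ℕ) ∧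
    (∀ U ∈ planarComponents (G ∪ range γ)ᶜ, U ≠ W →
      ((range fun i => γ (a i)) ∩ frontier U).encard = 3 ∧ IsDeltoidLike (frontier U)) ∧
    IsCardioidLike (frontier W) ∧ ∃ v, (range fun i => γ (a i)) ∩ frontier W = {γ (a v)} ∧
      (D = 0 → s (a v) = 0) ∧ (0 < D → s (a v) ≠ 0) := by
  classical
  obtain ⟨comp, hC⟩ := hL.exists_rightComponent hA
  obtain ⟨mate, hM⟩ := hL.exists_mate hA
  obtain ⟨S, hS, hsum, hcS, hSc⟩ := hM.exists_finset hL hA hC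
  have hfin : {p | ∃ v, γ (a v) = p ∧ s (a v) ≠ 0}.Finite :=
    (Set.finite_range fun v => γ (a v)).subset (by rintro _ ⟨v, rfl, -⟩; exact ⟨v, rfl⟩)
  have h1 := hM.card_components_ge hL hA hC hfin.toFinset (by
    intro p hp
    obtain ⟨v, hv, hs⟩ := hfin.mem_toFinset.1 hp
    exact ⟨v, hv, fun h => hs ((hM.eq_iff v).1 h)⟩)
  rw [← Set.ncard_eq_toFinset_card _ hfin, hSc] at h1
  have hmem : ∀ U, U ∈ S ↔ U ∈ planarComponents (G ∪ range γ)ᶜ := fun U => by rw [← hS]; rfl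
  have hWS : W ∈ S := (hmem W).2 hW
  have h3 : ∀ U ∈ S, (if U = W then 1 else 3) ≤ (fiber comp U).card := fun U hU => by
    split_ifs with h
    · obtain ⟨i, hi⟩ : U ∈ range comp := by
        rw [hM.range_comp hL hA hC]; exact (hmem U).1 hU
      exact Finset.card_pos.2 ⟨i, mem_fiber.2 hi⟩
    · exact three_le_card_fiber hL hA hC hM ((hmem U).1 hU) (hb U ((hmem U).1 hU) h)
  have hconst : ∀ x y : ℝ, ∑ U ∈ S, (if U = W then x else y) = x + (S.card - 1 : ℝ) * y := by
    intro x y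
    rw [← Finset.add_sum_erase S _ hWS, if_pos rfl, Finset.sum_congr rfl fun U hU =>
      if_neg (Finset.ne_of_mem_erase hU), Finset.sum_const, nsmul_eq_mul,
      Finset.cast_card_erase_of_mem hWS]
  have hconst' : (∑ U ∈ S, (if U = W then 1 else 3)) + 2 = 3 * S.card := by
    have := hconst 1 3
    have h : (((∑ U ∈ S, (if U = W then 1 else 3)) + 2 : ℕ) : ℝ) = ((3 * S.card : ℕ) : ℝ) := by
      push_cast
      rw [this]
      ring
    exact_mod_cast h
  -- The unbounded component has at least one arc and each other at least three. With `3D+1` arcs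
  -- and at least `D+1` components this leaves no slack.
  have h4 := Finset.sum_le_sum h3
  have h5 : S.card = D + 1 := by omega
  have h6 : ∀ U ∈ S, (if U = W then 1 else 3) = (fiber comp U).card :=
    (Finset.sum_eq_sum_iff_of_le h3).1 (by omega)
  have hW1 : (fiber comp W).card = 1 := by rw [← h6 W hWS, if_pos rfl]
  obtain ⟨i, hi⟩ := Finset.card_eq_one.1 hW1
  have hiW : comp i = W := mem_fiber.1 (by rw [hi]; exact Finset.mem_singleton_self i)
  have hset : {j | comp j = W} = {i} := by rw [← coe_fiber, hi]; exact Finset.coe_singleton i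
  have hstep : pred (mate i) = i := by
    have : pred (mate i) ∈ {j | comp j = W} := (hM.comp_pred hL hA hC i).trans hiW
    rwa [hset] at this
  have hloop : γ (b i) = γ (a i) := by
    have := hA.gamma_b hL (mate i)
    rwa [hstep, hM.gamma] at this
  have h7 : ∀ U ∈ S, (if U = W then 3 * Real.pi else Real.pi) ≤
      ∑ i ∈ fiber comp U, κ * (b i - a i) := fun U hU => by
    obtain ⟨n, hn⟩ := hM.exists_turning (U := U) hL hA hC (by
      rw [← h6 U hU]; split_ifs <;> decide)
    split_ifs with h
    · subst h
      rw [hn]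
      -- The unbounded component is bordered by one arc that closes up, which is impossible for a
      -- turning of `π`; the next odd multiple is `3π`.
      have hn0 : n ≠ 0 := by
        rintro rfl
        rw [hi, Finset.sum_singleton] at hn
        exact hL.gamma_ne_of_short hA (by rw [hn]; simp) hloop
      have : (1 : ℝ) ≤ n := by exact_mod_cast Nat.one_le_iff_ne_zero.2 hn0
      have := mul_le_mul_of_nonneg_right this Real.pi_pos.le
      linarith
    · rw [hn]
      have := mul_nonneg (Nat.cast_nonneg (α := ℝ) n) Real.pi_pos.le
      linarith
  -- The lower bounds add up to `3π + Dπ`, which is the total turning `2πκ`.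
  have h8 := (Finset.sum_eq_sum_iff_of_le h7).1 (by
      rw [hsum, ← Finset.mul_sum, hA.sum_length, hconst, h5]
      push_cast
      linear_combination -Real.pi * hκ)
  refine ⟨by rw [← hS, Set.encard_coe_eq_coe_finsetCard, h5], fun U hU hne => ?_,
    hM.isCardioidLike hL hA hC hW hWb hWb' hset hstep, i, ?_, fun h0 => ?_, fun h0 hs => ?_⟩
  · have h9 := h6 U ((hmem U).2 hU)
    have h10 := h8 U ((hmem U).2 hU)
    rw [if_neg hne] at h9 h10
    exact hM.deltoid_of_card hL hA hC hU (hb U hU hne) h9.symm h10.symm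
  · rw [vertices_inter_frontier hL hA hC hM hW, hset, image_singleton]
  · rw [h0] at hcard
    exact (hM.eq_iff i).1 ((Fintype.card_le_one_iff_subsingleton.1 hcard.le).elim _ _)
  -- If the vertex of the loop were a cusp, the loop would satisfy `pred i = i`. An interval of arcs
  -- starting at `i` could then not jump there, so there would be no other arc.
  · have hm := (hM.eq_iff i).2 hs
    rw [hm] at hstep
    obtain ⟨j, hj⟩ := Fintype.exists_ne_of_one_lt_card (by omega : 1 < Fintype.card ι) i
    obtain ⟨J, hJ⟩ := hA.interval i j hj.symm
    have := hJ i
    rw [hstep, sub_self, if_pos rfl, if_neg hj.symm] at this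
    norm_num at this

end

/-! ### The decomposition of the circle by finitely many singular parameters -/

/-- For `i < j` the half-open interval `[i, j)` works. For `i > j` the run passes the last index,
and the complement of `[j, i)` does. -/
lemma exists_interval_indicator {m : ℕ} (i j : Fin (m + 1)) (hij : i ≠ j) :
    ∃ J : Finset (Fin (m + 1)), ∀ w,
      ((if finRotate (m + 1) w ∈ J then 1 else 0) - (if w ∈ J then 1 else 0) : ℤ) =
      (if finRotate (m + 1) w = i then 1 else 0) - (if finRotate (m + 1) w = j then 1 else 0) := by
  have key : ∀ i j : Fin (m + 1), i < j → ∀ w,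
      ((if finRotate (m + 1) w ∈ Finset.univ.filter (fun v => i ≤ v ∧ v < j) then 1 else 0) -
        (if w ∈ Finset.univ.filter (fun v => i ≤ v ∧ v < j) then 1 else 0) : ℤ) =
      (if finRotate (m + 1) w = i then 1 else 0) -
        (if finRotate (m + 1) w = j then 1 else 0) := by
    intro i j hij w
    have hv := coe_finRotate w
    have hj := j.is_lt
    have hw := w.is_lt
    have hij' : (i : ℕ) < j := hij
    simp only [Finset.mem_filter, Finset.mem_univ, true_and, Fin.le_def, Fin.lt_def, Fin.ext_iff,
      Nat.succ_eq_add_one, Fin.val_last] at hv ⊢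
    split_ifs at hv ⊢ <;> omega
  rcases lt_or_gt_of_ne hij with h | h
  · exact ⟨_, key i j h⟩
  · refine ⟨(Finset.univ.filter fun v => j ≤ v ∧ v < i)ᶜ, fun w => ?_⟩
    have := key j i h w
    simp only [Finset.mem_compl]
    split_ifs at this ⊢ <;> omega

/-- The singular angles in `[0, 2π)` are sorted, and consecutive ones bound the arcs. The last arc
ends at the first angle plus `2π`, so that the arcs tile one full period starting at the first
angle. -/
lemma exists_arcSystem {s : ℝ → ℝ} {γ : ℝ → ℂ} {T : Finset ℝ} (hT : T.Nonempty)
    (hsub : ∀ θ ∈ T, θ ∈ Ico 0 (2 * Real.pi))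
    (hsing : ∀ t, (s t = 0 ∨ ∃ t', γ t' = γ t ∧ circlePoint t' ≠ circlePoint t) ↔
      ∃ θ ∈ T, circlePoint t = circlePoint θ) :
    ∃ (m : ℕ) (a b : Fin (m + 1) → ℝ) (pred : Equiv.Perm (Fin (m + 1))),
      ArcSystem s γ a b pred ∧ m + 1 = T.card ∧ range a = T := by
  have hπ := Real.pi_pos
  obtain ⟨m, hm⟩ : ∃ m, T.card = m + 1 := Nat.exists_eq_succ_of_ne_zero
    (Finset.card_pos.2 hT).ne'
  set θ := T.orderEmbOfFin hm
  have hrange : range θ = T := Finset.range_orderEmbOfFin T hm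
  have hθ : ∀ i, θ i ∈ Ico 0 (2 * Real.pi) := fun i => hsub _ (Finset.orderEmbOfFin_mem T hm i)
  set b : Fin (m + 1) → ℝ := fun i =>
    θ (finRotate (m + 1) i) + if i = Fin.last m then 2 * Real.pi else 0 with hb
  have hblast : b (Fin.last m) = θ 0 + 2 * Real.pi := by
    simp only [b, if_pos, finRotate_last]
  have hbne : ∀ i, i ≠ Fin.last m → b i = θ (finRotate (m + 1) i) := fun i hi => by
    simp only [b, if_neg hi, add_zero]
  have hle : ∀ i j, i < j → b i ≤ θ j := by
    intro i j hij
    have hi : i ≠ Fin.last m := (hij.trans_le (Fin.le_last j)).ne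
    rw [hbne i hi]
    refine θ.monotone ?_
    rw [Fin.le_def, coe_finRotate_of_ne_last hi]
    exact hij
  have hle0 : ∀ i, b i ≤ θ 0 + 2 * Real.pi := by
    intro i
    by_cases hi : i = Fin.last m
    · rw [hi, hblast]
    · rw [hbne i hi]
      linarith [(hθ (finRotate (m + 1) i)).2, (hθ 0).1]
  have hlt : ∀ i, θ i < b i := by
    intro i
    by_cases hi : i = Fin.last m
    · rw [hi, hblast]
      linarith [(hθ (Fin.last m)).2, (hθ 0).1]
    · rw [hbne i hi]
      refine θ.strictMono ?_
      rw [Fin.lt_def, coe_finRotate_of_ne_last hi]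
      omega
  have hend : ∀ w, circlePoint (b w) = circlePoint (θ (finRotate (m + 1) w)) := by
    intro w
    refine circlePoint_eq_iff.2 ?_
    by_cases hi : w = Fin.last m
    · exact ⟨1, by simp [hb, hi]⟩
    · exact ⟨0, by simp [hb, hi]⟩
  have huniq : ∀ {t t'}, t ∈ Ico (θ 0) (θ 0 + 2 * Real.pi) → t' ∈ Ico (θ 0) (θ 0 + 2 * Real.pi) →
      circlePoint t = circlePoint t' → t = t' := by
    intro t t' ht ht' h
    obtain ⟨n, hn⟩ := circlePoint_eq_iff.1 h
    have h1 : (n : ℝ) < 1 := by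
      by_contra! h'
      nlinarith [ht.2, ht'.1]
    have h2 : (-1 : ℝ) < n := by
      by_contra! h'
      nlinarith [ht.1, ht'.2]
    have h3 : n = 0 := by
      have h4 : n < 1 := by exact_mod_cast h1
      have h5 : -1 < n := by exact_mod_cast h2
      omega
    rw [hn, h3]
    simp
  have hmem : ∀ {i t}, t ∈ Ico (θ i) (b i) → t ∈ Ico (θ 0) (θ 0 + 2 * Real.pi) := fun {i t} ht =>
    ⟨(θ.monotone (Fin.zero_le i)).trans ht.1, ht.2.trans_le (hle0 i)⟩
  have hdisj : ∀ i j, ∀ t ∈ Ico (θ i) (b i), ∀ t' ∈ Ico (θ j) (b j),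
      circlePoint t = circlePoint t' → i = j ∧ t = t' := by
    intro i j t ht t' ht' h
    have := huniq (hmem ht) (hmem ht') h
    subst this
    refine ⟨?_, rfl⟩
    by_contra hne
    rcases lt_or_gt_of_ne hne with h | h
    · linarith [hle _ _ h, ht.2, ht'.1]
    · linarith [hle _ _ h, ht'.2, ht.1]
  refine ⟨m, θ, b, (finRotate (m + 1)).symm, ⟨hlt, fun v => ?_, fun i t ht => ?_, fun t => ?_,
    hdisj, ?_, fun v => ?_, fun i j hij => ?_⟩, hm.symm, hrange⟩
  · rw [hend, Equiv.apply_symm_apply]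
  · have hns : ¬ (s t = 0 ∨ ∃ t', γ t' = γ t ∧ circlePoint t' ≠ circlePoint t) := by
      rw [hsing]
      rintro ⟨x, hx, hE⟩
      obtain ⟨j, rfl⟩ : x ∈ range θ := by rw [hrange]; exact hx
      obtain ⟨rfl, h⟩ := hdisj i j t ⟨ht.1.le, ht.2⟩ _ ⟨le_rfl, hlt j⟩ hE
      exact ht.1.ne' h
    push Not at hns
    exact hns
  · have hp : 0 < 2 * Real.pi := by positivity
    set t' := toIcoMod hp (θ 0) t
    have ht' : t' ∈ Ico (θ 0) (θ 0 + 2 * Real.pi) := toIcoMod_mem_Ico hp _ _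
    have hE : circlePoint t' = circlePoint t := by
      refine circlePoint_eq_iff.2 ⟨-toIcoDiv hp (θ 0) t, ?_⟩
      simp only [t', toIcoMod, zsmul_eq_mul]
      push_cast
      ring
    have hne : (Finset.univ.filter fun j => θ j ≤ t').Nonempty :=
      ⟨0, Finset.mem_filter.2 ⟨Finset.mem_univ _, ht'.1⟩⟩
    obtain ⟨i, hi, hmax⟩ := Finset.exists_max_image _ id hne
    rw [Finset.mem_filter] at hi
    refine ⟨i, t', ⟨hi.2, ?_⟩, hE⟩
    by_cases hl : i = Fin.last m
    · rw [hl, hblast]; exact ht'.2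
    · rw [hbne i hl]
      by_contra! h
      have := hmax _ (Finset.mem_filter.2 ⟨Finset.mem_univ _, h⟩)
      rw [id, id, Fin.le_def, coe_finRotate_of_ne_last hl] at this
      omega
  · simp only [b, Finset.sum_sub_distrib, Finset.sum_add_distrib]
    rw [Equiv.sum_comp (finRotate (m + 1)) θ]
    simp
  · obtain ⟨t', h⟩ | h := ((hsing (θ v)).2 ⟨θ v, Finset.orderEmbOfFin_mem T hm v, rfl⟩).symm
    · exact .inr ⟨t', h⟩
    · exact .inl h
  · obtain ⟨J, hJ⟩ := exists_interval_indicator i j hij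
    refine ⟨J, fun v => ?_⟩
    have := hJ ((finRotate (m + 1)).symm v)
    rwa [Equiv.apply_symm_apply] at this

/-! ### Boundary behaviour of univalent maps -/

/-- The directions `v` such that all points `F ζ + ε * v` with small `ε > 0` are values of `F` at
points of the unit disc close to `ζ`. -/
def reachableDirections (F : ℂ → ℂ) (ζ : ℂ) : Set ℂ :=
  {v | ∀ N ∈ 𝓝 ζ, ∀ᶠ ε : ℝ in 𝓝[>] 0, ∃ w ∈ N, ‖w‖ < 1 ∧ F w = F ζ + ε * v}

lemma eventually_norm_lt_one {w : ℝ → ℂ} {ζ h : ℂ} (hw : HasDerivAt w h 0) (h0 : w 0 = ζ)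
    (hζ : ‖ζ‖ = 1) (hneg : (h / ζ).re < 0) : ∀ᶠ ε : ℝ in 𝓝[>] 0, ‖w ε‖ < 1 := by
  have hζ0 : ζ ≠ 0 := norm_pos_iff.1 (by rw [hζ]; exact one_pos)
  have h1 : HasDerivAt (fun ε => ‖w ε / ζ‖ ^ 2 - 1) (2 * (h / ζ).re) 0 := by
    have := ((hw.div_const ζ).norm_sq).sub_const 1
    refine this.congr_deriv ?_
    rw [h0, div_self hζ0, Complex.inner]
    simp
  have h2 := eventually_nhdsWithin_sign_eq_of_deriv_neg (by rw [h1.deriv]; linarith)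
    (by simp [h0, hζ])
  filter_upwards [nhdsWithin_le_nhds h2, self_mem_nhdsWithin] with ε hε hε0
  have hε0' : 0 - ε < 0 := by rw [zero_sub]; exact neg_neg_of_pos hε0
  rw [sign_neg hε0', sign_eq_neg_one_iff, norm_div, hζ, div_one] at hε
  nlinarith [norm_nonneg (w ε)]

lemma exists_lift {φ : ℂ → ℂ} {ζ q : ℂ} (hφ : HasStrictDerivAt φ q ζ) (hq : q ≠ 0) (x : ℂ) :
    ∃ w : ℝ → ℂ, w 0 = ζ ∧ HasDerivAt w (x / q) 0 ∧ ∀ᶠ δ : ℝ in 𝓝 0, φ (w δ) = φ ζ + δ * x := by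
  have hg := hφ.to_localInverse hq
  have hr := HasStrictFDerivAt.eventually_right_inverse (hφ.hasStrictFDerivAt_equiv hq)
  set g := hφ.localInverse φ q ζ hq with hgdef
  have hg0 : g (φ ζ) = ζ := HasStrictFDerivAt.localInverse_apply_image
    (hφ.hasStrictFDerivAt_equiv hq)
  have hl : HasDerivAt (fun δ : ℝ => φ ζ + δ * x) x 0 := by
    simpa using (((hasDerivAt_id (0 : ℝ)).ofReal_comp).mul_const x).const_add (φ ζ)
  have hl0 : φ ζ + ((0 : ℝ) : ℂ) * x = φ ζ := by simp
  refine ⟨fun δ => g (φ ζ + δ * x), by simp [hg0], ?_, ?_⟩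
  · have h1 : HasDerivAt g q⁻¹ (φ ζ + ((0 : ℝ) : ℂ) * x) := by rw [hl0]; exact hg.hasDerivAt
    refine (h1.comp (0 : ℝ) hl).congr_deriv ?_
    rw [div_eq_inv_mul]
  · have hc : Tendsto (fun δ : ℝ => φ ζ + δ * x) (𝓝 0) (𝓝 (φ ζ)) := by
      have := hl.continuousAt.tendsto
      rwa [hl0] at this
    exact hc.eventually hr

/-- The local inverse has derivative `1/F'(ζ)`; the lifted segment enters the disc when its initial
direction has negative component along the outward normal `ζ`. An open half-plane of directions is
reachable. -/
lemma mem_reachableDirections_of_regular {F : ℂ → ℂ} {ζ v : ℂ} (hF : AnalyticAt ℂ F ζ)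
    (h' : deriv F ζ ≠ 0) (hζ : ‖ζ‖ = 1) (hv : (v / (deriv F ζ * ζ)).re < 0) :
    v ∈ reachableDirections F ζ := by
  obtain ⟨w, h0, hw, hwF⟩ := exists_lift hF.hasStrictDerivAt h' v
  intro N hN
  have h1 := eventually_norm_lt_one hw h0 hζ (by rwa [div_div])
  have h2 : ∀ᶠ ε in 𝓝 (0 : ℝ), w ε ∈ N := hw.continuousAt.tendsto.eventually (h0 ▸ hN)
  filter_upwards [h1, nhdsWithin_le_nhds h2, nhdsWithin_le_nhds hwF] with ε e1 e2 e3
  exact ⟨w ε, e2, e1, e3⟩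

lemma exists_sq_eq_of_slitPlane {z : ℂ} (hz : z ∈ Complex.slitPlane) :
    ∃ r : ℂ, r ^ 2 = z ∧ 0 < r.re := by
  have h1 : (z ^ ((2 : ℕ)⁻¹ : ℂ)) ^ 2 = z := Complex.cpow_nat_inv_pow z two_ne_zero
  set r := z ^ ((2 : ℕ)⁻¹ : ℂ)
  have hre : r.re ≠ 0 := by
    intro h
    rw [← h1, Complex.mem_slitPlane_iff, pow_two, Complex.mul_re, Complex.mul_im, h] at hz
    simp only [mul_zero, zero_mul, zero_sub, add_zero, ne_eq, not_true_eq_false, or_false] at hz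
    nlinarith [mul_self_nonneg r.im]
  rcases lt_or_gt_of_ne hre with h | h
  · exact ⟨-r, by rw [neg_sq, h1], by simpa using h⟩
  · exact ⟨r, h1, h⟩

/-- At a simple critical point `F - F ζ` is the square of a local coordinate `ψ`. The inward
half-plane of directions for `ψ` squares onto a slit plane, so every direction is reachable except
possibly those on one ray. -/
lemma exists_reachableDirections_of_cusp {F : ℂ → ℂ} {ζ : ℂ} (hF : AnalyticAt ℂ F ζ)
    (h' : deriv F ζ = 0) (h'' : deriv (deriv F) ζ ≠ 0) (hζ : ‖ζ‖ = 1) :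
    ∃ Q ≠ 0, ∀ v, v / Q ∈ Complex.slitPlane → v ∈ reachableDirections F ζ := by
  have hζ0 : ζ ≠ 0 := norm_pos_iff.1 (by rw [hζ]; exact one_pos)
  have o1 : analyticOrderAt (deriv F) ζ = 1 := by
    have := hF.deriv.analyticOrderAt_deriv_add_one
    rw [hF.deriv.deriv.analyticOrderAt_eq_zero.2 h''] at this
    simpa [h'] using this.symm
  have o2 : analyticOrderAt (fun z => F z - F ζ) ζ = (2 : ℕ) := by
    rw [← hF.analyticOrderAt_deriv_add_one, o1]; norm_num
  obtain ⟨g, hg, hg0, hFg⟩ := (hF.sub analyticAt_const).analyticOrderAt_eq_natCast.1 o2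
  set q := (g ζ) ^ ((2 : ℕ)⁻¹ : ℂ)
  have hq2 : q ^ 2 = g ζ := Complex.cpow_nat_inv_pow _ two_ne_zero
  have hq0 : q ≠ 0 := by
    intro h
    rw [h, zero_pow two_ne_zero] at hq2
    exact hg0 hq2.symm
  -- Dividing by `g ζ` keeps the base of the complex power close to `1`, away from the cut.
  set ψ : ℂ → ℂ := fun z => (z - ζ) * (q * (g z / g ζ) ^ ((2 : ℕ)⁻¹ : ℂ)) with hψ
  have hroot : AnalyticAt ℂ (fun z => q * (g z / g ζ) ^ ((2 : ℕ)⁻¹ : ℂ)) ζ := by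
    refine analyticAt_const.mul ((hg.div analyticAt_const hg0).cpow analyticAt_const ?_)
    rw [Pi.div_apply, div_self hg0]
    exact Complex.one_mem_slitPlane
  have hψa : AnalyticAt ℂ ψ ζ := (analyticAt_id.sub analyticAt_const).mul hroot
  have hψd : deriv ψ ζ = q := by
    have h1 := ((hasDerivAt_id ζ).sub_const ζ).mul hroot.differentiableAt.hasDerivAt
    have h2 := h1.deriv
    simp only [id, sub_self, zero_mul, add_zero, one_mul, div_self hg0, Complex.one_cpow,
      mul_one] at h2
    exact h2
  have hsd : HasStrictDerivAt ψ q ζ := hψd ▸ hψa.hasStrictDerivAt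
  have hψ2 : ∀ᶠ z in 𝓝 ζ, F z = F ζ + ψ z ^ 2 := by
    filter_upwards [hFg] with z hz
    rw [hψ, mul_pow, mul_pow, hq2, Complex.cpow_nat_inv_pow _ two_ne_zero, mul_div_cancel₀ _ hg0]
    rw [smul_eq_mul, Pi.sub_apply] at hz
    rw [← hz]
    ring
  refine ⟨q ^ 2 * ζ ^ 2, mul_ne_zero (pow_ne_zero _ hq0) (pow_ne_zero _ hζ0), fun v hv N hN => ?_⟩
  obtain ⟨r, hr, hr0⟩ := exists_sq_eq_of_slitPlane hv
  obtain ⟨w, h0, hw, hwψ⟩ := exists_lift hsd hq0 (-r * (q * ζ))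
  have h1 := eventually_norm_lt_one hw h0 hζ (by
    rw [div_div, mul_div_assoc, div_self (mul_ne_zero hq0 hζ0), mul_one]
    simpa using hr0)
  have hwc : Tendsto w (𝓝 0) (𝓝 ζ) := h0 ▸ hw.continuousAt.tendsto
  have h2 : ∀ᶠ δ in 𝓝[>] (0 : ℝ), ∃ u ∈ N, ‖u‖ < 1 ∧ F u = F ζ + ((δ ^ 2 : ℝ) : ℂ) * v := by
    filter_upwards [h1, nhdsWithin_le_nhds (hwc.eventually hN), nhdsWithin_le_nhds hwψ,
      nhdsWithin_le_nhds (hwc.eventually hψ2)] with δ e1 e2 e3 e4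
    refine ⟨w δ, e2, e1, ?_⟩
    rw [e4, e3, show ψ ζ = 0 by rw [hψ]; simp, zero_add]
    rw [eq_div_iff (mul_ne_zero (pow_ne_zero _ hq0) (pow_ne_zero _ hζ0))] at hr
    rw [← hr]
    push_cast
    ring
  -- A step `δ` of the coordinate `ψ` gives a displacement `δ²` of `F`, so `δ = √ε`.
  have h3 : Tendsto Real.sqrt (𝓝[>] 0) (𝓝[>] 0) := by
    refine tendsto_nhdsWithin_iff.2 ⟨tendsto_nhdsWithin_of_tendsto_nhds ?_, ?_⟩
    · simpa using Real.continuous_sqrt.tendsto 0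
    · filter_upwards [self_mem_nhdsWithin] with ε hε
      exact Real.sqrt_pos.2 hε
  filter_upwards [h3.eventually h2, self_mem_nhdsWithin] with ε hε (hε0 : 0 < ε)
  rwa [Real.sq_sqrt hε0.le] at hε

/-- `F` is univalent in the unit disc, possibly punctured at the origin, and analytic on the
circle. -/
structure IsUnivalentUpToCircle (F : ℂ → ℂ) (Dm : Set ℂ) : Prop where
  isOpen : IsOpen Dm
  isPreconnected : IsPreconnected Dm
  subset : Dm ⊆ Metric.ball 0 1
  punctured : ∀ w : ℂ, w ≠ 0 → ‖w‖ < 1 → w ∈ Dm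
  analytic : AnalyticOnNhd ℂ F (Dm ∪ Metric.sphere 0 1)
  injOn : InjOn F Dm
  isClosed : IsClosed (F '' (Dm ∪ Metric.sphere 0 1))

namespace IsUnivalentUpToCircle

variable {F : ℂ → ℂ} {Dm : Set ℂ}

lemma analyticAt (hF : IsUnivalentUpToCircle F Dm) {ζ : ℂ} (hζ : ‖ζ‖ = 1) : AnalyticAt ℂ F ζ :=
  hF.analytic ζ (.inr (by simpa using hζ))

lemma isOpen_image (hF : IsUnivalentUpToCircle F Dm) {S : Set ℂ} (hS : S ⊆ Dm) (hSo : IsOpen S) :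
    IsOpen (F '' S) := by
  rcases (hF.analytic.mono subset_union_left).is_constant_or_isOpen hF.isPreconnected with
    ⟨w, hw⟩ | h
  · have h1 : (1 / 2 : ℂ) ∈ Dm := hF.punctured _ (by norm_num) (by norm_num)
    have h2 : (1 / 3 : ℂ) ∈ Dm := hF.punctured _ (by norm_num) (by norm_num)
    have := hF.injOn h1 h2 ((hw _ h1).trans (hw _ h2).symm)
    norm_num at this
  · exact h S hS hSo

lemma frequently_disc {ζ : ℂ} (hζ : ‖ζ‖ = 1) : ∃ᶠ w in 𝓝 ζ, w ≠ 0 ∧ ‖w‖ < 1 := by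
  have h1 : ζ ∈ closure (Metric.ball (0 : ℂ) 1) := by
    rw [closure_ball _ one_ne_zero]; simp [hζ]
  have h2 : ∀ᶠ w in 𝓝 ζ, w ≠ 0 := isOpen_ne.mem_nhds (norm_pos_iff.1 (by rw [hζ]; exact one_pos))
  refine ((mem_closure_iff_frequently.1 h1).and_eventually h2).mono fun w hw => ⟨hw.2, ?_⟩
  simpa using hw.1

/-- If a boundary value were attained at an interior point `w`, the open image of a neighbourhood of
`w` would contain values of `F` at interior points near `ζ`, against injectivity. -/
lemma notMem_image (hF : IsUnivalentUpToCircle F Dm) {ζ : ℂ} (hζ : ‖ζ‖ = 1) : F ζ ∉ F '' Dm := by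
  rintro ⟨w, hw, hwζ⟩
  have hne : w ≠ ζ := by
    rintro rfl
    have := hF.subset hw
    simp [hζ] at this
  obtain ⟨A, B, hA, hB, hwA, hζB, hAB⟩ := t2_separation hne
  have h1 : F '' (Dm ∩ A) ∈ 𝓝 (F ζ) :=
    (hF.isOpen_image inter_subset_left (hF.isOpen.inter hA)).mem_nhds ⟨w, ⟨hw, hwA⟩, hwζ⟩
  have h2 := (hF.analyticAt hζ).continuousAt.eventually h1
  obtain ⟨x, hx, ⟨y, hy, hyx⟩, hxB⟩ :=
    ((frequently_disc hζ).and_eventually (h2.and (hB.mem_nhds hζB))).exists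
  have := hF.injOn hy.1 (hF.punctured x hx.1 hx.2) hyx
  exact disjoint_left.1 hAB hy.2 (this ▸ hxB)

lemma disjoint_reachable (hF : IsUnivalentUpToCircle F Dm) {ζ ζ' : ℂ} (hζ : ‖ζ‖ = 1)
    (hζ' : ‖ζ'‖ = 1) (hne : ζ ≠ ζ') (heq : F ζ = F ζ') {v : ℂ} (h : v ∈ reachableDirections F ζ)
    (h' : v ∈ reachableDirections F ζ') : False := by
  obtain ⟨A, B, hA, hB, hζA, hζB, hAB⟩ := t2_separation hne
  have h0 : ∀ {ζ : ℂ}, ‖ζ‖ = 1 → {w : ℂ | w ≠ 0} ∈ 𝓝 ζ := fun h =>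
    isOpen_ne.mem_nhds (norm_pos_iff.1 (by rw [h]; exact one_pos))
  obtain ⟨ε, ⟨w, hw, hw1, hwF⟩, w', hw', hw1', hwF'⟩ :=
    ((h _ (inter_mem (hA.mem_nhds hζA) (h0 hζ))).and
      (h' _ (inter_mem (hB.mem_nhds hζB) (h0 hζ')))).exists
  have := hF.injOn (hF.punctured w hw.2 hw1) (hF.punctured w' hw'.2 hw1')
    (hwF.trans ((congrArg (· + (ε : ℂ) * v) heq).trans hwF'.symm))
  exact disjoint_left.1 hAB hw.1 (this ▸ hw'.1)

/-- At a double point the curve is regular and its two branches have opposite normals. -/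
lemma opposite (hF : IsUnivalentUpToCircle F Dm)
    (hsimple : ∀ ζ, ‖ζ‖ = 1 → deriv F ζ = 0 → deriv (deriv F) ζ ≠ 0) {ζ ζ' : ℂ} (hζ : ‖ζ‖ = 1)
    (hζ' : ‖ζ'‖ = 1) (hne : ζ ≠ ζ') (heq : F ζ = F ζ') :
    deriv F ζ ≠ 0 ∧ deriv F ζ' ≠ 0 ∧
      ∃ r : ℝ, 0 < r ∧ deriv F ζ * ζ = -r * (deriv F ζ' * ζ') := by
  have hdis := fun {v} => hF.disjoint_reachable hζ hζ' hne heq (v := v)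
  have hz : ∀ {ζ : ℂ}, ‖ζ‖ = 1 → ζ ≠ 0 := fun h => norm_pos_iff.1 (by rw [h]; exact one_pos)
  have hslit : ∀ {z : ℂ}, z.im ≠ 0 → z ∈ Complex.slitPlane := fun h => .inr h
  have hreal : ∀ {z : ℂ}, z ∉ Complex.slitPlane → z.im = 0 := fun h => by
    by_contra h'; exact h (.inr h')
  -- A half-plane and a slit plane always meet: the two directions `N(-1 ± i)` are not parallel, so
  -- they cannot both lie on the excluded ray.
  have hexcl : ∀ {ζ₁ ζ₂ : ℂ}, ‖ζ₁‖ = 1 → ‖ζ₂‖ = 1 → deriv F ζ₁ = 0 → deriv F ζ₂ ≠ 0 →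
      ∃ v, v ∈ reachableDirections F ζ₁ ∧ v ∈ reachableDirections F ζ₂ := by
    intro ζ₁ ζ₂ h₁ h₂ hd₁ hd₂
    obtain ⟨Q, hQ, hQv⟩ := exists_reachableDirections_of_cusp (hF.analyticAt h₁) hd₁
      (hsimple _ h₁ hd₁) h₁
    set N := deriv F ζ₂ * ζ₂ with hN
    have hN0 : N ≠ 0 := mul_ne_zero hd₂ (hz h₂)
    have hr : ∀ x : ℂ, x.re < 0 → N * x ∈ reachableDirections F ζ₂ := fun x hx =>
      mem_reachableDirections_of_regular (hF.analyticAt h₂) hd₂ h₂ (by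
        rwa [← hN, mul_div_cancel_left₀ _ hN0])
    by_contra! hno
    have h1 := hreal fun h => hno _ (hQv _ h) (hr (-1 + Complex.I) (by simp))
    have h2 := hreal fun h => hno _ (hQv _ h) (hr (-1 - Complex.I) (by simp))
    have e1 : N * (-1 + Complex.I) / Q = (N / Q) * (-1 + Complex.I) := by ring
    have e2 : N * (-1 - Complex.I) / Q = (N / Q) * (-1 - Complex.I) := by ring
    rw [e1] at h1
    rw [e2] at h2
    simp only [Complex.mul_im, Complex.add_re, Complex.add_im, Complex.neg_re, Complex.neg_im,
      Complex.one_re, Complex.one_im, Complex.I_re, Complex.I_im, Complex.sub_re,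
      Complex.sub_im] at h1 h2
    have h3 : N / Q = 0 := Complex.ext (by simp; linarith) (by simp; linarith)
    exact div_ne_zero hN0 hQ h3
  have hreg : deriv F ζ ≠ 0 ∧ deriv F ζ' ≠ 0 := by
    by_cases h1 : deriv F ζ = 0 <;> by_cases h2 : deriv F ζ' = 0
    · obtain ⟨Q, hQ, hQv⟩ := exists_reachableDirections_of_cusp (hF.analyticAt hζ) h1
        (hsimple _ hζ h1) hζ
      obtain ⟨Q', hQ', hQv'⟩ := exists_reachableDirections_of_cusp (hF.analyticAt hζ') h2
        (hsimple _ hζ' h2) hζ'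
      exfalso
      -- Two slit planes always meet: if `Q` lies on the cut of the second one, the cuts are
      -- collinear and `Q(1 + i)` avoids both.
      by_cases h3 : Q / Q' ∈ Complex.slitPlane
      · exact hdis (hQv Q (by rw [div_self hQ]; exact Complex.one_mem_slitPlane)) (hQv' Q h3)
      · refine hdis (hQv (Q * (1 + Complex.I)) (hslit ?_)) (hQv' (Q * (1 + Complex.I)) (hslit ?_))
        · rw [mul_div_cancel_left₀ _ hQ]; simp
        · rw [mul_div_right_comm]
          have h4 := hreal h3
          have h5 : (Q / Q').re ≠ 0 := fun h => div_ne_zero hQ hQ' (Complex.ext h h4)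
          simpa [Complex.mul_im, h4] using h5
    · obtain ⟨v, hv, hv'⟩ := hexcl hζ hζ' h1 h2
      exact (hdis hv hv').elim
    · obtain ⟨v, hv, hv'⟩ := hexcl hζ' hζ h2 h1
      exact (hdis hv' hv).elim
    · exact ⟨h1, h2⟩
  refine ⟨hreg.1, hreg.2, ?_⟩
  set N := deriv F ζ * ζ with hN
  set N' := deriv F ζ' * ζ' with hN'
  have hN0 : N ≠ 0 := mul_ne_zero hreg.1 (hz hζ)
  have hN0' : N' ≠ 0 := mul_ne_zero hreg.2 (hz hζ')
  have hp := norm_pos_iff.2 hN0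
  have hp' := norm_pos_iff.2 hN0'
  set n : ℂ := N / ‖N‖ with hn
  set n' : ℂ := N' / ‖N'‖ with hn'
  have en : N = ‖N‖ * n := by rw [hn, mul_div_cancel₀]; exact_mod_cast hp.ne'
  have en' : N' = ‖N'‖ * n' := by rw [hn', mul_div_cancel₀]; exact_mod_cast hp'.ne'
  have un : ‖n‖ = 1 := by rw [hn, norm_div, Complex.norm_real, norm_norm, div_self hp.ne']
  have un' : ‖n'‖ = 1 := by rw [hn', norm_div, Complex.norm_real, norm_norm, div_self hp'.ne']
  by_cases hopp : n = -n'
  · refine ⟨‖N‖ / ‖N'‖, div_pos hp hp', ?_⟩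
    calc N = ‖N‖ * -n' := by rw [← hopp]; exact en
      _ = -((‖N‖ / ‖N'‖ : ℝ) : ℂ) * N' := by rw [hn']; push_cast; ring
  · exfalso
    have hn0 : n ≠ 0 := norm_pos_iff.1 (by rw [un]; exact one_pos)
    have hn0' : n' ≠ 0 := norm_pos_iff.1 (by rw [un']; exact one_pos)
    have hre : ∀ {x y : ℂ}, ‖x‖ = 1 → ‖y‖ = 1 → x ≠ -y → 0 < (1 + x / y).re := by
      intro x y hx hy hxy
      have hy0 : y ≠ 0 := norm_pos_iff.1 (by rw [hy]; exact one_pos)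
      have h1 : ‖x / y‖ = 1 := by rw [norm_div, hx, hy, div_one]
      have h2 : x / y ≠ -1 := by rw [Ne, div_eq_iff hy0]; simpa using hxy
      have h3 := Complex.sq_norm (x / y)
      rw [h1, Complex.normSq_apply] at h3
      by_contra! h4
      rw [Complex.add_re, Complex.one_re] at h4
      have h5 : (x / y).re = -1 := by nlinarith [mul_self_nonneg (x / y).im]
      have h6 : (x / y).im = 0 := by nlinarith
      exact h2 (Complex.ext (by simpa using h5) (by simpa using h6))
    -- Two open half-planes whose unit normals are not opposite have the direction `-(n + n')` in
    -- common.
    refine hdis (v := -(n + n')) (mem_reachableDirections_of_regular (hF.analyticAt hζ) hreg.1 hζ ?_)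
      (mem_reachableDirections_of_regular (hF.analyticAt hζ') hreg.2 hζ' ?_)
    · rw [← hN, en, show -(n + n') / (‖N‖ * n) = ((-(‖N‖)⁻¹ : ℝ) : ℂ) * (1 + n' / n) by
        push_cast; field_simp, Complex.re_ofReal_mul]
      have := hre un' un (fun h => hopp (by rw [h, neg_neg]))
      have h7 := inv_pos.2 hp
      nlinarith
    · rw [← hN', en', show -(n + n') / (‖N'‖ * n') = ((-(‖N'‖)⁻¹ : ℝ) : ℂ) * (1 + n / n') by
        push_cast; field_simp; ring, Complex.re_ofReal_mul]
      have := hre un un' hopp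
      have h7 := inv_pos.2 hp'
      nlinarith

end IsUnivalentUpToCircle

/-! ### Polar form of the derivative along the circle; a univalent map gives a turning loop. -/

lemma circlePoint_ne_zero (t : ℝ) : circlePoint t ≠ 0 := Complex.exp_ne_zero _

lemma circlePoint_arg {ζ : ℂ} (hζ : ‖ζ‖ = 1) : circlePoint ζ.arg = ζ := by
  have := Complex.norm_mul_exp_arg_mul_I ζ
  rwa [hζ, Complex.ofReal_one, one_mul] at this

lemma exists_circlePoint {ζ : ℂ} (hζ : ‖ζ‖ = 1) :
    ∃ t ∈ Ico 0 (2 * Real.pi), circlePoint t = ζ := by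
  have hp : 0 < 2 * Real.pi := by positivity
  refine ⟨toIcoMod hp 0 ζ.arg, by simpa using toIcoMod_mem_Ico hp 0 ζ.arg, ?_⟩
  rw [← circlePoint_arg hζ]
  refine circlePoint_eq_iff.2 ⟨-toIcoDiv hp 0 ζ.arg, ?_⟩
  rw [circlePoint_arg hζ]
  simp only [toIcoMod, zsmul_eq_mul]
  push_cast
  ring

lemma hasDerivAt_circlePoint (t : ℝ) : HasDerivAt circlePoint (circlePoint t * Complex.I) t := by
  have h := hasDerivAt_turningDir 1 1 t
  have e : turningDir 1 1 = circlePoint := by ext; simp [turningDir]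
  rw [e] at h
  exact h.congr_deriv (by push_cast; ring)

/-- Half-angle factorization: the source of the constant turning rate `1/2` per critical point on
the circle. -/
lemma one_sub_circlePoint (u : ℝ) :
    1 - circlePoint u = -2 * Complex.I * circlePoint (u / 2) * (Real.sin (u / 2) : ℝ) := by
  have h1 : circlePoint u = circlePoint (u / 2) * circlePoint (u / 2) := by
    rw [← circlePoint_add, add_halves]
  have h2 : (Real.cos (u / 2) : ℂ) ^ 2 + (Real.sin (u / 2) : ℂ) ^ 2 = 1 := by
    exact_mod_cast Real.cos_sq_add_sin_sq (u / 2)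
  rw [h1, circlePoint_eq_cos_sin]
  linear_combination -h2 + (Real.sin (u / 2) : ℂ) ^ 2 * Complex.I_sq

lemma circlePoint_zpow (t : ℝ) (m : ℤ) : circlePoint t ^ m = circlePoint (m * t) := by
  rw [circlePoint, circlePoint, ← Complex.exp_int_mul]
  push_cast
  ring_nf

section

variable {F : ℂ → ℂ} {Dm : Set ℂ} {E : Finset ℂ} {C : ℂ} {m : ℤ}

/-- The constant factor in the polar form of the derivative along the circle. -/
noncomputable def polarConst (E : Finset ℂ) (C : ℂ) : ℂ :=
  C * Complex.I * ∏ η ∈ E, (-2 * Complex.I * circlePoint (-η.arg / 2))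

/-- The signed speed of the image of the circle. -/
noncomputable def polarSpeed (E : Finset ℂ) (C : ℂ) (t : ℝ) : ℝ :=
  ‖polarConst E C‖ * ∏ η ∈ E, Real.sin ((t - η.arg) / 2)

lemma polarConst_ne_zero (hC : C ≠ 0) : polarConst E C ≠ 0 := by
  refine mul_ne_zero (mul_ne_zero hC Complex.I_ne_zero) (Finset.prod_ne_zero_iff.2 fun η _ => ?_)
  exact mul_ne_zero (mul_ne_zero (by norm_num) Complex.I_ne_zero) (circlePoint_ne_zero _)

/-- Every factor `1 - ζ/η` is a constant times `exp (it/2)` times a real sine, and `ζ ^ m`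
contributes `exp (imt)`. All phases therefore combine into a single exponential with rate `m +
|E|/2`. -/
lemma polar_form (hE : ∀ η ∈ E, ‖η‖ = 1) (hC : C ≠ 0)
    (hform : ∀ ζ, ‖ζ‖ = 1 → ζ * deriv F ζ = C * ζ ^ m * ∏ η ∈ E, (1 - ζ / η)) (t : ℝ) :
    deriv F (circlePoint t) * (circlePoint t * Complex.I) =
      turningDir (m + E.card / 2) (polarConst E C / ‖polarConst E C‖) t * polarSpeed E C t := by
  have hK : (‖polarConst E C‖ : ℂ) ≠ 0 := by
    exact_mod_cast (norm_pos_iff.2 (polarConst_ne_zero hC)).ne'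
  have h1 : ∀ η ∈ E, 1 - circlePoint t / η = -2 * Complex.I * circlePoint (-η.arg / 2) *
      (circlePoint (t / 2) * (Real.sin ((t - η.arg) / 2) : ℝ)) := by
    intro η hη
    have h2 : circlePoint t / η = circlePoint (t - η.arg) := by
      rw [div_eq_iff (norm_pos_iff.1 (by rw [hE η hη]; exact one_pos))]
      conv_lhs => rw [show t = (t - η.arg) + η.arg by ring, circlePoint_add,
        circlePoint_arg (hE η hη)]
    rw [h2, one_sub_circlePoint, show (t - η.arg) / 2 = -η.arg / 2 + t / 2 by ring, circlePoint_add]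
    ring
  have h3 : circlePoint ((m + E.card / 2) * t) = circlePoint (m * t) * circlePoint (t / 2) ^ E.card := by
    rw [← zpow_natCast, circlePoint_zpow, ← circlePoint_add]
    congr 1
    push_cast
    ring
  calc deriv F (circlePoint t) * (circlePoint t * Complex.I)
      = (circlePoint t * deriv F (circlePoint t)) * Complex.I := by ring
    _ = C * circlePoint (m * t) * (∏ η ∈ E, (-2 * Complex.I * circlePoint (-η.arg / 2) *
        (circlePoint (t / 2) * (Real.sin ((t - η.arg) / 2) : ℝ)))) * Complex.I := by
      rw [hform _ (norm_circlePoint t), Finset.prod_congr rfl h1, circlePoint_zpow]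
    _ = _ := by
      have h4 : ∏ η ∈ E, (-2 * Complex.I * circlePoint (-η.arg / 2) *
          (circlePoint (t / 2) * (Real.sin ((t - η.arg) / 2) : ℝ))) =
          (∏ η ∈ E, (-2 * Complex.I * circlePoint (-η.arg / 2))) * (circlePoint (t / 2) ^ E.card *
          ∏ η ∈ E, ((Real.sin ((t - η.arg) / 2) : ℝ) : ℂ)) := by
        rw [Finset.prod_mul_distrib]
        congr 1
        rw [Finset.prod_mul_distrib, Finset.prod_const]
      rw [h4, turningDir, h3, polarSpeed]
      push_cast
      rw [show polarConst E C / ‖polarConst E C‖ * (circlePoint (m * t) *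
        circlePoint (t / 2) ^ E.card) * (‖polarConst E C‖ *
        ∏ η ∈ E, Complex.sin ((t - η.arg) / 2)) = polarConst E C * (circlePoint (m * t) *
        circlePoint (t / 2) ^ E.card) * ∏ η ∈ E, Complex.sin ((t - η.arg) / 2) by
          field_simp, polarConst]
      ring

lemma sin_half_eq_zero_iff {η : ℂ} (hη : ‖η‖ = 1) {t : ℝ} :
    Real.sin ((t - η.arg) / 2) = 0 ↔ circlePoint t = η := by
  conv_rhs => rw [← circlePoint_arg hη]
  rw [Real.sin_eq_zero_iff, circlePoint_eq_iff]
  refine exists_congr fun n => ⟨fun h => by linarith, fun h => by rw [h]; ring⟩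

lemma polarSpeed_eq_zero_iff (hE : ∀ η ∈ E, ‖η‖ = 1) (hC : C ≠ 0) {t : ℝ} :
    polarSpeed E C t = 0 ↔ circlePoint t ∈ E := by
  rw [polarSpeed, mul_eq_zero, or_iff_right (norm_pos_iff.2 (polarConst_ne_zero hC)).ne',
    Finset.prod_eq_zero_iff]
  constructor
  · rintro ⟨η, hη, h⟩
    rwa [(sin_half_eq_zero_iff (hE η hη)).1 h]
  · exact fun h => ⟨_, h, (sin_half_eq_zero_iff (hE _ h)).2 rfl⟩

lemma contDiff_polarSpeed : ContDiff ℝ (⊤ : ℕ∞) (polarSpeed E C) := by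
  unfold polarSpeed
  exact contDiff_const.mul (contDiff_prod fun η _ => by fun_prop)

lemma deriv_polarSpeed_ne_zero (hE : ∀ η ∈ E, ‖η‖ = 1) (hC : C ≠ 0) {t : ℝ}
    (ht : polarSpeed E C t = 0) : deriv (polarSpeed E C) t ≠ 0 := by
  classical
  have hmem := (polarSpeed_eq_zero_iff hE hC).1 ht
  set η := circlePoint t
  have hη := hE η hmem
  have hsplit : polarSpeed E C = fun t => Real.sin ((t - η.arg) / 2) *
      (‖polarConst E C‖ * ∏ ξ ∈ E.erase η, Real.sin ((t - ξ.arg) / 2)) := by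
    ext t
    rw [polarSpeed, ← Finset.mul_prod_erase E _ hmem]
    ring
  have hrest : ‖polarConst E C‖ * ∏ ξ ∈ E.erase η, Real.sin ((t - ξ.arg) / 2) ≠ 0 := by
    refine mul_ne_zero (norm_pos_iff.2 (polarConst_ne_zero hC)).ne'
      (Finset.prod_ne_zero_iff.2 fun ξ hξ h => ?_)
    rw [Finset.mem_erase] at hξ
    exact hξ.1 ((sin_half_eq_zero_iff (hE ξ hξ.2)).1 h).symm
  have hs0 : Real.sin ((t - η.arg) / 2) = 0 := (sin_half_eq_zero_iff hη).2 rfl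
  have h1 : HasDerivAt (fun t => Real.sin ((t - η.arg) / 2))
      (Real.cos ((t - η.arg) / 2) * (1 / 2)) t :=
    (((hasDerivAt_id t).sub_const η.arg).div_const 2).sin
  have h2 : DifferentiableAt ℝ (fun t => ‖polarConst E C‖ *
      ∏ ξ ∈ E.erase η, Real.sin ((t - ξ.arg) / 2)) t :=
    ((contDiff_const.mul (contDiff_prod fun η _ => by fun_prop) :
      ContDiff ℝ (⊤ : ℕ∞) _).differentiable (by simp)).differentiableAt
  obtain ⟨x, h3⟩ : ∃ x, HasDerivAt (polarSpeed E C) (Real.cos ((t - η.arg) / 2) * (1 / 2) *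
      (‖polarConst E C‖ * ∏ ξ ∈ E.erase η, Real.sin ((t - ξ.arg) / 2)) +
      Real.sin ((t - η.arg) / 2) * x) t := by
    rw [hsplit]
    exact ⟨_, h1.mul h2.hasDerivAt⟩
  rw [h3.deriv, hs0, zero_mul, add_zero]
  refine mul_ne_zero (mul_ne_zero ?_ (by norm_num)) hrest
  intro hc
  have := Real.sin_sq_add_cos_sq ((t - η.arg) / 2)
  rw [hs0, hc] at this
  norm_num at this

lemma hasDerivAt_comp_circlePoint {f : ℂ → ℂ} {t : ℝ} (hf : DifferentiableAt ℂ f (circlePoint t)) :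
    HasDerivAt (fun t => f (circlePoint t)) (deriv f (circlePoint t) * (circlePoint t * Complex.I))
      t :=
  hf.hasDerivAt.comp t (hasDerivAt_circlePoint t)

lemma deriv_eq_zero_iff (hE : ∀ η ∈ E, ‖η‖ = 1) (hC : C ≠ 0)
    (hform : ∀ ζ, ‖ζ‖ = 1 → ζ * deriv F ζ = C * ζ ^ m * ∏ η ∈ E, (1 - ζ / η)) {ζ : ℂ}
    (hζ : ‖ζ‖ = 1) : deriv F ζ = 0 ↔ ζ ∈ E := by
  have h0 : ∀ {ζ : ℂ}, ‖ζ‖ = 1 → ζ ≠ 0 := fun h => norm_pos_iff.1 (by rw [h]; exact one_pos)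
  have h1 : deriv F ζ = 0 ↔ ζ * deriv F ζ = 0 := by simp [h0 hζ]
  rw [h1, hform ζ hζ, mul_eq_zero, or_iff_right (mul_ne_zero hC (zpow_ne_zero _ (h0 hζ))),
    Finset.prod_eq_zero_iff]
  refine ⟨fun ⟨η, hη, h⟩ => ?_, fun h => ⟨ζ, h, by rw [div_self (h0 hζ), sub_self]⟩⟩
  rw [sub_eq_zero, eq_comm, div_eq_one_iff_eq (h0 (hE η hη))] at h
  rwa [h]

/-- Differentiating the polar form at a critical point leaves the direction times the derivative of
the speed. The latter is nonzero because the critical points in `E` are distinct. -/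
lemma IsUnivalentUpToCircle.deriv_deriv_ne_zero (hF : IsUnivalentUpToCircle F Dm)
    (hE : ∀ η ∈ E, ‖η‖ = 1) (hC : C ≠ 0)
    (hform : ∀ ζ, ‖ζ‖ = 1 → ζ * deriv F ζ = C * ζ ^ m * ∏ η ∈ E, (1 - ζ / η)) (ζ : ℂ)
    (hζ : ‖ζ‖ = 1) (h : deriv F ζ = 0) : deriv (deriv F) ζ ≠ 0 := by
  obtain ⟨t, -, rfl⟩ := exists_circlePoint hζ
  have hs : polarSpeed E C t = 0 := (polarSpeed_eq_zero_iff hE hC).2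
    ((deriv_eq_zero_iff hE hC hform hζ).1 h)
  intro h2
  have hA := hF.analyticAt hζ
  have d1 := (hasDerivAt_comp_circlePoint hA.deriv.differentiableAt).mul
    ((hasDerivAt_circlePoint t).mul_const Complex.I)
  rw [h2, h, zero_mul, zero_mul, zero_mul, add_zero] at d1
  have e : (fun t => deriv F (circlePoint t)) * (fun t => circlePoint t * Complex.I) =
      fun t => turningDir (m + E.card / 2) (polarConst E C / ‖polarConst E C‖) t *
        polarSpeed E C t := funext fun t => polar_form hE hC hform t
  rw [e] at d1
  have d2 := (hasDerivAt_turningDir (m + E.card / 2) (polarConst E C / ‖polarConst E C‖) t).mul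
    ((contDiff_polarSpeed (E := E) (C := C)).differentiable (by simp) t).hasDerivAt.ofReal_comp
  have d3 := d1.unique d2
  rw [hs, Complex.ofReal_zero, mul_zero, zero_add, eq_comm, mul_eq_zero] at d3
  rcases d3 with d3 | d3
  · have hK := polarConst_ne_zero (E := E) hC
    rw [turningDir, mul_eq_zero, div_eq_zero_iff] at d3
    rcases d3 with (d3 | d3) | d3
    · exact hK d3
    · exact norm_ne_zero_iff.2 hK (by exact_mod_cast d3)
    · exact circlePoint_ne_zero _ d3
  · exact deriv_polarSpeed_ne_zero hE hC hs (by exact_mod_cast d3)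

lemma range_comp_circlePoint (F : ℂ → ℂ) :
    range (fun t => F (circlePoint t)) = F '' Metric.sphere 0 1 := by
  ext p
  constructor
  · rintro ⟨t, rfl⟩
    exact ⟨_, by simp [norm_circlePoint], rfl⟩
  · rintro ⟨ζ, hζ, rfl⟩
    obtain ⟨t, -, rfl⟩ := exists_circlePoint (by simpa using hζ : ‖ζ‖ = 1)
    exact ⟨t, rfl⟩

/-- The left normal `iγ'` equals `-ζ F'(ζ)`, the image of the inward normal of the disc; hence the
image of the disc lies on the left of the curve. -/
theorem IsUnivalentUpToCircle.turningLoop (hF : IsUnivalentUpToCircle F Dm)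
    (hE : ∀ η ∈ E, ‖η‖ = 1) (hC : C ≠ 0)
    (hform : ∀ ζ, ‖ζ‖ = 1 → ζ * deriv F ζ = C * ζ ^ m * ∏ η ∈ E, (1 - ζ / η))
    (hκ : 0 < (m + E.card / 2 : ℝ)) :
    TurningLoop (m + E.card / 2) (polarConst E C / ‖polarConst E C‖) (polarSpeed E C)
      (fun t => F (circlePoint t)) (F '' Dm) := by
  have hK := polarConst_ne_zero (E := E) hC
  have hvel := polar_form hE hC hform
  refine ⟨hκ, ?_, contDiff_polarSpeed, fun t => ?_, fun t t' h => congrArg F h,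
    fun t ht => deriv_polarSpeed_ne_zero hE hC ht, hF.isOpen_image le_rfl hF.isOpen, ?_,
    fun t => hF.notMem_image (norm_circlePoint t), ?_, fun t ht => ?_, fun t t' h hne => ?_⟩
  · rw [norm_div, Complex.norm_real, norm_norm, div_self (norm_ne_zero_iff.2 hK)]
  · rw [← hvel]
    exact hasDerivAt_comp_circlePoint (hF.analyticAt (norm_circlePoint t)).differentiableAt
  · exact ⟨⟨_, mem_image_of_mem F (hF.punctured (1 / 2) (by norm_num) (by norm_num))⟩,
      hF.isPreconnected.image _ (hF.analytic.mono subset_union_left).continuousOn⟩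
  · rw [range_comp_circlePoint, ← image_union]
    exact hF.isClosed
  · rw [← hvel]
    have hd : deriv F (circlePoint t) ≠ 0 := fun h => ht ((polarSpeed_eq_zero_iff hE hC).2
      ((deriv_eq_zero_iff hE hC hform (norm_circlePoint t)).1 h))
    have h1 := mem_reachableDirections_of_regular (hF.analyticAt (norm_circlePoint t)) hd
      (norm_circlePoint t) (v := Complex.I * (deriv F (circlePoint t) *
        (circlePoint t * Complex.I))) (by
        rw [show Complex.I * (deriv F (circlePoint t) * (circlePoint t * Complex.I)) =
          -1 * (deriv F (circlePoint t) * circlePoint t) by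
            linear_combination Complex.I_sq * (deriv F (circlePoint t) * circlePoint t),
          mul_div_cancel_right₀ _ (mul_ne_zero hd (circlePoint_ne_zero t))]
        simp)
    filter_upwards [h1 {w | w ≠ 0} (isOpen_ne.mem_nhds (circlePoint_ne_zero t))] with ε hε
    obtain ⟨w, hw0, hw, hwF⟩ := hε
    exact ⟨w, hF.punctured w hw0 hw, hwF⟩
  · obtain ⟨h1, h2, r, hr, hopp⟩ := hF.opposite (hF.deriv_deriv_ne_zero hE hC hform)
      (norm_circlePoint t) (norm_circlePoint t') hne h
    have hs : ∀ t, deriv F (circlePoint t) ≠ 0 → polarSpeed E C t ≠ 0 := fun t h h' => h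
      ((deriv_eq_zero_iff hE hC hform (norm_circlePoint t)).2 ((polarSpeed_eq_zero_iff hE hC).1 h'))
    refine ⟨hs t h1, hs t' h2, r, hr, ?_⟩
    rw [← hvel, ← hvel]
    linear_combination Complex.I * hopp

end

/-! ### Critical and double parameters, and their number. -/

/-- A polynomial of degree at most `n` with `n` distinct nonzero roots. -/
lemma eval_eq_prod_of_roots {Q : Polynomial ℂ} {E : Finset ℂ} (hdeg : Q.natDegree ≤ E.card)
    (h0 : (0 : ℂ) ∉ E) (hE : ∀ η ∈ E, Q.eval η = 0) (z : ℂ) :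
    Q.eval z = Q.coeff 0 * ∏ η ∈ E, (1 - z / η) := by
  classical
  have hne : ∀ η ∈ E, η ≠ 0 := fun η hη h => h0 (h ▸ hη)
  set R : Polynomial ℂ := Q - Polynomial.C (Q.coeff 0) *
    ∏ η ∈ E, (1 - Polynomial.C η⁻¹ * Polynomial.X) with hR
  have heval : ∀ x, R.eval x = Q.eval x - Q.coeff 0 * ∏ η ∈ E, (1 - x / η) := by
    intro x
    simp only [hR, Polynomial.eval_sub, Polynomial.eval_mul, Polynomial.eval_C,
      Polynomial.eval_prod, Polynomial.eval_one, Polynomial.eval_X]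
    congr 2
    exact Finset.prod_congr rfl fun η _ => by rw [div_eq_inv_mul]
  have hRdeg : R.natDegree ≤ E.card := by
    refine (Polynomial.natDegree_sub_le _ _).trans (max_le hdeg ?_)
    refine (Polynomial.natDegree_C_mul_le _ _).trans ?_
    refine (Polynomial.natDegree_prod_le _ _).trans ?_
    rw [Finset.card_eq_sum_ones]
    refine Finset.sum_le_sum fun η _ => ?_
    refine (Polynomial.natDegree_sub_le _ _).trans (max_le (by simp) ?_)
    exact (Polynomial.natDegree_C_mul_le _ _).trans Polynomial.natDegree_X_le
  -- The difference vanishes on `E` and at `0`, one point more than its degree allows.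
  have hzero : R = 0 := by
    refine Polynomial.eq_zero_of_natDegree_lt_card_of_eval_eq_zero' R (insert 0 E) (fun x hx => ?_)
      (by rw [Finset.card_insert_of_notMem h0]; omega)
    rw [heval]
    rcases Finset.mem_insert.1 hx with rfl | hx
    · rw [Polynomial.coeff_zero_eq_eval_zero]; simp
    · rw [hE x hx, Finset.prod_eq_zero hx (by rw [div_self (hne x hx), sub_self]), mul_zero, sub_zero]
  have := heval z
  rw [hzero, Polynomial.eval_zero] at this
  linear_combination -this

lemma enat_eq_of_add_eq {x : ℕ∞} {n k : ℕ} (h : x + k = (n + k : ℕ)) : x = n := by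
  induction x using ENat.recTopCoe with
  | top => exact absurd h.symm (by rw [top_add]; exact ENat.natCast_ne_top _)
  | coe m =>
    norm_cast at h ⊢
    omega

namespace IsUnivalentUpToCircle

variable {F : ℂ → ℂ} {Dm : Set ℂ} {E : Finset ℂ} {C : ℂ} {m : ℤ}

/-- The critical points on the circle, if there are as many cusps as the degree allows. -/
lemma exists_critical_finset {Q : Polynomial ℂ} {n : ℕ} (hQ0 : Q.coeff 0 ≠ 0)
    (hQn : Q.natDegree ≤ n) (hQ : ∀ ζ, ‖ζ‖ = 1 → ζ * deriv F ζ = ζ ^ m * Q.eval ζ)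
    (hcusp : (cuspPoints F).encard = n) : ∃ E : Finset ℂ, (∀ η ∈ E, ‖η‖ = 1) ∧ E.card = n ∧
      ∀ ζ, ‖ζ‖ = 1 → ζ * deriv F ζ = Q.coeff 0 * ζ ^ m * ∏ η ∈ E, (1 - ζ / η) := by
  classical
  have hQne : Q ≠ 0 := by rintro rfl; simp at hQ0
  have h0 : ∀ {ζ : ℂ}, ‖ζ‖ = 1 → ζ ≠ 0 := fun h => norm_pos_iff.1 (by rw [h]; exact one_pos)
  set E := Q.roots.toFinset.filter fun ζ => ‖ζ‖ = 1 with hE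
  have hmem : ∀ ζ, ζ ∈ E ↔ Q.eval ζ = 0 ∧ ‖ζ‖ = 1 := fun ζ => by
    rw [hE, Finset.mem_filter, Multiset.mem_toFinset, Polynomial.mem_roots hQne,
      Polynomial.IsRoot.def]
  have hsub : cuspPoints F ⊆ F '' (E : Set ℂ) := by
    rintro _ ⟨ζ, hζ, hd, rfl⟩
    refine ⟨ζ, (hmem ζ).2 ⟨?_, hζ⟩, rfl⟩
    have := hQ ζ hζ
    rw [hd, mul_zero, eq_comm, mul_eq_zero] at this
    exact this.resolve_left (zpow_ne_zero _ (h0 hζ))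
  -- Each cusp needs a root on the circle, and there are at most `n` roots; all of them are used,
  -- and they are simple.
  have h1 : n ≤ E.card := by
    have := (Set.encard_le_encard hsub).trans (Set.encard_image_le F E)
    rw [hcusp, Set.encard_coe_eq_coe_finsetCard] at this
    exact_mod_cast this
  have h2 : E.card ≤ n := by
    refine (Finset.card_filter_le _ _).trans ((Multiset.toFinset_card_le _).trans ?_)
    exact (Polynomial.card_roots' Q).trans hQn
  refine ⟨E, fun η hη => ((hmem η).1 hη).2, le_antisymm h2 h1, fun ζ hζ => ?_⟩
  rw [hQ ζ hζ, eval_eq_prod_of_roots (hQn.trans h1)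
    (fun h => h0 ((hmem 0).1 h).2 rfl) (fun η hη => ((hmem η).1 hη).1)]
  ring

/-- Each double point has exactly two parameters on the circle. -/
lemma exists_double_finset (hF : IsUnivalentUpToCircle F Dm)
    (hE : ∀ η ∈ E, ‖η‖ = 1) (hC : C ≠ 0)
    (hform : ∀ ζ, ‖ζ‖ = 1 → ζ * deriv F ζ = C * ζ ^ m * ∏ η ∈ E, (1 - ζ / η))
    (hκ : 0 < (m + E.card / 2 : ℝ)) {D : ℕ} (hD : (doublePoints F).encard = D) :
    ∃ B : Finset ℂ, B.card = 2 * D ∧ ∀ ζ, ζ ∈ B ↔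
      ‖ζ‖ = 1 ∧ ∃ ζ', ‖ζ'‖ = 1 ∧ ζ' ≠ ζ ∧ F ζ' = F ζ := by
  classical
  have hL := hF.turningLoop hE hC hform hκ
  have hfin : (doublePoints F).Finite := Set.finite_of_encard_eq_coe hD
  have h1 : ∀ p : ℂ, ∃ z₁ z₂ : ℂ, p ∈ doublePoints F →
      ‖z₁‖ = 1 ∧ ‖z₂‖ = 1 ∧ z₁ ≠ z₂ ∧ F z₁ = p ∧ F z₂ = p := by
    intro p
    by_cases hp : p ∈ doublePoints F
    · obtain ⟨z₁, z₂, h⟩ := hp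
      exact ⟨z₁, z₂, fun _ => h⟩
    · exact ⟨0, 0, fun h => (hp h).elim⟩
  choose z₁ z₂ hz using h1
  have hz' : ∀ p ∈ hfin.toFinset, _ := fun p hp => hz p (hfin.mem_toFinset.1 hp)
  refine ⟨hfin.toFinset.biUnion fun p => {z₁ p, z₂ p}, ?_, fun ζ => ?_⟩
  · rw [Finset.card_biUnion, Finset.sum_congr rfl fun p hp => Finset.card_pair (hz' p hp).2.2.1,
      Finset.sum_const, smul_eq_mul, mul_comm, ← Set.ncard_eq_toFinset_card _ hfin, Set.ncard_def,
      hD, ENat.toNat_natCast]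
    intro p hp q hq hpq
    have h1 : ∀ {p}, p ∈ hfin.toFinset → ∀ x ∈ ({z₁ p, z₂ p} : Finset ℂ), F x = p := by
      intro p hp x hx
      rw [Finset.mem_insert, Finset.mem_singleton] at hx
      rcases hx with rfl | rfl
      · exact (hz' p hp).2.2.2.1
      · exact (hz' p hp).2.2.2.2
    refine Finset.disjoint_left.2 fun x hx hx' => hpq ?_
    rw [← h1 hp x hx, h1 hq x hx']
  · rw [Finset.mem_biUnion]
    constructor
    · rintro ⟨p, hp, hx⟩
      obtain ⟨n1, n2, hne, e1, e2⟩ := hz' p hp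
      rw [Finset.mem_insert, Finset.mem_singleton] at hx
      rcases hx with rfl | rfl
      · exact ⟨n1, z₂ p, n2, hne.symm, e2.trans e1.symm⟩
      · exact ⟨n2, z₁ p, n1, hne, e1.trans e2.symm⟩
    · rintro ⟨hζ, ζ', hζ', hne, heq⟩
      have hp : F ζ ∈ hfin.toFinset := hfin.mem_toFinset.2 ⟨ζ, ζ', hζ, hζ', hne.symm, rfl, heq⟩
      refine ⟨F ζ, hp, ?_⟩
      obtain ⟨n1, n2, hne', e1, e2⟩ := hz' _ hp
      obtain ⟨t, -, ht⟩ := exists_circlePoint hζ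
      obtain ⟨t₁, -, ht₁⟩ := exists_circlePoint n1
      obtain ⟨t₂, -, ht₂⟩ := exists_circlePoint n2
      have := hL.circlePoint_of_double (α := t₁) (β := t₂) (t := t)
        (by simp only [ht₁, ht₂, e1, e2]) (by rwa [ht₁, ht₂]) (by simp only [ht₁, ht, e1])
      rw [ht, ht₁, ht₂] at this
      rwa [Finset.mem_insert, Finset.mem_singleton]

/-- The vertices are the critical points together with two parameters for each double point. The two
kinds are disjoint because the curve is regular at a double point. -/
theorem exists_arcSystem (hF : IsUnivalentUpToCircle F Dm)
    (hE : ∀ η ∈ E, ‖η‖ = 1) (hC : C ≠ 0)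
    (hform : ∀ ζ, ‖ζ‖ = 1 → ζ * deriv F ζ = C * ζ ^ m * ∏ η ∈ E, (1 - ζ / η))
    (hκ : 0 < (m + E.card / 2 : ℝ)) {D : ℕ} (hD : (doublePoints F).encard = D)
    (hpos : 0 < E.card + 2 * D) :
    ∃ (k : ℕ) (a b : Fin (k + 1) → ℝ) (pred : Equiv.Perm (Fin (k + 1))),
      ArcSystem (polarSpeed E C) (fun t => F (circlePoint t)) a b pred ∧
      k + 1 = E.card + 2 * D ∧
      (range fun i => F (circlePoint (a i))) = singularPoints F ∧
      {p | ∃ v, F (circlePoint (a v)) = p ∧ polarSpeed E C (a v) ≠ 0} = doublePoints F := by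
  classical
  obtain ⟨B, hBcard, hB⟩ := hF.exists_double_finset hE hC hform hκ hD
  have hdE := fun {ζ} (hζ : ‖ζ‖ = 1) => deriv_eq_zero_iff (F := F) hE hC hform hζ
  have hdisj : Disjoint E B := Finset.disjoint_left.2 fun ζ hζ hζB => by
    obtain ⟨h1, ζ', hζ', hne, heq⟩ := (hB ζ).1 hζB
    exact (hF.opposite (hF.deriv_deriv_ne_zero hE hC hform) h1 hζ' hne.symm heq.symm).1
      ((hdE h1).2 hζ)
  set Z := E ∪ B
  have hZ1 : ∀ ζ ∈ Z, ‖ζ‖ = 1 := fun ζ hζ => (Finset.mem_union.1 hζ).elim (hE ζ)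
    fun h => ((hB ζ).1 h).1
  have hZc : Z.card = E.card + 2 * D := by rw [Finset.card_union_of_disjoint hdisj, hBcard]
  have h1 : ∀ ζ : ℂ, ∃ t : ℝ, ζ ∈ Z → t ∈ Ico 0 (2 * Real.pi) ∧ circlePoint t = ζ := by
    intro ζ
    by_cases hζ : ζ ∈ Z
    · obtain ⟨t, ht⟩ := exists_circlePoint (hZ1 ζ hζ)
      exact ⟨t, fun _ => ht⟩
    · exact ⟨0, fun h => (hζ h).elim⟩
  choose ang hang using h1
  have hinj : InjOn ang Z := fun x hx y hy hxy => by
    rw [← (hang x hx).2, ← (hang y hy).2, hxy]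
  set T := Z.image ang
  have hTc : T.card = E.card + 2 * D := by rw [Finset.card_image_of_injOn hinj, hZc]
  have hTmem : ∀ t, (∃ θ ∈ T, circlePoint t = circlePoint θ) ↔ circlePoint t ∈ Z := by
    intro t
    constructor
    · rintro ⟨θ, hθ, he⟩
      obtain ⟨ζ, hζ, rfl⟩ := Finset.mem_image.1 hθ
      rw [he, (hang ζ hζ).2]
      exact hζ
    · exact fun h => ⟨_, Finset.mem_image_of_mem _ h, (hang _ h).2.symm⟩
  have hdouble : ∀ t, circlePoint t ∈ B ↔
      ∃ t', F (circlePoint t') = F (circlePoint t) ∧ circlePoint t' ≠ circlePoint t := by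
    intro t
    rw [hB]
    constructor
    · rintro ⟨-, ζ', hζ', hne, heq⟩
      obtain ⟨t', -, rfl⟩ := exists_circlePoint hζ'
      exact ⟨t', heq, hne⟩
    · rintro ⟨t', heq, hne⟩
      exact ⟨norm_circlePoint t, _, norm_circlePoint t', hne, heq⟩
  obtain ⟨k, a, b, pred, hA, hk, hr⟩ := _root_.exists_arcSystem (s := polarSpeed E C)
    (γ := fun t => F (circlePoint t)) (T := T) (Finset.card_pos.1 (by omega))
    (fun θ hθ => by
      obtain ⟨ζ, hζ, rfl⟩ := Finset.mem_image.1 hθ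
      exact (hang ζ hζ).1)
    (fun t => by
      rw [hTmem, Finset.mem_union, polarSpeed_eq_zero_iff hE hC, hdouble])
  have hvert : ∀ ζ, (∃ v, circlePoint (a v) = ζ) ↔ ζ ∈ Z := by
    intro ζ
    constructor
    · rintro ⟨v, rfl⟩
      rw [← hTmem]
      exact ⟨a v, by rw [← Finset.mem_coe, ← hr]; exact ⟨v, rfl⟩, rfl⟩
    · intro hζ
      have : ang ζ ∈ range a := by rw [hr]; exact Finset.mem_image_of_mem _ hζ
      obtain ⟨v, hv⟩ := this
      exact ⟨v, by rw [hv, (hang ζ hζ).2]⟩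
  have hdB : ∀ p, p ∈ doublePoints F ↔ ∃ ζ ∈ B, F ζ = p := by
    intro p
    constructor
    · rintro ⟨ζ₁, ζ₂, n1, n2, hne, e1, e2⟩
      exact ⟨ζ₁, (hB _).2 ⟨n1, ζ₂, n2, hne.symm, e2.trans e1.symm⟩, e1⟩
    · rintro ⟨ζ, hζ, rfl⟩
      obtain ⟨n1, ζ', n2, hne, heq⟩ := (hB _).1 hζ
      exact ⟨ζ, ζ', n1, n2, hne.symm, rfl, heq⟩
  have hcE : ∀ p, p ∈ cuspPoints F ↔ ∃ ζ ∈ E, F ζ = p := by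
    intro p
    constructor
    · rintro ⟨ζ, hζ, hd, rfl⟩
      exact ⟨ζ, (hdE hζ).1 hd, rfl⟩
    · rintro ⟨ζ, hζ, rfl⟩
      exact ⟨ζ, hE ζ hζ, (hdE (hE ζ hζ)).2 hζ, rfl⟩
  refine ⟨k, a, b, pred, hA, hk.trans hTc, ?_, ?_⟩
  · ext p
    rw [singularPoints, mem_union, hcE, hdB]
    constructor
    · rintro ⟨v, rfl⟩
      exact (Finset.mem_union.1 ((hvert _).1 ⟨v, rfl⟩)).imp (fun h => ⟨_, h, rfl⟩)
        fun h => ⟨_, h, rfl⟩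
    · intro h
      obtain ⟨ζ, hζ, rfl⟩ : ∃ ζ ∈ Z, F ζ = p := h.elim
        (fun ⟨ζ, h, e⟩ => ⟨ζ, Finset.mem_union_left _ h, e⟩)
        fun ⟨ζ, h, e⟩ => ⟨ζ, Finset.mem_union_right _ h, e⟩
      obtain ⟨v, rfl⟩ := (hvert ζ).2 hζ
      exact ⟨v, rfl⟩
  · ext p
    rw [hdB]
    constructor
    · rintro ⟨v, rfl, hs⟩
      refine ⟨_, (Finset.mem_union.1 ((hvert _).1 ⟨v, rfl⟩)).resolve_left fun h => ?_, rfl⟩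
      exact hs ((polarSpeed_eq_zero_iff hE hC).2 h)
    · rintro ⟨ζ, hζ, rfl⟩
      obtain ⟨v, rfl⟩ := (hvert ζ).2 (Finset.mem_union_right _ hζ)
      exact ⟨v, rfl, fun h => Finset.disjoint_left.1 hdisj
        ((polarSpeed_eq_zero_iff hE hC).1 h) hζ⟩

/-- The complementary components if all of them are bounded. -/
theorem deltoids (hF : IsUnivalentUpToCircle F Dm) {d : ℕ} (hd : 2 ≤ d) {Q : Polynomial ℂ}
    (hQ0 : Q.coeff 0 ≠ 0) (hQn : Q.natDegree ≤ d + 1)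
    (hQ : ∀ ζ, ‖ζ‖ = 1 → ζ * deriv F ζ = ζ ^ (-1 : ℤ) * Q.eval ζ)
    (hcusp : (cuspPoints F).encard = d + 1) (hdouble : (doublePoints F).encard + 2 = d)
    (hb : ∀ U ∈ planarComponents (F '' (Dm ∪ Metric.sphere 0 1))ᶜ, Bornology.IsBounded U) :
    (planarComponents (F '' (Dm ∪ Metric.sphere 0 1))ᶜ).encard = ((d - 1 : ℕ) : ℕ∞) ∧
    ∀ U ∈ planarComponents (F '' (Dm ∪ Metric.sphere 0 1))ᶜ,
      (singularPoints F ∩ frontier U).encard = 3 ∧ IsDeltoidLike (frontier U) := by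
  obtain ⟨D, rfl⟩ : ∃ D, d = D + 2 := ⟨d - 2, by omega⟩
  have hD : (doublePoints F).encard = D := enat_eq_of_add_eq (k := 2) hdouble
  obtain ⟨E, hE, hEc, hform⟩ := exists_critical_finset hQ0 hQn hQ (by exact_mod_cast hcusp)
  -- Here `|E| = d + 1 = D + 3`; together with `2D` double parameters this gives `3(D+1)` arcs.
  have hκ : (((-1 : ℤ) : ℝ) + E.card / 2) = (D + 1) / 2 := by
    rw [hEc]; push_cast; ring
  have hκ0 : 0 < (((-1 : ℤ) : ℝ) + E.card / 2) := by rw [hκ]; positivity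
  obtain ⟨k, a, b, pred, hA, hk, hsing, hdbl⟩ := hF.exists_arcSystem hE hQ0 hform hκ0 hD (by omega)
  have hL := hF.turningLoop hE hQ0 hform hκ0
  have hV : F '' Dm ∪ range (fun t => F (circlePoint t)) = F '' (Dm ∪ Metric.sphere 0 1) := by
    rw [range_comp_circlePoint, image_union]
  have := hL.deltoids_of_bounded hA (D := D) (by
    rw [hdbl, Set.ncard_def, hD, ENat.toNat_natCast]) (by rw [Fintype.card_fin, hk, hEc]; ring)
    (by rw [hκ]; ring) (by rwa [hV])
  rw [hV, hsing] at this
  exact this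

/-- The complementary components if exactly one of them is unbounded. -/
theorem deltoids_cardioid (hF : IsUnivalentUpToCircle F Dm) {d : ℕ} (hd : 2 ≤ d)
    {Q : Polynomial ℂ} (hQ0 : Q.coeff 0 ≠ 0) (hQn : Q.natDegree ≤ d - 1)
    (hQ : ∀ ζ, ‖ζ‖ = 1 → ζ * deriv F ζ = ζ ^ (1 : ℤ) * Q.eval ζ)
    (hcusp : (cuspPoints F).encard + 1 = d) (hdouble : (doublePoints F).encard + 2 = d)
    {W : Set ℂ} (hW : W ∈ planarComponents (F '' (Dm ∪ Metric.sphere 0 1))ᶜ)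
    (hWb : ¬ Bornology.IsBounded W) (hWb' : Bornology.IsBounded (closure W)ᶜ)
    (hb : ∀ U ∈ planarComponents (F '' (Dm ∪ Metric.sphere 0 1))ᶜ, U ≠ W →
      Bornology.IsBounded U) :
    (planarComponents (F '' (Dm ∪ Metric.sphere 0 1))ᶜ).encard = ((d - 1 : ℕ) : ℕ∞) ∧
    (∀ U ∈ planarComponents (F '' (Dm ∪ Metric.sphere 0 1))ᶜ, U ≠ W →
      (singularPoints F ∩ frontier U).encard = 3 ∧ IsDeltoidLike (frontier U)) ∧
    IsCardioidLike (frontier W) ∧ ∃ p : ℂ, singularPoints F ∩ frontier W = {p} ∧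
      (d = 2 → p ∈ cuspPoints F) ∧ (2 < d → p ∈ doublePoints F) := by
  obtain ⟨D, rfl⟩ : ∃ D, d = D + 2 := ⟨d - 2, by omega⟩
  have hD : (doublePoints F).encard = D := enat_eq_of_add_eq (k := 2) hdouble
  have hn : (cuspPoints F).encard = (D + 1 : ℕ) := enat_eq_of_add_eq (k := 1) hcusp
  obtain ⟨E, hE, hEc, hform⟩ := exists_critical_finset hQ0 hQn hQ hn
  -- Here `|E| = d - 1 = D + 1`; together with `2D` double parameters this gives `3D + 1` arcs.
  have hκ : (((1 : ℤ) : ℝ) + E.card / 2) = (D + 3) / 2 := by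
    rw [hEc]; push_cast; ring
  have hκ0 : 0 < (((1 : ℤ) : ℝ) + E.card / 2) := by rw [hκ]; positivity
  obtain ⟨k, a, b, pred, hA, hk, hsing, hdbl⟩ := hF.exists_arcSystem hE hQ0 hform hκ0 hD (by omega)
  have hL := hF.turningLoop hE hQ0 hform hκ0
  have hV : F '' Dm ∪ range (fun t => F (circlePoint t)) = F '' (Dm ∪ Metric.sphere 0 1) := by
    rw [range_comp_circlePoint, image_union]
  have := hL.deltoids_cardioid_of_unbounded hA (D := D) (W := W) (by
    rw [hdbl, Set.ncard_def, hD, ENat.toNat_natCast]) (by rw [Fintype.card_fin, hk, hEc]; omega)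
    (by rw [hκ]; ring) (by rwa [hV]) hWb hWb' (by rwa [hV])
  rw [hV, hsing] at this
  obtain ⟨h1, h2, h3, v, h4, h5, h6⟩ := this
  refine ⟨h1, h2, h3, _, h4, fun h => ?_, fun h => ?_⟩
  · refine ⟨circlePoint (a v), norm_circlePoint _, ?_, rfl⟩
    exact (deriv_eq_zero_iff hE hQ0 hform (norm_circlePoint _)).2
      ((polarSpeed_eq_zero_iff hE hQ0).1 (h5 (by omega)))
  · rw [← hdbl]
    exact ⟨v, rfl, h6 (by omega)⟩

end IsUnivalentUpToCircle

/-! ### Complements of the images of the disc and of the exterior disc. -/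

lemma isPreconnected_annulus {I : Set ℝ} (hI : IsPreconnected I) (hpos : I ⊆ Ioi 0) :
    IsPreconnected {z : ℂ | ‖z‖ ∈ I} := by
  have h : {z : ℂ | ‖z‖ ∈ I} = (fun x : ℝ × ℝ => (x.1 : ℂ) * circlePoint x.2) '' (I ×ˢ univ) := by
    ext z
    constructor
    · intro hz
      exact ⟨(‖z‖, z.arg), ⟨hz, mem_univ _⟩, Complex.norm_mul_exp_arg_mul_I z⟩
    · rintro ⟨⟨r, t⟩, ⟨hr, -⟩, rfl⟩
      rw [mem_ofPred_eq, norm_mul, norm_circlePoint, mul_one, Complex.norm_real, Real.norm_eq_abs,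
        abs_of_pos (hpos hr)]
      exact hr
  rw [h]
  have := continuous_circlePoint
  exact (hI.prod isPreconnected_univ).image _ (Continuous.continuousOn (by fun_prop))

lemma isConnected_norm_gt (R : ℝ) : IsConnected {z : ℂ | R < ‖z‖} := by
  rcases le_or_gt 0 R with hR | hR
  · refine ⟨⟨((R + 1 : ℝ) : ℂ), ?_⟩, isPreconnected_annulus isPreconnected_Ioi fun x hx =>
      hR.trans_lt hx⟩
    rw [mem_ofPred_eq, Complex.norm_real, Real.norm_eq_abs]
    linarith [le_abs_self (R + 1)]
  · have : {z : ℂ | R < ‖z‖} = univ := eq_univ_of_forall fun z => hR.trans_le (norm_nonneg z)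
    rw [this]
    exact isConnected_univ

lemma not_isBounded_norm_gt (R : ℝ) : ¬ Bornology.IsBounded {z : ℂ | R < ‖z‖} := by
  intro h
  have := h.union (Metric.isBounded_closedBall (x := (0 : ℂ)) (r := R))
  refine NormedSpace.unbounded_univ ℝ ℂ (this.subset fun z _ => ?_)
  rcases lt_or_ge R ‖z‖ with h | h
  · exact .inl h
  · exact .inr (by simpa using h)

/-- The complement of a compact set has exactly one unbounded component. -/
lemma exists_unbounded_component {K : Set ℂ} (hK : IsCompact K) :
    ∃ W ∈ planarComponents Kᶜ, ¬ Bornology.IsBounded W ∧ Bornology.IsBounded (closure W)ᶜ ∧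
      ∀ U ∈ planarComponents Kᶜ, U ≠ W → Bornology.IsBounded U := by
  obtain ⟨R, hR⟩ := hK.isBounded.subset_closedBall 0
  have hsub : {z : ℂ | R < ‖z‖} ⊆ Kᶜ := fun z hz hzK => by
    have := hR hzK
    rw [mem_closedBall_zero_iff] at this
    exact absurd hz (not_lt.2 this)
  obtain ⟨W, hW, hWs⟩ := exists_planarComponents_of_isPreconnected
    (isConnected_norm_gt R).isPreconnected hsub (isConnected_norm_gt R).nonempty
  refine ⟨W, hW, fun h => not_isBounded_norm_gt R (h.subset hWs), ?_, fun U hU hne => ?_⟩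
  · refine (Metric.isBounded_closedBall (x := (0 : ℂ)) (r := R)).subset fun z hz => ?_
    rw [mem_closedBall_zero_iff]
    by_contra! h
    exact hz (subset_closure (hWs h))
  · refine (Metric.isBounded_closedBall (x := (0 : ℂ)) (r := R)).subset fun z hz => ?_
    rw [mem_closedBall_zero_iff]
    by_contra! h
    exact hne (planarComponents_eq hU hW hz (hWs h))

lemma isUnivalentUpToCircle_of_disc {F : ℂ → ℂ}
    (hF : AnalyticOnNhd ℂ F (Metric.closedBall 0 1)) (hinj : InjOn F (Metric.ball 0 1)) :
    IsUnivalentUpToCircle F (Metric.ball 0 1) := by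
  have h : Metric.ball (0 : ℂ) 1 ∪ Metric.sphere 0 1 = Metric.closedBall 0 1 :=
    Metric.ball_union_sphere
  refine ⟨Metric.isOpen_ball, (convex_ball 0 1).isPreconnected, le_rfl, fun w _ hw => by simpa,
    by rwa [h], hinj, ?_⟩
  rw [h]
  exact ((isCompact_closedBall 0 1).image_of_continuousOn hF.continuousOn).isClosed

/-- The complement of the image of the closed disc. -/
theorem complement_disc {F : ℂ → ℂ} (hF : AnalyticOnNhd ℂ F (Metric.closedBall 0 1))
    (hinj : InjOn F (Metric.ball 0 1)) {d : ℕ} (hd : 2 ≤ d) {Q : Polynomial ℂ}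
    (hQ0 : Q.coeff 0 ≠ 0) (hQn : Q.natDegree ≤ d - 1) (hQ : ∀ ζ, ‖ζ‖ = 1 → deriv F ζ = Q.eval ζ)
    (hcusp : (cuspPoints F).encard + 1 = d) (hdouble : (doublePoints F).encard + 2 = d) :
    (planarComponents (F '' Metric.closedBall 0 1)ᶜ).encard = ((d - 1 : ℕ) : ℕ∞) ∧
    {U ∈ planarComponents (F '' Metric.closedBall 0 1)ᶜ | Bornology.IsBounded U}.encard =
      ((d - 2 : ℕ) : ℕ∞) ∧
    (∀ U ∈ planarComponents (F '' Metric.closedBall 0 1)ᶜ, Bornology.IsBounded U →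
      (singularPoints F ∩ frontier U).encard = 3 ∧ IsDeltoidLike (frontier U)) ∧
    ∃ V : Set ℂ,
      {U ∈ planarComponents (F '' Metric.closedBall 0 1)ᶜ | ¬ Bornology.IsBounded U} = {V} ∧
      IsCardioidLike (frontier V) ∧
      ∃ p : ℂ, singularPoints F ∩ frontier V = {p} ∧
        (d = 2 → p ∈ cuspPoints F) ∧ (2 < d → p ∈ doublePoints F) := by
  have hU := isUnivalentUpToCircle_of_disc hF hinj
  have hK : IsCompact (F '' Metric.closedBall 0 1) :=
    (isCompact_closedBall 0 1).image_of_continuousOn hF.continuousOn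
  obtain ⟨W, hW, hWb, hWb', hb⟩ := exists_unbounded_component hK
  have h : Metric.ball (0 : ℂ) 1 ∪ Metric.sphere 0 1 = Metric.closedBall 0 1 :=
    Metric.ball_union_sphere
  have := hU.deltoids_cardioid hd hQ0 hQn (fun ζ hζ => by rw [zpow_one, hQ ζ hζ]) hcusp hdouble
    (W := W) (by rwa [h]) hWb hWb' (by rwa [h])
  rw [h] at this
  obtain ⟨h1, h2, h3, h4⟩ := this
  refine ⟨h1, ?_, fun U hU hUb => h2 U hU fun e => hWb (e ▸ hUb), W, ?_, h3, h4⟩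
  · have e : {U ∈ planarComponents (F '' Metric.closedBall 0 1)ᶜ | Bornology.IsBounded U} =
        planarComponents (F '' Metric.closedBall 0 1)ᶜ \ {W} := by
      ext U
      exact ⟨fun hU => ⟨hU.1, fun e => hWb (e ▸ hU.2)⟩, fun hU => ⟨hU.1, hb U hU.1 hU.2⟩⟩
    have := Set.encard_sdiff_singleton_add_one hW
    rw [h1] at this
    rw [e]
    refine enat_eq_of_add_eq (k := 1) ?_
    rw [Nat.cast_one, this]
    congr 1
    omega
  · ext U
    exact ⟨fun hU => by_contra fun e => hU.2 (hb U hU.1 e), fun e => by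
      rw [mem_singleton_iff] at e
      rw [e]
      exact ⟨hW, hWb⟩⟩

section

variable {f : ℂ → ℂ}

/-- Points of large modulus have images far from a given `p`, so near `p` the image agrees with that
of a compact part. -/
lemma isClosed_image_of_tendsto {K : Set ℂ} (hK : IsClosed K) (hf : ContinuousOn f K)
    (ht : Tendsto f (Bornology.cobounded ℂ) (Bornology.cobounded ℂ)) : IsClosed (f '' K) := by
  refine isClosed_of_closure_subset fun p hp => ?_
  have h1 : ∀ᶠ z in Bornology.cobounded ℂ, ‖p‖ + 1 ≤ ‖f z‖ := by
    have := (tendsto_norm_atTop_iff_cobounded.2 ht).eventually_ge_atTop (‖p‖ + 1)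
    exact this
  obtain ⟨R, hR⟩ : ∃ R : ℝ, ∀ z : ℂ, R < ‖z‖ → ‖p‖ + 1 ≤ ‖f z‖ := by
    obtain ⟨R, -, hR⟩ := (Filter.hasBasis_cobounded_norm (E := ℂ)).eventually_iff.1 h1
    exact ⟨R, fun z hz => hR hz.le⟩
  have hsub : f '' K ⊆ f '' (K ∩ Metric.closedBall 0 R) ∪ {q | ‖p‖ + 1 ≤ ‖q‖} := by
    rintro _ ⟨z, hz, rfl⟩
    rcases lt_or_ge R ‖z‖ with h | h
    · exact .inr (hR z h)
    · exact .inl ⟨z, ⟨hz, by simpa using h⟩, rfl⟩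
  have hc : IsClosed (f '' (K ∩ Metric.closedBall 0 R) ∪ {q | ‖p‖ + 1 ≤ ‖q‖}) := by
    refine IsClosed.union ?_ (isClosed_le continuous_const continuous_norm)
    exact (((isCompact_closedBall 0 R).inter_left hK).image_of_continuousOn
      (hf.mono inter_subset_left)).isClosed
  rcases closure_minimal hsub hc hp with h | h
  · exact image_mono inter_subset_left h
  · exact absurd h (by simp)

lemma image_inv_exterior (f : ℂ → ℂ) :
    (fun w => f w⁻¹) '' ((Metric.ball 0 1 \ {0}) ∪ Metric.sphere 0 1) = f '' {z | 1 ≤ ‖z‖} := by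
  ext p
  constructor
  · rintro ⟨w, hw, rfl⟩
    refine ⟨w⁻¹, ?_, rfl⟩
    rw [mem_ofPred_eq, norm_inv]
    rcases hw with hw | hw
    · have h1 : ‖w‖ < 1 := by simpa using hw.1
      exact (one_lt_inv_iff₀.2 ⟨norm_pos_iff.2 hw.2, h1⟩).le
    · rw [mem_sphere_zero_iff_norm.1 hw, inv_one]
  · rintro ⟨z, hz, rfl⟩
    have hz : 1 ≤ ‖z‖ := hz
    refine ⟨z⁻¹, ?_, by simp⟩
    have h0 : z ≠ 0 := by rintro rfl; norm_num at hz
    rcases hz.eq_or_lt with h | h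
    · right; rw [mem_sphere_zero_iff_norm, norm_inv, ← h, inv_one]
    · left
      exact ⟨by rw [mem_ball_zero_iff, norm_inv]; exact inv_lt_one_of_one_lt₀ h, by simpa using h0⟩

lemma isUnivalentUpToCircle_of_exterior (hf : AnalyticOnNhd ℂ f {z | 1 ≤ ‖z‖})
    (hinj : InjOn f {z | 1 < ‖z‖})
    (ht : Tendsto f (Bornology.cobounded ℂ) (Bornology.cobounded ℂ)) :
    IsUnivalentUpToCircle (fun w => f w⁻¹) (Metric.ball 0 1 \ {0}) := by
  have hK : IsClosed {z : ℂ | 1 ≤ ‖z‖} := isClosed_le continuous_const continuous_norm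
  refine ⟨Metric.isOpen_ball.sdiff isClosed_singleton, ?_, sdiff_subset, fun w h0 hw =>
    ⟨by simpa using hw, h0⟩, fun w hw => ?_, fun w hw w' hw' h => ?_, ?_⟩
  · convert isPreconnected_annulus (isPreconnected_Ioo (a := (0 : ℝ)) (b := 1)) fun x hx => hx.1
      using 1
    ext z
    simp [and_comm]
  · have hw0 : w ≠ 0 := by
      rintro rfl
      rcases hw with hw | hw
      · exact hw.2 rfl
      · simp at hw
    have hw1 : ‖w‖ ≤ 1 := by
      rcases hw with hw | hw
      · exact (mem_ball_zero_iff.1 hw.1).le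
      · exact (mem_sphere_zero_iff_norm.1 hw).le
    refine AnalyticAt.comp (hf w⁻¹ ?_) (analyticAt_inv hw0)
    rw [mem_ofPred_eq, norm_inv]
    exact (one_le_inv₀ (norm_pos_iff.2 hw0)).2 hw1
  · have h1 : ∀ {w : ℂ}, w ∈ Metric.ball (0 : ℂ) 1 \ {0} → w⁻¹ ∈ {z : ℂ | 1 < ‖z‖} := fun hw => by
      rw [mem_ofPred_eq, norm_inv]
      exact one_lt_inv_iff₀.2 ⟨norm_pos_iff.2 hw.2, by simpa using hw.1⟩
    exact inv_injective (hinj (h1 hw) (h1 hw') h)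
  · rw [image_inv_exterior]
    exact isClosed_image_of_tendsto hK hf.continuousOn ht

/-- The image of the open exterior is open, and its limit points outside a disc containing the
boundary curve belong to it again. It therefore contains the connected outside of that disc, and all
complementary components are bounded. -/
lemma exists_norm_gt_subset (hf : AnalyticOnNhd ℂ f {z | 1 ≤ ‖z‖})
    (hinj : InjOn f {z | 1 < ‖z‖})
    (ht : Tendsto f (Bornology.cobounded ℂ) (Bornology.cobounded ℂ)) :
    ∃ R : ℝ, {z : ℂ | R < ‖z‖} ⊆ f '' {z | 1 < ‖z‖} := by
  have hU := isUnivalentUpToCircle_of_exterior hf hinj ht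
  have hcs : IsCompact (f '' Metric.sphere 0 1) := (isCompact_sphere 0 1).image_of_continuousOn
    (hf.continuousOn.mono fun z hz => by simp at hz ⊢; exact hz.ge)
  obtain ⟨R, hR⟩ := hcs.isBounded.subset_closedBall 0
  have hsplit : {z : ℂ | 1 ≤ ‖z‖} = {z | 1 < ‖z‖} ∪ Metric.sphere 0 1 := by
    ext z; simp [le_iff_lt_or_eq, eq_comm]
  have hopen : IsOpen (f '' {z | 1 < ‖z‖}) := by
    have := hU.isOpen_image le_rfl hU.isOpen
    convert this using 1
    ext p
    constructor
    · rintro ⟨z, hz, rfl⟩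
      have hz : 1 < ‖z‖ := hz
      refine ⟨z⁻¹, ⟨by rw [mem_ball_zero_iff, norm_inv]; exact inv_lt_one_of_one_lt₀ hz, ?_⟩,
        by simp⟩
      rw [mem_singleton_iff, inv_eq_zero]
      rintro rfl
      norm_num at hz
    · rintro ⟨w, hw, rfl⟩
      refine ⟨w⁻¹, ?_, rfl⟩
      rw [mem_ofPred_eq, norm_inv]
      exact one_lt_inv_iff₀.2 ⟨norm_pos_iff.2 hw.2, by simpa using hw.1⟩
  have hclosed : IsClosed (f '' {z | 1 ≤ ‖z‖}) := isClosed_image_of_tendsto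
    (isClosed_le continuous_const continuous_norm) hf.continuousOn ht
  refine ⟨R, (isConnected_norm_gt R).isPreconnected.subset_of_closure_inter_subset hopen ?_ ?_⟩
  · have h1 : ∀ᶠ z in Bornology.cobounded ℂ, R < ‖f z‖ :=
      (tendsto_norm_atTop_iff_cobounded.2 ht).eventually_gt_atTop R
    have h2 : ∀ᶠ z in Bornology.cobounded ℂ, 1 < ‖z‖ :=
      tendsto_norm_cobounded_atTop.eventually_gt_atTop 1
    obtain ⟨z, hz1, hz2⟩ := (h1.and h2).exists
    exact ⟨f z, hz1, z, hz2, rfl⟩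
  · rintro p ⟨hp, hpR⟩
    have : p ∈ f '' {z | 1 ≤ ‖z‖} := closure_minimal (image_mono fun z (hz : 1 < ‖z‖) => (le_of_lt hz : 1 ≤ ‖z‖)) hclosed hp
    rw [hsplit, image_union] at this
    refine this.resolve_right fun h => ?_
    have := hR h
    rw [mem_closedBall_zero_iff] at this
    exact absurd hpR (not_lt.2 this)

lemma cuspPoints_comp_inv (hf : ∀ ζ, ‖ζ‖ = 1 → DifferentiableAt ℂ f ζ) :
    cuspPoints (fun w => f w⁻¹) = cuspPoints f := by
  have hinv : ∀ {ζ : ℂ}, ‖ζ‖ = 1 → ‖ζ⁻¹‖ = 1 := fun h => by rw [norm_inv, h, inv_one]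
  have h0 : ∀ {ζ : ℂ}, ‖ζ‖ = 1 → ζ ≠ 0 := fun h => norm_pos_iff.1 (by rw [h]; exact one_pos)
  have hd : ∀ {ζ : ℂ}, ‖ζ‖ = 1 → (deriv (fun w => f w⁻¹) ζ = 0 ↔ deriv f ζ⁻¹ = 0) := by
    intro ζ hζ
    have := ((hf ζ⁻¹ (hinv hζ)).hasDerivAt.comp ζ (hasDerivAt_inv (h0 hζ))).deriv
    rw [Function.comp_def] at this
    rw [this, mul_eq_zero, or_iff_left]
    simp [h0 hζ]
  ext p
  constructor
  · rintro ⟨ζ, hζ, h, rfl⟩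
    exact ⟨ζ⁻¹, hinv hζ, (hd hζ).1 h, rfl⟩
  · rintro ⟨ζ, hζ, h, rfl⟩
    exact ⟨ζ⁻¹, hinv hζ, (hd (hinv hζ)).2 (by rwa [inv_inv]), by simp⟩

lemma doublePoints_comp_inv (f : ℂ → ℂ) : doublePoints (fun w => f w⁻¹) = doublePoints f := by
  have hinv : ∀ {ζ : ℂ}, ‖ζ‖ = 1 → ‖ζ⁻¹‖ = 1 := fun h => by rw [norm_inv, h, inv_one]
  ext p
  constructor
  · rintro ⟨ζ, ζ', h, h', hne, e, e'⟩
    exact ⟨ζ⁻¹, ζ'⁻¹, hinv h, hinv h', fun he => hne (inv_injective he), e, e'⟩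
  · rintro ⟨ζ, ζ', h, h', hne, e, e'⟩
    exact ⟨ζ⁻¹, ζ'⁻¹, hinv h, hinv h', fun he => hne (inv_injective he), by simpa, by simpa⟩

/-- The complement of the image of the closed exterior disc. -/
theorem complement_exterior (hf : AnalyticOnNhd ℂ f {z | 1 ≤ ‖z‖})
    (hinj : InjOn f {z | 1 < ‖z‖})
    (ht : Tendsto f (Bornology.cobounded ℂ) (Bornology.cobounded ℂ)) {d : ℕ} (hd : 2 ≤ d)
    {Q : Polynomial ℂ} (hQ0 : Q.coeff 0 ≠ 0) (hQn : Q.natDegree ≤ d + 1)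
    (hQ : ∀ ζ, ‖ζ‖ = 1 → deriv f ζ = Q.eval ζ⁻¹)
    (hcusp : (cuspPoints f).encard = d + 1) (hdouble : (doublePoints f).encard + 2 = d) :
    (planarComponents (f '' {z | 1 ≤ ‖z‖})ᶜ).encard = ((d - 1 : ℕ) : ℕ∞) ∧
    ∀ U ∈ planarComponents (f '' {z | 1 ≤ ‖z‖})ᶜ,
      (singularPoints f ∩ frontier U).encard = 3 ∧ IsDeltoidLike (frontier U) := by
  have hU := isUnivalentUpToCircle_of_exterior hf hinj ht
  have hdf : ∀ ζ, ‖ζ‖ = 1 → DifferentiableAt ℂ f ζ := fun ζ hζ => (hf ζ hζ.ge).differentiableAt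
  obtain ⟨R, hR⟩ := exists_norm_gt_subset hf hinj ht
  have h0 : ∀ {ζ : ℂ}, ‖ζ‖ = 1 → ζ ≠ 0 := fun h => norm_pos_iff.1 (by rw [h]; exact one_pos)
  -- For `F(w) = f(1/w)` the chain rule gives `ζ F'(ζ) = -ζ⁻¹ Q(ζ)` on the circle.
  have := hU.deltoids hd (Q := -Q) (by simpa using hQ0) (by rwa [Polynomial.natDegree_neg])
    (fun ζ hζ => by
      have hi : ‖ζ⁻¹‖ = 1 := by rw [norm_inv, hζ, inv_one]
      have := ((hdf ζ⁻¹ hi).hasDerivAt.comp ζ (hasDerivAt_inv (h0 hζ))).deriv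
      rw [Function.comp_def] at this
      rw [this, hQ _ hi, inv_inv, zpow_neg_one, Polynomial.eval_neg]
      have := h0 hζ
      field_simp)
    (by rwa [cuspPoints_comp_inv hdf]) (by rwa [doublePoints_comp_inv])
    (fun U hUc => by
      rw [image_inv_exterior] at hUc
      refine (Metric.isBounded_closedBall (x := (0 : ℂ)) (r := R)).subset fun z hz => ?_
      rw [mem_closedBall_zero_iff]
      by_contra! h
      exact planarComponents_subset hUc hz (image_mono
        (fun z (hz : 1 < ‖z‖) => (le_of_lt hz : 1 ≤ ‖z‖)) (hR h)))
  rw [image_inv_exterior, singularPoints, cuspPoints_comp_inv hdf, doublePoints_comp_inv] at this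
  exact this

end

/-! ### Maps with finitely many coefficients; Suffridge polynomials. -/

/-- The complement of the image of the closed disc under a map that is a polynomial in the disc. -/
theorem complement_disc_of_polynomial {F : ℂ → ℂ}
    (hF : AnalyticOnNhd ℂ F (Metric.closedBall 0 1)) (hinj : InjOn F (Metric.ball 0 1)) {d : ℕ}
    (hd : 2 ≤ d) {P : Polynomial ℂ} (hP1 : P.coeff 1 ≠ 0) (hPd : P.natDegree ≤ d)
    (hP : ∀ z ∈ Metric.ball (0 : ℂ) 1, F z = P.eval z)
    (hcusp : (cuspPoints F).encard + 1 = d) (hdouble : (doublePoints F).encard + 2 = d) :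
    (planarComponents (F '' Metric.closedBall 0 1)ᶜ).encard = ((d - 1 : ℕ) : ℕ∞) ∧
    {U ∈ planarComponents (F '' Metric.closedBall 0 1)ᶜ | Bornology.IsBounded U}.encard =
      ((d - 2 : ℕ) : ℕ∞) ∧
    (∀ U ∈ planarComponents (F '' Metric.closedBall 0 1)ᶜ, Bornology.IsBounded U →
      (singularPoints F ∩ frontier U).encard = 3 ∧ IsDeltoidLike (frontier U)) ∧
    ∃ V : Set ℂ,
      {U ∈ planarComponents (F '' Metric.closedBall 0 1)ᶜ | ¬ Bornology.IsBounded U} = {V} ∧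
      IsCardioidLike (frontier V) ∧
      ∃ p : ℂ, singularPoints F ∩ frontier V = {p} ∧
        (d = 2 → p ∈ cuspPoints F) ∧ (2 < d → p ∈ doublePoints F) := by
  refine complement_disc hF hinj hd (Q := P.derivative) ?_ ?_ ?_ hcusp hdouble
  · simpa [Polynomial.coeff_derivative] using hP1
  · exact (Polynomial.natDegree_derivative_le P).trans (Nat.sub_le_sub_right hPd 1)
  · have h1 : EqOn (deriv F) (fun z => P.derivative.eval z) (Metric.ball 0 1) := fun z hz => by
      have : F =ᶠ[𝓝 z] fun z => P.eval z := by
        filter_upwards [Metric.isOpen_ball.mem_nhds hz] with w hw using hP w hw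
      rw [this.deriv_eq, Polynomial.deriv]
    have h2 := h1.of_subset_closure (t := Metric.closedBall 0 1) hF.deriv.continuousOn
      P.derivative.continuous.continuousOn Metric.ball_subset_closedBall
      (by rw [closure_ball _ one_ne_zero])
    exact fun ζ hζ => h2 (by simp [hζ])

/-- The complement of the image of the closed exterior disc under a map whose Laurent series at
infinity is finite. -/
theorem complement_exterior_of_polynomial {f : ℂ → ℂ} (hf : AnalyticOnNhd ℂ f {z | 1 ≤ ‖z‖})
    (hinj : InjOn f {z | 1 < ‖z‖})
    (ht : Tendsto f (Bornology.cobounded ℂ) (Bornology.cobounded ℂ)) {d : ℕ} (hd : 2 ≤ d)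
    {α : ℂ} (hα : α ≠ 0) {P : Polynomial ℂ} (hPd : P.natDegree ≤ d)
    (hP : ∀ z, 1 < ‖z‖ → f z = α * z + P.eval z⁻¹)
    (hcusp : (cuspPoints f).encard = d + 1) (hdouble : (doublePoints f).encard + 2 = d) :
    (planarComponents (f '' {z | 1 ≤ ‖z‖})ᶜ).encard = ((d - 1 : ℕ) : ℕ∞) ∧
    ∀ U ∈ planarComponents (f '' {z | 1 ≤ ‖z‖})ᶜ,
      (singularPoints f ∩ frontier U).encard = 3 ∧ IsDeltoidLike (frontier U) := by
  -- The derivative of `αz + P(1/z)` is `α - z⁻² P'(1/z)`, a polynomial in `1/z` of degree at most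
  -- `d + 1`. The identity extends from the open exterior to the circle by continuity.
  set Q : Polynomial ℂ := Polynomial.C α - Polynomial.X ^ 2 * P.derivative with hQ
  refine complement_exterior hf hinj ht hd (Q := Q) ?_ ?_ ?_ hcusp hdouble
  · simpa [hQ, Polynomial.mul_coeff_zero] using hα
  · refine (Polynomial.natDegree_sub_le _ _).trans (max_le (by simp) ?_)
    refine Polynomial.natDegree_mul_le.trans ?_
    have := Polynomial.natDegree_derivative_le P
    rw [Polynomial.natDegree_X_pow]
    omega
  · have h1 : EqOn (deriv f) (fun z => Q.eval z⁻¹) {z | 1 < ‖z‖} := fun z hz => by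
      have hz0 : z ≠ 0 := norm_pos_iff.1 (one_pos.trans hz)
      have : f =ᶠ[𝓝 z] fun z => α * z + P.eval z⁻¹ := by
        filter_upwards [(isOpen_lt continuous_const continuous_norm).mem_nhds hz] with w hw
        exact hP w hw
      have h2 := (((hasDerivAt_id z).const_mul α).add
        ((P.hasDerivAt z⁻¹).comp z (hasDerivAt_inv hz0))).deriv
      rw [this.deriv_eq]
      refine Eq.trans h2 ?_
      simp only [hQ, Polynomial.eval_sub, Polynomial.eval_C, Polynomial.eval_mul,
        Polynomial.eval_pow, Polynomial.eval_X, inv_pow]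
      ring
    have h2 := h1.of_subset_closure (t := {z | 1 ≤ ‖z‖}) hf.deriv.continuousOn
      (Q.continuous.comp_continuousOn (continuousOn_inv₀.mono fun z (hz : 1 ≤ ‖z‖) =>
        norm_pos_iff.1 (one_pos.trans_le hz))) (fun z (hz : 1 < ‖z‖) => (le_of_lt hz : 1 ≤ ‖z‖))
      (fun z (hz : 1 ≤ ‖z‖) => by
        rcases hz.eq_or_lt with h | h
        · refine mem_closure_of_tendsto (f := fun ε : ℝ => ((1 + ε : ℝ) : ℂ) * z) (b := 𝓝[>] 0) ?_ ?_
          · refine tendsto_nhdsWithin_of_tendsto_nhds ?_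
            have : ContinuousAt (fun ε : ℝ => ((1 + ε : ℝ) : ℂ) * z) 0 := by fun_prop
            simpa [ContinuousAt] using this
          · filter_upwards [self_mem_nhdsWithin] with ε (hε : 0 < ε)
            rw [norm_mul, ← h, mul_one, Complex.norm_real, Real.norm_eq_abs]
            exact (by linarith : 1 < 1 + ε).trans_le (le_abs_self _)
        · exact subset_closure h)
    exact fun ζ hζ => h2 (by rw [mem_ofPred_eq, hζ])

theorem IsSuffridgeS.complement {d : ℕ} (hd : 2 ≤ d) {f : ℂ → ℂ} (hf : IsSuffridgeS d f) :
    {U ∈ planarComponents (f '' Metric.closedBall 0 1)ᶜ | Bornology.IsBounded U}.encard =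
      ((d - 2 : ℕ) : ℕ∞) ∧
    (∀ U ∈ planarComponents (f '' Metric.closedBall 0 1)ᶜ, Bornology.IsBounded U →
      (singularPoints f ∩ frontier U).encard = 3 ∧ IsDeltoidLike (frontier U)) ∧
    ∃ V : Set ℂ,
      {U ∈ planarComponents (f '' Metric.closedBall 0 1)ᶜ | ¬ Bornology.IsBounded U} = {V} ∧
      IsCardioidLike (frontier V) ∧
      ∃ p : ℂ, singularPoints f ∩ frontier V = {p} ∧
        (d = 2 → p ∈ cuspPoints f) ∧ (2 < d → p ∈ doublePoints f) := by
  obtain ⟨⟨⟨a, ha⟩, hinj⟩, hcusp, hdouble⟩ := hf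
  set P : Polynomial ℂ := Polynomial.X +
    ∑ k ∈ Finset.Icc 2 d, Polynomial.C (a k) * Polynomial.X ^ k with hP
  have hfP : f = fun z => P.eval z := by
    ext z
    simp [hP, ha, Polynomial.eval_finsetSum]
  refine (complement_disc_of_polynomial ?_ hinj hd (P := P) ?_ ?_ (fun z _ => by rw [hfP]) hcusp
    hdouble).2
  · intro z _
    rw [hfP]
    exact (P.differentiable.analyticAt z)
  · have : ∑ k ∈ Finset.Icc 2 d, (Polynomial.C (a k) * Polynomial.X ^ k).coeff 1 = 0 :=
      Finset.sum_eq_zero fun k hk => by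
        rw [Polynomial.coeff_C_mul_X_pow, if_neg]
        have := (Finset.mem_Icc.1 hk).1
        omega
    rw [hP, Polynomial.coeff_add, Polynomial.coeff_X_one, Polynomial.finsetSum_coeff, this]
    simp
  · refine (Polynomial.natDegree_add_le _ _).trans (max_le (Polynomial.natDegree_X_le.trans
      (by omega)) ?_)
    refine Polynomial.natDegree_sum_le_of_forall_le _ _ fun k hk => ?_
    exact (Polynomial.natDegree_C_mul_X_pow_le _ _).trans (Finset.mem_Icc.1 hk).2

theorem IsSuffridgeSigma.complement {d : ℕ} (hd : 2 ≤ d) {f : ℂ → ℂ} (hf : IsSuffridgeSigma d f) :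
    (planarComponents (f '' {z | 1 ≤ ‖z‖})ᶜ).encard = ((d - 1 : ℕ) : ℕ∞) ∧
      ∀ U ∈ planarComponents (f '' {z | 1 ≤ ‖z‖})ᶜ,
        (singularPoints f ∩ frontier U).encard = 3 ∧ IsDeltoidLike (frontier U) := by
  obtain ⟨⟨⟨a, ha⟩, hinj⟩, hcusp, hdouble⟩ := hf
  set P : Polynomial ℂ := ∑ k ∈ Finset.Icc 1 d, Polynomial.C (a k) * Polynomial.X ^ k with hP
  have hfP : ∀ z, z ≠ 0 → f z = z + P.eval z⁻¹ := by
    intro z hz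
    simp [hP, ha z hz, Polynomial.eval_finsetSum, div_eq_mul_inv]
  have hne : ∀ {z : ℂ}, 1 ≤ ‖z‖ → z ≠ 0 := fun hz => norm_pos_iff.1 (one_pos.trans_le hz)
  refine complement_exterior_of_polynomial ?_ hinj ?_ hd one_ne_zero (P := P) ?_
    (fun z hz => by rw [one_mul, hfP z (hne hz.le)]) hcusp hdouble
  · intro z hz
    have h1 : AnalyticAt ℂ (fun z => z + P.eval z⁻¹) z :=
      analyticAt_id.add ((P.differentiable.analyticAt z⁻¹).comp (analyticAt_inv (hne hz)))
    refine h1.congr ?_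
    filter_upwards [isOpen_ne.mem_nhds (hne hz)] with w hw
    exact (hfP w hw).symm
  · have h1 : Tendsto (fun z => P.eval z⁻¹) (Bornology.cobounded ℂ) (𝓝 (P.eval 0)) :=
      (P.continuous.tendsto 0).comp tendsto_inv₀_cobounded
    have h2 : ∀ᶠ z in Bornology.cobounded ℂ, ‖P.eval z⁻¹‖ < ‖P.eval 0‖ + 1 :=
      h1.norm.eventually_lt_const (by linarith)
    have h3 : ∀ᶠ z in Bornology.cobounded ℂ, 1 < ‖z‖ :=
      tendsto_norm_cobounded_atTop.eventually_gt_atTop 1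
    rw [← tendsto_norm_atTop_iff_cobounded]
    refine tendsto_atTop_mono' _ ?_ (tendsto_atTop_add_const_right _ (-(‖P.eval 0‖ + 1))
      tendsto_norm_cobounded_atTop)
    filter_upwards [h2, h3] with z hz hz1
    rw [hfP z (hne hz1.le)]
    have := norm_sub_le (z + P.eval z⁻¹) (P.eval z⁻¹)
    rw [add_sub_cancel_right] at this
    linarith
  · refine Polynomial.natDegree_sum_le_of_forall_le _ _ fun k hk => ?_
    exact (Polynomial.natDegree_C_mul_X_pow_le _ _).trans (Finset.mem_Icc.1 hk).2

/-! ### Injective holomorphic maps have no critical points. -/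

/-- A holomorphic function that is injective near a point has nonvanishing derivative there. -/
theorem AnalyticAt.deriv_ne_zero_of_injOn {f : ℂ → ℂ} {z₀ : ℂ} (hf : AnalyticAt ℂ f z₀)
    {U : Set ℂ} (hU : U ∈ 𝓝 z₀) (hinj : InjOn f U) : deriv f z₀ ≠ 0 := by
  intro hd
  have hf' : AnalyticAt ℂ (fun z => f z - f z₀) z₀ := hf.sub analyticAt_const
  have hne : ¬ ∀ᶠ z in 𝓝 z₀, f z - f z₀ = 0 := by
    intro h
    obtain ⟨z, ⟨hz, hzU⟩, hzz⟩ := ((h.and hU).filter_mono nhdsWithin_le_nhds |>.and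
      (self_mem_nhdsWithin : {z₀}ᶜ ∈ 𝓝[≠] z₀)).exists
    exact hzz (hinj hzU (mem_of_mem_nhds hU) (sub_eq_zero.mp hz))
  obtain ⟨k, g, hg, hg0, hfg⟩ := hf'.exists_eventuallyEq_pow_smul_nonzero_iff.mpr hne
  have hk : 2 ≤ k := by
    have h0 : k ≠ 0 := by
      rintro rfl
      have := hfg.self_of_nhds
      simp only [sub_self, pow_zero, one_smul] at this
      exact hg0 this.symm
    have h1 : k ≠ 1 := by
      rintro rfl
      have h2 : deriv (fun z => f z - f z₀) z₀ = deriv (fun z => (z - z₀) ^ 1 • g z) z₀ :=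
        EventuallyEq.deriv_eq hfg
      have h3 : HasDerivAt (fun z => (z - z₀) ^ 1 • g z) (g z₀) z₀ := by
        have := ((hasDerivAt_id z₀).sub_const z₀).mul hg.differentiableAt.hasDerivAt
        simp only [pow_one, smul_eq_mul]
        refine this.congr_deriv ?_
        simp
      rw [h3.deriv, deriv_sub_const, hd] at h2
      exact hg0 h2.symm
    omega
  have hk0 : k ≠ 0 := by omega
  set q : ℂ := g z₀ ^ ((k : ℂ)⁻¹) with hq
  have hqk : q ^ k = g z₀ := Complex.cpow_nat_inv_pow _ hk0
  have hq0 : q ≠ 0 := fun h => hg0 (by rw [← hqk, h, zero_pow hk0])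
  set ψ : ℂ → ℂ := fun z => (z - z₀) * (q * (g z / g z₀) ^ ((k : ℂ)⁻¹)) with hψ
  have hroot : AnalyticAt ℂ (fun z => q * (g z / g z₀) ^ ((k : ℂ)⁻¹)) z₀ := by
    refine analyticAt_const.mul ((hg.div analyticAt_const hg0).cpow analyticAt_const ?_)
    simp [div_self hg0]
  have hψa : AnalyticAt ℂ ψ z₀ := (analyticAt_id.sub analyticAt_const).mul hroot
  have hψd : deriv ψ z₀ = q := by
    have := ((hasDerivAt_id z₀).sub_const z₀).mul hroot.differentiableAt.hasDerivAt
    refine (this.congr_deriv ?_).deriv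
    simp [div_self hg0]
  have hψk : ∀ z, ψ z ^ k = (z - z₀) ^ k * g z := by
    intro z
    rw [hψ, mul_pow, mul_pow, hqk, Complex.cpow_nat_inv_pow _ hk0, mul_div_cancel₀ _ hg0]
  have hmap : map ψ (𝓝 z₀) = 𝓝 0 := by
    have := (hψa.hasStrictDerivAt).map_nhds_eq (by rw [hψd]; exact hq0)
    simpa [hψ] using this
  have hV : ψ '' {z | z ∈ U ∧ f z - f z₀ = (z - z₀) ^ k • g z} ∈ 𝓝 (0 : ℂ) := by
    rw [← hmap]
    exact image_mem_map (by filter_upwards [hU, hfg] with z h1 h2 using ⟨h1, h2⟩)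
  obtain ⟨ε, hε, hball⟩ := Metric.mem_nhds_iff.mp hV
  -- `f - f z₀` is the `k`-th power of the local coordinate `ψ` with `k ≥ 2`. Two nearby points
  -- whose `ψ`-values differ by a primitive `k`-th root of unity then have the same image.
  set ω : ℂ := Complex.exp (2 * Real.pi * Complex.I / k) with hω
  have hωp : IsPrimitiveRoot ω k := Complex.isPrimitiveRoot_exp k hk0
  have hω1 : ω ≠ 1 := hωp.ne_one (by omega)
  have hωn : ‖ω‖ = 1 := hωp.norm'_eq_one hk0
  have he0 : ((ε / 2 : ℝ) : ℂ) ≠ 0 := by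
    rw [Complex.ofReal_ne_zero]; positivity
  have hen : ‖((ε / 2 : ℝ) : ℂ)‖ < ε := by
    rw [Complex.norm_real, Real.norm_of_nonneg (by positivity)]; linarith
  obtain ⟨z₁, ⟨hz₁, hf₁⟩, h₁⟩ := hball (mem_ball_zero_iff.mpr hen)
  obtain ⟨z₂, ⟨hz₂, hf₂⟩, h₂⟩ := hball (a := ((ε / 2 : ℝ) : ℂ) * ω)
    (mem_ball_zero_iff.mpr (by rwa [norm_mul, hωn, mul_one]))
  have hfe : f z₁ = f z₂ := by
    have : f z₁ - f z₀ = f z₂ - f z₀ := by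
      rw [hf₁, hf₂, smul_eq_mul, smul_eq_mul, ← hψk, ← hψk, h₁, h₂, mul_pow, hωp.pow_eq_one,
        mul_one]
    linear_combination this
  have hz : z₁ = z₂ := hinj hz₁ hz₂ hfe
  rw [hz, h₂] at h₁
  exact hω1 (mul_left_cancel₀ he0 (by rw [h₁, mul_one]))

/-! ### Taylor coefficients and the inversion of a convolution. -/

/-- The Taylor coefficients at the origin. -/
noncomputable def taylorCoeff (f : ℂ → ℂ) (k : ℕ) : ℂ := iteratedDeriv k f 0 / (k.factorial : ℂ)

theorem hasSum_taylorCoeff {f : ℂ → ℂ} {R : ℝ} (hf : DifferentiableOn ℂ f (Metric.ball 0 R))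
    {z : ℂ} (hz : ‖z‖ < R) : HasSum (fun k => taylorCoeff f k * z ^ k) (f z) := by
  have h := Complex.hasSum_taylorSeries_on_ball hf (mem_ball_zero_iff.mpr hz)
  have he : (fun k => taylorCoeff f k * z ^ k) =
      fun n : ℕ => ((n.factorial : ℕ) : ℂ)⁻¹ • (z - 0) ^ n • iteratedDeriv n f 0 := by
    funext k
    rw [taylorCoeff, smul_eq_mul, smul_eq_mul, sub_zero]
    ring
  rw [he]
  exact h

theorem summable_norm_taylorCoeff {f : ℂ → ℂ} {R : ℝ}
    (hf : DifferentiableOn ℂ f (Metric.ball 0 R)) {r : ℝ} (hr : 0 ≤ r) (hrR : r < R) :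
    Summable fun k => ‖taylorCoeff f k‖ * r ^ k := by
  have h := (hasSum_taylorCoeff hf (z := (r : ℂ))
    (by rwa [Complex.norm_real, Real.norm_of_nonneg hr])).summable.norm
  refine h.congr fun k => ?_
  rw [norm_mul, norm_pow, Complex.norm_real, Real.norm_of_nonneg hr]

theorem taylorCoeff_mul {f g : ℂ → ℂ} (hf : AnalyticAt ℂ f 0) (hg : AnalyticAt ℂ g 0) (n : ℕ) :
    taylorCoeff (fun z => f z * g z) n =
      ∑ ij ∈ Finset.HasAntidiagonal.antidiagonal n, taylorCoeff f ij.1 * taylorCoeff g ij.2 := by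
  simp only [taylorCoeff]
  rw [show (fun z => f z * g z) = f * g from rfl,
    iteratedDeriv_mul hf.contDiffAt hg.contDiffAt,
    Finset.Nat.sum_antidiagonal_eq_sum_range_succ_mk, Finset.sum_div]
  refine Finset.sum_congr rfl fun i hi => ?_
  rw [Nat.cast_choose _ (by simp at hi; omega)]
  have := Nat.factorial_ne_zero n
  have := Nat.factorial_ne_zero i
  have := Nat.factorial_ne_zero (n - i)
  field_simp

theorem taylorCoeff_congr {f g : ℂ → ℂ} (h : f =ᶠ[𝓝 0] g) (n : ℕ) :
    taylorCoeff f n = taylorCoeff g n := by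
  rw [taylorCoeff, taylorCoeff, h.iteratedDeriv_eq]

theorem taylorCoeff_one (n : ℕ) : taylorCoeff (fun _ => 1) n = if n = 0 then 1 else 0 := by
  rw [taylorCoeff, iteratedDeriv_const]
  split_ifs with h <;> simp [h]

theorem taylorCoeff_deriv (f : ℂ → ℂ) (n : ℕ) :
    taylorCoeff (deriv f) n = (n + 1) * taylorCoeff f (n + 1) := by
  have h1 : ((n.factorial : ℕ) : ℂ) ≠ 0 := by exact_mod_cast Nat.factorial_ne_zero n
  have h2 : ((n : ℂ) + 1) ≠ 0 := by exact_mod_cast Nat.succ_ne_zero n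
  rw [taylorCoeff, taylorCoeff, iteratedDeriv_succ', Nat.factorial_succ]
  push_cast
  field_simp

theorem taylorCoeff_sub {f g : ℂ → ℂ} (hf : AnalyticAt ℂ f 0) (hg : AnalyticAt ℂ g 0) (n : ℕ) :
    taylorCoeff (fun z => f z - g z) n = taylorCoeff f n - taylorCoeff g n := by
  simp only [taylorCoeff]
  rw [show (fun z => f z - g z) = f - g from rfl, iteratedDeriv_sub hf.contDiffAt hg.contDiffAt,
    sub_div]

theorem taylorCoeff_id_mul {f : ℂ → ℂ} (hf : AnalyticAt ℂ f 0) (n : ℕ) :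
    taylorCoeff (fun z => z * f z) (n + 1) = taylorCoeff f n := by
  rw [taylorCoeff_mul (f := fun z => z) analyticAt_id hf]
  have hid : ∀ k, taylorCoeff (fun z : ℂ => z) k = if k = 1 then 1 else 0 := by
    intro k
    rcases k with _ | _ | k
    · simp [taylorCoeff]
    · simp [taylorCoeff]
    · rw [taylorCoeff, iteratedDeriv_succ', show deriv (fun z : ℂ => z) = fun _ => 1 from
        funext fun z => deriv_id z, iteratedDeriv_const]
      simp
  rw [Finset.sum_eq_single (1, n)]
  · simp [hid]
  · rintro ⟨i, j⟩ hij hne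
    simp only [hid]
    rw [if_neg, zero_mul]
    rintro rfl
    have hij : 1 + j = n + 1 := Finset.HasAntidiagonal.mem_antidiagonal.mp hij
    exact hne (by rw [show j = n by omega])
  · intro h
    exact absurd (Finset.HasAntidiagonal.mem_antidiagonal.mpr (add_comm 1 n)) h

/-- A holomorphic function whose Taylor coefficients vanish from some index on is a polynomial. -/
theorem exists_polynomial_of_taylorCoeff {f : ℂ → ℂ} {R : ℝ}
    (hf : DifferentiableOn ℂ f (Metric.ball 0 R)) {d : ℕ} (h : ∀ n, d < n → taylorCoeff f n = 0) :
    ∃ P : Polynomial ℂ, P.natDegree ≤ d ∧ (∀ k ≤ d, P.coeff k = taylorCoeff f k) ∧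
      ∀ z, ‖z‖ < R → f z = P.eval z := by
  have hc : ∀ k ≤ d, (∑ k ∈ Finset.range (d + 1),
      Polynomial.C (taylorCoeff f k) * Polynomial.X ^ k).coeff k = taylorCoeff f k := by
    intro k hk
    rw [Polynomial.finsetSum_coeff]
    simp only [Polynomial.coeff_C_mul_X_pow]
    rw [Finset.sum_eq_single k (fun b _ hb => if_neg (Ne.symm hb))
      (fun h => absurd (Finset.mem_range.mpr (by omega)) h), if_pos rfl]
  refine ⟨_, ?_, hc, fun z hz => ?_⟩
  · refine Polynomial.natDegree_sum_le_of_forall_le _ _ fun k hk => ?_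
    exact (Polynomial.natDegree_C_mul_X_pow_le _ _).trans (by simp at hk; omega)
  · have h1 := hasSum_taylorCoeff hf hz
    have h2 : HasSum (fun k => taylorCoeff f k * z ^ k)
        (∑ k ∈ Finset.range (d + 1), taylorCoeff f k * z ^ k) :=
      hasSum_sum_of_ne_finset_zero fun k hk => by
        rw [h k (by simp at hk; omega), zero_mul]
    rw [h1.unique h2, Polynomial.eval_finsetSum]
    simp

/-- If a convolution with the Taylor coefficients of a function without zeros in the unit disc
annihilates a geometrically decaying sequence from some index on, so does the sequence itself. -/
theorem eq_zero_of_tsum_mul_eq_zero {A B b : ℕ → ℂ} {s C : ℝ} (hs : 0 < s)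
    (hA : Summable fun k => ‖A k‖ * s ^ k) (hB : Summable fun k => ‖B k‖ * s ^ k)
    (hb : ∀ k, ‖b k‖ ≤ C * s ^ k)
    (hAB : ∀ n, ∑ ij ∈ Finset.HasAntidiagonal.antidiagonal n, A ij.1 * B ij.2 =
      if n = 0 then 1 else 0) {n₀ : ℕ}
    (h : ∀ n, n₀ ≤ n → ∑' m, A m * b (n + m) = 0) {n : ℕ} (hn : n₀ ≤ n) : b n = 0 := by
  have hsum : Summable fun x : ℕ × ℕ => A x.1 * B x.2 * b (n + (x.1 + x.2)) := by
    refine Summable.of_norm_bounded (g := fun x : ℕ × ℕ =>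
      (C * s ^ n) * ((‖A x.1‖ * s ^ x.1) * (‖B x.2‖ * s ^ x.2))) ?_ fun x => ?_
    · exact (hA.mul_of_nonneg hB (fun k => by positivity) fun k => by positivity).mul_left _
    · rw [norm_mul, norm_mul]
      refine (mul_le_mul_of_nonneg_left (hb _) (by positivity)).trans_eq ?_
      ring
  -- The double series of `A i * B j * b (n + i + j)` is summed in two ways. Summed over `i` first,
  -- each inner sum vanishes by hypothesis, as `n + j ≥ n₀`.
  have h1 : ∑' x : ℕ × ℕ, A x.1 * B x.2 * b (n + (x.1 + x.2)) = 0 := by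
    rw [← (Equiv.prodComm ℕ ℕ).tsum_eq]
    refine ((Equiv.prodComm ℕ ℕ).summable_iff.mpr hsum).tsum_prod.trans ?_
    refine (tsum_congr fun j => ?_).trans tsum_zero
    have : ∀ m, A m * B j * b (n + (m + j)) = B j * (A m * b (n + j + m)) := fun m => by
      rw [show n + (m + j) = n + j + m by ring]; ring
    simp only [Function.comp_apply, Equiv.prodComm_apply, Prod.swap, this]
    rw [tsum_mul_left, h (n + j) (by omega), mul_zero]
  -- Summed along antidiagonals, the convolution of `A` and `B` leaves only `b n`.
  have h2 := Finset.HasAntidiagonal.sigmaAntidiagonalEquivProd.tsum_eq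
    (fun x : ℕ × ℕ => A x.1 * B x.2 * b (n + (x.1 + x.2)))
  have h2' := (Finset.HasAntidiagonal.sigmaAntidiagonalEquivProd.summable_iff.mpr hsum).tsum_sigma'
    (fun k => (hasSum_fintype _).summable)
  have h3 : ∀ k, ∑' c : Finset.HasAntidiagonal.antidiagonal k,
      A (c : ℕ × ℕ).1 * B (c : ℕ × ℕ).2 * b (n + ((c : ℕ × ℕ).1 + (c : ℕ × ℕ).2)) =
        if k = 0 then b n else 0 := by
    intro k
    rw [tsum_fintype, Finset.sum_coe_sort _ (fun c : ℕ × ℕ => A c.1 * B c.2 * b (n + (c.1 + c.2)))]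
    rw [Finset.sum_congr rfl (g := fun c : ℕ × ℕ => A c.1 * B c.2 * b (n + k)) fun c hc => by
      rw [Finset.HasAntidiagonal.mem_antidiagonal.mp hc], ← Finset.sum_mul, hAB]
    split_ifs with hk <;> simp [hk]
  have h4 := h2'.symm.trans (h2.trans h1)
  simp only [Function.comp_apply, Finset.HasAntidiagonal.sigmaAntidiagonalEquivProd_apply, h3,
    tsum_ite_eq] at h4
  exact h4

/-! ### Orthogonality with a radial weight. -/

/-- The moments of the measure `|w|⁻ᵖ dA` on the unit disc. -/
noncomputable def weightedMoment (p N k : ℕ) : ℂ :=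
  ∫ w in Metric.ball (0 : ℂ) 1, w ^ N * (starRingEnd ℂ w) ^ k * (((‖w‖ ^ p)⁻¹ : ℝ) : ℂ)

theorem norm_weighted_le {p N k : ℕ} (hp : p ≤ N) {w : ℂ} (hw : w ∈ Metric.ball (0 : ℂ) 1) :
    ‖w ^ N * (starRingEnd ℂ w) ^ k * (((‖w‖ ^ p)⁻¹ : ℝ) : ℂ)‖ ≤ 1 := by
  have hw1 : ‖w‖ ≤ 1 := (mem_ball_zero_iff.mp hw).le
  rw [norm_mul, norm_mul, norm_pow, norm_pow, RCLike.norm_conj, Complex.norm_real,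
    Real.norm_of_nonneg (by positivity)]
  have h1 : ‖w‖ ^ N * (‖w‖ ^ p)⁻¹ ≤ 1 :=
    mul_inv_le_one_of_le₀ (pow_le_pow_of_le_one (norm_nonneg _) hw1 hp) (by positivity)
  have h2 : ‖w‖ ^ k ≤ 1 := pow_le_one₀ (norm_nonneg _) hw1
  calc ‖w‖ ^ N * ‖w‖ ^ k * (‖w‖ ^ p)⁻¹ = (‖w‖ ^ N * (‖w‖ ^ p)⁻¹) * ‖w‖ ^ k := by ring
    _ ≤ 1 * 1 := mul_le_mul h1 h2 (by positivity) zero_le_one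
    _ = 1 := one_mul 1

theorem measurable_weighted (p N k : ℕ) :
    Measurable fun w : ℂ => w ^ N * (starRingEnd ℂ w) ^ k * (((‖w‖ ^ p)⁻¹ : ℝ) : ℂ) := by
  have : Measurable fun w : ℂ => (starRingEnd ℂ w) := Complex.continuous_conj.measurable
  fun_prop

theorem integrableOn_weighted {p N : ℕ} (k : ℕ) (hp : p ≤ N) :
    IntegrableOn (fun w : ℂ => w ^ N * (starRingEnd ℂ w) ^ k * (((‖w‖ ^ p)⁻¹ : ℝ) : ℂ))
      (Metric.ball 0 1) :=
  Measure.integrableOn_of_bounded (M := 1) measure_ball_lt_top.ne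
    (measurable_weighted p N k).aestronglyMeasurable
    ((ae_restrict_mem Metric.isOpen_ball.measurableSet).mono fun _ => norm_weighted_le hp)

/-- Rotation by `π/(N - k)` preserves area and weight but multiplies the integrand by `-1`. -/
theorem weightedMoment_eq_zero {p N k : ℕ} (h : N ≠ k) : weightedMoment p N k = 0 := by
  have hne : ((N : ℂ) - k) ≠ 0 := sub_ne_zero.mpr (by exact_mod_cast h)
  set θ : ℝ := Real.pi / ((N : ℝ) - k) with hθ
  have hmp : MeasurePreserving (rotation (Circle.exp θ)) (volume : Measure ℂ) volume :=
    LinearIsometryEquiv.measurePreserving _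
  have hpre : rotation (Circle.exp θ) ⁻¹' Metric.ball (0 : ℂ) 1 = Metric.ball 0 1 := by
    ext w
    rw [mem_preimage, mem_ball_zero_iff, mem_ball_zero_iff, LinearIsometryEquiv.norm_map]
  have h1 := hmp.setIntegral_preimage_emb
    (rotation (Circle.exp θ)).toHomeomorph.measurableEmbedding
    (fun w : ℂ => w ^ N * (starRingEnd ℂ w) ^ k * (((‖w‖ ^ p)⁻¹ : ℝ) : ℂ)) (Metric.ball 0 1)
  rw [hpre] at h1
  have h2 : ∀ w : ℂ, (rotation (Circle.exp θ) w) ^ N *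
      (starRingEnd ℂ (rotation (Circle.exp θ) w)) ^ k *
        (((‖rotation (Circle.exp θ) w‖ ^ p)⁻¹ : ℝ) : ℂ) =
      -(w ^ N * (starRingEnd ℂ w) ^ k * (((‖w‖ ^ p)⁻¹ : ℝ) : ℂ)) := by
    intro w
    have h3 : Complex.exp (θ * Complex.I) ^ N *
        (starRingEnd ℂ (Complex.exp (θ * Complex.I))) ^ k = -1 := by
      rw [← Complex.exp_conj, ← Complex.exp_nat_mul, ← Complex.exp_nat_mul, ← Complex.exp_add,
        map_mul, Complex.conj_I, Complex.conj_ofReal, ← Complex.exp_pi_mul_I]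
      congr 1
      rw [hθ]
      push_cast
      field_simp
      ring
    rw [LinearIsometryEquiv.norm_map, rotation_apply, Circle.coe_exp, map_mul, mul_pow, mul_pow]
    linear_combination (w ^ N * (starRingEnd ℂ w) ^ k * (((‖w‖ ^ p)⁻¹ : ℝ) : ℂ)) * h3
  simp only [h2] at h1
  rw [integral_neg] at h1
  rw [weightedMoment]
  have h4 := h1
  linear_combination (-(1 : ℂ) / 2) * h4

theorem weightedMoment_ne_zero {p N : ℕ} (h : p ≤ N) : weightedMoment p N N ≠ 0 := by
  have h1 : ∀ w : ℂ, w ^ N * (starRingEnd ℂ w) ^ N * (((‖w‖ ^ p)⁻¹ : ℝ) : ℂ) =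
      ((‖w‖ ^ (2 * N) * (‖w‖ ^ p)⁻¹ : ℝ) : ℂ) := by
    intro w
    rw [← mul_pow, Complex.mul_conj, Complex.normSq_eq_norm_sq, Complex.ofReal_mul, pow_mul]
    push_cast
    rfl
  have hint := integrableOn_weighted N h
  simp only [h1] at hint
  rw [weightedMoment]
  simp only [h1]
  rw [integral_complex_ofReal, Complex.ofReal_ne_zero]
  refine ne_of_gt ?_
  have hint' : IntegrableOn (fun w : ℂ => ‖w‖ ^ (2 * N) * (‖w‖ ^ p)⁻¹) (Metric.ball 0 1) :=
    hint.re
  rw [setIntegral_pos_iff_support_of_nonneg_ae (Eventually.of_forall fun w => by positivity) hint']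
  have : Function.support (fun w : ℂ => ‖w‖ ^ (2 * N) * (‖w‖ ^ p)⁻¹) ∩ Metric.ball 0 1 ⊇
      Metric.ball 0 1 \ {0} := by
    rintro w ⟨hw, hw0⟩
    refine ⟨?_, hw⟩
    have : 0 < ‖w‖ := norm_pos_iff.mpr hw0
    exact (by positivity : (0 : ℝ) < ‖w‖ ^ (2 * N) * (‖w‖ ^ p)⁻¹).ne'
  refine lt_of_lt_of_le ?_ (measure_mono this)
  refine (Metric.isOpen_ball.sdiff isClosed_singleton).measure_pos _ ⟨1 / 2, ?_, ?_⟩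
  · simp; norm_num
  · simp

theorem norm_weightedMoment_le {p N : ℕ} (h : p ≤ N) :
    ‖weightedMoment p N N‖ ≤ volume.real (Metric.ball (0 : ℂ) 1) := by
  have := norm_setIntegral_le_of_norm_le_const (μ := volume) (s := Metric.ball (0 : ℂ) 1) (C := 1)
    measure_ball_lt_top (fun w hw => norm_weighted_le (p := p) (N := N) (k := N) h hw)
  rwa [one_mul] at this

/-- A function that is holomorphic on a disc larger than the unit disc, orthogonal with respect to
the weight `|w|⁻ᵖ` to `wⁿ A` for all `n ≥ n₀` with `A` without zeros in the unit disc, has no Taylor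
coefficients of index at least `n₀`. -/
theorem taylorCoeff_eq_zero_of_orthogonal {A E : ℂ → ℂ} {R : ℝ} (hR : 1 < R)
    (hA : DifferentiableOn ℂ A (Metric.ball 0 R)) (hE : DifferentiableOn ℂ E (Metric.ball 0 R))
    (hA0 : ∀ w, ‖w‖ < 1 → A w ≠ 0) {p n₀ : ℕ} (hp : p ≤ n₀)
    (h : ∀ n, n₀ ≤ n → ∫ w in Metric.ball (0 : ℂ) 1,
      w ^ n * A w * starRingEnd ℂ (E w) * (((‖w‖ ^ p)⁻¹ : ℝ) : ℂ) = 0)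
    {n : ℕ} (hn : n₀ ≤ n) : taylorCoeff E n = 0 := by
  -- The coefficients of `E` decay like `R'⁻ᵏ`. This compensates for the series of `1/A`, which is
  -- only known to converge for radii below one.
  obtain ⟨R', hR'1, hR'⟩ := exists_between hR
  have hR'0 : 0 < R' := by linarith
  have hball : Metric.ball (0 : ℂ) 1 ⊆ Metric.ball 0 R := Metric.ball_subset_ball hR.le
  have hsA : Summable fun k => ‖taylorCoeff A k‖ := by
    simpa using summable_norm_taylorCoeff hA zero_le_one hR
  have hsE : Summable fun k => ‖taylorCoeff E k‖ := by
    simpa using summable_norm_taylorCoeff hE zero_le_one hR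
  have hsE' := summable_norm_taylorCoeff hE hR'0.le hR'
  -- Indices below `p` are cut off because the moments are bounded only for `p ≤ N`; the relations
  -- used involve indices at least `n₀ ≥ p`.
  set b : ℕ → ℂ := fun N => if N < p then 0 else
    starRingEnd ℂ (taylorCoeff E N) * weightedMoment p N N with hb
  suffices b n = 0 by
    rw [hb] at this
    simp only [if_neg (show ¬ n < p by omega)] at this
    simpa using (mul_eq_zero.mp this).resolve_right (weightedMoment_ne_zero (by omega))
  have hA1 : DifferentiableOn ℂ A (Metric.ball 0 1) := hA.mono hball
  have hB1 : DifferentiableOn ℂ (fun w => (A w)⁻¹) (Metric.ball 0 1) :=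
    hA1.inv fun w hw => hA0 w (mem_ball_zero_iff.mp hw)
  have hnhds : Metric.ball (0 : ℂ) 1 ∈ 𝓝 0 := Metric.ball_mem_nhds 0 one_pos
  refine eq_zero_of_tsum_mul_eq_zero (A := taylorCoeff A) (B := taylorCoeff fun w => (A w)⁻¹)
    (s := R'⁻¹) (C := (∑' k, ‖taylorCoeff E k‖ * R' ^ k) * volume.real (Metric.ball (0 : ℂ) 1))
    (n₀ := n₀) (by positivity)
    (summable_norm_taylorCoeff hA1 (by positivity) (inv_lt_one_of_one_lt₀ hR'1))
    (summable_norm_taylorCoeff hB1 (by positivity) (inv_lt_one_of_one_lt₀ hR'1))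
    ?_ ?_ ?_ hn
  · intro k
    by_cases hk : k < p
    · rw [hb]
      simp only [if_pos hk, norm_zero]
      have : 0 ≤ ∑' k, ‖taylorCoeff E k‖ * R' ^ k := tsum_nonneg fun k => by positivity
      positivity
    · rw [hb]
      simp only [if_neg hk, norm_mul, RCLike.norm_conj]
      have h1 : ‖taylorCoeff E k‖ * R' ^ k ≤ ∑' k, ‖taylorCoeff E k‖ * R' ^ k :=
        hsE'.le_tsum k fun j _ => by positivity
      have h2 : ‖taylorCoeff E k‖ ≤ (∑' k, ‖taylorCoeff E k‖ * R' ^ k) * R'⁻¹ ^ k := by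
        rw [inv_pow, ← div_eq_mul_inv, le_div_iff₀ (by positivity)]
        exact h1
      calc _ ≤ ((∑' k, ‖taylorCoeff E k‖ * R' ^ k) * R'⁻¹ ^ k) *
          volume.real (Metric.ball (0 : ℂ) 1) :=
            mul_le_mul h2 (norm_weightedMoment_le (by omega)) (norm_nonneg _)
              ((norm_nonneg _).trans h2)
        _ = _ := by ring
  · intro k
    rw [← taylorCoeff_mul (hA1.analyticAt hnhds) (hB1.analyticAt hnhds), ← taylorCoeff_one]
    refine taylorCoeff_congr ?_ k
    filter_upwards [hnhds] with w hw
    exact mul_inv_cancel₀ (hA0 w (mem_ball_zero_iff.mp hw))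
  · intro n hn
    set F : ℕ × ℕ → ℂ → ℂ := fun x w => taylorCoeff A x.1 * starRingEnd ℂ (taylorCoeff E x.2) *
      (w ^ (n + x.1) * (starRingEnd ℂ w) ^ x.2 * (((‖w‖ ^ p)⁻¹ : ℝ) : ℂ)) with hF
    have hFint : ∀ x, IntegrableOn (F x) (Metric.ball 0 1) := fun x =>
      (integrableOn_weighted x.2 (by omega)).const_mul _
    have hprod : Summable fun x : ℕ × ℕ => ‖taylorCoeff A x.1‖ * ‖taylorCoeff E x.2‖ :=
      hsA.mul_of_nonneg hsE (fun k => norm_nonneg _) fun k => norm_nonneg _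
    have hFle : ∀ x, ∀ w ∈ Metric.ball (0 : ℂ) 1,
        ‖F x w‖ ≤ ‖taylorCoeff A x.1‖ * ‖taylorCoeff E x.2‖ := by
      intro x w hw
      rw [hF]
      simp only
      rw [norm_mul, norm_mul, RCLike.norm_conj]
      exact mul_le_of_le_one_right (by positivity) (norm_weighted_le (by omega) hw)
    have hFsum : Summable fun x => ∫ w in Metric.ball (0 : ℂ) 1, ‖F x w‖ := by
      refine Summable.of_nonneg_of_le (fun x => integral_nonneg fun w => norm_nonneg _)
        (fun x => ?_) (hprod.mul_right (volume.real (Metric.ball (0 : ℂ) 1)))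
      have := norm_setIntegral_le_of_norm_le_const (μ := volume) (f := fun w => ‖F x w‖)
        (s := Metric.ball (0 : ℂ) 1) measure_ball_lt_top
        (fun w hw => (norm_norm _).trans_le (hFle x w hw))
      exact (le_abs_self _).trans this
    have hFtot : ∀ w ∈ Metric.ball (0 : ℂ) 1, ∑' x, F x w =
        w ^ n * A w * starRingEnd ℂ (E w) * (((‖w‖ ^ p)⁻¹ : ℝ) : ℂ) := by
      intro w hw
      have hw1 := (mem_ball_zero_iff.mp hw).trans hR
      have h1 := hasSum_taylorCoeff hA hw1
      have h2 := (hasSum_taylorCoeff hE hw1).map (starRingEnd ℂ) Complex.continuous_conj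
      rw [mul_assoc (w ^ n), ← h1.tsum_eq, ← h2.tsum_eq,
        tsum_mul_tsum_of_summable_norm h1.summable.norm h2.summable.norm, ← tsum_mul_left,
        ← tsum_mul_right]
      refine tsum_congr fun x => ?_
      simp only [hF, Function.comp_apply, map_mul, map_pow]
      ring
    have hHS := hasSum_integral_of_summable_integral_norm (μ := volume.restrict (Metric.ball 0 1))
      hFint hFsum
    rw [setIntegral_congr_fun Metric.isOpen_ball.measurableSet hFtot, h n hn] at hHS
    have hFI : ∀ x, ∫ w in Metric.ball (0 : ℂ) 1, F x w = taylorCoeff A x.1 *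
        starRingEnd ℂ (taylorCoeff E x.2) * weightedMoment p (n + x.1) x.2 := fun x =>
      integral_const_mul _ _
    simp only [hFI] at hHS
    -- In the expanded integral only the pairs with equal powers of `w` and its conjugate survive,
    -- which turns orthogonality into a convolution relation.
    have h5 := hHS.prod_fiberwise (g := fun m => taylorCoeff A m * b (n + m)) fun m => by
      have h6 : (taylorCoeff A m * b (n + m)) = taylorCoeff A m *
          starRingEnd ℂ (taylorCoeff E (n + m)) * weightedMoment p (n + m) (n + m) := by
        rw [hb]
        simp only [if_neg (show ¬ n + m < p by omega)]
        ring
      rw [h6]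
      refine hasSum_single (n + m) fun k hk => ?_
      rw [weightedMoment_eq_zero (Ne.symm hk), mul_zero]
    exact h5.tsum_eq

/-! ### Holomorphic changes of variables and functions descending to the image. -/

theorem abs_det_restrictScalars_smulRight (c : ℂ) :
    |((ContinuousLinearMap.smulRight (1 : ℂ →L[ℂ] ℂ) c).restrictScalars ℝ).det| = ‖c‖ ^ 2 := by
  have h : ((ContinuousLinearMap.smulRight (1 : ℂ →L[ℂ] ℂ) c).restrictScalars ℝ).det =
      Complex.normSq c := by
    rw [ContinuousLinearMap.det, ContinuousLinearMap.coe_restrictScalars,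
      LinearMap.det_restrictScalars, Algebra.norm_complex_apply]
    congr 1
    simp
  rw [h, Complex.normSq_eq_norm_sq, abs_of_nonneg (sq_nonneg _)]

theorem hasFDerivWithinAt_real {ψ ψ' : ℂ → ℂ} {S : Set ℂ} {x : ℂ}
    (h : HasDerivAt ψ (ψ' x) x) : HasFDerivWithinAt ψ
      ((ContinuousLinearMap.smulRight (1 : ℂ →L[ℂ] ℂ) (ψ' x)).restrictScalars ℝ) S x :=
  (h.hasFDerivAt.restrictScalars ℝ).hasFDerivWithinAt

/-- Change of variables under an injective holomorphic map. -/
theorem setIntegral_image_holomorphic {ψ ψ' : ℂ → ℂ} {S : Set ℂ} (hS : MeasurableSet S)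
    (hψ : ∀ x ∈ S, HasDerivAt ψ (ψ' x) x) (hinj : InjOn ψ S) (g : ℂ → ℂ) :
    ∫ z in ψ '' S, g z = ∫ w in S, ((‖ψ' w‖ ^ 2 : ℝ) : ℂ) * g (ψ w) := by
  rw [integral_image_eq_integral_abs_det_fderiv_smul volume hS
    (fun x hx => hasFDerivWithinAt_real (hψ x hx)) hinj]
  simp only [abs_det_restrictScalars_smulRight, Complex.real_smul]

theorem integrableOn_image_holomorphic {ψ ψ' : ℂ → ℂ} {S : Set ℂ} (hS : MeasurableSet S)
    (hψ : ∀ x ∈ S, HasDerivAt ψ (ψ' x) x) (hinj : InjOn ψ S) (g : ℂ → ℂ) :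
    IntegrableOn g (ψ '' S) ↔ IntegrableOn (fun w => ((‖ψ' w‖ ^ 2 : ℝ) : ℂ) * g (ψ w)) S := by
  rw [integrableOn_image_iff_integrableOn_abs_det_fderiv_smul volume hS
    (fun x hx => hasFDerivWithinAt_real (hψ x hx)) hinj]
  simp only [abs_det_restrictScalars_smulRight, Complex.real_smul]

/-- A continuous function that is constant on the fibres of a closed map descends to the image. -/
theorem exists_continuousOn_descent {φ h : ℂ → ℂ} {K : Set ℂ} (hK : IsClosed K)
    (hφ : ∀ C ⊆ K, IsClosed C → IsClosed (φ '' C)) (hh : ContinuousOn h K)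
    (hfib : ∀ w₁ ∈ K, ∀ w₂ ∈ K, φ w₁ = φ w₂ → h w₁ = h w₂) :
    ∃ g : ℂ → ℂ, ContinuousOn g (φ '' K) ∧ ∀ w ∈ K, g (φ w) = h w := by
  classical
  have hex : ∀ z : ℂ, ∃ c, ∀ w ∈ K, φ w = z → h w = c := by
    intro z
    by_cases hz : ∃ w ∈ K, φ w = z
    · obtain ⟨w, hw, rfl⟩ := hz
      exact ⟨h w, fun w' hw' he => hfib w' hw' w hw he⟩
    · exact ⟨0, fun w hw he => absurd ⟨w, hw, he⟩ hz⟩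
  choose g hg using hex
  have hgφ : ∀ w ∈ K, g (φ w) = h w := fun w hw => (hg (φ w) w hw rfl).symm
  refine ⟨g, continuousOn_iff_isClosed.mpr fun C hC => ?_, hgφ⟩
  refine ⟨φ '' (K ∩ h ⁻¹' C), hφ _ inter_subset_left (hh.preimage_isClosed_of_isClosed hK hC), ?_⟩
  ext z
  constructor
  · rintro ⟨hz, w, hw, rfl⟩
    refine ⟨⟨w, ⟨hw, ?_⟩, rfl⟩, ⟨w, hw, rfl⟩⟩
    rw [mem_preimage, ← hgφ w hw]
    exact hz
  · rintro ⟨⟨w, ⟨hw, hwC⟩, rfl⟩, hz⟩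
    refine ⟨?_, hz⟩
    rw [mem_preimage, hgφ w hw]
    exact hwC

/-- Near `φ w` the function `g` is `h` composed with the local holomorphic inverse of `φ`. -/
theorem differentiableAt_descent {φ h g : ℂ → ℂ} {w : ℂ} (hφ : AnalyticAt ℂ φ w)
    (hd : deriv φ w ≠ 0) (hh : DifferentiableAt ℂ h w) (hg : ∀ᶠ v in 𝓝 w, g (φ v) = h v) :
    DifferentiableAt ℂ g (φ w) := by
  have hs := hφ.hasStrictDerivAt
  have h1 := (hs.to_localInverse hd).hasDerivAt
  have h2 : hs.localInverse φ _ w hd (φ w) = w := by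
    exact HasStrictFDerivAt.localInverse_apply_image (hs.hasStrictFDerivAt_equiv hd)
  have h3 : ∀ᶠ z in 𝓝 (φ w), φ (hs.localInverse φ _ w hd z) = z :=
    (hs.hasStrictFDerivAt_equiv hd).eventually_right_inverse
  have h4 : ∀ᶠ z in 𝓝 (φ w), g z = h (hs.localInverse φ _ w hd z) := by
    have h5 : Tendsto (hs.localInverse φ _ w hd) (𝓝 (φ w)) (𝓝 w) := by
      have := h1.continuousAt.tendsto
      rwa [h2] at this
    filter_upwards [h3, h5.eventually hg] with z hz hz'
    rw [← hz', hz]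
  refine DifferentiableAt.congr_of_eventuallyEq ?_ h4
  refine DifferentiableAt.comp (φ w) ?_ h1.differentiableAt
  rwa [h2]

theorem exists_ball_of_analyticOnNhd {f : ℂ → ℂ} (hf : AnalyticOnNhd ℂ f (Metric.closedBall 0 1)) :
    ∃ R, 1 < R ∧ ∀ z ∈ Metric.ball (0 : ℂ) R, AnalyticAt ℂ f z := by
  obtain ⟨δ, hδ, hsub⟩ := (isCompact_closedBall (0 : ℂ) 1).exists_thickening_subset_open
    (isOpen_analyticAt ℂ f) hf
  refine ⟨1 + δ, by linarith, fun z hz => hsub ?_⟩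
  rwa [thickening_closedBall hδ zero_le_one, add_comm]

/-! ### Disc automorphisms and the normalization of the conformal map. -/

/-- The automorphism of the unit disc that maps the origin to `a`. -/
noncomputable def discAut (a z : ℂ) : ℂ := (z + a) / (1 + starRingEnd ℂ a * z)

theorem discAut_denom_ne_zero {a z : ℂ} (ha : ‖a‖ < 1) (hz : ‖z‖ ≤ 1) :
    1 + starRingEnd ℂ a * z ≠ 0 := by
  intro h
  have h1 : ‖starRingEnd ℂ a * z‖ = 1 := by
    rw [← norm_neg, ← eq_neg_of_add_eq_zero_left h, norm_one]
  rw [norm_mul, RCLike.norm_conj] at h1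
  nlinarith [norm_nonneg a, norm_nonneg z]

theorem one_sub_normSq_discAut {a z : ℂ} (ha : ‖a‖ < 1) (hz : ‖z‖ ≤ 1) :
    1 - ‖discAut a z‖ ^ 2 =
      (1 - ‖a‖ ^ 2) * (1 - ‖z‖ ^ 2) / ‖1 + starRingEnd ℂ a * z‖ ^ 2 := by
  have h0 := discAut_denom_ne_zero ha hz
  have h1 : ‖1 + starRingEnd ℂ a * z‖ ≠ 0 := norm_ne_zero_iff.mpr h0
  rw [discAut, norm_div, div_pow, eq_div_iff (pow_ne_zero 2 h1), sub_mul,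
    div_mul_cancel₀ _ (pow_ne_zero 2 h1)]
  simp only [← Complex.normSq_eq_norm_sq, Complex.normSq_apply]
  simp
  ring

theorem norm_discAut_lt_one {a z : ℂ} (ha : ‖a‖ < 1) (hz : ‖z‖ < 1) : ‖discAut a z‖ < 1 := by
  have h := one_sub_normSq_discAut ha hz.le
  have h1 : 0 < ‖1 + starRingEnd ℂ a * z‖ := norm_pos_iff.mpr (discAut_denom_ne_zero ha hz.le)
  have h2 : 0 < 1 - ‖a‖ ^ 2 := by nlinarith [norm_nonneg a]
  have h3 : 0 < 1 - ‖z‖ ^ 2 := by nlinarith [norm_nonneg z]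
  have h4 : 0 < 1 - ‖discAut a z‖ ^ 2 := by rw [h]; positivity
  nlinarith [norm_nonneg (discAut a z)]

theorem norm_discAut_eq_one {a z : ℂ} (ha : ‖a‖ < 1) (hz : ‖z‖ = 1) : ‖discAut a z‖ = 1 := by
  have h := one_sub_normSq_discAut ha hz.le
  rw [hz, one_pow, sub_self, mul_zero, zero_div] at h
  have h1 : (‖discAut a z‖ - 1) * (‖discAut a z‖ + 1) = 0 := by linear_combination -h
  rcases mul_eq_zero.mp h1 with h2 | h2
  · linarith
  · linarith [norm_nonneg (discAut a z)]

theorem discAut_neg_discAut {a z : ℂ} (ha : ‖a‖ < 1) (hz : ‖z‖ ≤ 1) :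
    discAut (-a) (discAut a z) = z := by
  have h0 := discAut_denom_ne_zero ha hz
  have h0' : 1 + z * starRingEnd ℂ a ≠ 0 := by rwa [mul_comm z]
  have h1 : (1 : ℂ) - starRingEnd ℂ a * a ≠ 0 := by
    have := discAut_denom_ne_zero (a := -a) (z := a) (by rwa [norm_neg]) ha.le
    simpa [sub_eq_add_neg] using this
  have e1 : discAut a z + -a = (z * (1 - starRingEnd ℂ a * a)) / (1 + starRingEnd ℂ a * z) := by
    rw [discAut]; field_simp; ring
  have e2 : 1 + starRingEnd ℂ (-a) * discAut a z =
      (1 - starRingEnd ℂ a * a) / (1 + starRingEnd ℂ a * z) := by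
    rw [discAut, map_neg]; field_simp; ring
  rw [discAut, e1, e2]
  field_simp

theorem discAut_discAut_neg {a z : ℂ} (ha : ‖a‖ < 1) (hz : ‖z‖ ≤ 1) :
    discAut a (discAut (-a) z) = z := by
  simpa using discAut_neg_discAut (a := -a) (by rwa [norm_neg]) hz

theorem analyticAt_discAut {a z : ℂ} (ha : ‖a‖ < 1) (hz : ‖z‖ ≤ 1) :
    AnalyticAt ℂ (discAut a) z :=
  (analyticAt_id.add analyticAt_const).div
    (analyticAt_const.add (analyticAt_const.mul analyticAt_id)) (discAut_denom_ne_zero ha hz)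

theorem deriv_discAut_ne_zero {a z : ℂ} (ha : ‖a‖ < 1) (hz : ‖z‖ ≤ 1) :
    deriv (discAut a) z ≠ 0 := by
  have h0 := discAut_denom_ne_zero ha hz
  have h1 : (1 : ℂ) - starRingEnd ℂ a * a ≠ 0 := by
    have := discAut_denom_ne_zero (a := -a) (z := a) (by rwa [norm_neg]) ha.le
    simpa [sub_eq_add_neg] using this
  have h2 : HasDerivAt (discAut a)
      ((1 - starRingEnd ℂ a * a) / (1 + starRingEnd ℂ a * z) ^ 2) z := by
    have := ((hasDerivAt_id z).add_const a).div
      (((hasDerivAt_id z).const_mul (starRingEnd ℂ a)).const_add 1) h0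
    refine this.congr_deriv ?_
    simp only [id]
    ring
  rw [h2.deriv]
  exact div_ne_zero h1 (pow_ne_zero 2 h0)

/-- A uniformization by the disc can be normalized to map the origin to a given point. -/
theorem IsDiscUniformization.exists_normalized {φ : ℂ → ℂ} {Ω : Set ℂ}
    (hφ : IsDiscUniformization φ Ω) {p : ℂ} (hp : p ∈ Ω) :
    ∃ ψ, IsDiscUniformization ψ Ω ∧ ψ 0 = p ∧ cuspPoints ψ = cuspPoints φ ∧
      doublePoints ψ = doublePoints φ := by
  rw [← hφ.image_eq] at hp
  obtain ⟨a, ha, rfl⟩ := hp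
  have ha : ‖a‖ < 1 := mem_ball_zero_iff.mp ha
  have hna : ‖-a‖ < 1 := by rwa [norm_neg]
  have hle : ∀ {z : ℂ}, ‖z‖ ≤ 1 → ‖discAut a z‖ ≤ 1 := fun {z} hz =>
    hz.lt_or_eq.elim (fun h => (norm_discAut_lt_one ha h).le) fun h => (norm_discAut_eq_one ha h).le
  have hne : ∀ {z w : ℂ}, ‖z‖ ≤ 1 → ‖w‖ ≤ 1 → discAut a z = discAut a w → z = w :=
    fun hz hw h => by rw [← discAut_neg_discAut ha hz, h, discAut_neg_discAut ha hw]
  have han : ∀ {z : ℂ}, ‖z‖ ≤ 1 → AnalyticAt ℂ φ (discAut a z) := fun hz =>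
    hφ.analytic _ (mem_closedBall_zero_iff.mpr (hle hz))
  have hd : ∀ {z : ℂ}, ‖z‖ = 1 → deriv (fun z => φ (discAut a z)) z =
      deriv φ (discAut a z) * deriv (discAut a) z := fun {z} hz =>
    deriv_comp z (han hz.le).differentiableAt (analyticAt_discAut ha hz.le).differentiableAt
  refine ⟨fun z => φ (discAut a z), ⟨?_, ?_, ?_⟩, ?_, ?_, ?_⟩
  · intro z hz
    have hz := mem_closedBall_zero_iff.mp hz
    exact (han hz).comp (analyticAt_discAut ha hz)
  · intro z hz w hw h
    have hz := mem_ball_zero_iff.mp hz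
    have hw := mem_ball_zero_iff.mp hw
    exact hne hz.le hw.le (hφ.injOn (mem_ball_zero_iff.mpr (norm_discAut_lt_one ha hz))
      (mem_ball_zero_iff.mpr (norm_discAut_lt_one ha hw)) h)
  · rw [← hφ.image_eq]
    ext p
    constructor
    · rintro ⟨z, hz, rfl⟩
      exact ⟨_, mem_ball_zero_iff.mpr (norm_discAut_lt_one ha (mem_ball_zero_iff.mp hz)), rfl⟩
    · rintro ⟨z, hz, rfl⟩
      have hz := mem_ball_zero_iff.mp hz
      refine ⟨discAut (-a) z, mem_ball_zero_iff.mpr (norm_discAut_lt_one hna hz), ?_⟩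
      simp only [discAut_discAut_neg ha hz.le]
  · simp [discAut]
  · ext p
    constructor
    · rintro ⟨ζ, hζ, h, rfl⟩
      rw [hd hζ] at h
      exact ⟨discAut a ζ, norm_discAut_eq_one ha hζ,
        (mul_eq_zero.mp h).resolve_right (deriv_discAut_ne_zero ha hζ.le), rfl⟩
    · rintro ⟨ζ, hζ, h, rfl⟩
      have h1 := norm_discAut_eq_one hna hζ
      refine ⟨discAut (-a) ζ, h1, ?_, ?_⟩
      · rw [hd h1, discAut_discAut_neg ha hζ.le, h, zero_mul]
      · simp only [discAut_discAut_neg ha hζ.le]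
  · ext p
    constructor
    · rintro ⟨ζ₁, ζ₂, h₁, h₂, hne', e₁, e₂⟩
      exact ⟨_, _, norm_discAut_eq_one ha h₁, norm_discAut_eq_one ha h₂,
        fun h => hne' (hne h₁.le h₂.le h), e₁, e₂⟩
    · rintro ⟨ζ₁, ζ₂, h₁, h₂, hne', e₁, e₂⟩
      refine ⟨discAut (-a) ζ₁, discAut (-a) ζ₂, norm_discAut_eq_one hna h₁,
        norm_discAut_eq_one hna h₂, fun h => hne' ?_, ?_, ?_⟩
      · rw [← discAut_discAut_neg ha h₁.le, h, discAut_discAut_neg ha h₂.le]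
      · simp only [discAut_discAut_neg ha h₁.le, e₁]
      · simp only [discAut_discAut_neg ha h₂.le, e₂]

/-- Interior values are taken only once, even allowing boundary points, so identifications occur
only at double points. This is why test functions vanishing there extend continuously to the
boundary. -/
theorem IsUnivalentUpToCircle.fiber_subset {F : ℂ → ℂ} {Dm : Set ℂ}
    (hF : IsUnivalentUpToCircle F Dm) {w₁ w₂ : ℂ} (h₁ : w₁ ∈ Dm ∪ Metric.sphere 0 1)
    (h₂ : w₂ ∈ Dm ∪ Metric.sphere 0 1) (h : F w₁ = F w₂) (hne : w₁ ≠ w₂) :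
    F w₁ ∈ doublePoints F := by
  rcases h₁ with h₁ | h₁ <;> rcases h₂ with h₂ | h₂
  · exact absurd (hF.injOn h₁ h₂ h) hne
  · exact absurd ⟨w₁, h₁, h⟩ (hF.notMem_image (mem_sphere_zero_iff_norm.mp h₂))
  · exact absurd ⟨w₂, h₂, h.symm⟩ (hF.notMem_image (mem_sphere_zero_iff_norm.mp h₁))
  · exact ⟨w₁, w₂, mem_sphere_zero_iff_norm.mp h₁, mem_sphere_zero_iff_norm.mp h₂, hne, rfl, h.symm⟩

theorem IsUnivalentUpToCircle.deriv_ne_zero {F : ℂ → ℂ} {Dm : Set ℂ}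
    (hF : IsUnivalentUpToCircle F Dm) {w : ℂ} (hw : w ∈ Dm) : deriv F w ≠ 0 :=
  (hF.analytic w (.inl hw)).deriv_ne_zero_of_injOn (hF.isOpen.mem_nhds hw) hF.injOn

theorem IsUnivalentUpToCircle.notMem_doublePoints {F : ℂ → ℂ} {Dm : Set ℂ}
    (hF : IsUnivalentUpToCircle F Dm) {w : ℂ} (hw : w ∈ Dm) : F w ∉ doublePoints F := by
  rintro ⟨ζ, -, hζ, -, -, h, -⟩
  exact hF.notMem_image hζ ⟨w, hw, h.symm⟩

/-- A polynomial in `z⁻¹` of degree at most `n` becomes a polynomial after multiplication by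
`zⁿ`. -/
theorem Polynomial.exists_eval_inv_mul_pow (q : Polynomial ℂ) {n : ℕ} (hn : q.natDegree ≤ n) :
    ∃ Q : Polynomial ℂ, ∀ z : ℂ, z ≠ 0 → z ^ n * q.eval z⁻¹ = Q.eval z := by
  refine ⟨∑ k ∈ Finset.range (q.natDegree + 1), Polynomial.C (q.coeff k) * Polynomial.X ^ (n - k),
    fun z hz => ?_⟩
  rw [Polynomial.eval_eq_sum_range, Polynomial.eval_finsetSum, Finset.mul_sum]
  refine Finset.sum_congr rfl fun k hk => ?_
  have hk : k ≤ n := by simp at hk; omega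
  simp only [Polynomial.eval_mul, Polynomial.eval_C, Polynomial.eval_pow, Polynomial.eval_X]
  rw [inv_pow, ← Nat.sub_add_cancel hk, pow_add, Nat.sub_add_cancel hk]
  field_simp

/-! ### Bounded quadrature domains: the normalized conformal map is a polynomial. -/

section Bounded

variable {ψ : ℂ → ℂ} {Ω : Set ℂ} {d : ℕ}

theorem IsDiscUniformization.isUnivalentUpToCircle (hψ : IsDiscUniformization ψ Ω) :
    IsUnivalentUpToCircle ψ (Metric.ball 0 1) :=
  isUnivalentUpToCircle_of_disc hψ.analytic hψ.injOn

theorem IsDiscUniformization.closure_eq (hψ : IsDiscUniformization ψ Ω) :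
    closure Ω = ψ '' Metric.closedBall 0 1 := by
  have hc : IsClosed (ψ '' Metric.closedBall 0 1) :=
    ((isCompact_closedBall 0 1).image_of_continuousOn hψ.analytic.continuousOn).isClosed
  rw [← hψ.image_eq]
  refine Subset.antisymm (closure_minimal (image_mono Metric.ball_subset_closedBall) hc) ?_
  rw [← closure_ball (0 : ℂ) one_ne_zero]
  refine ContinuousOn.image_closure ?_
  rw [closure_ball (0 : ℂ) one_ne_zero]
  exact hψ.analytic.continuousOn

/-- A function on the closed disc that is constant on the fibres of the uniformization `ψ` descends
to the closure of the domain. -/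
theorem IsDiscUniformization.exists_descent (hψ : IsDiscUniformization ψ Ω) {h : ℂ → ℂ}
    (hh : ∀ w ∈ Metric.closedBall (0 : ℂ) 1, AnalyticAt ℂ h w)
    (h0 : ∀ w, ψ w ∈ doublePoints ψ → h w = 0) :
    ∃ g : ℂ → ℂ, DifferentiableOn ℂ g Ω ∧ ContinuousOn g (closure Ω) ∧
      ∀ w ∈ Metric.closedBall (0 : ℂ) 1, g (ψ w) = h w := by
  have hU := hψ.isUnivalentUpToCircle
  obtain ⟨g, hgc, hg⟩ := exists_continuousOn_descent (φ := ψ) (h := h) Metric.isClosed_closedBall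
    (fun C hC hCc => (((isCompact_closedBall 0 1).of_isClosed_subset hCc hC).image_of_continuousOn
      (hψ.analytic.continuousOn.mono hC)).isClosed)
    (fun w hw => (hh w hw).continuousAt.continuousWithinAt) (fun w₁ h₁ w₂ h₂ he => by
      by_cases hne : w₁ = w₂
      · rw [hne]
      · rw [← Metric.ball_union_sphere] at h₁ h₂
        have hm := hU.fiber_subset h₁ h₂ he hne
        rw [h0 w₁ hm, h0 w₂ (he ▸ hm)])
  refine ⟨g, ?_, by rwa [hψ.closure_eq], hg⟩
  rw [← hψ.image_eq]
  rintro _ ⟨w, hw, rfl⟩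
  refine (differentiableAt_descent (hψ.analytic w (Metric.ball_subset_closedBall hw))
    (hU.deriv_ne_zero hw) (hh w (Metric.ball_subset_closedBall hw)).differentiableAt
    ?_).differentiableWithinAt
  filter_upwards [Metric.isOpen_ball.mem_nhds hw] with v hv using
    hg v (Metric.ball_subset_closedBall hv)

/-- The quadrature identity is applied to `g` with `g ∘ ψ = wⁿ ∏ (ψ - p)`. The product vanishes at
the double points, so `g` is continuous on the closure; the zero of order at least `n ≥ d` at the
node annihilates the right-hand side. -/
theorem IsBoundedQDNodeZero.orthogonal (hΩ : IsBoundedQDNodeZero d Ω)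
    (hψ : IsDiscUniformization ψ Ω) (h0 : ψ 0 = 0) {T : Finset ℂ} (hT : ↑T = doublePoints ψ)
    {n : ℕ} (hn : d ≤ n) :
    ∫ w in Metric.ball (0 : ℂ) 1, w ^ n * ((∏ p ∈ T, (ψ w - p)) * deriv ψ w) *
      starRingEnd ℂ (deriv ψ w) = 0 := by
  have hU := hψ.isUnivalentUpToCircle
  have hprod : ∀ w ∈ Metric.closedBall (0 : ℂ) 1,
      AnalyticAt ℂ (fun w => ∏ p ∈ T, (ψ w - p)) w := fun w hw =>
    Finset.analyticAt_fun_prod T fun p _ => (hψ.analytic w hw).sub analyticAt_const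
  obtain ⟨g, hgd, hgc, hg⟩ := hψ.exists_descent
    (h := fun w => w ^ n * ∏ p ∈ T, (ψ w - p))
    (fun w hw => (analyticAt_id.pow n).mul (hprod w hw)) (fun w hw => by
      rw [← hT] at hw
      rw [Finset.prod_eq_zero hw (sub_self _), mul_zero])
  obtain ⟨e, hed, he⟩ : ∃ e : ℂ → ℂ, DifferentiableOn ℂ e Ω ∧
      ∀ w ∈ Metric.ball (0 : ℂ) 1, e (ψ w) = w := by
    have hex : ∀ z, ∃ w, ∀ v ∈ Metric.ball (0 : ℂ) 1, ψ v = z → v = w := fun z => by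
      by_cases hz : ∃ w ∈ Metric.ball (0 : ℂ) 1, ψ w = z
      · obtain ⟨w, hw, rfl⟩ := hz
        exact ⟨w, fun v hv h => hψ.injOn hv hw h⟩
      · exact ⟨0, fun v hv h => absurd ⟨v, hv, h⟩ hz⟩
    choose e he using hex
    have he' : ∀ w ∈ Metric.ball (0 : ℂ) 1, e (ψ w) = w := fun w hw => (he _ w hw rfl).symm
    refine ⟨e, ?_, he'⟩
    rw [← hψ.image_eq]
    rintro _ ⟨w, hw, rfl⟩
    refine (differentiableAt_descent (h := id) (hψ.analytic w (Metric.ball_subset_closedBall hw))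
      (hU.deriv_ne_zero hw) differentiableAt_id ?_).differentiableWithinAt
    filter_upwards [Metric.isOpen_ball.mem_nhds hw] with v hv using he' v hv
  have hgz : ∀ z ∈ Ω, g z = e z ^ n * ∏ p ∈ T, (z - p) := by
    rw [← hψ.image_eq]
    rintro _ ⟨w, hw, rfl⟩
    rw [hg w (Metric.ball_subset_closedBall hw), he w hw]
  have hΩ0 : Ω ∈ 𝓝 (0 : ℂ) := hΩ.isOpen.mem_nhds hΩ.zero_mem
  have he0 : e 0 = 0 := by
    have := he 0 (Metric.mem_ball_self one_pos)
    rwa [h0] at this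
  have hed' : DifferentiableOn ℂ (dslope e 0) Ω := (Complex.differentiableOn_dslope hΩ0).mpr hed
  have hez : ∀ z, e z = z * dslope e 0 z := fun z => by
    have := sub_smul_dslope e 0 z
    rw [sub_zero, he0, sub_zero, smul_eq_mul] at this
    exact this.symm
  obtain ⟨q, hqd, -, hq⟩ := hΩ.quadrature
  obtain ⟨ρ, hρ, hρΩ⟩ := Metric.nhds_basis_closedBall.mem_iff.mp hΩ0
  have hquad := hq g hgd hgc ρ hρ hρΩ
  obtain ⟨Q, hQ⟩ := Polynomial.exists_eval_inv_mul_pow q (hqd.le.trans hn)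
  -- The inverse map is `e z = z * dslope e 0 z`, so `g` contains the factor `zⁿ`. It cancels the
  -- pole of `q(1/z)`, and Cauchy's theorem applies.
  have hcirc : ∮ z in C(0, ρ), g z * q.eval z⁻¹ = 0 := by
    rw [circleIntegral.integral_congr hρ.le
      (g := fun z => dslope e 0 z ^ n * (∏ p ∈ T, (z - p)) * Q.eval z) fun z hz => ?_]
    · refine DiffContOnCl.circleIntegral_eq_zero hρ.le ?_
      refine DifferentiableOn.diffContOnCl ?_
      rw [closure_ball _ hρ.ne']
      refine ((hed'.mono hρΩ).pow n).mul ?_ |>.mul Q.differentiable.differentiableOn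
      exact (Differentiable.fun_finsetProd fun p _ =>
        differentiable_id.sub_const p).differentiableOn
    · have hz0 : z ≠ 0 := by
        rintro rfl
        rw [mem_sphere_zero_iff_norm, norm_zero] at hz
        exact hρ.ne hz
      simp only
      rw [hgz z (hρΩ (Metric.sphere_subset_closedBall hz)), hez z, ← hQ z hz0]
      ring
  rw [hcirc, mul_zero, ← hψ.image_eq, setIntegral_image_holomorphic
    Metric.isOpen_ball.measurableSet (fun w hw => (hψ.analytic w
      (Metric.ball_subset_closedBall hw)).differentiableAt.hasDerivAt) hψ.injOn] at hquad
  refine Eq.trans ?_ hquad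
  refine setIntegral_congr_fun Metric.isOpen_ball.measurableSet fun w hw => ?_
  rw [hg w (Metric.ball_subset_closedBall hw), ← Complex.normSq_eq_norm_sq,
    ← Complex.mul_conj]
  ring

theorem IsExtremeBoundedQD.complement (hd : 2 ≤ d) (hΩ : IsExtremeBoundedQD d Ω) :
    (planarComponents (interior Ωᶜ)).encard = ((d - 1 : ℕ) : ℕ∞) ∧
      (∀ U ∈ planarComponents (interior Ωᶜ), Bornology.IsBounded U →
        IsDeltoidLike (frontier U)) ∧
      ∃ V : Set ℂ,
        {U ∈ planarComponents (interior Ωᶜ) | ¬ Bornology.IsBounded U} = {V} ∧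
        IsCardioidLike (frontier V) := by
  obtain ⟨φ, hφ, hcusp, hdouble⟩ := hΩ.singularities
  obtain ⟨ψ, hψ, h0, hc, hdb⟩ := hφ.exists_normalized hΩ.quadratureDomain.zero_mem
  rw [← hc] at hcusp
  rw [← hdb] at hdouble
  have hU := hψ.isUnivalentUpToCircle
  have hfin : (doublePoints ψ).Finite := by
    refine Set.encard_ne_top_iff.mp fun h => ?_
    rw [h, top_add] at hdouble
    exact ENat.natCast_ne_top d hdouble.symm
  obtain ⟨R, hR, hψR⟩ := exists_ball_of_analyticOnNhd hψ.analytic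
  have hψd : DifferentiableOn ℂ ψ (Metric.ball 0 R) := fun z hz =>
    (hψR z hz).differentiableAt.differentiableWithinAt
  have hE : DifferentiableOn ℂ (deriv ψ) (Metric.ball 0 R) := fun z hz =>
    (hψR z hz).deriv.differentiableAt.differentiableWithinAt
  have hA : DifferentiableOn ℂ (fun w => (∏ p ∈ hfin.toFinset, (ψ w - p)) * deriv ψ w)
      (Metric.ball 0 R) :=
    (DifferentiableOn.fun_finsetProd fun p _ => hψd.sub_const p).mul hE
  -- Orthogonality removes the coefficients of `ψ'` from index `d` on, hence those of `ψ` above `d`.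
  have hcoeff : ∀ n, d < n → taylorCoeff ψ n = 0 := by
    intro n hn
    obtain ⟨k, rfl⟩ : ∃ k, n = k + 1 := ⟨n - 1, by omega⟩
    have h1 := taylorCoeff_eq_zero_of_orthogonal hR hA hE (p := 0) (n₀ := d) ?_ (Nat.zero_le d) ?_
      (n := k) (by omega)
    · rw [taylorCoeff_deriv] at h1
      exact (mul_eq_zero.mp h1).resolve_left (by exact_mod_cast Nat.succ_ne_zero k)
    · intro w hw
      have hw : w ∈ Metric.ball (0 : ℂ) 1 := mem_ball_zero_iff.mpr hw
      refine mul_ne_zero (Finset.prod_ne_zero_iff.mpr fun p hp => ?_) (hU.deriv_ne_zero hw)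
      rw [Set.Finite.mem_toFinset] at hp
      exact sub_ne_zero.mpr fun h => hU.notMem_doublePoints hw (h ▸ hp)
    · intro n hn
      simpa using hΩ.quadratureDomain.orthogonal hψ h0 hfin.coe_toFinset hn
  obtain ⟨P, hPd, hPc, hP⟩ := exists_polynomial_of_taylorCoeff hψd hcoeff
  have hP1 : P.coeff 1 ≠ 0 := by
    rw [hPc 1 (by omega)]
    have := hU.deriv_ne_zero (Metric.mem_ball_self one_pos)
    simpa [taylorCoeff] using this
  have hint : interior Ωᶜ = (ψ '' Metric.closedBall 0 1)ᶜ := by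
    rw [interior_compl, hψ.closure_eq]
  obtain ⟨r1, -, r2, V, hV, hVc, -⟩ := complement_disc_of_polynomial hψ.analytic hψ.injOn hd hP1 hPd
    (fun z hz => hP z ((mem_ball_zero_iff.mp hz).trans hR)) hcusp hdouble
  rw [hint]
  exact ⟨r1, fun U hU hb => (r2 U hU hb).2, V, hV, hVc⟩

end Bounded

/-! ### Unbounded quadrature domains: the conformal map has a finite Laurent series. -/

/-- The bound of a polynomial on circles of radius at least one. -/
theorem Polynomial.exists_norm_eval_le (q : Polynomial ℂ) {d : ℕ} (hq : q.natDegree ≤ d) :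
    ∃ C, 0 ≤ C ∧ ∀ z : ℂ, 1 ≤ ‖z‖ → ‖q.eval z‖ ≤ C * ‖z‖ ^ d := by
  refine ⟨∑ k ∈ Finset.range (q.natDegree + 1), ‖q.coeff k‖,
    Finset.sum_nonneg fun k _ => norm_nonneg _, fun z hz => ?_⟩
  rw [Polynomial.eval_eq_sum_range, Finset.sum_mul]
  refine (norm_sum_le _ _).trans (Finset.sum_le_sum fun k hk => ?_)
  rw [norm_mul, norm_pow]
  have : k ≤ d := by simp at hk; omega
  exact mul_le_mul_of_nonneg_left (pow_le_pow_right₀ hz this) (norm_nonneg _)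

section Unbounded

variable {φ : ℂ → ℂ} {W : Set ℂ} {d : ℕ}

theorem IsExteriorUniformization.isUnivalentUpToCircle (hφ : IsExteriorUniformization φ W) :
    IsUnivalentUpToCircle (fun w => φ w⁻¹) (Metric.ball 0 1 \ {0}) :=
  isUnivalentUpToCircle_of_exterior hφ.analytic hφ.injOn hφ.tendsto

theorem IsExteriorUniformization.image_inv (hφ : IsExteriorUniformization φ W) :
    (fun w => φ w⁻¹) '' (Metric.ball 0 1 \ {0}) = W := by
  rw [← hφ.image_eq]
  ext p
  constructor
  · rintro ⟨w, ⟨hw, hw0⟩, rfl⟩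
    refine ⟨w⁻¹, ?_, rfl⟩
    rw [mem_ofPred_eq, norm_inv]
    exact (one_lt_inv₀ (norm_pos_iff.mpr hw0)).mpr (mem_ball_zero_iff.mp hw)
  · rintro ⟨z, hz, rfl⟩
    have hz0 : z ≠ 0 := norm_pos_iff.mp (one_pos.trans hz)
    refine ⟨z⁻¹, ⟨?_, inv_ne_zero hz0⟩, by simp only [inv_inv]⟩
    rw [mem_ball_zero_iff, norm_inv]
    exact inv_lt_one_of_one_lt₀ hz

theorem IsExteriorUniformization.closure_eq (hφ : IsExteriorUniformization φ W) :
    closure W = φ '' {z | 1 ≤ ‖z‖} := by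
  have hK : IsClosed {z : ℂ | 1 ≤ ‖z‖} := isClosed_le continuous_const continuous_norm
  have hc : IsClosed (φ '' {z | 1 ≤ ‖z‖}) :=
    isClosed_image_of_tendsto hK hφ.analytic.continuousOn hφ.tendsto
  have hcl : closure {z : ℂ | 1 < ‖z‖} = {z | 1 ≤ ‖z‖} := by
    have h1 : {z : ℂ | 1 < ‖z‖} = (Metric.closedBall 0 1)ᶜ := by
      ext z; simp
    have h2 : {z : ℂ | 1 ≤ ‖z‖} = (Metric.ball 0 1)ᶜ := by
      ext z; simp
    rw [h1, h2, closure_compl, interior_closedBall _ one_ne_zero]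
  rw [← hφ.image_eq]
  refine Subset.antisymm (closure_minimal (image_mono fun z (hz : 1 < ‖z‖) => hz.le) hc) ?_
  rw [← hcl]
  refine ContinuousOn.image_closure ?_
  rw [hcl]
  exact hφ.analytic.continuousOn

/-- The uniformization has a simple pole at infinity. -/
theorem IsExteriorUniformization.exists_simple_pole (hφ : IsExteriorUniformization φ W) :
    ∃ a ≠ 0, ∃ H : ℂ → ℂ, AnalyticOnNhd ℂ H (Metric.closedBall 0 1) ∧ H 0 = a ∧
      ∀ w, w ≠ 0 → H w = w * φ w⁻¹ := by
  have hU := hφ.isUnivalentUpToCircle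
  have hinv : Tendsto (fun w : ℂ => φ w⁻¹) (𝓝[≠] 0) (Bornology.cobounded ℂ) :=
    hφ.tendsto.comp tendsto_inv₀_nhdsNE_zero
  -- `1/φ(1/w)` extends by zero across the origin and stays injective, so its derivative there is
  -- nonzero. Hence `w φ(1/w)` is analytic at the origin with nonzero value.
  set G : ℂ → ℂ := Function.update (fun w => (φ w⁻¹)⁻¹) 0 0 with hG
  have hGne : ∀ {w}, w ≠ 0 → G w = (φ w⁻¹)⁻¹ := fun hw => Function.update_of_ne hw _ _
  have hG0 : G 0 = 0 := Function.update_self _ _ _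
  have hne : ∀ᶠ w in 𝓝[≠] (0 : ℂ), φ w⁻¹ ≠ 0 := by
    filter_upwards [hinv.eventually (tendsto_norm_cobounded_atTop.eventually_gt_atTop 0)]
      with w hw using norm_pos_iff.mp hw
  obtain ⟨δ, hδ, hball⟩ := Metric.mem_nhdsWithin_iff.mp hne
  set r := min δ 1 with hr
  have hr0 : 0 < r := lt_min hδ one_pos
  have hnz : ∀ w ∈ Metric.ball (0 : ℂ) r, w ≠ 0 → φ w⁻¹ ≠ 0 := fun w hw hw0 =>
    hball ⟨Metric.ball_subset_ball (min_le_left _ _) hw, hw0⟩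
  have hDm : ∀ w ∈ Metric.ball (0 : ℂ) r, w ≠ 0 → w ∈ Metric.ball (0 : ℂ) 1 \ {0} :=
    fun w hw hw0 => ⟨Metric.ball_subset_ball (min_le_right _ _) hw, hw0⟩
  have hball0 : Metric.ball (0 : ℂ) r ∈ 𝓝 0 := Metric.ball_mem_nhds 0 hr0
  have hGd : DifferentiableOn ℂ G (Metric.ball 0 r) := by
    refine (Complex.differentiableOn_compl_singleton_and_continuousAt_iff hball0).mp ⟨?_, ?_⟩
    · rintro w ⟨hw, hw0⟩
      have h1 : DifferentiableAt ℂ (fun w => (φ w⁻¹)⁻¹) w :=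
        (hU.analytic w (.inl (hDm w hw hw0))).differentiableAt.inv (hnz w hw hw0)
      refine (h1.congr_of_eventuallyEq ?_).differentiableWithinAt
      filter_upwards [isOpen_ne.mem_nhds hw0] with v hv using hGne hv
    · rw [continuousAt_iff_punctured_nhds, hG0]
      refine (tendsto_inv₀_cobounded.comp hinv).congr' ?_
      filter_upwards [self_mem_nhdsWithin] with v hv using (hGne hv).symm
  have hGinj : InjOn G (Metric.ball 0 r) := by
    intro v hv w hw h
    by_cases hv0 : v = 0 <;> by_cases hw0 : w = 0
    · rw [hv0, hw0]
    · rw [hv0, hG0, hGne hw0] at h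
      exact absurd h.symm (inv_ne_zero (hnz w hw hw0))
    · rw [hw0, hG0, hGne hv0] at h
      exact absurd h (inv_ne_zero (hnz v hv hv0))
    · rw [hGne hv0, hGne hw0] at h
      exact hU.injOn (hDm v hv hv0) (hDm w hw hw0) (inv_injective h)
  have hGd0 : deriv G 0 ≠ 0 := (hGd.analyticAt hball0).deriv_ne_zero_of_injOn hball0 hGinj
  have hk : AnalyticAt ℂ (dslope G 0) 0 :=
    ((Complex.differentiableOn_dslope hball0).mpr hGd).analyticAt hball0
  have hk0 : dslope G 0 0 ≠ 0 := by rwa [dslope_same]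
  set H : ℂ → ℂ := Function.update (fun w => w * φ w⁻¹) 0 (deriv G 0)⁻¹ with hH
  have hHne : ∀ {w}, w ≠ 0 → H w = w * φ w⁻¹ := fun hw => Function.update_of_ne hw _ _
  have hH0 : H 0 = (deriv G 0)⁻¹ := Function.update_self _ _ _
  refine ⟨(deriv G 0)⁻¹, inv_ne_zero hGd0, H, fun w hw => ?_, hH0, fun w hw => hHne hw⟩
  by_cases hw0 : w = 0
  · subst hw0
    refine (hk.inv hk0).congr ?_
    filter_upwards [hball0] with v hv
    by_cases hv0 : v = 0
    · rw [hv0, hH0, Pi.inv_apply, dslope_same]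
    · have h1 : v * dslope G 0 v = (φ v⁻¹)⁻¹ := by
        have := sub_smul_dslope G 0 v
        rwa [sub_zero, hG0, sub_zero, smul_eq_mul, hGne hv0] at this
      rw [hHne hv0, Pi.inv_apply, ← inv_inv (φ v⁻¹), ← h1, mul_inv, ← mul_assoc,
        mul_inv_cancel₀ hv0, one_mul]
  · have h1 : w ∈ (Metric.ball (0 : ℂ) 1 \ {0}) ∪ Metric.sphere 0 1 := by
      rw [← Metric.ball_union_sphere] at hw
      exact hw.imp (fun h => ⟨h, hw0⟩) id
    refine (analyticAt_id.mul (hU.analytic w h1)).congr ?_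
    filter_upwards [isOpen_ne.mem_nhds hw0] with v hv using (hHne hv).symm

/-- A function on the closed punctured disc that is constant on the fibres of the uniformization
descends to the closure of the domain. -/
theorem IsExteriorUniformization.exists_descent (hφ : IsExteriorUniformization φ W) {h : ℂ → ℂ}
    (hh : ∀ w, ‖w‖ ≤ 1 → AnalyticAt ℂ h w)
    (h0 : ∀ w, w ≠ 0 → φ w⁻¹ ∈ doublePoints φ → h w = 0) :
    ∃ g : ℂ → ℂ, DifferentiableOn ℂ g W ∧ ContinuousOn g (closure W) ∧
      ∀ w, w ≠ 0 → ‖w‖ ≤ 1 → g (φ w⁻¹) = h w := by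
  have hU := hφ.isUnivalentUpToCircle
  have hK : IsClosed {z : ℂ | 1 ≤ ‖z‖} := isClosed_le continuous_const continuous_norm
  have hne : ∀ {z : ℂ}, 1 ≤ ‖z‖ → z ≠ 0 := fun hz => norm_pos_iff.mp (one_pos.trans_le hz)
  have hle : ∀ {z : ℂ}, 1 ≤ ‖z‖ → ‖z⁻¹‖ ≤ 1 := fun hz => by
    rw [norm_inv]; exact inv_le_one_of_one_le₀ hz
  have hmem : ∀ {z : ℂ}, 1 ≤ ‖z‖ → z⁻¹ ∈ (Metric.ball (0 : ℂ) 1 \ {0}) ∪ Metric.sphere 0 1 :=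
    fun {z} hz => by
      have : z⁻¹ ∈ Metric.ball (0 : ℂ) 1 ∪ Metric.sphere 0 1 := by
        rw [Metric.ball_union_sphere]; exact mem_closedBall_zero_iff.mpr (hle hz)
      exact this.imp (fun h => ⟨h, inv_ne_zero (hne hz)⟩) id
  have hhi : ∀ z : ℂ, 1 ≤ ‖z‖ → AnalyticAt ℂ (fun z => h z⁻¹) z := fun z hz =>
    (hh z⁻¹ (hle hz)).comp (analyticAt_inv (hne hz))
  obtain ⟨g, hgc, hg⟩ := exists_continuousOn_descent (φ := φ) (h := fun z => h z⁻¹) hK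
    (fun C hC hCc => isClosed_image_of_tendsto hCc (hφ.analytic.continuousOn.mono hC) hφ.tendsto)
    (fun z hz => (hhi z hz).continuousAt.continuousWithinAt) (fun z₁ h₁ z₂ h₂ he => by
      by_cases hne' : z₁ = z₂
      · rw [hne']
      · have hm := hU.fiber_subset (hmem h₁) (hmem h₂) (by simpa using he)
          (fun h => hne' (inv_injective h))
        rw [doublePoints_comp_inv] at hm
        rw [h0 z₁⁻¹ (inv_ne_zero (hne h₁)) hm, h0 z₂⁻¹ (inv_ne_zero (hne h₂))]
        simpa [he] using hm)
  refine ⟨g, ?_, by rwa [hφ.closure_eq], fun w hw hw1 => ?_⟩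
  · rw [← hφ.image_eq]
    rintro _ ⟨z, hz, rfl⟩
    have hz : 1 < ‖z‖ := hz
    have ho : {z : ℂ | 1 < ‖z‖} ∈ 𝓝 z :=
      (isOpen_lt continuous_const continuous_norm).mem_nhds hz
    refine (differentiableAt_descent (hφ.analytic z hz.le)
      ((hφ.analytic z hz.le).deriv_ne_zero_of_injOn ho hφ.injOn)
      (hhi z hz.le).differentiableAt ?_).differentiableWithinAt
    filter_upwards [ho] with v hv using hg v (le_of_lt hv)
  · have h1 : 1 ≤ ‖w⁻¹‖ := by
      rw [norm_inv]; exact (one_le_inv₀ (norm_pos_iff.mpr hw)).mpr hw1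
    have := hg w⁻¹ h1
    rwa [inv_inv] at this

end Unbounded

/-- The contour integral at infinity of a function that decays faster than a polynomial grows. -/
theorem circleIntegral_mul_polynomial_eq_zero {g : ℂ → ℂ} {W : Set ℂ} (hW : IsOpen W)
    (hg : DifferentiableOn ℂ g W) {ρ : ℝ} (hρ : 0 < ρ) (hρW : {z : ℂ | ρ ≤ ‖z‖} ⊆ W)
    {q : Polynomial ℂ} {d n : ℕ} (hq : q.natDegree ≤ d) (hn : d + 2 ≤ n) {C : ℝ}
    (hgC : ∀ z, ρ ≤ ‖z‖ → ‖g z‖ * ‖z‖ ^ n ≤ C) :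
    ∮ z in C(0, ρ), g z * q.eval z = 0 := by
  obtain ⟨K, hK, hqK⟩ := Polynomial.exists_norm_eval_le q hq
  have hdiff : ∀ z : ℂ, ρ ≤ ‖z‖ → DifferentiableAt ℂ (fun z => g z * q.eval z) z := fun z hz =>
    (hg.differentiableAt (hW.mem_nhds (hρW hz))).mul q.differentiableAt
  -- The contour is pushed out to radius `R`. The integrand is `O(R⁻²)` there, so the integral is
  -- `O(R⁻¹)`.
  have heq : ∀ R, ρ ≤ R → ∮ z in C(0, R), g z * q.eval z = ∮ z in C(0, ρ), g z * q.eval z := by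
    intro R hR
    refine Complex.circleIntegral_eq_of_differentiable_on_annulus_off_countable hρ hR
      countable_empty (fun z hz => ?_) fun z hz => ?_
    · have : ρ ≤ ‖z‖ := by simpa using hz.2
      exact (hdiff z this).continuousAt.continuousWithinAt
    · have : ρ < ‖z‖ := by simpa using hz.1.2
      exact hdiff z this.le
  have hbound : ∀ R, max ρ 1 ≤ R →
      ‖∮ z in C(0, ρ), g z * q.eval z‖ ≤ (2 * Real.pi * C * K) * R⁻¹ := by
    intro R hR
    have hR1 : 1 ≤ R := (le_max_right _ _).trans hR
    have hRρ : ρ ≤ R := (le_max_left _ _).trans hR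
    have hR0 : 0 < R := by linarith
    rw [← heq R hRρ]
    have h1 : ∀ z ∈ Metric.sphere (0 : ℂ) R, ‖g z * q.eval z‖ ≤ C * K * (R⁻¹ * R⁻¹) := by
      intro z hz
      have hz : ‖z‖ = R := mem_sphere_zero_iff_norm.mp hz
      have e1 := hgC z (by rw [hz]; exact hRρ)
      have e2 := hqK z (by rw [hz]; exact hR1)
      rw [hz] at e1 e2
      have e3 : R ^ (d + 2) ≤ R ^ n := pow_le_pow_right₀ hR1 hn
      have e4 : ‖g z‖ * R ^ (d + 2) ≤ C :=
        (mul_le_mul_of_nonneg_left e3 (norm_nonneg _)).trans e1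
      rw [norm_mul]
      calc ‖g z‖ * ‖q.eval z‖ ≤ ‖g z‖ * (K * R ^ d) := mul_le_mul_of_nonneg_left e2 (norm_nonneg _)
        _ = (‖g z‖ * R ^ (d + 2)) * K * (R⁻¹ * R⁻¹) := by
            rw [pow_add]; field_simp
        _ ≤ C * K * (R⁻¹ * R⁻¹) := by gcongr
    refine (circleIntegral.norm_integral_le_of_norm_le_const hR0.le h1).trans_eq ?_
    field_simp
  have hlim : Tendsto (fun R : ℝ => (2 * Real.pi * C * K) * R⁻¹) atTop (𝓝 0) := by
    simpa using tendsto_inv_atTop_zero.const_mul (2 * Real.pi * C * K)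
  have := ge_of_tendsto hlim ((eventually_ge_atTop (max ρ 1)).mono hbound)
  exact norm_le_zero_iff.mp this

/-- The principal value of an absolutely convergent integral. -/
theorem tendsto_setIntegral_inter_ball {g : ℂ → ℂ} {W : Set ℂ} (hg : IntegrableOn g W) :
    Tendsto (fun R : ℝ => ∫ z in W ∩ Metric.ball 0 R, g z) atTop (𝓝 (∫ z in W, g z)) := by
  have h1 := (aecover_ball (μ := volume.restrict W) (x := (0 : ℂ)) (r := fun R : ℝ => R)
    tendsto_id).integral_tendsto_of_countably_generated hg
  refine h1.congr fun R => ?_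
  rw [Measure.restrict_restrict Metric.isOpen_ball.measurableSet, inter_comm]

section Unbounded

variable {φ H : ℂ → ℂ} {W : Set ℂ} {d : ℕ}

theorem hasDerivAt_simple_pole (hH : AnalyticOnNhd ℂ H (Metric.closedBall 0 1))
    (hHφ : ∀ w, w ≠ 0 → H w = w * φ w⁻¹) {w : ℂ} (hw : ‖w‖ ≤ 1) (hw0 : w ≠ 0) :
    HasDerivAt (fun w => φ w⁻¹) ((w * deriv H w - H w) / w ^ 2) w := by
  have h1 := ((hH w (mem_closedBall_zero_iff.mpr hw)).differentiableAt.hasDerivAt.div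
    (hasDerivAt_id w) hw0)
  refine (h1.congr_of_eventuallyEq ?_).congr_deriv ?_
  · filter_upwards [isOpen_ne.mem_nhds hw0] with v hv
    have hv : v ≠ 0 := hv
    rw [Pi.div_apply, id, hHφ v hv, mul_div_cancel_left₀ _ hv]
  · simp only [id, mul_one]
    rw [mul_comm]

theorem IsUnboundedQDNodeInfty.isOpen_finitePart {Ω : Set (OnePoint ℂ)}
    (hΩ : IsUnboundedQDNodeInfty d Ω) : IsOpen (finitePart Ω) :=
  hΩ.isOpen.preimage OnePoint.continuous_coe

/-- With `φ(1/w) = H(w)/w` the area element is `|wH' - H|² |w|⁻⁴ dA`, the source of the weight. The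
test function is `wⁿ` times a product vanishing at the double points, and it decays like `|z|⁻ⁿ`;
for `n ≥ d + 2` the contour integral at infinity vanishes. -/
theorem IsUnboundedQDNodeInfty.orthogonal {Ω : Set (OnePoint ℂ)} (hΩ : IsUnboundedQDNodeInfty d Ω)
    (hd : 2 ≤ d) (hφ : IsExteriorUniformization φ (finitePart Ω))
    (hH : AnalyticOnNhd ℂ H (Metric.closedBall 0 1))
    (hHφ : ∀ w, w ≠ 0 → H w = w * φ w⁻¹) {T : Finset ℂ} (hT : ↑T = doublePoints φ)
    {n : ℕ} (hn : d + 2 ≤ n) :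
    ∫ w in Metric.ball (0 : ℂ) 1, w ^ n * ((∏ p ∈ T, (H w - p * w)) * (w * deriv H w - H w)) *
      starRingEnd ℂ (w * deriv H w - H w) * (((‖w‖ ^ 4)⁻¹ : ℝ) : ℂ) = 0 := by
  set W := finitePart Ω with hW
  have hU := hφ.isUnivalentUpToCircle
  -- The factor `H - pw` is `w (φ(1/w) - p)`: multiplying by `w` removes the pole at the origin and
  -- keeps the zeros at the double points.
  set k : ℂ → ℂ := fun w => ∏ p ∈ T, (H w - p * w) with hk
  have hka : ∀ w, ‖w‖ ≤ 1 → AnalyticAt ℂ k w := fun w hw =>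
    Finset.analyticAt_fun_prod T fun p _ =>
      (hH w (mem_closedBall_zero_iff.mpr hw)).sub (analyticAt_const.mul analyticAt_id)
  set E : ℂ → ℂ := fun w => w * deriv H w - H w with hE
  have hEa : ∀ w, ‖w‖ ≤ 1 → AnalyticAt ℂ E w := fun w hw =>
    (analyticAt_id.mul (hH w (mem_closedBall_zero_iff.mpr hw)).deriv).sub
      (hH w (mem_closedBall_zero_iff.mpr hw))
  obtain ⟨g, hgd, hgc, hg⟩ := hφ.exists_descent (h := fun w => w ^ n * k w)
    (fun w hw => (analyticAt_id.pow n).mul (hka w hw)) (fun w hw0 hw => by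
      rw [← hT] at hw
      have : k w = 0 := Finset.prod_eq_zero hw (by rw [hHφ w hw0, mul_comm, sub_self])
      rw [this, mul_zero])
  have hbdd : ∀ {f : ℂ → ℂ}, (∀ w, ‖w‖ ≤ 1 → AnalyticAt ℂ f w) →
      ∃ M, 0 ≤ M ∧ ∀ w, ‖w‖ ≤ 1 → ‖f w‖ ≤ M := by
    intro f hf
    obtain ⟨M, hM⟩ := (isCompact_closedBall (0 : ℂ) 1).exists_bound_of_continuousOn
      (f := f) fun w hw => (hf w (mem_closedBall_zero_iff.mp hw)).continuousAt.continuousWithinAt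
    refine ⟨M, (norm_nonneg _).trans (hM 0 (by simp)), fun w hw =>
      hM w (mem_closedBall_zero_iff.mpr hw)⟩
  obtain ⟨Mk, hMk0, hMk⟩ := hbdd hka
  obtain ⟨ME, hME0, hME⟩ := hbdd hEa
  obtain ⟨MH, hMH0, hMH⟩ := hbdd fun w hw => hH w (mem_closedBall_zero_iff.mpr hw)
  have hdecay : ∀ z ∈ W, ‖g z‖ * ‖z‖ ^ n ≤ Mk * MH ^ n := by
    rw [← hφ.image_inv]
    rintro _ ⟨w, ⟨hw, hw0⟩, rfl⟩
    have hw1 : ‖w‖ ≤ 1 := (mem_ball_zero_iff.mp hw).le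
    simp only
    rw [hg w hw0 hw1, ← norm_pow, ← norm_mul]
    have : w ^ n * k w * φ w⁻¹ ^ n = k w * H w ^ n := by
      rw [hHφ w hw0, mul_pow]; ring
    rw [this, norm_mul, norm_pow]
    exact mul_le_mul (hMk w hw1) (pow_le_pow_left₀ (norm_nonneg _) (hMH w hw1) n) (by positivity)
      hMk0
  obtain ⟨R₀, hR₀⟩ := exists_norm_gt_subset hφ.analytic hφ.injOn hφ.tendsto
  rw [hφ.image_eq] at hR₀
  set ρ : ℝ := max R₀ 0 + 1 with hρ
  have hρ0 : 0 < ρ := by positivity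
  have hρW : {z : ℂ | ρ ≤ ‖z‖} ⊆ W := fun z (hz : ρ ≤ ‖z‖) =>
    hR₀ (show R₀ < ‖z‖ by have := le_max_left R₀ 0; linarith)
  have hg0 : Tendsto g (Bornology.cobounded ℂ) (𝓝 0) := by
    have h1 : Tendsto (fun z : ℂ => Mk * MH ^ n * ‖z‖⁻¹) (Bornology.cobounded ℂ) (𝓝 0) := by
      simpa using (tendsto_inv_atTop_zero.comp tendsto_norm_cobounded_atTop).const_mul (Mk * MH ^ n)
    refine squeeze_zero_norm' ?_ h1
    filter_upwards [tendsto_norm_cobounded_atTop.eventually_ge_atTop (max ρ 1)] with z hz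
    have hz1 : 1 ≤ ‖z‖ := (le_max_right _ _).trans hz
    have h2 := hdecay z (hρW ((le_max_left _ _).trans hz))
    rw [← div_eq_mul_inv, le_div_iff₀ (by linarith)]
    refine le_trans ?_ h2
    exact mul_le_mul_of_nonneg_left (le_self_pow₀ hz1 (by omega)) (norm_nonneg _)
  obtain ⟨q, hqd, hq⟩ := hΩ.quadrature
  have hquad := hq g hgd hgc hg0 ρ hρ0 hρW
  rw [circleIntegral_mul_polynomial_eq_zero hΩ.isOpen_finitePart hgd hρ0 hρW hqd.le hn
    fun z hz => hdecay z (hρW hz), mul_zero, neg_zero] at hquad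
  have hDmo : IsOpen (Metric.ball (0 : ℂ) 1 \ {0}) := hU.isOpen
  have hder : ∀ w ∈ Metric.ball (0 : ℂ) 1 \ {0},
      HasDerivAt (fun w => φ w⁻¹) (E w / w ^ 2) w := fun w hw =>
    hasDerivAt_simple_pole hH hHφ (mem_ball_zero_iff.mp hw.1).le hw.2
  set I : ℂ → ℂ := fun w => w ^ n * (k w * E w) * starRingEnd ℂ (E w) *
    (((‖w‖ ^ 4)⁻¹ : ℝ) : ℂ) with hI
  have hIeq : ∀ w ∈ Metric.ball (0 : ℂ) 1 \ {0},
      ((‖E w / w ^ 2‖ ^ 2 : ℝ) : ℂ) * g (φ w⁻¹) = I w := by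
    intro w hw
    rw [hg w hw.2 (mem_ball_zero_iff.mp hw.1).le, norm_div, norm_pow, div_pow, ← pow_mul,
      ← Complex.normSq_eq_norm_sq, div_eq_mul_inv, Complex.ofReal_mul, ← Complex.mul_conj]
    simp only [hI]
    ring
  -- As `n ≥ d + 2 ≥ 4`, the power `wⁿ` absorbs the weight `|w|⁻⁴`. The integral converges
  -- absolutely and agrees with its principal value.
  have hIint : IntegrableOn I (Metric.ball 0 1 \ {0}) := by
    have hc : ContinuousOn I (Metric.ball 0 1 \ {0}) := fun w hw => by
      have hw1 := (mem_ball_zero_iff.mp hw.1).le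
      have hk1 := (hka w hw1).continuousAt
      have hE1 := (hEa w hw1).continuousAt
      have hn1 : ContinuousAt (fun w : ℂ => (‖w‖ ^ 4)⁻¹) w :=
        (continuous_norm.continuousAt.pow 4).inv₀ (pow_ne_zero 4 (norm_ne_zero_iff.mpr hw.2))
      exact ((((continuousAt_id.pow n).mul (hk1.mul hE1)).mul
        (Complex.continuous_conj.continuousAt.comp hE1)).mul
        (Complex.continuous_ofReal.continuousAt.comp hn1)).continuousWithinAt
    refine IntegrableOn.of_bound ((measure_mono sdiff_subset).trans_lt measure_ball_lt_top)
      (hc.aestronglyMeasurable hDmo.measurableSet) (Mk * ME * ME)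
      ((ae_restrict_mem hDmo.measurableSet).mono fun w hw => ?_)
    have hw1 := (mem_ball_zero_iff.mp hw.1).le
    have h1 : ‖w ^ n * (starRingEnd ℂ w) ^ 0 * (((‖w‖ ^ 4)⁻¹ : ℝ) : ℂ)‖ ≤ 1 :=
      norm_weighted_le (by omega) hw.1
    have h2 : I w = (w ^ n * (starRingEnd ℂ w) ^ 0 * (((‖w‖ ^ 4)⁻¹ : ℝ) : ℂ)) *
        (k w * E w * starRingEnd ℂ (E w)) := by
      simp only [hI]
      ring
    rw [h2, norm_mul]
    refine (mul_le_of_le_one_left (by positivity) h1).trans ?_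
    rw [norm_mul, norm_mul, RCLike.norm_conj]
    have := hMk w hw1
    have := hME w hw1
    gcongr
  have hgint : IntegrableOn g W := by
    rw [← hφ.image_inv, integrableOn_image_holomorphic hDmo.measurableSet hder hU.injOn]
    exact hIint.congr_fun (fun w hw => (hIeq w hw).symm) hDmo.measurableSet
  have h0 := tendsto_nhds_unique (tendsto_setIntegral_inter_ball hgint) hquad
  rw [← hφ.image_inv, setIntegral_image_holomorphic hDmo.measurableSet hder hU.injOn,
    setIntegral_congr_fun hDmo.measurableSet hIeq] at h0
  rw [← setIntegral_congr_set (sdiff_null_ae_eq_self (measure_singleton (0 : ℂ)))]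
  exact h0

theorem taylorCoeff_mul_deriv_sub {H : ℂ → ℂ} (hH : AnalyticAt ℂ H 0) (n : ℕ) :
    taylorCoeff (fun w => w * deriv H w - H w) (n + 1) = n * taylorCoeff H (n + 1) := by
  rw [taylorCoeff_sub (f := fun w => w * deriv H w) (analyticAt_id.mul hH.deriv) hH, taylorCoeff_id_mul hH.deriv,
    taylorCoeff_deriv]
  ring

theorem IsExtremeUnboundedQD.complement (hd : 2 ≤ d) {Ω : Set (OnePoint ℂ)}
    (hΩ : IsExtremeUnboundedQD d Ω) :
    (planarComponents (interior (finitePart Ω)ᶜ)).encard = ((d - 1 : ℕ) : ℕ∞) ∧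
      ∀ U ∈ planarComponents (interior (finitePart Ω)ᶜ), IsDeltoidLike (frontier U) := by
  obtain ⟨φ, hφ, hcusp, hdouble⟩ := hΩ.singularities
  have hU := hφ.isUnivalentUpToCircle
  have hfin : (doublePoints φ).Finite := by
    refine Set.encard_ne_top_iff.mp fun h => ?_
    rw [h, top_add] at hdouble
    exact ENat.natCast_ne_top d hdouble.symm
  obtain ⟨a, ha, H, hH, hH0, hHφ⟩ := hφ.exists_simple_pole
  obtain ⟨R, hR, hHR⟩ := exists_ball_of_analyticOnNhd hH
  have hHd : DifferentiableOn ℂ H (Metric.ball 0 R) := fun z hz =>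
    (hHR z hz).differentiableAt.differentiableWithinAt
  have hE : DifferentiableOn ℂ (fun w => w * deriv H w - H w) (Metric.ball 0 R) := fun z hz =>
    (differentiableAt_id.mul (hHR z hz).deriv.differentiableAt |>.sub
      (hHR z hz).differentiableAt).differentiableWithinAt
  have hA : DifferentiableOn ℂ (fun w => (∏ p ∈ hfin.toFinset, (H w - p * w)) *
      (w * deriv H w - H w)) (Metric.ball 0 R) :=
    (DifferentiableOn.fun_finsetProd fun p _ =>
      hHd.sub (differentiableOn_id.const_mul p)).mul hE
  have hcoeff : ∀ n, d + 1 < n → taylorCoeff H n = 0 := by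
    intro n hn
    obtain ⟨k, rfl⟩ : ∃ k, n = k + 1 := ⟨n - 1, by omega⟩
    -- The coefficient of index `k + 1` of `wH' - H` is `k` times that of `H`, and `k > d`, so `H`
    -- loses its coefficients above `d + 1`.
    have h1 := taylorCoeff_eq_zero_of_orthogonal hR hA hE (p := 4) (n₀ := d + 2) ?_ (by omega)
      (fun n hn => hΩ.quadratureDomain.orthogonal hd hφ hH hHφ hfin.coe_toFinset hn)
      (n := k + 1) (by omega)
    · rw [taylorCoeff_mul_deriv_sub (hH 0 (by simp))] at h1
      exact (mul_eq_zero.mp h1).resolve_left (Nat.cast_ne_zero.mpr (by omega))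
    · intro w hw
      by_cases hw0 : w = 0
      · rw [hw0]
        simp only [mul_zero, sub_zero, zero_mul, zero_sub, hH0, Finset.prod_const]
        exact mul_ne_zero (pow_ne_zero _ ha) (neg_ne_zero.mpr ha)
      · have hwD : w ∈ Metric.ball (0 : ℂ) 1 \ {0} := ⟨mem_ball_zero_iff.mpr hw, hw0⟩
        refine mul_ne_zero (Finset.prod_ne_zero_iff.mpr fun p hp => ?_) fun h => ?_
        · rw [Set.Finite.mem_toFinset] at hp
          rw [hHφ w hw0, mul_comm p, ← mul_sub]
          refine mul_ne_zero hw0 (sub_ne_zero.mpr fun h => ?_)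
          refine hU.notMem_doublePoints hwD ?_
          rw [doublePoints_comp_inv]
          exact h ▸ hp
        · refine hU.deriv_ne_zero hwD ?_
          rw [(hasDerivAt_simple_pole hH hHφ hw.le hw0).deriv, h, zero_div]
  obtain ⟨P, hPd, hPc, hP⟩ := exists_polynomial_of_taylorCoeff hHd hcoeff
  -- Splitting off the constant term `a` of the polynomial `H` gives the pole `az`; the remaining
  -- `divX` has degree at most `d`.
  have hform : ∀ z, 1 < ‖z‖ → φ z = a * z + P.divX.eval z⁻¹ := by
    intro z hz
    have hz0 : z ≠ 0 := norm_pos_iff.mp (one_pos.trans hz)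
    have h1 : ‖z⁻¹‖ < R := by
      rw [norm_inv]
      exact (inv_lt_one_of_one_lt₀ hz).trans hR
    have h2 := hP z⁻¹ h1
    rw [hHφ _ (inv_ne_zero hz0), inv_inv, ← P.divX_mul_X_add, Polynomial.eval_add,
      Polynomial.eval_mul, Polynomial.eval_X, Polynomial.eval_C] at h2
    have h3 : P.coeff 0 = a := by
      rw [hPc 0 (Nat.zero_le _), ← hH0]
      simp [taylorCoeff]
    rw [h3] at h2
    calc φ z = z * (z⁻¹ * φ z) := by rw [← mul_assoc, mul_inv_cancel₀ hz0, one_mul]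
      _ = a * z + P.divX.eval z⁻¹ := by
        rw [h2, mul_add, mul_left_comm, mul_inv_cancel₀ hz0]
        ring
  have hint : interior (finitePart Ω)ᶜ = (φ '' {z | 1 ≤ ‖z‖})ᶜ := by
    rw [interior_compl, hφ.closure_eq]
  obtain ⟨r1, r2⟩ := complement_exterior_of_polynomial hφ.analytic hφ.injOn hφ.tendsto hd ha
    (P := P.divX) (by rw [Polynomial.natDegree_divX_eq_natDegree_tsub_one]; omega) hform hcusp
    hdouble
  rw [hint]
  exact ⟨r1, fun U hU => (r2 U hU).2⟩

end Unbounded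

theorem mainTheorem12 (d : ℕ) (hd : 2 ≤ d) :
    -- Suffridge polynomials in `Σ_d`
    (∀ f : ℂ → ℂ, IsSuffridgeSigma d f →
      (planarComponents (f '' {z | 1 ≤ ‖z‖})ᶜ).encard = ((d - 1 : ℕ) : ℕ∞) ∧
      ∀ U ∈ planarComponents (f '' {z | 1 ≤ ‖z‖})ᶜ,
        (singularPoints f ∩ frontier U).encard = 3 ∧ IsDeltoidLike (frontier U)) ∧
    -- Suffridge polynomials in `S_d`
    (∀ f : ℂ → ℂ, IsSuffridgeS d f →
      {U ∈ planarComponents (f '' Metric.closedBall 0 1)ᶜ | Bornology.IsBounded U}.encard =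
        ((d - 2 : ℕ) : ℕ∞) ∧
      (∀ U ∈ planarComponents (f '' Metric.closedBall 0 1)ᶜ, Bornology.IsBounded U →
        (singularPoints f ∩ frontier U).encard = 3 ∧ IsDeltoidLike (frontier U)) ∧
      ∃ V : Set ℂ,
        {U ∈ planarComponents (f '' Metric.closedBall 0 1)ᶜ | ¬ Bornology.IsBounded U} = {V} ∧
        IsCardioidLike (frontier V) ∧
        ∃ p : ℂ, singularPoints f ∩ frontier V = {p} ∧
          (d = 2 → p ∈ cuspPoints f) ∧ (2 < d → p ∈ doublePoints f)) ∧
    -- extreme unbounded quadrature domains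
    (∀ Ω : Set (OnePoint ℂ), IsExtremeUnboundedQD d Ω →
      (planarComponents (interior (finitePart Ω)ᶜ)).encard = ((d - 1 : ℕ) : ℕ∞) ∧
      ∀ U ∈ planarComponents (interior (finitePart Ω)ᶜ), IsDeltoidLike (frontier U)) ∧
    -- extreme bounded quadrature domains
    (∀ Ω : Set ℂ, IsExtremeBoundedQD d Ω →
      (planarComponents (interior Ωᶜ)).encard = ((d - 1 : ℕ) : ℕ∞) ∧
      (∀ U ∈ planarComponents (interior Ωᶜ), Bornology.IsBounded U →
        IsDeltoidLike (frontier U)) ∧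
      ∃ V : Set ℂ,
        {U ∈ planarComponents (interior Ωᶜ) | ¬ Bornology.IsBounded U} = {V} ∧
        IsCardioidLike (frontier V)) :=
  ⟨fun _ hf => hf.complement hd, fun _ hf => hf.complement hd, fun _ hΩ => hΩ.complement hd,
    fun _ hΩ => hΩ.complement hd⟩
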